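/- **Setting.** Let $N=\{1,\dots,d\}$, $X=X_1\times\cdots\times X_d$, and let $\succcurlyeq$ be a binary relation on $X$ with asymmetric part $\succ$ and symmetric part $\sim$. Write $a_ix_{-i}$ for $x$ with $i$-th coordinate replaced by $a_i$, and $a_ip_jz_{-ij}$ similarly. Put $a_i\succcurlyeq_i b_i$ iff $a_ix_{-i}\succcurlyeq b_ix_{-i}$ for all $x_{-i}$, and $a_i\sim_i b_i$ iff $a_i\succcurlyeq_i b_i$ and $b_i\succcurlyeq_i a_i$. An element of $X_i$ is *maximal* (*minimal*) if it is $\succcurlyeq_i$-above (below) every element of $X_i$, and *non-extreme* if it is neither. For $i\ne j$, *$ij$-triple cancellation* holds on $A\subset X$ if, whenever the eight points involved are in $A$, $a_ip_jz_{-ij}\preccurlyeq b_iq_jz_{-ij}$, $a_ir_jz_{-ij}\succcurlyeq b_is_jz_{-ij}$ and $c_ip_jz_{-ij}\succcurlyeq d_iq_jz_{-ij}$ imply $c_ir_jz_{-ij}\succcurlyeq d_is_jz_{-ij}$. Let $SE^z_{ij}=\{x_ix_jz_{-ij}: x_i\succcurlyeq_i z_i,\ z_j\succcurlyeq_j x_j\}$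 and $NW^z_{ij}=\{x_ix_jz_{-ij}: z_i\succcurlyeq_i x_i,\ x_j\succcurlyeq_j z_j\}$. Write $i\,R^z j$ if $ij$-triple cancellation holds on $SE^z_{ij}$; $i\,S^z j$ if not $j\,R^z i$; $i\,E^z j$ if $i\,R^z j$ and $j\,R^z i$. The coordinates $i,j$ are *interacting* if $i\,S^zj$ or $j\,S^zi$ for some $z$. An *interaction clique* is a nonempty $A\subset N$ any two elements of which are joined by a chain of successively interacting coordinates. Let $SE_{ij}$ be the union of (1) all $z$ with $i\,R^zj$, $z_i$ not maximal and $z_j$ not minimal; (2) all $z$ with $z_i$ maximal such that for no $x_j,y_j$ with $z_j\succcurlyeq_j x_j\succcurlyeq_j y_j$ we have $j\,R^{x_jz_{-j}}i$ and not $j\,R^{y_jz_{-j}}i$; (3) all $z$ with $z_j$ minimal such that for no $x_i,y_i$ with $y_i\succcurlyeq_i x_i\succcurlyeq_i z_i$ we have $j\,R^{x_iz_{-i}}i$ and not $j\,R^{y_iz_{-i}}i$. The relations $S^z$ ($z\in X$) are listed as $S_a,S_b,\dots$ (the *coordinate orders*), and $X^{S_a}=\bigcap SE_{kl}$ over all $k\neq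 l$ such that not $l\,S_a k$. Coordinate $i$ is *essential* on $A\subset X$ if $x_ix_{-i}\succ y_ix_{-i}$ for some $x_ix_{-i},y_ix_{-i}\in A$. Let $I$ be a set of consecutive integers. A family $g^k_i\in X_i$ ($k\in I$) is a *standard sequence* on $i$ *contained in* $A$ if there are $l\ne i$, $z_{-il}$ and $y^0_l\not\sim_l y^1_l$ such that $g^k_iy^1_lz_{-il}\sim g^{k+1}_iy^0_lz_{-il}$ whenever $k,k+1\in I$, and all these points are in $A$. **Axioms.** Assume: (A1) $\succcurlyeq$ is complete and transitive. (A2) If $a_ix_{-i}\succ b_ix_{-i}$ for some $x_{-i}$, then $a_iy_{-i}\succcurlyeq b_iy_{-i}$ for all $y_{-i}$. (A3) For all $z$ and $i\neq j$, $ij$-triple cancellation holds on $SE^z_{ij}$ or on $NW^z_{ij}$; and (acyclicity) for $i\ne k$, $i\,S^z\cdots S^z k$ implies $i\,R^z k$. (A4) $a_ix_{-i}\preccurlyeq b_iy_{-i}$, $a_iw_{-i}\succcurlyeq b_iz_{-i}$ and $c_ix_{-i}\succcurlyeq d_iy_{-i}$ imply $c_iw_{-i}\succcurlyeq d_iz_{-i}$,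 provided that either (a) all eight points are in one $X^{S_a}$; or (b) $a_ix_{-i},b_iy_{-i},a_iw_{-i},b_iz_{-i}$ are in some $X^{S_a}$ on which $i$ is essential and the other four points are in some $X^{S_b}$; or (c) $a_ix_{-i},b_iy_{-i},c_ix_{-i},d_iy_{-i}$ are in some $X^{S_a}$ on which $i$ is essential and the other four points are in some $X^{S_b}$. (A5) For $i\ne j$: $a_ix_{-i}\preccurlyeq b_iy_{-i}$, $c_ix_{-i}\succcurlyeq d_iy_{-i}$, $a_iy^0_{-i}\sim p_jx^0_{-j}$, $b_iy^0_{-i}\sim q_jx^0_{-j}$, $c_iy^1_{-i}\sim r_jx^1_{-j}$, $d_iy^1_{-i}\sim s_jx^1_{-j}$ and $p_je_{-j}\succcurlyeq q_jf_{-j}$ imply $r_je_{-j}\succcurlyeq s_jf_{-j}$, provided that $a_ix_{-i},b_iy_{-i},c_ix_{-i},d_iy_{-i}$ are in one $X^{S_a}$ on which $i$ is essential, $a_iy^0_{-i},b_iy^0_{-i},c_iy^1_{-i},d_iy^1_{-i}$ are in one $X^{S_b}$, $p_jx^0_{-j},q_jx^0_{-j},r_jx^1_{-j},s_jx^1_{-j}$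 are in one $X^{S_c}$ on which $j$ is essential, and $p_je_{-j},q_jf_{-j},r_je_{-j},s_jf_{-j}$ are in one $X^{S_d}$. (A6) If $a_ix_{-i},b_ix_{-i},c_ix_{-i},d_ix_{-i}\in X^{S_a}$, $a_ix_{-i}\succ b_ix_{-i}$ and $c_iy_{-i}\succ d_iy_{-i}$ for some $y_{-i}$, then $c_ix_{-i}\succ d_ix_{-i}$. (A7) Every coordinate is essential on $X$. (A8) If $a_ix_{-i}\succcurlyeq y\succcurlyeq b_ix_{-i}$, then $c_ix_{-i}\sim y$ for some $c_i$. (A9) Every standard sequence contained in some $X^{S_a}$ and bounded above and below by elements of $X_i$ is finite (as a set); and if exactly one coordinate is essential on $X^{S_a}$, then $X^{S_a}$ has a countable order-dense subset. **Structural assumptions.** Assume also: if $a_ix_{-i}\sim b_ix_{-i}$ for all $x_{-i}$, then $a_i=b_i$; if $a_ix_{-i}\succ b_ix_{-i}$, then $a_ix_{-i}\succ c_ix_{-i}\succ b_ix_{-i}$ for some $c_i$; for $i\neq j$, if $i\,S^{x_iz_{-i}}j$ and $j\,S^{y_iz_{-i}}i$, then $i\,E^{c_iz_{-i}}j$ for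 some $c_i\in X_i$; for every maximal interaction clique $A$ there are two points, different on $A$, at both of which $i\,E\,j$ for all distinct $i,j\in A$. **Theorem.** Let $i\neq j$ be interacting coordinates. Suppose that there are coordinate orders $S_a,S_b$ with $i\,S_a j$ and $j\,S_b i$ that agree on all other ordered pairs, and that $i$ and $j$ are both essential on $X^{S_a}$ and on $X^{S_b}$. Let $r^0,r^1,r^2\in X$ satisfy $i\,E^{r^0}j$, $i\,E^{r^1}j$, $i\,E^{r^2}j$, their $i$-th and $j$-th coordinates being non-extreme. Let $a^k_i$ ($k\in I$) and $b^k_j$ ($k\in J$) be standard sequences on $i$ and on $j$, each contained in some $X^{S}$ on which that coordinate is essential, and let $m\neq 0$ and $n$ be integers with $0,m,n\in I\cap J$. If $$a^0_ir^0_{-i}\sim r^0,\quad b^0_jr^0_{-j}\sim r^0,\quad r^1_ir^0_{-i}\sim a^m_ir^0_{-i},\quad r^1_jr^0_{-j}\sim b^m_jr^0_{-j},\quad r^2_ir^0_{-i}\sim a^n_ir^0_{-i},$$ then $r^2_jr^0_{-j}\sim b^n_jr^0_{-j}$. -/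

import Mathlib

namespace Conjoint

/-! Preferences on a heterogeneous product `X 0 × ⋯ × X (n-1)`. The relation is `ge x y` (`x ≽ y`).
The point `a_i x_{-i}` is `Function.update x i a`, and `a_i p_j z_{-ij}` is
`Function.update (Function.update z i a) j p`. -/

variable {n : ℕ} {X : Fin n → Type*}

/-- Strict preference. -/
def Gt (ge : (∀ k, X k) → (∀ k, X k) → Prop) (x y : ∀ k, X k) : Prop :=
  ge x y ∧ ¬ ge y x

/-- Indifference. -/
def Sim (ge : (∀ k, X k) → (∀ k, X k) → Prop) (x y : ∀ k, X k) : Prop :=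
  ge x y ∧ ge y x

/-- `a_i p_j z_{-ij}`. -/
def pt2 (z : ∀ k, X k) (i j : Fin n) (a : X i) (p : X j) : ∀ k, X k :=
  Function.update (Function.update z i a) j p

/-- The coordinate relation: `a ≽_i b` iff `a_i x_{-i} ≽ b_i x_{-i}` for all `x_{-i}`. -/
def CoordGe (ge : (∀ k, X k) → (∀ k, X k) → Prop) (i : Fin n) (a b : X i) : Prop :=
  ∀ x : ∀ k, X k, ge (Function.update x i a) (Function.update x i b)

/-- `a ∼_i b`. -/
def CoordSim (ge : (∀ k, X k) → (∀ k, X k) → Prop) (i : Fin n) (a b : X i) : Prop :=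
  CoordGe ge i a b ∧ CoordGe ge i b a

/-- `a` is maximal in `X i`. -/
def IsMaxCoord (ge : (∀ k, X k) → (∀ k, X k) → Prop) (i : Fin n) (a : X i) : Prop :=
  ∀ b : X i, CoordGe ge i a b

/-- `a` is minimal in `X i`. -/
def IsMinCoord (ge : (∀ k, X k) → (∀ k, X k) → Prop) (i : Fin n) (a : X i) : Prop :=
  ∀ b : X i, CoordGe ge i b a

/-- `a` is neither maximal nor minimal in `X i`. -/
def NonExtreme (ge : (∀ k, X k) → (∀ k, X k) → Prop) (i : Fin n) (a : X i) : Prop :=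
  ¬ IsMaxCoord ge i a ∧ ¬ IsMinCoord ge i a

/-- `ij`-triple cancellation on the set `A`: the eight points involved lie in `A`. -/
def TripleCancelOn (ge : (∀ k, X k) → (∀ k, X k) → Prop) (i j : Fin n)
    (A : Set (∀ k, X k)) : Prop :=
  ∀ (a b c d : X i) (p q r s : X j) (z : ∀ k, X k),
    pt2 z i j a p ∈ A → pt2 z i j b q ∈ A → pt2 z i j a r ∈ A → pt2 z i j b s ∈ A →
    pt2 z i j c p ∈ A → pt2 z i j d q ∈ A → pt2 z i j c r ∈ A → pt2 z i j d s ∈ A →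
    ge (pt2 z i j b q) (pt2 z i j a p) →
    ge (pt2 z i j a r) (pt2 z i j b s) →
    ge (pt2 z i j c p) (pt2 z i j d q) →
    ge (pt2 z i j c r) (pt2 z i j d s)

/-- The cone `SE^z_{ij}`. -/
def SEcone (ge : (∀ k, X k) → (∀ k, X k) → Prop) (z : ∀ k, X k) (i j : Fin n) :
    Set (∀ k, X k) :=
  {x | (∀ k, k ≠ i → k ≠ j → x k = z k) ∧ CoordGe ge i (x i) (z i) ∧ CoordGe ge j (z j) (x j)}

/-- The cone `NW^z_{ij}`. -/
def NWcone (ge : (∀ k, X k) → (∀ k, X k) → Prop) (z : ∀ k, X k) (i j : Fin n) :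
    Set (∀ k, X k) :=
  {x | (∀ k, k ≠ i → k ≠ j → x k = z k) ∧ CoordGe ge i (z i) (x i) ∧ CoordGe ge j (x j) (z j)}

/-- `i R^z j`. -/
def RRel (ge : (∀ k, X k) → (∀ k, X k) → Prop) (z : ∀ k, X k) (i j : Fin n) : Prop :=
  TripleCancelOn ge i j (SEcone ge z i j)

/-- `i S^z j`, that is, not `j R^z i` (for distinct coordinates). -/
def SRel (ge : (∀ k, X k) → (∀ k, X k) → Prop) (z : ∀ k, X k) (i j : Fin n) : Prop :=
  i ≠ j ∧ ¬ RRel ge z j i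

/-- `i E^z j`. -/
def ERel (ge : (∀ k, X k) → (∀ k, X k) → Prop) (z : ∀ k, X k) (i j : Fin n) : Prop :=
  RRel ge z i j ∧ RRel ge z j i

/-- The set `SE_{ij}`: the union of three sets. -/
def SESet (ge : (∀ k, X k) → (∀ k, X k) → Prop) (i j : Fin n) : Set (∀ k, X k) :=
  {z | RRel ge z i j ∧ ¬ IsMaxCoord ge i (z i) ∧ ¬ IsMinCoord ge j (z j)} ∪
  {z | IsMaxCoord ge i (z i) ∧
    ¬ ∃ x y : X j, CoordGe ge j (z j) x ∧ CoordGe ge j x y ∧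
      RRel ge (Function.update z j x) j i ∧ ¬ RRel ge (Function.update z j y) j i} ∪
  {z | IsMinCoord ge j (z j) ∧
    ¬ ∃ x y : X i, CoordGe ge i y x ∧ CoordGe ge i x (z i) ∧
      RRel ge (Function.update z i x) j i ∧ ¬ RRel ge (Function.update z i y) j i}

/-- `S` is one of the finitely many coordinate orders `S_a`, i.e. `S = S^z` for some `z`. -/
def IsCoordOrder (ge : (∀ k, X k) → (∀ k, X k) → Prop) (S : Fin n → Fin n → Prop) : Prop :=
  ∃ z : ∀ k, X k, S = SRel ge z

/-- `X^S`, the intersection of the sets `SE_{kl}` over all `k ≠ l` with `k R l`,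
where `k R l` means not `l S k`. -/
def XSet (ge : (∀ k, X k) → (∀ k, X k) → Prop) (S : Fin n → Fin n → Prop) :
    Set (∀ k, X k) :=
  {z | ∀ k l, k ≠ l → ¬ S l k → z ∈ SESet ge k l}

/-- Coordinate `i` is essential on `A`. -/
def EssentialOn (ge : (∀ k, X k) → (∀ k, X k) → Prop) (i : Fin n)
    (A : Set (∀ k, X k)) : Prop :=
  ∃ (x : ∀ k, X k) (a b : X i), Function.update x i a ∈ A ∧ Function.update x i b ∈ A ∧
    Gt ge (Function.update x i a) (Function.update x i b)

/-- Coordinates `i` and `j` are interacting. -/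
def Interacting (ge : (∀ k, X k) → (∀ k, X k) → Prop) (i j : Fin n) : Prop :=
  ∃ z : ∀ k, X k, SRel ge z i j ∨ SRel ge z j i

/-- Interaction clique: any two elements are linked by a chain of interacting coordinates. -/
def IsClique (ge : (∀ k, X k) → (∀ k, X k) → Prop) (A : Set (Fin n)) : Prop :=
  A.Nonempty ∧ ∀ i ∈ A, ∀ j ∈ A, Relation.ReflTransGen (Interacting ge) i j

/-- The family `g k`, `k ∈ I`, where `I` is a set of consecutive integers, is a standard sequence
on coordinate `i` contained in `A`: for some other coordinate `l` and some `y0`, `y1` in `X l`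
with `y0 ≁_l y1` we have `g^k_i y1_l z_{-il} ∼ g^{k+1}_i y0_l z_{-il}` whenever `k, k+1 ∈ I`,
and all these points are in `A`. -/
def IsStdSeqIn (ge : (∀ k, X k) → (∀ k, X k) → Prop) (i : Fin n) (I : Set ℤ) (g : ℤ → X i)
    (A : Set (∀ k, X k)) : Prop :=
  I.OrdConnected ∧
  ∃ (l : Fin n) (z : ∀ k, X k) (y0 y1 : X l), l ≠ i ∧ ¬ CoordSim ge l y0 y1 ∧
    ∀ k : ℤ, k ∈ I → k + 1 ∈ I →
      pt2 z i l (g k) y1 ∈ A ∧ pt2 z i l (g (k + 1)) y0 ∈ A ∧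
      Sim ge (pt2 z i l (g k) y1) (pt2 z i l (g (k + 1)) y0)

/-- Intra-coordinate trade-off consistency (axiom A4). -/
def IntraTradeoff (ge : (∀ k, X k) → (∀ k, X k) → Prop) : Prop :=
  ∀ (i : Fin n) (a b c d : X i) (x y w z : ∀ k, X k),
    ((∃ S, IsCoordOrder ge S ∧
        Function.update x i a ∈ XSet ge S ∧ Function.update y i b ∈ XSet ge S ∧
        Function.update w i a ∈ XSet ge S ∧ Function.update z i b ∈ XSet ge S ∧
        Function.update x i c ∈ XSet ge S ∧ Function.update y i d ∈ XSet ge S ∧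
        Function.update w i c ∈ XSet ge S ∧ Function.update z i d ∈ XSet ge S) ∨
     (∃ S T, IsCoordOrder ge S ∧ IsCoordOrder ge T ∧
        Function.update x i a ∈ XSet ge S ∧ Function.update y i b ∈ XSet ge S ∧
        Function.update w i a ∈ XSet ge S ∧ Function.update z i b ∈ XSet ge S ∧
        EssentialOn ge i (XSet ge S) ∧
        Function.update x i c ∈ XSet ge T ∧ Function.update y i d ∈ XSet ge T ∧
        Function.update w i c ∈ XSet ge T ∧ Function.update z i d ∈ XSet ge T) ∨
     (∃ S T, IsCoordOrder ge S ∧ IsCoordOrder ge T ∧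
        Function.update x i a ∈ XSet ge S ∧ Function.update y i b ∈ XSet ge S ∧
        Function.update x i c ∈ XSet ge S ∧ Function.update y i d ∈ XSet ge S ∧
        EssentialOn ge i (XSet ge S) ∧
        Function.update w i a ∈ XSet ge T ∧ Function.update z i b ∈ XSet ge T ∧
        Function.update w i c ∈ XSet ge T ∧ Function.update z i d ∈ XSet ge T)) →
    ge (Function.update y i b) (Function.update x i a) →
    ge (Function.update w i a) (Function.update z i b) →
    ge (Function.update x i c) (Function.update y i d) →
    ge (Function.update w i c) (Function.update z i d)

/-- Inter-coordinate trade-off consistency (axiom A5). -/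
def InterTradeoff (ge : (∀ k, X k) → (∀ k, X k) → Prop) : Prop :=
  ∀ (i j : Fin n), i ≠ j → ∀ (a b c d : X i) (p q r s : X j)
    (x y y0 y1 x0 x1 e f : ∀ k, X k) (S₁ S₂ S₃ S₄ : Fin n → Fin n → Prop),
    IsCoordOrder ge S₁ → IsCoordOrder ge S₂ → IsCoordOrder ge S₃ → IsCoordOrder ge S₄ →
    Function.update x i a ∈ XSet ge S₁ → Function.update y i b ∈ XSet ge S₁ →
    Function.update x i c ∈ XSet ge S₁ → Function.update y i d ∈ XSet ge S₁ →
    EssentialOn ge i (XSet ge S₁) →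
    Function.update y0 i a ∈ XSet ge S₂ → Function.update y0 i b ∈ XSet ge S₂ →
    Function.update y1 i c ∈ XSet ge S₂ → Function.update y1 i d ∈ XSet ge S₂ →
    Function.update x0 j p ∈ XSet ge S₃ → Function.update x0 j q ∈ XSet ge S₃ →
    Function.update x1 j r ∈ XSet ge S₃ → Function.update x1 j s ∈ XSet ge S₃ →
    EssentialOn ge j (XSet ge S₃) →
    Function.update e j p ∈ XSet ge S₄ → Function.update f j q ∈ XSet ge S₄ →
    Function.update e j r ∈ XSet ge S₄ → Function.update f j s ∈ XSet ge S₄ →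
    ge (Function.update y i b) (Function.update x i a) →
    ge (Function.update x i c) (Function.update y i d) →
    Sim ge (Function.update y0 i a) (Function.update x0 j p) →
    Sim ge (Function.update y0 i b) (Function.update x0 j q) →
    Sim ge (Function.update y1 i c) (Function.update x1 j r) →
    Sim ge (Function.update y1 i d) (Function.update x1 j s) →
    ge (Function.update e j p) (Function.update f j q) →
    ge (Function.update e j r) (Function.update f j s)

/-- The axioms A1–A9 on the preference relation. -/
structure Axioms (ge : (∀ k, X k) → (∀ k, X k) → Prop) : Prop where
  /-- A1: weak order. -/
  total : ∀ x y, ge x y ∨ ge y x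
  trans : ∀ x y z, ge x y → ge y z → ge x z
  /-- A2: weak separability. -/
  weakSep : ∀ (i : Fin n) (a b : X i) (x y : ∀ k, X k),
    Gt ge (Function.update x i a) (Function.update x i b) →
      ge (Function.update y i a) (Function.update y i b)
  /-- A3: coordinate ordering completeness. -/
  coordComplete : ∀ (z : ∀ k, X k) (i j : Fin n), i ≠ j →
    TripleCancelOn ge i j (SEcone ge z i j) ∨ TripleCancelOn ge i j (NWcone ge z i j)
  /-- A3-ACYCL: coordinate ordering acyclicity. -/
  coordAcyclic : ∀ (z : ∀ k, X k) (i k : Fin n), i ≠ k →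
    Relation.TransGen (SRel ge z) i k → RRel ge z i k
  /-- A4. -/
  intra : IntraTradeoff ge
  /-- A5. -/
  inter : InterTradeoff ge
  /-- A6: bi-independence. -/
  biIndep : ∀ (S : Fin n → Fin n → Prop), IsCoordOrder ge S →
    ∀ (i : Fin n) (a b c d : X i) (x y : ∀ k, X k),
      Function.update x i a ∈ XSet ge S → Function.update x i b ∈ XSet ge S →
      Function.update x i c ∈ XSet ge S → Function.update x i d ∈ XSet ge S →
      Gt ge (Function.update x i a) (Function.update x i b) →
      Gt ge (Function.update y i c) (Function.update y i d) →
      Gt ge (Function.update x i c) (Function.update x i d)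
  /-- A7: essentiality. -/
  essential : ∀ i : Fin n, EssentialOn ge i Set.univ
  /-- A8: restricted solvability. -/
  solvable : ∀ (i : Fin n) (a b : X i) (x y : ∀ k, X k),
    ge (Function.update x i a) y → ge y (Function.update x i b) →
      ∃ c : X i, Sim ge (Function.update x i c) y
  /-- A9: every bounded standard sequence contained in some `X^S` is finite. -/
  archimedean : ∀ (S : Fin n → Fin n → Prop), IsCoordOrder ge S →
    ∀ (i : Fin n) (I : Set ℤ) (g : ℤ → X i), IsStdSeqIn ge i I g (XSet ge S) →
      (∃ lo hi : X i, ∀ k ∈ I, CoordGe ge i hi (g k) ∧ CoordGe ge i (g k) lo) →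
      (g '' I).Finite
  /-- A9, case of exactly one essential coordinate: a countable order-dense subset exists. -/
  orderDense : ∀ (S : Fin n → Fin n → Prop), IsCoordOrder ge S →
    (∃! i : Fin n, EssentialOn ge i (XSet ge S)) →
      ∃ D : Set (∀ k, X k), D.Countable ∧ D ⊆ XSet ge S ∧
        ∀ x ∈ XSet ge S, ∀ y ∈ XSet ge S, Gt ge x y → ∃ d ∈ D, ge x d ∧ ge d y

/-- The structural assumptions on the preference relation. -/
structure StructuralAssumptions (ge : (∀ k, X k) → (∀ k, X k) → Prop) : Prop where
  /-- Equivalent points along a dimension are collapsed. -/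
  collapsed : ∀ (i : Fin n) (a b : X i),
    (∀ x : ∀ k, X k, Sim ge (Function.update x i a) (Function.update x i b)) → a = b
  /-- Density. -/
  dense : ∀ (i : Fin n) (a b : X i) (x : ∀ k, X k),
    Gt ge (Function.update x i a) (Function.update x i b) →
      ∃ c : X i, Gt ge (Function.update x i a) (Function.update x i c) ∧
        Gt ge (Function.update x i c) (Function.update x i b)
  /-- Closedness. -/
  closed : ∀ (i j : Fin n), i ≠ j → ∀ (z : ∀ k, X k) (a b : X i),
    SRel ge (Function.update z i a) i j → SRel ge (Function.update z i b) j i →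
      ∃ c : X i, ERel ge (Function.update z i c) i j
  /-- Geometry of `X`: for every maximal interaction clique `A` there are two points, different
  on `A`, at which all pairs of distinct coordinates of `A` are in the relation `E`. -/
  geometry : ∀ A : Set (Fin n), Maximal (IsClique ge) A →
    ∃ r0 r1 : ∀ k, X k, (∃ i ∈ A, r0 i ≠ r1 i) ∧
      ∀ i ∈ A, ∀ j ∈ A, i ≠ j → ERel ge r0 i j ∧ ERel ge r1 i j

end Conjoint

/-! The argument has two halves: interaction of two coordinates leaves no room for a third one, and
a preference on two coordinates is represented by a function that is additive on each of two
regions, from which the claim is read off.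

First half. A failure of strict monotonicity would, by density and closedness, produce an infinite
pattern of rows and columns that finitely many coordinate orders and A4 exclude (`Rep.strictMono`).
Hence a failure of triple cancellation can be made strict and placed at non-extreme elements
(`exists_strictFail_of_not_RRel`). Strict failures persist nearby, so every open rectangle contains
one of constant coordinate order (`exists_tame`). Now suppose that there is a third coordinate. By
pigeonhole and A4, a level of one slice of a plane meets only finitely many levels of a parallel
slice (`finite_values`), and the two slices are then ordered alike unless one contains an infinite
staircase between two levels (`eq_of_eq`). A5 and the Archimedean axiom exclude staircases
(`noStair_of_tame`, `noStair`). Increments on one coordinate can therefore be measured on another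
independently of the rest, and fine grids with a common unit yield triple cancellation in every
plane (`not_strictFail`). So no two coordinates interact (`not_interacting_of_three`).

Second half. With `i` and `j` alone, the non-extreme plane is covered by a region inside the set of
`Sa` and one inside the set of `Sb`. Counting ever finer standard sequences represents a quadrant
additively (`Corner.exists_rep`), and quadrants are glued to represent a region
(`Region.exists_rep`). A4 makes the two representations proportional on each coordinate
(`Cells.exists_ratio`), A5 makes their levels proportional (`Cells.exists_matched`). The result is a
function equal to `u + v` on one region and to `ωi * u + ωj * v` on the other
(`Cells.exists_weightedRep`), normalised to vanish at `r0`. At a point with `i E j` both formulas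
hold, so `(ωi - 1) * u + (ωj - 1) * v = 0` there. Standard sequences progress at constant rates `A`
in `u` and `B` in `v` (`Rep.exists_rate`). The point `r1` gives `(ωi - 1) * A + (ωj - 1) * B = 0`,
since `m ≠ 0`; the point `r2`, where `u` is `k * A`, then gives `(ωj - 1) * (v - k * B) = 0`. If `ωj
= 1`, then `ωi = 1` and the preference would be additive, against `Sa i j`. So `v` is `k * B` at
`r2`, which is its value at `b k` (`Rep.eq_of_counts`). -/

namespace Conjoint

-- Order-valued representation and coordinate chains

universe u

variable {n : ℕ} {X : Fin n → Type u}

/-- A numerical-style representation of the preference: `V` is order-valued, and every coordinate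
carries the linear order induced by the preference. -/
structure Rep [∀ k, LinearOrder (X k)] {L : Type*} [LinearOrder L]
    (ge : (∀ k, X k) → (∀ k, X k) → Prop) (V : (∀ k, X k) → L) : Prop where
  ax : Axioms ge
  str : StructuralAssumptions ge
  ge_iff : ∀ x y, ge x y ↔ V y ≤ V x
  le_iff : ∀ k (a b : X k), a ≤ b ↔ CoordGe ge k b a

/-- The quotient by indifference serves as the chain of values; real numbers enter only in the
second half of the proof. -/
theorem exists_orderValued {P : Type u} (ge : P → P → Prop) (htot : ∀ x y, ge x y ∨ ge y x)
    (htr : ∀ x y z, ge x y → ge y z → ge x z) :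
    ∃ (L : Type u) (_ : LinearOrder L) (V : P → L), ∀ x y, ge x y ↔ V y ≤ V x := by
  classical
  let _ : Preorder P :=
    { le := fun x y => ge y x
      le_refl := fun x => (htot x x).elim id id
      le_trans := fun x y z h1 h2 => htr _ _ _ h2 h1 }
  let _ : Std.Total (α := P) (· ≤ ·) := ⟨fun x y => htot y x⟩
  exact ⟨Antisymmetrization P (· ≤ ·), inferInstance, toAntisymmetrization (· ≤ ·),
    fun x y => Iff.rfl⟩

/-- Failure in both directions would mean strict preferences in opposite directions, which weak
separability forbids. -/
theorem coordGe_total {ge : (∀ k, X k) → (∀ k, X k) → Prop} (hax : Axioms ge) (k : Fin n)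
    (a b : X k) : CoordGe ge k a b ∨ CoordGe ge k b a := by
  by_contra h
  push Not at h
  obtain ⟨h1, h2⟩ := h
  simp only [CoordGe, not_forall] at h1 h2
  obtain ⟨x, hx⟩ := h1
  obtain ⟨y, hy⟩ := h2
  refine hy (hax.weakSep k b a x y ⟨?_, hx⟩)
  exact (hax.total _ _).resolve_left hx

/-- Antisymmetry of the coordinate orders is the assumption that equivalent elements coincide. -/
theorem exists_rep {ge : (∀ k, X k) → (∀ k, X k) → Prop} (hax : Axioms ge)
    (hstr : StructuralAssumptions ge) :
    ∃ (_ : ∀ k, LinearOrder (X k)) (L : Type u) (_ : LinearOrder L) (V : (∀ k, X k) → L),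
      Rep ge V := by
  classical
  obtain ⟨L, iL, V, hV⟩ := exists_orderValued ge hax.total hax.trans
  let io : ∀ k, LinearOrder (X k) := fun k =>
    { le := fun a b => CoordGe ge k b a
      le_refl := fun a x => (hax.total _ _).elim id id
      le_trans := fun a b c h1 h2 x => hax.trans _ _ _ (h2 x) (h1 x)
      le_antisymm := fun a b h1 h2 => hstr.collapsed k a b fun x => ⟨h2 x, h1 x⟩
      le_total := fun a b => coordGe_total hax k b a
      toDecidableLE := Classical.decRel _ }
  exact ⟨io, L, iL, V, hax, hstr, hV, fun k a b => Iff.rfl⟩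

theorem pt2_self_left (z : ∀ k, X k) {i j : Fin n} (h : i ≠ j) (a : X i) (p : X j) :
    pt2 z i j a p i = a := by simp [pt2, h]

theorem pt2_self_right (z : ∀ k, X k) (i j : Fin n) (a : X i) (p : X j) :
    pt2 z i j a p j = p := by simp [pt2]

theorem pt2_of_ne (z : ∀ k, X k) {i j k : Fin n} (hi : k ≠ i) (hj : k ≠ j) (a : X i) (p : X j) :
    pt2 z i j a p k = z k := by simp [pt2, hi, hj]

theorem pt2_comm (z : ∀ k, X k) {i j : Fin n} (h : i ≠ j) (a : X i) (p : X j) :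
    pt2 z i j a p = pt2 z j i p a := by
  simp only [pt2]; rw [Function.update_comm h.symm]

theorem pt2_pt2 (z : ∀ k, X k) {i j : Fin n} (h : i ≠ j) (a b : X i) (p q : X j) :
    pt2 (pt2 z i j a p) i j b q = pt2 z i j b q := by
  funext k
  by_cases hj : k = j
  · subst hj; simp [pt2]
  · by_cases hi : k = i
    · subst hi; simp [pt2, hj]
    · simp [pt2, hi, hj]

theorem pt2_update_left (z : ∀ k, X k) {i j : Fin n} (a b : X i) (p : X j) :
    pt2 (Function.update z i b) i j a p = pt2 z i j a p := by
  simp [pt2]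

theorem update_pt2_left (z : ∀ k, X k) {i j : Fin n} (h : i ≠ j) (a b : X i) (p : X j) :
    Function.update (pt2 z i j a p) i b = pt2 z i j b p := by
  funext k
  by_cases hi : k = i
  · subst hi; simp [pt2, h]
  · by_cases hj : k = j
    · subst hj; simp [pt2, hi]
    · simp [pt2, hi, hj]

theorem update_pt2_right (z : ∀ k, X k) {i j : Fin n} (a : X i) (p q : X j) :
    Function.update (pt2 z i j a p) j q = pt2 z i j a q := by
  simp [pt2]

/-! ### Strict monotonicity in every coordinate -/

/-- Pattern of constancy and strictness in a plane, produced by closedness. -/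
theorem exists_closed_columns {α β L : Type*} [iα : LinearOrder α] [iβ : LinearOrder β]
    [iL : LinearOrder L]
    {F : α → β → L} (m1 : ∀ p, Monotone fun a => F a p) (m2 : ∀ a, Monotone (F a))
    {R1 R2 : α → β → Prop}
    (ind1 : ∀ z w x y r s, R1 z w → z ≤ x → z ≤ y → r ≤ w → s ≤ w → F x r = F x s → F y r = F y s)
    (ind2 : ∀ z w x y r s, R2 z w → x ≤ z → y ≤ z → w ≤ r → w ≤ s → F x r = F x s → F y r = F y s)
    (closed : ∀ w u u', ¬ R2 u w → ¬ R1 u' w → ∃ c, R1 c w ∧ R2 c w)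
    {u u' : α} (huu : u' < u) {w : ℕ → β} (hw : StrictMono w)
    (hs : StrictMono fun t => F u (w t)) (hc : ∀ s t, F u' (w s) = F u' (w t)) :
    ∃ c : ℕ → α, (∀ t, u' < c t ∧ c t < u) ∧
      (∀ t s s', s ≤ t + 1 → s' ≤ t + 1 → s ≠ s' → F (c t) (w s) ≠ F (c t) (w s')) ∧
      (∀ t s s', t + 1 ≤ s → t + 1 ≤ s' → F (c t) (w s) = F (c t) (w s')) ∧
      (∀ t t' s, t < t' → t' < s → F (c t) (w s) < F (c t') (w s)) := by
  have hne : ∀ s s', s ≠ s' → F u (w s) ≠ F u (w s') := fun s s' h h' => h (hs.injective h')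
  -- `R1` at a column up to `u'` would carry the constancy along `u'` over to `u`, and so would `R2`
  -- at a column from `u` on. Closedness therefore yields columns strictly between `u'` and `u`
  -- where both hold: they separate the lower rows, like `u`, and are constant on the upper ones,
  -- like `u'`.
  have hR1 : ∀ x t, x ≤ u' → ¬ R1 x (w (t + 1)) := fun x t hx h =>
    hne t (t + 1) (by omega) (ind1 _ _ u' u _ _ h hx (hx.trans huu.le) (hw.monotone (by omega)) le_rfl
      (hc _ _))
  have hR2 : ∀ x t, u ≤ x → ¬ R2 x (w (t + 1)) := fun x t hx h =>
    hne (t + 1) (t + 2) (by omega) (ind2 _ _ u' u _ _ h (huu.le.trans hx) hx le_rfl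
      (hw.monotone (by omega)) (hc _ _))
  choose c hc1 hc2 using fun t => closed (w (t + 1)) u u' (hR2 u t le_rfl) (hR1 u' t le_rfl)
  have hlt : ∀ t, u' < c t ∧ c t < u := fun t =>
    ⟨not_le.1 fun h => hR1 _ t h (hc1 t), not_le.1 fun h => hR2 _ t h (hc2 t)⟩
  have hstr : ∀ t s s', s ≤ t + 1 → s' ≤ t + 1 → s ≠ s' → F (c t) (w s) ≠ F (c t) (w s') :=
    fun t s s' h h' hss he => hne s s' hss (ind1 _ _ _ _ _ _ (hc1 t) le_rfl (hlt t).2.le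
      (hw.monotone h) (hw.monotone h') he)
  have hcon : ∀ t s s', t + 1 ≤ s → t + 1 ≤ s' → F (c t) (w s) = F (c t) (w s') :=
    fun t s s' h h' => ind2 _ _ _ _ _ _ (hc2 t) (hlt t).1.le le_rfl
      (hw.monotone h) (hw.monotone h') (hc _ _)
  refine ⟨c, hlt, hstr, hcon, fun t t' s htt hs' => ?_⟩
  -- Otherwise `R1` at `c t'` would transfer to `u` the equality of rows `t'` and `t' + 1`, which
  -- holds in column `c t` because `t < t'`.
  have hcc : c t < c t' := by
    refine not_le.1 fun h => ?_
    exact hne t' (t' + 1) (by omega) (ind1 _ _ (c t) u _ _ (hc1 t') h ((h.trans (hlt t).2.le))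
      (hw.monotone (by omega)) le_rfl (hcon _ _ _ (by omega) (by omega)))
  calc F (c t) (w s) = F (c t) (w (t + 1)) := hcon _ _ _ (by omega) le_rfl
    _ ≤ F (c t') (w (t + 1)) := m1 _ hcc.le
    _ < F (c t') (w (t' + 1)) := lt_of_le_of_ne (m2 _ (hw.monotone (by omega)))
        (hstr _ _ _ (by omega) le_rfl (by omega))
    _ = F (c t') (w s) := hcon _ _ _ le_rfl (by omega)


/-- Reversing the orders of both coordinates and of the values exchanges `R1` and `R2`. -/
theorem exists_closed_columns_anti {α β L : Type*} [LinearOrder α] [LinearOrder β] [LinearOrder L]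
    {F : α → β → L} (m1 : ∀ p, Monotone fun a => F a p) (m2 : ∀ a, Monotone (F a))
    {R1 R2 : α → β → Prop}
    (ind1 : ∀ z w x y r s, R1 z w → z ≤ x → z ≤ y → r ≤ w → s ≤ w → F x r = F x s → F y r = F y s)
    (ind2 : ∀ z w x y r s, R2 z w → x ≤ z → y ≤ z → w ≤ r → w ≤ s → F x r = F x s → F y r = F y s)
    (closed : ∀ w u u', ¬ R2 u w → ¬ R1 u' w → ∃ c, R1 c w ∧ R2 c w)
    {u u' : α} (huu : u < u') {w : ℕ → β} (hw : StrictAnti w)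
    (hs : StrictAnti fun t => F u (w t)) (hc : ∀ s t, F u' (w s) = F u' (w t)) :
    ∃ c : ℕ → α, (∀ t, u < c t ∧ c t < u') ∧
      (∀ t s s', s ≤ t + 1 → s' ≤ t + 1 → s ≠ s' → F (c t) (w s) ≠ F (c t) (w s')) ∧
      (∀ t s s', t + 1 ≤ s → t + 1 ≤ s' → F (c t) (w s) = F (c t) (w s')) ∧
      (∀ t t' s, t < t' → t' < s → F (c t') (w s) < F (c t) (w s)) := by
  obtain ⟨c, h1, h2⟩ := exists_closed_columns (α := αᵒᵈ) (β := βᵒᵈ) (L := Lᵒᵈ)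
    (iα := OrderDual.instLinearOrder α) (iβ := OrderDual.instLinearOrder β)
    (iL := OrderDual.instLinearOrder L)
    (F := fun a p => OrderDual.toDual (F (OrderDual.ofDual a) (OrderDual.ofDual p)))
    (fun p x y h => m1 (OrderDual.ofDual p) h) (fun a x y h => m2 (OrderDual.ofDual a) h)
    (R1 := fun a p => R2 (OrderDual.ofDual a) (OrderDual.ofDual p))
    (R2 := fun a p => R1 (OrderDual.ofDual a) (OrderDual.ofDual p))
    (fun _ _ _ _ _ _ h1 h2 h3 h4 h5 h6 => ind2 _ _ _ _ _ _ h1 h2 h3 h4 h5 h6)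
    (fun _ _ _ _ _ _ h1 h2 h3 h4 h5 h6 => ind1 _ _ _ _ _ _ h1 h2 h3 h4 h5 h6)
    (fun w u u' h h' => (closed (OrderDual.ofDual w) (OrderDual.ofDual u') (OrderDual.ofDual u)
      h' h).imp fun c hc => hc.symm)
    (u := OrderDual.toDual u) (u' := OrderDual.toDual u') huu
    (w := fun t => OrderDual.toDual (w t)) (fun s t h => hw h) (fun s t h => hs h) hc
  exact ⟨fun t => OrderDual.ofDual (c t), fun t => ⟨(h1 t).2, (h1 t).1⟩, h2⟩

namespace Rep

/-- At non-extreme coordinates the first clause of `SESet` suffices. -/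
theorem mem_XSet {ge : (∀ k, X k) → (∀ k, X k) → Prop} {z : ∀ k, X k} (hz : ∀ k, NonExtreme ge k (z k))
    {S : Fin n → Fin n → Prop} (h : ∀ k l, k ≠ l → ¬ S l k → RRel ge z k l) :
    z ∈ XSet ge S := fun k l hkl hS => Or.inl (Or.inl ⟨h k l hkl hS, (hz k).1, (hz l).2⟩)

theorem mem_XSet_of_eq {ge : (∀ k, X k) → (∀ k, X k) → Prop} {z : ∀ k, X k} (hz : ∀ k, NonExtreme ge k (z k))
    {S : Fin n → Fin n → Prop} (h : SRel ge z = S) :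
    z ∈ XSet ge S := mem_XSet hz fun k l hkl hS => by
  subst h
  by_contra hc
  exact hS ⟨hkl.symm, hc⟩

/-- Properties stable under changing one good coordinate to a good value are constant. -/
theorem iff_of_good {T : (∀ k, X k) → Prop} {G : ∀ k, X k → Prop}
    (hT : ∀ x m v, (∀ m, G m (x m)) → G m v → T x → T (Function.update x m v))
    {x y : ∀ k, X k} (hx : ∀ m, G m (x m)) (hy : ∀ m, G m (y m)) (h : T x) : T y := by
  classical
  have : ∀ s : Finset (Fin n), T (s.piecewise y x) := by
    intro s
    induction s using Finset.induction_on with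
    | empty => simpa using h
    | insert m s hm ih =>
      rw [Finset.piecewise_insert]
      refine hT _ _ _ (fun m' => ?_) (hy m) ih
      by_cases hm' : m' ∈ s
      · simp [hm', hy]
      · simp [hm', hx]
  simpa using this Finset.univ

/-- Number of extreme coordinates other than `k`. -/
noncomputable def numExtreme (ge : (∀ k, X k) → (∀ k, X k) → Prop) (k : Fin n) (x : ∀ k, X k) : ℕ :=
  by classical exact (Finset.univ.filter fun m => m ≠ k ∧ ¬ NonExtreme ge m (x m)).card

theorem numExtreme_lt {ge : (∀ k, X k) → (∀ k, X k) → Prop} {k m : Fin n} (hm : m ≠ k) {x : ∀ k, X k} (hx : ¬ NonExtreme ge m (x m))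
    {v : X m} (hv : NonExtreme ge m v) :
    numExtreme ge k (Function.update x m v) < numExtreme ge k x := by
  classical
  unfold numExtreme
  apply Finset.card_lt_card
  rw [Finset.ssubset_iff_of_subset]
  · exact ⟨m, by simp [hm, hx], by simp [hv]⟩
  · intro l hl
    by_cases h : l = m
    · subst h; simp [hv] at hl
    · simpa [h] using hl

variable [∀ k, LinearOrder (X k)] {L : Type*} [LinearOrder L]
  {ge : (∀ k, X k) → (∀ k, X k) → Prop} {V : (∀ k, X k) → L}

theorem gt_iff (R : Rep ge V) (x y : ∀ k, X k) : Gt ge x y ↔ V y < V x := by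
  rw [Gt, R.ge_iff, R.ge_iff, not_le]
  exact ⟨fun h => h.2, fun h => ⟨h.le, h⟩⟩

theorem sim_iff (R : Rep ge V) (x y : ∀ k, X k) : Sim ge x y ↔ V x = V y := by
  rw [Sim, R.ge_iff, R.ge_iff]
  exact ⟨fun h => le_antisymm h.2 h.1, fun h => ⟨h.ge, h.le⟩⟩

theorem mono (R : Rep ge V) (k : Fin n) (x : ∀ k, X k) :
    Monotone fun a => V (Function.update x k a) := fun a b h =>
  (R.ge_iff _ _).1 ((R.le_iff k a b).1 h x)

theorem lt_of_lt (R : Rep ge V) {k : Fin n} {x : ∀ k, X k} {a b : X k}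
    (h : V (Function.update x k a) < V (Function.update x k b)) : a < b :=
  not_le.1 fun h' => h.not_ge (R.mono k x h')

theorem exists_lt (R : Rep ge V) {k : Fin n} {a b : X k} (h : a < b) :
    ∃ x : ∀ k, X k, V (Function.update x k a) < V (Function.update x k b) := by
  by_contra hc
  push Not at hc
  exact h.not_ge ((R.le_iff k b a).2 fun x => (R.ge_iff _ _).2 (hc x))

theorem dense (R : Rep ge V) {k : Fin n} {x : ∀ k, X k} {a b : X k}
    (h : V (Function.update x k a) < V (Function.update x k b)) :
    ∃ c, V (Function.update x k a) < V (Function.update x k c) ∧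
      V (Function.update x k c) < V (Function.update x k b) := by
  obtain ⟨c, h1, h2⟩ := R.str.dense k b a x ((R.gt_iff _ _).2 h)
  exact ⟨c, (R.gt_iff _ _).1 h2, (R.gt_iff _ _).1 h1⟩

theorem solv (R : Rep ge V) {k : Fin n} {x y : ∀ k, X k} {a b : X k}
    (h1 : V (Function.update x k a) ≤ V y) (h2 : V y ≤ V (Function.update x k b)) :
    ∃ c, V (Function.update x k c) = V y := by
  obtain ⟨c, hc⟩ := R.ax.solvable k b a x y ((R.ge_iff _ _).2 h2) ((R.ge_iff _ _).2 h1)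
  exact ⟨c, (R.sim_iff _ _).1 hc⟩

theorem nonExtreme_iff (R : Rep ge V) {k : Fin n} {a : X k} :
    NonExtreme ge k a ↔ (∃ b, a < b) ∧ ∃ b, b < a := by
  simp only [NonExtreme, IsMaxCoord, IsMinCoord, ← R.le_iff, not_forall, not_le]

theorem exists_nonExtreme (R : Rep ge V) (k : Fin n) : ∃ a, NonExtreme ge k a := by
  obtain ⟨x, a, b, -, -, h⟩ := R.ax.essential k
  obtain ⟨c, h1, h2⟩ := R.dense ((R.gt_iff _ _).1 h)
  exact ⟨c, R.nonExtreme_iff.2 ⟨⟨_, R.lt_of_lt h2⟩, ⟨_, R.lt_of_lt h1⟩⟩⟩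

/-- Form (b) of A4, with the same element on both sides of each comparison, becomes independence of
a common coordinate, across two cells. -/
theorem ind (R : Rep ge V) {i : Fin n} {a c : X i} {w z : ∀ k, X k} {S T : Fin n → Fin n → Prop}
    (hS : IsCoordOrder ge S) (hT : IsCoordOrder ge T) (hi : EssentialOn ge i (XSet ge S))
    (h1 : Function.update w i a ∈ XSet ge S) (h2 : Function.update z i a ∈ XSet ge S)
    (h3 : Function.update w i c ∈ XSet ge T) (h4 : Function.update z i c ∈ XSet ge T)
    (h : V (Function.update w i a) ≤ V (Function.update z i a)) :
    V (Function.update w i c) ≤ V (Function.update z i c) := by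
  rw [← R.ge_iff] at h ⊢
  exact R.ax.intra i a a c c z z z w (Or.inr (Or.inl ⟨S, T, hS, hT, h2, h2, h2, h1, hi, h4, h4, h4, h3⟩))
    ((R.ax.total _ _).elim id id) h ((R.ax.total _ _).elim id id)

theorem mem_SEcone_pt2 (R : Rep ge V) {z : ∀ k, X k} {i k : Fin n} (hik : i ≠ k) {a x : X i}
    {p r : X k} : pt2 z i k x r ∈ SEcone ge (pt2 z i k a p) i k ↔ a ≤ x ∧ r ≤ p := by
  simp only [SEcone, Set.mem_ofPred_eq, pt2_self_left _ hik, pt2_self_right, R.le_iff]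
  refine ⟨fun h => h.2, fun h => ⟨fun m h1 h2 => ?_, h⟩⟩
  rw [pt2_of_ne _ h1 h2, pt2_of_ne _ h1 h2]

theorem tripleCancel (R : Rep ge V) {z : ∀ k, X k} {i k : Fin n} (hik : i ≠ k) {u : X i}
    {w : X k} (h : RRel ge (pt2 z i k u w) i k) {a b c d : X i} {p q r s : X k}
    (ha : u ≤ a) (hb : u ≤ b) (hc : u ≤ c) (hd : u ≤ d)
    (hp : p ≤ w) (hq : q ≤ w) (hr : r ≤ w) (hs : s ≤ w)
    (h1 : V (pt2 z i k a p) ≤ V (pt2 z i k b q)) (h2 : V (pt2 z i k b s) ≤ V (pt2 z i k a r))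
    (h3 : V (pt2 z i k d q) ≤ V (pt2 z i k c p)) :
    V (pt2 z i k d s) ≤ V (pt2 z i k c r) := by
  have key := h a b c d p q r s (pt2 z i k u w)
  simp only [pt2_pt2 _ hik, R.mem_SEcone_pt2 hik, R.ge_iff] at key
  exact key ⟨ha, hp⟩ ⟨hb, hq⟩ ⟨ha, hr⟩ ⟨hb, hs⟩ ⟨hc, hp⟩ ⟨hd, hq⟩ ⟨hc, hr⟩ ⟨hd, hs⟩ h1 h2 h3

/-- Triple cancellation with two of its three premises trivial moves an indifference from one column
of the cone to another. -/
theorem cone_ind (R : Rep ge V) {z : ∀ k, X k} {i k : Fin n} (hik : i ≠ k) {u : X i}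
    {w : X k} (h : RRel ge (pt2 z i k u w) i k) {x y : X i} {r s : X k}
    (hx : u ≤ x) (hy : u ≤ y) (hr : r ≤ w) (hs : s ≤ w)
    (h1 : V (pt2 z i k x r) = V (pt2 z i k x s)) : V (pt2 z i k y r) = V (pt2 z i k y s) :=
  le_antisymm (R.tripleCancel hik h hx hx hy hy hr hr hs hr le_rfl h1.le le_rfl)
    (R.tripleCancel hik h hx hx hy hy hr hr hr hs le_rfl h1.ge le_rfl)

theorem cone_ind' (R : Rep ge V) {z : ∀ k, X k} {i k : Fin n} (hik : i ≠ k) {u : X i}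
    {w : X k} (h : RRel ge (pt2 z i k u w) k i) {x y : X i} {r s : X k}
    (hx : x ≤ u) (hy : y ≤ u) (hr : w ≤ r) (hs : w ≤ s)
    (h1 : V (pt2 z i k x r) = V (pt2 z i k x s)) : V (pt2 z i k y r) = V (pt2 z i k y s) := by
  simp only [pt2_comm z hik] at *
  have h' := fun a b c d p q r s h1 h2 h3 h4 h5 h6 h7 h8 =>
    R.tripleCancel hik.symm h (a := a) (b := b) (c := c) (d := d) (p := p) (q := q) (r := r) (s := s)
      h1 h2 h3 h4 h5 h6 h7 h8
  exact le_antisymm (h' r r s r x x y y hr hr hs hr hx hx hy hy le_rfl le_rfl h1.le)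
    (h' s s r s x x y y hs hs hr hs hx hx hy hy le_rfl le_rfl h1.ge)


/-- A colour pattern forbidden by coordinate independence. -/
theorem no_pattern (R : Rep ge V) {i k : Fin n} (hik : i ≠ k) {z : ∀ k, X k}
    (hz : ∀ m, m ≠ i → m ≠ k → NonExtreme ge m (z m)) {c : ℕ → X i} {w : ℕ → X k} {u : X i}
    (hu : NonExtreme ge i u) (hcn : ∀ t, NonExtreme ge i (c t)) (hwn : ∀ t, NonExtreme ge k (w t))
    (hs : ∀ s t, s ≠ t → V (pt2 z i k u (w s)) ≠ V (pt2 z i k u (w t)))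
    (hc : ∀ t s s', t < s → t < s' → V (pt2 z i k (c t) (w s)) = V (pt2 z i k (c t) (w s')))
    (hd : ∀ t t' s, t < t' → t' < s → V (pt2 z i k (c t) (w s)) ≠ V (pt2 z i k (c t') (w s))) :
    False := by
  classical
  let C := Fin n → Fin n → Prop
  -- `N` is the number of relations on the coordinates. Among the infinitely many rows beyond `N`,
  -- two agree in colour on `N + 1` columns and on `u`; two of these columns then agree in colour in
  -- such a row.
  obtain ⟨N, ⟨e⟩⟩ := Finite.exists_equiv_fin C
  let col : X i → X k → C := fun a p => SRel ge (pt2 z i k a p)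
  have hmem : ∀ a p, NonExtreme ge i a → NonExtreme ge k p →
      pt2 z i k a p ∈ XSet ge (col a p) := fun a p ha hp => mem_XSet_of_eq (fun m => by
    by_cases hi : m = i
    · subst hi; rwa [pt2_self_left _ hik]
    · by_cases hk : m = k
      · subst hk; rwa [pt2_self_right]
      · rw [pt2_of_ne _ hi hk]; exact hz m hi hk) rfl
  obtain ⟨s, s', hss, he⟩ := Finite.exists_ne_map_eq_of_infinite
    (fun s : ℕ => (fun t : Fin (N + 1) => col (c t) (w (N + 1 + s)), col u (w (N + 1 + s))))
  simp only [Prod.mk.injEq, funext_iff] at he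
  obtain ⟨he1, he2⟩ := he
  obtain ⟨t, t', htt, hte⟩ := Fintype.exists_ne_map_eq_of_card_lt
    (fun t : Fin (N + 1) => e (col (c t) (w (N + 1 + s)))) (by simp)
  have hte := e.injective hte
  have hne : V (pt2 z i k (c t) (w (N + 1 + s))) ≠ V (pt2 z i k (c t') (w (N + 1 + s))) := by
    rcases lt_or_gt_of_ne htt with h | h
    · exact hd _ _ _ h (by omega)
    · exact (hd _ _ _ h (by omega)).symm
  set S := col (c t) (w (N + 1 + s)) with hS
  have m1 : pt2 z i k (c t) (w (N + 1 + s)) ∈ XSet ge S := hmem _ _ (hcn _) (hwn _)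
  have m2 : pt2 z i k (c t) (w (N + 1 + s')) ∈ XSet ge S := by
    rw [hS, he1]; exact hmem _ _ (hcn _) (hwn _)
  have m3 : pt2 z i k (c t') (w (N + 1 + s)) ∈ XSet ge S := by
    rw [hte]; exact hmem _ _ (hcn _) (hwn _)
  -- Two values of coordinate `i` that differ strictly lie in one cell, so A4 may carry the
  -- indifference of the two rows from column `c t` to column `u`.
  have hess : EssentialOn ge i (XSet ge S) := by
    rcases lt_or_gt_of_ne hne with h | h
    · exact ⟨pt2 z i k (c t) (w (N + 1 + s)), c t', c t, by rwa [update_pt2_left _ hik],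
        by rwa [update_pt2_left _ hik], by rwa [R.gt_iff, update_pt2_left _ hik, update_pt2_left _ hik]⟩
    · exact ⟨pt2 z i k (c t) (w (N + 1 + s)), c t, c t', by rwa [update_pt2_left _ hik],
        by rwa [update_pt2_left _ hik], by rwa [R.gt_iff, update_pt2_left _ hik, update_pt2_left _ hik]⟩
  have n1 : pt2 z i k u (w (N + 1 + s)) ∈ XSet ge (col u (w (N + 1 + s))) := hmem _ _ hu (hwn _)
  have n2 : pt2 z i k u (w (N + 1 + s')) ∈ XSet ge (col u (w (N + 1 + s))) := by
    rw [he2]; exact hmem _ _ hu (hwn _)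
  have hSo : IsCoordOrder ge S := ⟨_, rfl⟩
  have hTo : IsCoordOrder ge (col u (w (N + 1 + s))) := ⟨_, rfl⟩
  have hceq : V (pt2 z i k (c t) (w (N + 1 + s))) = V (pt2 z i k (c t) (w (N + 1 + s'))) :=
    hc _ _ _ (by omega) (by omega)
  have key := fun p q (h1 : pt2 z i k (c t) p ∈ XSet ge S) (h2 : pt2 z i k (c t) q ∈ XSet ge S)
      (h3 : pt2 z i k u p ∈ XSet ge (col u (w (N + 1 + s))))
      (h4 : pt2 z i k u q ∈ XSet ge (col u (w (N + 1 + s))))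
      (h : V (pt2 z i k (c t) p) ≤ V (pt2 z i k (c t) q)) =>
    R.ind (w := pt2 z i k (c t) p) (z := pt2 z i k (c t) q) (a := c t) (c := u) hSo hTo hess
      (by rwa [update_pt2_left _ hik]) (by rwa [update_pt2_left _ hik])
      (by rwa [update_pt2_left _ hik]) (by rwa [update_pt2_left _ hik])
      (by rwa [update_pt2_left _ hik, update_pt2_left _ hik])
  simp only [update_pt2_left _ hik] at key
  exact hs _ _ (by omega) (le_antisymm (key _ _ m1 m2 n1 n2 hceq.le) (key _ _ m2 m1 n2 n1 hceq.ge))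

/-- An infinite strictly increasing sequence inside a strict pair. -/
theorem exists_seq (R : Rep ge V) {k : Fin n} {x : ∀ k, X k} {a b : X k}
    (h : V (Function.update x k a) < V (Function.update x k b)) :
    ∃ w : ℕ → X k, (∀ t, a < w t ∧ w t < b) ∧
      StrictMono fun t => V (Function.update x k (w t)) := by
  obtain ⟨c, hac, hcb⟩ := R.dense h
  choose f hf1 hf2 using fun w : {w : X k // V (Function.update x k w) < V (Function.update x k b)} =>
    R.dense w.2
  let g : ℕ → {w : X k // V (Function.update x k w) < V (Function.update x k b)} :=
    fun t => Nat.rec ⟨c, hcb⟩ (fun _ w => ⟨f w, hf2 w⟩) t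
  have hg : StrictMono fun t => V (Function.update x k (g t).1) :=
    strictMono_nat_of_lt_succ fun t => hf1 (g t)
  refine ⟨fun t => (g t).1, fun t => ⟨?_, R.lt_of_lt (g t).2⟩, hg⟩
  exact R.lt_of_lt (hac.trans_le (hg.monotone (Nat.zero_le t)))

theorem exists_seq_anti (R : Rep ge V) {k : Fin n} {x : ∀ k, X k} {a b : X k}
    (h : V (Function.update x k a) < V (Function.update x k b)) :
    ∃ w : ℕ → X k, (∀ t, a < w t ∧ w t < b) ∧
      StrictAnti fun t => V (Function.update x k (w t)) := by
  obtain ⟨c, hac, hcb⟩ := R.dense h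
  choose f hf1 hf2 using fun w : {w : X k // V (Function.update x k a) < V (Function.update x k w)} =>
    R.dense w.2
  let g : ℕ → {w : X k // V (Function.update x k a) < V (Function.update x k w)} :=
    fun t => Nat.rec ⟨c, hac⟩ (fun _ w => ⟨f w, hf1 w⟩) t
  have hg : StrictAnti fun t => V (Function.update x k (g t).1) :=
    strictAnti_nat_of_succ_lt fun t => hf2 (g t)
  refine ⟨fun t => (g t).1, fun t => ⟨R.lt_of_lt (g t).2, ?_⟩, hg⟩
  exact R.lt_of_lt ((hg.antitone (Nat.zero_le t)).trans_lt hcb)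

theorem pt2_mono_left (R : Rep ge V) {i k : Fin n} (hik : i ≠ k) (z : ∀ k, X k) (p : X k) :
    Monotone fun a => V (pt2 z i k a p) := fun a b h => by
  have := R.mono i (pt2 z i k a p) h
  simpa only [update_pt2_left _ hik] using this

theorem pt2_mono_right (R : Rep ge V) (i k : Fin n) (z : ∀ k, X k) (a : X i) :
    Monotone fun p => V (pt2 z i k a p) := fun _ _ h => R.mono k _ h

/-- Columns in a plane where a pair of values is distinguished at one column but not at another. -/
theorem exists_columns (R : Rep ge V) {i k : Fin n} (hik : i ≠ k) {z : ∀ k, X k} {u u' : X i}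
    {a b : X k} (hs : V (pt2 z i k u a) < V (pt2 z i k u b))
    (hc : V (pt2 z i k u' a) = V (pt2 z i k u' b)) :
    ∃ (c : ℕ → X i) (w : ℕ → X k), (∀ t, NonExtreme ge i (c t)) ∧ (∀ t, a < w t ∧ w t < b) ∧
      (∀ s s', s ≠ s' → V (pt2 z i k u (w s)) ≠ V (pt2 z i k u (w s'))) ∧
      (∀ t s s', s ≤ t + 1 → s' ≤ t + 1 → s ≠ s' →
        V (pt2 z i k (c t) (w s)) ≠ V (pt2 z i k (c t) (w s'))) ∧
      (∀ t s s', t + 1 ≤ s → t + 1 ≤ s' → V (pt2 z i k (c t) (w s)) = V (pt2 z i k (c t) (w s'))) ∧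
      (∀ t t' s, t < t' → t' < s → V (pt2 z i k (c t) (w s)) ≠ V (pt2 z i k (c t') (w s))) := by
  have ind1 : ∀ z' w x y r s, RRel ge (pt2 z i k z' w) i k → z' ≤ x → z' ≤ y → r ≤ w → s ≤ w →
      V (pt2 z i k x r) = V (pt2 z i k x s) → V (pt2 z i k y r) = V (pt2 z i k y s) :=
    fun _ _ _ _ _ _ h => R.cone_ind hik h
  have ind2 : ∀ z' w x y r s, RRel ge (pt2 z i k z' w) k i → x ≤ z' → y ≤ z' → w ≤ r → w ≤ s →
      V (pt2 z i k x r) = V (pt2 z i k x s) → V (pt2 z i k y r) = V (pt2 z i k y s) :=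
    fun _ _ _ _ _ _ h => R.cone_ind' hik h
  have closed : ∀ w u u', ¬ RRel ge (pt2 z i k u w) k i → ¬ RRel ge (pt2 z i k u' w) i k →
      ∃ c, RRel ge (pt2 z i k c w) i k ∧ RRel ge (pt2 z i k c w) k i := fun w u u' h h' => by
    obtain ⟨c, hc⟩ := R.str.closed i k hik (pt2 z i k u w) u u'
      ⟨hik, by rwa [update_pt2_left _ hik]⟩ ⟨hik.symm, by rwa [update_pt2_left _ hik]⟩
    exact ⟨c, by simpa only [ERel, update_pt2_left _ hik] using hc⟩
  have hcon : ∀ w w', a < w → w < b → a < w' → w' < b →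
      V (pt2 z i k u' w) = V (pt2 z i k u' w') := by
    have : ∀ w, a < w → w < b → V (pt2 z i k u' w) = V (pt2 z i k u' a) := fun w h1 h2 =>
      le_antisymm ((R.pt2_mono_right i k z u' h2.le).trans hc.ge) (R.pt2_mono_right i k z u' h1.le)
    intro w w' h1 h2 h3 h4
    rw [this w h1 h2, this w' h3 h4]
  rcases lt_trichotomy u' u with h | h | h
  · obtain ⟨w, hw, hwm⟩ := R.exists_seq (x := Function.update z i u) hs
    have hws : StrictMono w := strictMono_nat_of_lt_succ fun t => R.lt_of_lt (hwm (Nat.lt_succ_self t))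
    obtain ⟨c, h1, h2, h3, h4⟩ := exists_closed_columns (F := fun a p => V (pt2 z i k a p))
      (fun p => R.pt2_mono_left hik z p) (fun a => R.pt2_mono_right i k z a) ind1 ind2 closed h hws hwm
      (fun s t => hcon _ _ (hw s).1 (hw s).2 (hw t).1 (hw t).2)
    exact ⟨c, w, fun t => R.nonExtreme_iff.2 ⟨⟨_, (h1 t).2⟩, ⟨_, (h1 t).1⟩⟩, hw,
      fun s s' hss he => hss (hwm.injective he), h2, h3, fun t t' s h h' => (h4 t t' s h h').ne⟩
  · rw [h] at hc; exact absurd hc hs.ne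
  · obtain ⟨w, hw, hwm⟩ := R.exists_seq_anti (x := Function.update z i u) hs
    have hws : StrictAnti w := strictAnti_nat_of_succ_lt fun t => R.lt_of_lt (hwm (Nat.lt_succ_self t))
    obtain ⟨c, h1, h2, h3, h4⟩ := exists_closed_columns_anti (F := fun a p => V (pt2 z i k a p))
      (fun p => R.pt2_mono_left hik z p) (fun a => R.pt2_mono_right i k z a) ind1 ind2 closed h hws hwm
      (fun s t => hcon _ _ (hw s).1 (hw s).2 (hw t).1 (hw t).2)
    exact ⟨c, w, fun t => R.nonExtreme_iff.2 ⟨⟨_, (h1 t).2⟩, ⟨_, (h1 t).1⟩⟩, hw,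
      fun s s' hss he => hss (hwm.injective he), h2, h3, fun t t' s h h' => (h4 t t' s h h').ne'⟩

/-- Between a column that separates a pair and one that does not there are non-extreme columns of
both kinds, for suitable other pairs. The first part pushes strictness, the second an indifference,
to a non-extreme value of coordinate `i`. -/
theorem slice_aux (R : Rep ge V) {i k : Fin n} (hik : i ≠ k) {z : ∀ k, X k} {u u' : X i}
    {a b : X k} (hs : V (pt2 z i k u a) < V (pt2 z i k u b))
    (hc : V (pt2 z i k u' a) = V (pt2 z i k u' b)) :
    (∃ c a' b', NonExtreme ge i c ∧ a ≤ a' ∧ b' ≤ b ∧ V (pt2 z i k c a') < V (pt2 z i k c b')) ∧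
    (∃ c a' b', NonExtreme ge i c ∧ a' < b' ∧ V (pt2 z i k c a') = V (pt2 z i k c b')) := by
  obtain ⟨c, w, hcn, hw, h1, h2, h3, -⟩ := R.exists_columns hik hs hc
  constructor
  · rcases lt_or_gt_of_ne (h2 0 0 1 (by simp) (by simp) (by simp)) with h | h
    · exact ⟨c 0, w 0, w 1, hcn 0, (hw 0).1.le, (hw 1).2.le, h⟩
    · exact ⟨c 0, w 1, w 0, hcn 0, (hw 1).1.le, (hw 0).2.le, h⟩
  · have he := h3 0 1 2 (by simp) (by simp)
    have hne : w 1 ≠ w 2 := fun h => h1 1 2 (by simp) (by rw [h])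
    rcases lt_or_gt_of_ne hne with h | h
    · exact ⟨c 0, w 1, w 2, hcn 0, h, he⟩
    · exact ⟨c 0, w 2, w 1, hcn 0, h, he.symm⟩

/-- At a non-extreme rest, strictness does not depend on the column. -/
theorem strict_of_strict (R : Rep ge V) {i k : Fin n} (hik : i ≠ k) {z : ∀ k, X k}
    (hz : ∀ m, m ≠ i → m ≠ k → NonExtreme ge m (z m)) {u u' : X i}
    {a b : X k} (hs : V (pt2 z i k u a) < V (pt2 z i k u b)) :
    V (pt2 z i k u' a) < V (pt2 z i k u' b) := by
  have hab : a < b := not_le.1 fun h => hs.not_ge (R.pt2_mono_right i k z u h)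
  refine lt_of_le_of_ne (R.pt2_mono_right i k z u' hab.le) fun hc => ?_
  -- A first application makes the separating column non-extreme, as `no_pattern` requires; the
  -- second produces the forbidden pattern.
  obtain ⟨⟨c, a', b', hcn, ha', hb', hlt⟩, -⟩ := R.slice_aux hik hs hc
  have hc' : V (pt2 z i k u' a') = V (pt2 z i k u' b') := by
    have hab' : a' < b' := not_le.1 fun h => hlt.not_ge (R.pt2_mono_right i k z c h)
    refine le_antisymm (R.pt2_mono_right i k z u' hab'.le) ?_
    exact (R.pt2_mono_right i k z u' hb').trans (hc.ge.trans (R.pt2_mono_right i k z u' ha'))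
  obtain ⟨d, w, hdn, hw, h1, h2, h3, h4⟩ := R.exists_columns hik hlt hc'
  exact R.no_pattern hik hz hcn hdn (fun t => R.nonExtreme_iff.2 ⟨⟨_, (hw t).2⟩, ⟨_, (hw t).1⟩⟩)
    h1 (fun t s s' h h' => h3 t s s' h h') h4

/-- Induction on the number of extreme coordinates. Moving one of them to a non-extreme value keeps
the comparison strict, or else `slice_aux` gives a non-extreme value at which a pair inside `[a, b]`
is separated; monotonicity returns to `a` and `b`. -/
theorem exists_strict_nonExtreme (R : Rep ge V) {k : Fin n} (N : ℕ) : ∀ {a b : X k} {x : ∀ k, X k},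
    numExtreme ge k x ≤ N → V (Function.update x k a) < V (Function.update x k b) →
    ∃ y : ∀ k, X k, (∀ m, m ≠ k → NonExtreme ge m (y m)) ∧
      V (Function.update y k a) < V (Function.update y k b) := by
  induction N with
  | zero =>
    intro a b x hx h
    refine ⟨x, fun m hm => ?_, h⟩
    by_contra hc
    obtain ⟨v, hv⟩ := R.exists_nonExtreme m
    have := numExtreme_lt hm hc hv
    omega
  | succ N ih =>
    intro a b x hx h
    by_cases hall : ∀ m, m ≠ k → NonExtreme ge m (x m)
    · exact ⟨x, hall, h⟩
    push Not at hall
    obtain ⟨m, hm, hmx⟩ := hall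
    obtain ⟨v, hv⟩ := R.exists_nonExtreme m
    have hs : V (pt2 x m k (x m) a) < V (pt2 x m k (x m) b) := by simpa [pt2] using h
    have hab : a < b := R.lt_of_lt h
    rcases (R.pt2_mono_right m k x v hab.le).lt_or_eq with h' | h'
    · exact ih (x := Function.update x m v) (by have := numExtreme_lt hm hmx hv; omega) h'
    · obtain ⟨⟨c, a', b', hc, ha', hb', hlt⟩, -⟩ := R.slice_aux hm hs h'
      obtain ⟨y, hy, hlt'⟩ := ih (x := Function.update x m c)
        (by have := numExtreme_lt hm hmx hc; omega) hlt
      exact ⟨y, hy, (R.mono k y ha').trans_lt (hlt'.trans_le (R.mono k y hb'))⟩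

/-- The order of the coordinate gives strictness somewhere; it is moved to a non-extreme rest, which
`strict_of_strict` then changes coordinate by coordinate. -/
theorem strict_nonExtreme (R : Rep ge V) {k : Fin n} {a b : X k} (hab : a < b) {y : ∀ k, X k}
    (hy : ∀ m, m ≠ k → NonExtreme ge m (y m)) :
    V (Function.update y k a) < V (Function.update y k b) := by
  obtain ⟨x, hx⟩ := R.exists_lt hab
  obtain ⟨x, hxn, hx⟩ := R.exists_strict_nonExtreme _ le_rfl hx
  refine iff_of_good (T := fun y => V (Function.update y k a) < V (Function.update y k b))
    (G := fun m v => m ≠ k → NonExtreme ge m v) ?_ hxn hy hx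
  intro x m v hx hv h
  by_cases hm : m = k
  · subst hm; simpa using h
  · refine R.strict_of_strict hm (z := x) (u := x m) (fun l _ h2 => hx l h2) ?_
    simpa [pt2] using h

/-- Again by induction on the number of extreme coordinates. An indifference at an extreme value
contrasts with strictness at a non-extreme one, and `slice_aux` turns the contrast into an
indifference of distinct elements at a point with fewer extreme coordinates. -/
theorem not_const (R : Rep ge V) {k : Fin n} (N : ℕ) : ∀ {a b : X k} {y : ∀ k, X k},
    numExtreme ge k y ≤ N → a < b → V (Function.update y k a) ≠ V (Function.update y k b) := by
  induction N with
  | zero =>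
    intro a b x hx hab
    refine (R.strict_nonExtreme hab fun m hm => ?_).ne
    by_contra hc
    obtain ⟨v, hv⟩ := R.exists_nonExtreme m
    have := numExtreme_lt hm hc hv
    omega
  | succ N ih =>
    intro a b x hx hab h
    by_cases hall : ∀ m, m ≠ k → NonExtreme ge m (x m)
    · exact (R.strict_nonExtreme hab hall).ne h
    push Not at hall
    obtain ⟨m, hm, hmx⟩ := hall
    obtain ⟨v, hv⟩ := R.exists_nonExtreme m
    have h1 : V (pt2 x m k v a) < V (pt2 x m k v b) :=
      lt_of_le_of_ne (R.pt2_mono_right m k x v hab.le)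
        (ih (y := Function.update x m v) (by have := numExtreme_lt hm hmx hv; omega) hab)
    obtain ⟨-, c, a', b', hc, hab', he⟩ := R.slice_aux hm h1 (u' := x m) (by simpa [pt2] using h)
    exact ih (y := Function.update x m c) (by have := numExtreme_lt hm hmx hc; omega) hab' he

/-- `V` is strictly increasing in every coordinate. -/
theorem strictMono (R : Rep ge V) (k : Fin n) (x : ∀ k, X k) :
    StrictMono fun a => V (Function.update x k a) := fun _ _ h =>
  lt_of_le_of_ne (R.mono k x h.le) (R.not_const _ le_rfl h)

end Rep
end Conjoint

/-! ### Strict violations of triple cancellation in a plane -/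

namespace Conjoint

universe u

/-- A strictly increasing solvable function on a product of two chains. -/
structure Plane {α β L : Type*} [LinearOrder α] [LinearOrder β] [LinearOrder L]
    (F : α → β → L) : Prop where
  m1 : ∀ p, StrictMono fun a => F a p
  m2 : ∀ a, StrictMono (F a)
  s1 : ∀ {p a e b q}, F a p ≤ F b q → F b q ≤ F e p → ∃ c, F c p = F b q
  s2 : ∀ {a p r b q}, F a p ≤ F b q → F b q ≤ F a r → ∃ s, F a s = F b q

/-- A configuration violating triple cancellation, with all four comparisons strict. -/
def StrictFail {α β L : Type*} [LT L] (F : α → β → L) (a b c d : α) (P Q R S : β) : Prop :=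
  F a P < F b Q ∧ F b S < F a R ∧ F d Q < F c P ∧ F c R < F d S

theorem strictFail_swap {α β L : Type*} [LT L] {F : α → β → L} {a b c d : α} {P Q R S : β} (hf : StrictFail F a b c d P Q R S) :
    StrictFail (fun p a => F a p) P Q R S a b c d := ⟨hf.1, hf.2.2.1, hf.2.1, hf.2.2.2⟩

namespace Plane

variable {α β L : Type*} [LinearOrder α] [LinearOrder β] [LinearOrder L] {F : α → β → L}

theorem swap (h : Plane F) : Plane fun p a => F a p :=
  ⟨h.m2, h.m1, fun h1 h2 => h.s2 h1 h2, fun h1 h2 => h.s1 h1 h2⟩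

/-- Openness of strict comparisons, from solvability and density: the slack absorbs a small increase
of one entry. -/
theorem up1 [DenselyOrdered α] (h : Plane F) {a b e : α} {p q : β} (hlt : F a p < F b q) (he : a < e) :
    ∃ c, a < c ∧ c ≤ e ∧ F c p < F b q := by
  rcases lt_or_ge (F e p) (F b q) with h1 | h1
  · exact ⟨e, he, le_rfl, h1⟩
  · obtain ⟨c, hc⟩ := h.s1 hlt.le h1
    obtain ⟨d, h2, h3⟩ := exists_between ((h.m1 p).lt_iff_lt.1 (hc.symm ▸ hlt))
    exact ⟨d, h2, h3.le.trans ((h.m1 p).le_iff_le.1 (hc.symm ▸ h1)), hc ▸ h.m1 p h3⟩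

theorem dn1 [DenselyOrdered α] (h : Plane F) {a b e : α} {p q : β} (hlt : F b q < F a p) (he : e < a) :
    ∃ c, e ≤ c ∧ c < a ∧ F b q < F c p := by
  rcases lt_or_ge (F b q) (F e p) with h1 | h1
  · exact ⟨e, le_rfl, he, h1⟩
  · obtain ⟨c, hc⟩ := h.s1 h1 hlt.le
    obtain ⟨d, h2, h3⟩ := exists_between ((h.m1 p).lt_iff_lt.1 (hc.symm ▸ hlt))
    exact ⟨d, ((h.m1 p).le_iff_le.1 (hc.symm ▸ h1)).trans h2.le, h3, hc ▸ h.m1 p h2⟩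

theorem up2 [DenselyOrdered β] (h : Plane F) {a b : α} {p q e : β} (hlt : F a p < F b q) (he : p < e) :
    ∃ c, p < c ∧ c ≤ e ∧ F a c < F b q := h.swap.up1 hlt he

theorem dn2 [DenselyOrdered β] (h : Plane F) {a b : α} {p q e : β} (hlt : F b q < F a p) (he : e < p) :
    ∃ c, e ≤ c ∧ c < p ∧ F b q < F a c := h.swap.dn1 hlt he

/-- Raising `c` or lowering `d` a little spends part of the slack of the second comparison to make
the first one strict. Neither move exists only if `d` is least and `c` greatest. -/
theorem improve [DenselyOrdered α] (h : Plane F) {c d : α} {P Q R S : β}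
    (h3 : F d Q ≤ F c P) (h4 : F c R < F d S) :
    ((∀ x, d ≤ x) ∧ ∀ x, x ≤ c) ∨ ∃ c' d', F d' Q < F c' P ∧ F c' R < F d' S := by
  by_cases hd : ∀ x, d ≤ x
  · by_cases hc : ∀ x, x ≤ c
    · exact Or.inl ⟨hd, hc⟩
    · push Not at hc
      obtain ⟨x, hx⟩ := hc
      obtain ⟨c', h5, -, h6⟩ := h.up1 h4 hx
      exact Or.inr ⟨c', d, h3.trans_lt (h.m1 P h5), h6⟩
  · push Not at hd
    obtain ⟨x, hx⟩ := hd
    obtain ⟨d', -, h5, h6⟩ := h.dn1 h4 hx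
    exact Or.inr ⟨c, d', (h.m1 Q h5).trans_le h3, h6⟩

/-- As `c` and `d` cannot move, slack travels round the cycle of comparisons the other way: `R`, `S`
make the second one strict, `a`, `b` the first, and `P`, `Q` the third. Another stuck pair
contradicts monotonicity or makes its comparison strict by itself. -/
theorem strictFail_of_stuck [DenselyOrdered α] [DenselyOrdered β] (h : Plane F) {a b c d : α}
    {P Q R S : β} (h1 : F a P ≤ F b Q) (h2 : F b S ≤ F a R) (h3 : F d Q ≤ F c P)
    (h4 : F c R < F d S) (hd : ∀ x, d ≤ x) (hc : ∀ x, x ≤ c) :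
    ∃ a b c d P Q R S, StrictFail F a b c d P Q R S := by
  have hcd : F d Q ≤ F c Q := (h.m1 Q).monotone (hd c)
  rcases h.swap.improve h2 h4 with ⟨hS, hR⟩ | ⟨R', S', h2', h4'⟩
  · exact absurd h4 (not_lt.2 (((h.m1 S).monotone (hd c)).trans ((h.m2 c).monotone (hR S))))
  have h4'' : R' < S' := (h.m2 c).lt_iff_lt.1 (h4'.trans_le ((h.m1 S').monotone (hd c)))
  rcases h.improve h1 h2' with ⟨ha, hb⟩ | ⟨b', a', h1', h2''⟩
  · exact absurd ((h.m2 a).lt_iff_lt.1 (((h.m1 S').monotone (ha b)).trans_lt h2')) h4''.not_gt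
  rcases h.swap.improve h3 h1' with ⟨hQ, hP⟩ | ⟨P', Q', h3', h1''⟩
  · rcases (hd c).lt_or_eq with hlt | heq
    · exact ⟨a', b', c, d, P, Q, R', S', h1', h2'', (h.m1 Q hlt).trans_le ((h.m2 c).monotone (hQ P)), h4'⟩
    · have hall : ∀ x, x = c := fun x => le_antisymm (hc x) (heq ▸ hd x)
      rw [hall a', hall b'] at h2''
      exact absurd ((h.m2 c).lt_iff_lt.1 h2'') h4''.not_gt
  · exact ⟨a', b', c, d, P', Q', R', S', h1'', h2'', h3', h4'⟩

/-- Each of the pairs `a, b`, `c, d`, `P, Q`, `R, S` occurs in two of the four comparisons, so the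
slack of the last one can be handed on to all others. `strictFail_of_stuck` covers a pair of the
last comparison that consists of the two ends of its chain. -/
theorem exists_strictFail [DenselyOrdered α] [DenselyOrdered β] (h : Plane F) {a b c d : α}
    {P Q R S : β} (h1 : F a P ≤ F b Q) (h2 : F b S ≤ F a R) (h3 : F d Q ≤ F c P)
    (h4 : F c R < F d S) :
    ∃ a b c d P Q R S, StrictFail F a b c d P Q R S := by
  rcases h.improve h3 h4 with ⟨hd, hc⟩ | ⟨c', d', h3', h4'⟩
  · exact h.strictFail_of_stuck h1 h2 h3 h4 hd hc
  rcases h.swap.improve h2 h4' with ⟨hS, hR⟩ | ⟨R', S', h2', h4''⟩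
  · obtain ⟨P, Q, R, S, a, b, c, d, k1, k2, k3, k4⟩ :=
      h.swap.strictFail_of_stuck h1 h3'.le h2 h4' hS hR
    exact ⟨a, b, c, d, P, Q, R, S, k1, k3, k2, k4⟩
  rcases h.improve h1 h2' with ⟨ha, hb⟩ | ⟨b', a', h1', h2''⟩
  · rcases h.swap.improve h1 h3' with ⟨hP, hQ⟩ | ⟨Q', P', h1', h3''⟩
    · rcases (ha b).lt_or_eq with hlt | heq
      · exact ⟨a, b, c', d', P, Q, R', S', (h.m1 P hlt).trans_le ((h.m2 b).monotone (hP Q)), h2', h3', h4''⟩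
      · have hall : ∀ x, x = b := fun x => le_antisymm (hb x) (heq ▸ ha x)
        rw [hall a] at h2'
        rw [hall c', hall d'] at h4''
        exact absurd ((h.m2 b).lt_iff_lt.1 h2') ((h.m2 b).lt_iff_lt.1 h4'').not_gt
    · exact ⟨a, b, c', d', P', Q', R', S', h1', h2', h3'', h4''⟩
  · exact ⟨a', b', c', d', P, Q, R', S', h1', h2'', h3', h4''⟩

/-- `a` occurs on the lower side of one strict comparison and on the upper side of another, so it
can be moved off an end of the chain in whichever direction leads inwards. -/
theorem inner1 [DenselyOrdered α] (h : Plane F) {a e b b' : α} (he : a ≠ e) {P Q R S : β}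
    (h1 : F a P < F b Q) (h2 : F b' S < F a R) :
    ∃ a', ((∃ l, l < a') ∧ ∃ u, a' < u) ∧ F a' P < F b Q ∧ F b' S < F a' R := by
  by_cases hu : ∃ u, a < u
  · by_cases hl : ∃ l, l < a
    · exact ⟨a, ⟨hl, hu⟩, h1, h2⟩
    · obtain ⟨u, hu⟩ := hu
      obtain ⟨w, hw1, hw2⟩ := exists_between hu
      obtain ⟨c, h3, h4, h5⟩ := h.up1 h1 hw1
      exact ⟨c, ⟨⟨a, h3⟩, ⟨u, h4.trans_lt hw2⟩⟩, h5, h2.trans (h.m1 R h3)⟩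
  · have hlt : e < a := lt_of_le_of_ne (not_lt.1 fun h => hu ⟨e, h⟩) he.symm
    obtain ⟨w, hw1, hw2⟩ := exists_between hlt
    obtain ⟨c, h3, h4, h5⟩ := h.dn1 h2 hw2
    exact ⟨c, ⟨⟨e, hw1.trans_le h3⟩, ⟨a, h4⟩⟩, (h.m1 P h4).trans h1, h5⟩

theorem exists_inner_strictFail_left [DenselyOrdered α] (h : Plane F) {a b c d : α} {P Q R S : β}
    (hf : StrictFail F a b c d P Q R S) :
    ∃ a' b' c' d', StrictFail F a' b' c' d' P Q R S ∧
      ∀ x ∈ ({a', b', c', d'} : Set α), (∃ l, l < x) ∧ ∃ u, x < u := by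
  obtain ⟨h1, h2, h3, h4⟩ := hf
  have hne : ∀ x : α, ∃ e, x ≠ e := by
    intro x
    by_contra hc
    push Not at hc
    rw [← hc a, ← hc b] at h2
    rw [← hc c, ← hc d] at h4
    exact ((h.m2 x).lt_iff_lt.1 h2).not_gt ((h.m2 x).lt_iff_lt.1 h4)
  obtain ⟨a', ia, h1, h2⟩ := h.inner1 (hne a).choose_spec h1 h2
  obtain ⟨b', ib, h2, h1⟩ := h.inner1 (hne b).choose_spec h2 h1
  obtain ⟨c', ic, h4, h3⟩ := h.inner1 (hne c).choose_spec h4 h3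
  obtain ⟨d', id', h3, h4⟩ := h.inner1 (hne d).choose_spec h3 h4
  refine ⟨a', b', c', d', ⟨h1, h2, h3, h4⟩, ?_⟩
  rintro x (rfl | rfl | rfl | rfl) <;> assumption

theorem exists_inner_strictFail [DenselyOrdered α] [DenselyOrdered β] (h : Plane F) {a b c d : α}
    {P Q R S : β} (h1 : F a P ≤ F b Q) (h2 : F b S ≤ F a R) (h3 : F d Q ≤ F c P)
    (h4 : F c R < F d S) :
    ∃ a b c d P Q R S, StrictFail F a b c d P Q R S ∧
      (∀ x ∈ ({a, b, c, d} : Set α), (∃ l, l < x) ∧ ∃ u, x < u) ∧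
      ∀ x ∈ ({P, Q, R, S} : Set β), (∃ l, l < x) ∧ ∃ u, x < u := by
  obtain ⟨a, b, c, d, P, Q, R, S, hf⟩ := h.exists_strictFail h1 h2 h3 h4
  obtain ⟨a, b, c, d, hf, hi⟩ := h.exists_inner_strictFail_left hf
  obtain ⟨P, Q, R, S, hf, hi'⟩ := h.swap.exists_inner_strictFail_left (strictFail_swap hf)
  exact ⟨a, b, c, d, P, Q, R, S, strictFail_swap hf, hi, hi'⟩

end Plane
end Conjoint

/-! ### Violations relative to a base point, and the restriction to non-extreme points -/

namespace Conjoint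

universe u

variable {n : ℕ} {Y : Fin n → Type u} [∀ k, LinearOrder (Y k)] {L : Type*} [LinearOrder L]

/-- A strict violation of triple cancellation in the plane of `p` and `q`, strictly below `z` on
coordinate `p` and strictly above `z` on coordinate `q`. -/
def Brk (V : (∀ k, Y k) → L) (z : ∀ k, Y k) (p q : Fin n) : Prop :=
  ∃ (a b c d : Y p) (P Q R S : Y q), StrictFail (fun a P => V (pt2 z p q a P)) a b c d P Q R S ∧
    (∀ x ∈ ({a, b, c, d} : Set (Y p)), x < z p) ∧ ∀ x ∈ ({P, Q, R, S} : Set (Y q)), z q < x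

/-- The coordinate order at `z`. -/
def col (V : (∀ k, Y k) → L) (z : ∀ k, Y k) : Fin n → Fin n → Prop :=
  fun p q => p ≠ q ∧ Brk V z p q

/-- The points compatible with the coordinate order `S`. -/
def Cell (V : (∀ k, Y k) → L) (S : Fin n → Fin n → Prop) : Set (∀ k, Y k) :=
  {z | ∀ k l, k ≠ l → ¬ S l k → ¬ Brk V z l k}

theorem mem_Cell_col (V : (∀ k, Y k) → L) (z : ∀ k, Y k) : z ∈ Cell V (col V z) :=
  fun _ _ hkl hS hb => hS ⟨hkl.symm, hb⟩

/-- The restriction of a preference satisfying the axioms to points without extreme coordinates. -/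
structure Model (V : (∀ k, Y k) → L) (Ord : (Fin n → Fin n → Prop) → Prop)
    (Ess : (Fin n → Fin n → Prop) → Fin n → Prop) : Prop where
  strictMono : ∀ k x, StrictMono fun a : Y k => V (Function.update x k a)
  solv : ∀ {k : Fin n} {x y : ∀ k, Y k} {a b : Y k}, V (Function.update x k a) ≤ V y →
    V y ≤ V (Function.update x k b) → ∃ c, V (Function.update x k c) = V y
  dense : ∀ k, DenselyOrdered (Y k)
  noMin : ∀ k, NoMinOrder (Y k)
  noMax : ∀ k, NoMaxOrder (Y k)
  nonempty : ∀ k, Nonempty (Y k)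
  anti : ∀ {z : ∀ k, Y k} {p q : Fin n}, p ≠ q → Brk V z p q → ¬ Brk V z q p
  ord : ∀ z, Ord (col V z)
  ess : ∀ {S : Fin n → Fin n → Prop} {i : Fin n} {x : ∀ k, Y k} {a b : Y i}, a ≠ b →
    Function.update x i a ∈ Cell V S → Function.update x i b ∈ Cell V S → Ess S i
  intra : ∀ {S T : Fin n → Fin n → Prop} {i : Fin n} {a b c d : Y i} {x y w z : ∀ k, Y k},
    Ord S → Ord T → Ess S i →
    Function.update x i a ∈ Cell V S → Function.update y i b ∈ Cell V S →
    Function.update w i a ∈ Cell V S → Function.update z i b ∈ Cell V S →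
    Function.update x i c ∈ Cell V T → Function.update y i d ∈ Cell V T →
    Function.update w i c ∈ Cell V T → Function.update z i d ∈ Cell V T →
    V (Function.update x i a) ≤ V (Function.update y i b) →
    V (Function.update z i b) ≤ V (Function.update w i a) →
    V (Function.update y i d) ≤ V (Function.update x i c) →
    V (Function.update z i d) ≤ V (Function.update w i c)
  intra' : ∀ {S T : Fin n → Fin n → Prop} {i : Fin n} {a b c d : Y i} {x y w z : ∀ k, Y k},
    Ord S → Ord T → Ess S i →
    Function.update x i a ∈ Cell V S → Function.update y i b ∈ Cell V S →
    Function.update x i c ∈ Cell V S → Function.update y i d ∈ Cell V S →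
    Function.update w i a ∈ Cell V T → Function.update z i b ∈ Cell V T →
    Function.update w i c ∈ Cell V T → Function.update z i d ∈ Cell V T →
    V (Function.update x i a) ≤ V (Function.update y i b) →
    V (Function.update z i b) ≤ V (Function.update w i a) →
    V (Function.update y i d) ≤ V (Function.update x i c) →
    V (Function.update z i d) ≤ V (Function.update w i c)
  inter : ∀ {i j : Fin n}, i ≠ j → ∀ {a b c d : Y i} {p q r s : Y j}
    {x y y0 y1 x0 x1 e f : ∀ k, Y k} {S₁ S₂ S₃ S₄ : Fin n → Fin n → Prop},
    Ord S₁ → Ord S₂ → Ord S₃ → Ord S₄ →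
    Function.update x i a ∈ Cell V S₁ → Function.update y i b ∈ Cell V S₁ →
    Function.update x i c ∈ Cell V S₁ → Function.update y i d ∈ Cell V S₁ → Ess S₁ i →
    Function.update y0 i a ∈ Cell V S₂ → Function.update y0 i b ∈ Cell V S₂ →
    Function.update y1 i c ∈ Cell V S₂ → Function.update y1 i d ∈ Cell V S₂ →
    Function.update x0 j p ∈ Cell V S₃ → Function.update x0 j q ∈ Cell V S₃ →
    Function.update x1 j r ∈ Cell V S₃ → Function.update x1 j s ∈ Cell V S₃ → Ess S₃ j →
    Function.update e j p ∈ Cell V S₄ → Function.update f j q ∈ Cell V S₄ →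
    Function.update e j r ∈ Cell V S₄ → Function.update f j s ∈ Cell V S₄ →
    V (Function.update x i a) ≤ V (Function.update y i b) →
    V (Function.update y i d) ≤ V (Function.update x i c) →
    V (Function.update y0 i a) = V (Function.update x0 j p) →
    V (Function.update y0 i b) = V (Function.update x0 j q) →
    V (Function.update y1 i c) = V (Function.update x1 j r) →
    V (Function.update y1 i d) = V (Function.update x1 j s) →
    V (Function.update f j q) ≤ V (Function.update e j p) →
    V (Function.update f j s) ≤ V (Function.update e j r)
  arch : ∀ {S : Fin n → Fin n → Prop} {i l : Fin n} {z : ∀ k, Y k} {y0 y1 : Y l} {g : ℕ → Y i}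
    {lo hi : Y i}, Ord S → l ≠ i → y0 ≠ y1 → (∀ t, lo ≤ g t ∧ g t ≤ hi) →
    (∀ t, pt2 z i l (g t) y1 ∈ Cell V S) → (∀ t, pt2 z i l (g (t + 1)) y0 ∈ Cell V S) →
    ¬ ∀ t, V (pt2 z i l (g t) y1) = V (pt2 z i l (g (t + 1)) y0)

theorem Plane.restrict {α β : Type*} [LinearOrder α] [LinearOrder β] {F : α → β → L}
    (h : Plane F) (A : Set α) (B : Set β) [A.OrdConnected] [B.OrdConnected] :
    Plane fun (a : A) (p : B) => F a p where
  m1 p _ _ hab := h.m1 p hab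
  m2 a _ _ hab := h.m2 a hab
  s1 {p a e b q} h1 h2 := by
    obtain ⟨c, hc⟩ := h.s1 h1 h2
    rw [← hc] at h1 h2
    exact ⟨⟨c, Set.OrdConnected.out ‹_› a.2 e.2 ⟨(h.m1 p).le_iff_le.1 h1, (h.m1 p).le_iff_le.1 h2⟩⟩, hc⟩
  s2 {a p r b q} h1 h2 := by
    obtain ⟨c, hc⟩ := h.s2 h1 h2
    rw [← hc] at h1 h2
    exact ⟨⟨c, Set.OrdConnected.out ‹_› p.2 r.2 ⟨(h.m2 a).le_iff_le.1 h1, (h.m2 a).le_iff_le.1 h2⟩⟩, hc⟩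

namespace Rep

variable {X : Fin n → Type u} [∀ k, LinearOrder (X k)]
  {ge : (∀ k, X k) → (∀ k, X k) → Prop} {V : (∀ k, X k) → L}

theorem denselyOrdered (R : Rep ge V) (k : Fin n) : DenselyOrdered (X k) := ⟨fun a b hab => by
  choose v _ using R.exists_nonExtreme
  obtain ⟨c, h1, h2⟩ := R.dense (R.strictMono k v hab)
  exact ⟨c, R.lt_of_lt h1, R.lt_of_lt h2⟩⟩

theorem plane (R : Rep ge V) {i k : Fin n} (hik : i ≠ k) (z : ∀ k, X k) :
    Plane fun a p => V (pt2 z i k a p) where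
  m1 p a b h := by
    have := R.strictMono i (pt2 z i k a p) h
    simpa only [update_pt2_left _ hik] using this
  m2 a p q h := R.strictMono k _ h
  s1 {p a e b q} h1 h2 := by
    obtain ⟨c, hc⟩ := R.solv (k := i) (x := pt2 z i k a p) (y := pt2 z i k b q) (a := a) (b := e)
      (by rwa [update_pt2_left _ hik]) (by rwa [update_pt2_left _ hik])
    exact ⟨c, by rwa [update_pt2_left _ hik] at hc⟩
  s2 {a p r b q} h1 h2 := R.solv h1 h2

/-- The violation is made strict and interior within the product of `Set.Iic (z p)` and `Set.Ici (z
q)`. Lying between two elements there gives non-extremeness in `X` and strict position relative to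
`z` at once. -/
theorem exists_strictFail_of_not_RRel (R : Rep ge V) {p q : Fin n} (hpq : p ≠ q) {z : ∀ k, X k}
    (h : ¬ RRel ge z q p) :
    ∃ (a b c d : X p) (P Q R S : X q), StrictFail (fun a P => V (pt2 z p q a P)) a b c d P Q R S ∧
      (∀ x ∈ ({a, b, c, d} : Set (X p)), NonExtreme ge p x ∧ x < z p) ∧
      ∀ x ∈ ({P, Q, R, S} : Set (X q)), NonExtreme ge q x ∧ z q < x := by
  have hz : z = pt2 z q p (z q) (z p) := by simp [pt2]
  have hR := h
  unfold RRel TripleCancelOn at hR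
  push Not at hR
  obtain ⟨a, b, c, d, P, Q, R', S, z', m1, m2, m3, m4, m5, m6, m7, m8, h1, h2, h3, h4⟩ := hR
  have hz' : ∀ x y, pt2 z' q p x y = pt2 z q p x y := by
    intro x y
    funext l
    by_cases hq : l = q
    · subst hq; rw [pt2_self_left _ hpq.symm, pt2_self_left _ hpq.symm]
    by_cases hp : l = p
    · subst hp; rw [pt2_self_right, pt2_self_right]
    · have := m1.1 l hq hp
      rw [pt2_of_ne _ hq hp] at this
      rw [pt2_of_ne _ hq hp, pt2_of_ne _ hq hp, this]
  simp only [hz'] at *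
  rw [hz] at m1 m2 m3 m4 m5 m6 m7 m8
  simp only [pt2_pt2 _ hpq.symm] at m1 m2 m3 m4 m5 m6 m7 m8
  rw [R.mem_SEcone_pt2 hpq.symm] at m1 m2 m3 m4 m5 m6 m7 m8
  have := R.denselyOrdered p
  have := R.denselyOrdered q
  have hF := (R.plane hpq z).restrict (Set.Iic (z p)) (Set.Ici (z q))
  simp only [pt2_comm z hpq.symm, R.ge_iff, not_le] at h1 h2 h3 h4
  obtain ⟨a', b', c', d', P', Q', R'', S', hf, hi1, hi2⟩ := hF.exists_inner_strictFail
    (a := ⟨P, m1.2⟩) (b := ⟨Q, m2.2⟩) (c := ⟨R', m3.2⟩) (d := ⟨S, m4.2⟩)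
    (P := ⟨a, m1.1⟩) (Q := ⟨b, m2.1⟩) (R := ⟨c, m5.1⟩) (S := ⟨d, m6.1⟩) h1 h3 h2 h4
  have k1 : ∀ x : Set.Iic (z p), ((∃ l, l < x) ∧ ∃ u, x < u) → NonExtreme ge p x.1 ∧ x.1 < z p := by
    rintro x ⟨⟨l, hl⟩, u, hu⟩
    exact ⟨R.nonExtreme_iff.2 ⟨⟨u.1, hu⟩, ⟨l.1, hl⟩⟩, lt_of_lt_of_le (show x.1 < u.1 from hu) u.2⟩
  have k2 : ∀ x : Set.Ici (z q), ((∃ l, l < x) ∧ ∃ u, x < u) → NonExtreme ge q x.1 ∧ z q < x.1 := by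
    rintro x ⟨⟨l, hl⟩, u, hu⟩
    exact ⟨R.nonExtreme_iff.2 ⟨⟨u.1, hu⟩, ⟨l.1, hl⟩⟩, lt_of_le_of_lt l.2 (show l.1 < x.1 from hl)⟩
  refine ⟨a', b', c', d', P', Q', R'', S', hf, ?_, ?_⟩
  · simp only [Set.mem_insert_iff, Set.mem_singleton_iff, forall_eq_or_imp, forall_eq] at hi1 ⊢
    exact ⟨k1 _ hi1.1, k1 _ hi1.2.1, k1 _ hi1.2.2.1, k1 _ hi1.2.2.2⟩
  · simp only [Set.mem_insert_iff, Set.mem_singleton_iff, forall_eq_or_imp, forall_eq] at hi2 ⊢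
    exact ⟨k2 _ hi2.1, k2 _ hi2.2.1, k2 _ hi2.2.2.1, k2 _ hi2.2.2.2⟩

end Rep
end Conjoint

namespace Conjoint

universe u

variable {n : ℕ} {L : Type*} [LinearOrder L]
variable {X : Fin n → Type u}

/-- The non-extreme elements of a coordinate. -/
abbrev Inner (ge : (∀ k, X k) → (∀ k, X k) → Prop) (k : Fin n) : Type u :=
  {a : X k // NonExtreme ge k a}

/-- The inclusion of points with non-extreme coordinates. -/
def incl {ge : (∀ k, X k) → (∀ k, X k) → Prop} (y : ∀ k, Inner ge k) : ∀ k, X k := fun k => (y k).1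

theorem incl_update {ge : (∀ k, X k) → (∀ k, X k) → Prop} (y : ∀ k, Inner ge k) (i : Fin n)
    (a : Inner ge i) : incl (Function.update y i a) = Function.update (incl y) i a.1 := by
  funext k
  by_cases h : k = i
  · subst h; simp [incl]
  · simp [incl, h]

theorem incl_pt2 {ge : (∀ k, X k) → (∀ k, X k) → Prop} (y : ∀ k, Inner ge k) (i j : Fin n)
    (a : Inner ge i) (p : Inner ge j) : incl (pt2 y i j a p) = pt2 (incl y) i j a.1 p.1 := by
  rw [pt2, incl_update, incl_update, pt2]

namespace Rep

variable [∀ k, LinearOrder (X k)]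
  {ge : (∀ k, X k) → (∀ k, X k) → Prop} {V : (∀ k, X k) → L}

theorem not_RRel_of_strictFail (R : Rep ge V) {p q : Fin n} (hpq : p ≠ q) {z : ∀ k, X k}
    {a b c d : X p} {P Q R' S : X q}
    (hf : StrictFail (fun a P => V (pt2 z p q a P)) a b c d P Q R' S)
    (hi : ∀ x ∈ ({a, b, c, d} : Set (X p)), x ≤ z p)
    (hi' : ∀ x ∈ ({P, Q, R', S} : Set (X q)), z q ≤ x) : ¬ RRel ge z q p := by
  intro h
  have hz : z = pt2 z q p (z q) (z p) := by simp [pt2]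
  rw [hz] at h
  obtain ⟨h1, h2, h3, h4⟩ := hf
  simp only [Set.mem_insert_iff, Set.mem_singleton_iff, forall_eq_or_imp, forall_eq] at hi hi'
  simp only [pt2_comm z hpq] at h1 h2 h3 h4
  exact h4.not_ge (R.tripleCancel hpq.symm h hi'.1 hi'.2.1 hi'.2.2.1 hi'.2.2.2 hi.1 hi.2.1
    hi.2.2.1 hi.2.2.2 h1.le h3.le h2.le)

/-- Non-extreme strict violations detect `S` completely, so the coordinate order at a non-extreme
point is visible inside the restricted model. -/
theorem brk_iff (R : Rep ge V) {p q : Fin n} (hpq : p ≠ q) (y : ∀ k, Inner ge k) :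
    Brk (fun y : ∀ k, Inner ge k => V (incl y)) y p q ↔ ¬ RRel ge (incl y) q p := by
  constructor
  · rintro ⟨a, b, c, d, P, Q, R', S, hf, h1, h2⟩
    simp only [StrictFail, incl_pt2] at hf
    refine R.not_RRel_of_strictFail hpq (a := a.1) (b := b.1) (c := c.1) (d := d.1)
      (P := P.1) (Q := Q.1) (R' := R'.1) (S := S.1) hf ?_ ?_
    · simp only [Set.mem_insert_iff, Set.mem_singleton_iff, forall_eq_or_imp, forall_eq] at h1 ⊢
      exact ⟨h1.1.le, h1.2.1.le, h1.2.2.1.le, h1.2.2.2.le⟩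
    · simp only [Set.mem_insert_iff, Set.mem_singleton_iff, forall_eq_or_imp, forall_eq] at h2 ⊢
      exact ⟨h2.1.le, h2.2.1.le, h2.2.2.1.le, h2.2.2.2.le⟩
  · intro h
    obtain ⟨a, b, c, d, P, Q, R', S, hf, h1, h2⟩ := R.exists_strictFail_of_not_RRel hpq h
    simp only [Set.mem_insert_iff, Set.mem_singleton_iff, forall_eq_or_imp, forall_eq] at h1 h2
    refine ⟨⟨a, h1.1.1⟩, ⟨b, h1.2.1.1⟩, ⟨c, h1.2.2.1.1⟩, ⟨d, h1.2.2.2.1⟩, ⟨P, h2.1.1⟩,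
      ⟨Q, h2.2.1.1⟩, ⟨R', h2.2.2.1.1⟩, ⟨S, h2.2.2.2.1⟩, ?_, ?_, ?_⟩
    · simpa only [StrictFail, incl_pt2] using hf
    · simp only [Set.mem_insert_iff, Set.mem_singleton_iff, forall_eq_or_imp, forall_eq]
      exact ⟨h1.1.2, h1.2.1.2, h1.2.2.1.2, h1.2.2.2.2⟩
    · simp only [Set.mem_insert_iff, Set.mem_singleton_iff, forall_eq_or_imp, forall_eq]
      exact ⟨h2.1.2, h2.2.1.2, h2.2.2.1.2, h2.2.2.2.2⟩

theorem mem_XSet_of_mem_Cell (R : Rep ge V) {S : Fin n → Fin n → Prop} {y : ∀ k, Inner ge k}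
    (h : y ∈ Cell (fun y : ∀ k, Inner ge k => V (incl y)) S) : incl y ∈ XSet ge S :=
  mem_XSet (fun k => (y k).2) fun k l hkl hS => by
    have := h k l hkl hS
    rwa [R.brk_iff hkl.symm, not_not] at this

theorem model (R : Rep ge V) : Model (fun y : ∀ k, Inner ge k => V (incl y)) (IsCoordOrder ge)
    (fun S i => EssentialOn ge i (XSet ge S)) where
  strictMono k x a b h := by
    simp only [incl_update]
    exact R.strictMono k (incl x) h
  solv {k x y a b} h1 h2 := by
    simp only [incl_update] at h1 h2 ⊢
    obtain ⟨c, hc⟩ := R.solv h1 h2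
    rw [← hc] at h1 h2
    have h1 := (R.strictMono k (incl x)).le_iff_le.1 h1
    have h2 := (R.strictMono k (incl x)).le_iff_le.1 h2
    have ha := R.nonExtreme_iff.1 a.2
    have hb := R.nonExtreme_iff.1 b.2
    exact ⟨⟨c, R.nonExtreme_iff.2 ⟨hb.1.imp fun _ h => h2.trans_lt h,
      ha.2.imp fun _ h => h.trans_le h1⟩⟩, hc⟩
  dense k := ⟨fun a b hab => by
    have := R.denselyOrdered k
    obtain ⟨c, h1, h2⟩ := exists_between (show a.1 < b.1 from hab)
    exact ⟨⟨c, R.nonExtreme_iff.2 ⟨⟨_, h2⟩, ⟨_, h1⟩⟩⟩, h1, h2⟩⟩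
  noMin k := ⟨fun a => by
    have := R.denselyOrdered k
    obtain ⟨b, hb⟩ := (R.nonExtreme_iff.1 a.2).2
    obtain ⟨c, h1, h2⟩ := exists_between hb
    exact ⟨⟨c, R.nonExtreme_iff.2 ⟨⟨_, h2⟩, ⟨_, h1⟩⟩⟩, h2⟩⟩
  noMax k := ⟨fun a => by
    have := R.denselyOrdered k
    obtain ⟨b, hb⟩ := (R.nonExtreme_iff.1 a.2).1
    obtain ⟨c, h1, h2⟩ := exists_between hb
    exact ⟨⟨c, R.nonExtreme_iff.2 ⟨⟨_, h2⟩, ⟨_, h1⟩⟩⟩, h1⟩⟩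
  nonempty k := (R.exists_nonExtreme k).elim fun a ha => ⟨⟨a, ha⟩⟩
  anti {z p q} hpq h1 h2 := by
    rw [R.brk_iff hpq] at h1
    rw [R.brk_iff hpq.symm] at h2
    rcases R.ax.coordComplete (incl z) p q hpq with h | h
    · exact h2 h
    · refine h1 ?_
      have : NWcone ge (incl z) p q = SEcone ge (incl z) q p := by
        ext x
        simp only [NWcone, SEcone, Set.mem_ofPred_eq]
        exact ⟨fun h => ⟨fun k h1 h2 => h.1 k h2 h1, h.2.2, h.2.1⟩,
          fun h => ⟨fun k h1 h2 => h.1 k h2 h1, h.2.2, h.2.1⟩⟩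
      rw [this] at h
      -- Exchanging the two coordinates swaps the last two premises of triple cancellation, so its
      -- north-west form for `p`, `q` is its south-east form for `q`, `p`.
      intro a b c d P Q R' S z' m1 m2 m3 m4 m5 m6 m7 m8 k1 k2 k3
      simp only [pt2_comm z' hpq.symm] at *
      exact h P Q R' S a b c d z' m1 m2 m5 m6 m3 m4 m7 m8 k1 k3 k2
  ord z := ⟨incl z, by
    funext p q
    by_cases hpq : p = q
    · simp [col, SRel, hpq]
    · simp [col, SRel, R.brk_iff hpq]⟩
  ess {S i x a b} hab ha hb := by
    have ha := R.mem_XSet_of_mem_Cell ha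
    have hb := R.mem_XSet_of_mem_Cell hb
    rw [incl_update] at ha hb
    rcases lt_or_gt_of_ne hab with h | h
    · exact ⟨incl x, b.1, a.1, hb, ha, (R.gt_iff _ _).2 (R.strictMono i _ h)⟩
    · exact ⟨incl x, a.1, b.1, ha, hb, (R.gt_iff _ _).2 (R.strictMono i _ h)⟩
  intra {S T i a b c d x y w z} hS hT hi h1 h2 h3 h4 h5 h6 h7 h8 k1 k2 k3 := by
    have h1 := R.mem_XSet_of_mem_Cell h1
    have h2 := R.mem_XSet_of_mem_Cell h2
    have h3 := R.mem_XSet_of_mem_Cell h3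
    have h4 := R.mem_XSet_of_mem_Cell h4
    have h5 := R.mem_XSet_of_mem_Cell h5
    have h6 := R.mem_XSet_of_mem_Cell h6
    have h7 := R.mem_XSet_of_mem_Cell h7
    have h8 := R.mem_XSet_of_mem_Cell h8
    simp only [incl_update, ← R.ge_iff] at *
    exact R.ax.intra i _ _ _ _ _ _ _ _ (Or.inr (Or.inl ⟨S, T, hS, hT, h1, h2, h3, h4, hi, h5, h6,
      h7, h8⟩)) k1 k2 k3
  intra' {S T i a b c d x y w z} hS hT hi h1 h2 h3 h4 h5 h6 h7 h8 k1 k2 k3 := by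
    have h1 := R.mem_XSet_of_mem_Cell h1
    have h2 := R.mem_XSet_of_mem_Cell h2
    have h3 := R.mem_XSet_of_mem_Cell h3
    have h4 := R.mem_XSet_of_mem_Cell h4
    have h5 := R.mem_XSet_of_mem_Cell h5
    have h6 := R.mem_XSet_of_mem_Cell h6
    have h7 := R.mem_XSet_of_mem_Cell h7
    have h8 := R.mem_XSet_of_mem_Cell h8
    simp only [incl_update, ← R.ge_iff] at *
    exact R.ax.intra i _ _ _ _ _ _ _ _ (Or.inr (Or.inr ⟨S, T, hS, hT, h1, h2, h3, h4, hi, h5, h6,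
      h7, h8⟩)) k1 k2 k3
  inter {i j} hij {a b c d p q r s x y y0 y1 x0 x1 e f S₁ S₂ S₃ S₄} o1 o2 o3 o4
      h1 h2 h3 h4 e1 h5 h6 h7 h8 h9 h10 h11 h12 e3 h13 h14 h15 h16 k1 k2 k3 k4 k5 k6 k7 := by
    have h1 := R.mem_XSet_of_mem_Cell h1
    have h2 := R.mem_XSet_of_mem_Cell h2
    have h3 := R.mem_XSet_of_mem_Cell h3
    have h4 := R.mem_XSet_of_mem_Cell h4
    have h5 := R.mem_XSet_of_mem_Cell h5
    have h6 := R.mem_XSet_of_mem_Cell h6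
    have h7 := R.mem_XSet_of_mem_Cell h7
    have h8 := R.mem_XSet_of_mem_Cell h8
    have h9 := R.mem_XSet_of_mem_Cell h9
    have h10 := R.mem_XSet_of_mem_Cell h10
    have h11 := R.mem_XSet_of_mem_Cell h11
    have h12 := R.mem_XSet_of_mem_Cell h12
    have h13 := R.mem_XSet_of_mem_Cell h13
    have h14 := R.mem_XSet_of_mem_Cell h14
    have h15 := R.mem_XSet_of_mem_Cell h15
    have h16 := R.mem_XSet_of_mem_Cell h16
    simp only [incl_update, ← R.ge_iff, ← R.sim_iff] at *
    exact R.ax.inter i j hij _ _ _ _ _ _ _ _ _ _ _ _ _ _ _ _ S₁ S₂ S₃ S₄ o1 o2 o3 o4 h1 h2 h3 h4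
      e1 h5 h6 h7 h8 h9 h10 h11 h12 e3 h13 h14 h15 h16 k1 k2 k3 k4 k5 k6 k7
  arch {S i l z y0 y1 g lo hi} hS hl hy hg h1 h2 h := by
    have hmono : ∀ (k : Fin n) (x : ∀ k, Inner ge k),
        StrictMono fun a : Inner ge k => V (incl (Function.update x k a)) := fun k x a b h => by
      simp only [incl_update]
      exact R.strictMono k (incl x) h
    have hm1 : ∀ p : Inner ge l, StrictMono fun a : Inner ge i => V (incl (pt2 z i l a p)) := by
      intro p a b hab
      have := hmono i (pt2 z i l a p) hab
      simpa only [update_pt2_left _ hl.symm] using this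
    -- All steps go in the direction given by the order of `y0` and `y1`, so the sequence has
    -- infinite range, and being bounded it contradicts A9.
    have hinj : Function.Injective g := by
      rcases lt_or_gt_of_ne hy with h' | h'
      · refine (strictMono_nat_of_lt_succ fun t => (hm1 y0).lt_iff_lt.1 ?_).injective
        rw [← h t]
        exact hmono l _ h'
      · refine (strictAnti_nat_of_succ_lt fun t => (hm1 y0).lt_iff_lt.1 ?_).injective
        rw [← h t]
        exact hmono l _ h'
    have hfin := R.ax.archimedean S hS i (Set.Ici 0) (fun t : ℤ => (g t.toNat).1)
      ⟨Set.ordConnected_Ici, l, incl z, y0.1, y1.1, hl, fun hc => hy (Subtype.ext (le_antisymm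
        ((R.le_iff _ _ _).2 hc.2) ((R.le_iff _ _ _).2 hc.1))), fun t ht _ => ?_⟩
      ⟨lo.1, hi.1, fun t _ => ⟨(R.le_iff _ _ _).1 (hg _).2, (R.le_iff _ _ _).1 (hg _).1⟩⟩
    · refine Set.infinite_of_injective_forall_mem (f := fun t : ℕ => (g t).1)
        (fun s t hst => hinj (Subtype.ext hst)) (fun t => ?_) hfin
      exact ⟨(t : ℤ), by simp, rfl⟩
    · have ht1 : (t + 1).toNat = t.toNat + 1 := by
        have : (0 : ℤ) ≤ t := ht
        omega
      have e1 := R.mem_XSet_of_mem_Cell (h1 t.toNat)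
      have e2 := R.mem_XSet_of_mem_Cell (h2 t.toNat)
      have e3 := h t.toNat
      simp only [incl_pt2] at e1 e2 e3
      simp only [ht1]
      exact ⟨e1, e2, (R.sim_iff _ _).2 e3⟩

end Rep
end Conjoint

/-! ### Openness of the coordinate orders -/

namespace Conjoint

universe u

variable {n : ℕ} {Y : Fin n → Type u} [∀ k, LinearOrder (Y k)] {L : Type*} [LinearOrder L]
  {V : (∀ k, Y k) → L} {Ord : (Fin n → Fin n → Prop) → Prop}
  {Ess : (Fin n → Fin n → Prop) → Fin n → Prop}

namespace Model

theorem plane (M : Model V Ord Ess) {i k : Fin n} (hik : i ≠ k) (z : ∀ k, Y k) :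
    Plane fun a p => V (pt2 z i k a p) where
  m1 p a b h := by
    have := M.strictMono i (pt2 z i k a p) h
    simpa only [update_pt2_left _ hik] using this
  m2 a p q h := M.strictMono k _ h
  s1 {p a e b q} h1 h2 := by
    obtain ⟨c, hc⟩ := M.solv (k := i) (x := pt2 z i k a p) (y := pt2 z i k b q) (a := a) (b := e)
      (by rwa [update_pt2_left _ hik]) (by rwa [update_pt2_left _ hik])
    exact ⟨c, by rwa [update_pt2_left _ hik] at hc⟩
  s2 {a p r b q} h1 h2 := M.solv h1 h2

theorem up (M : Model V Ord Ess) {k : Fin n} {x y : ∀ k, Y k} {a e : Y k}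
    (h : V (Function.update x k a) < V y) (he : a < e) :
    ∃ c, a < c ∧ c ≤ e ∧ V (Function.update x k c) < V y := by
  have := M.dense k
  rcases lt_or_ge (V (Function.update x k e)) (V y) with h1 | h1
  · exact ⟨e, he, le_rfl, h1⟩
  · obtain ⟨c, hc⟩ := M.solv h.le h1
    obtain ⟨d, h2, h3⟩ := exists_between ((M.strictMono k x).lt_iff_lt.1 (hc.symm ▸ h))
    exact ⟨d, h2, h3.le.trans ((M.strictMono k x).le_iff_le.1 (hc.symm ▸ h1)),
      hc ▸ M.strictMono k x h3⟩

theorem dn (M : Model V Ord Ess) {k : Fin n} {x y : ∀ k, Y k} {a e : Y k}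
    (h : V y < V (Function.update x k a)) (he : e < a) :
    ∃ c, e ≤ c ∧ c < a ∧ V y < V (Function.update x k c) := by
  have := M.dense k
  rcases lt_or_ge (V y) (V (Function.update x k e)) with h1 | h1
  · exact ⟨e, le_rfl, he, h1⟩
  · obtain ⟨c, hc⟩ := M.solv h1 h.le
    obtain ⟨d, h2, h3⟩ := exists_between ((M.strictMono k x).lt_iff_lt.1 (hc.symm ▸ h))
    exact ⟨d, ((M.strictMono k x).le_iff_le.1 (hc.symm ▸ h1)).trans h2.le, h3,
      hc ▸ M.strictMono k x h2⟩

theorem monotone (M : Model V Ord Ess) {x y : ∀ k, Y k} (h : ∀ k, x k ≤ y k) : V x ≤ V y := by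
  classical
  have : ∀ s : Finset (Fin n), V x ≤ V (s.piecewise y x) := by
    intro s
    induction s using Finset.induction_on with
    | empty => simp
    | insert m s hm ih =>
      rw [Finset.piecewise_insert]
      refine ih.trans ?_
      conv_lhs => rw [← Function.update_eq_self m (s.piecewise y x)]
      refine (M.strictMono m _).monotone ?_
      simp [hm, h]
  simpa using this Finset.univ

/-- The slack is spent one coordinate at a time, on raising `x` and lowering `y`. -/
theorem exists_box_lt (M : Model V Ord Ess) {x y : ∀ k, Y k} (h : V x < V y) :
    ∃ u l : ∀ k, Y k, (∀ k, x k < u k) ∧ (∀ k, l k < y k) ∧ V u < V l := by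
  classical
  have : ∀ s : Finset (Fin n), ∃ u l : ∀ k, Y k, (∀ k, x k < u k) ∧ (∀ k, l k < y k) ∧
      V (s.piecewise u x) < V (s.piecewise l y) := by
    intro s
    induction s using Finset.induction_on with
    | empty =>
      have := M.noMax
      have := M.noMin
      exact ⟨fun k => (exists_gt (x k)).choose, fun k => (exists_lt (y k)).choose,
        fun k => (exists_gt (x k)).choose_spec, fun k => (exists_lt (y k)).choose_spec, by simpa using h⟩
    | insert m s hm ih =>
      obtain ⟨u, l, hu, hl, hlt⟩ := ih
      obtain ⟨c, hc1, -, hc3⟩ := M.up (k := m) (x := s.piecewise u x) (a := x m) (e := u m)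
        (y := s.piecewise l y) (by
          have : x m = s.piecewise u x m := by simp [hm]
          rw [this, Function.update_eq_self]; exact hlt) (hu m)
      obtain ⟨d, -, hd1, hd3⟩ := M.dn (k := m) (x := s.piecewise l y) (a := y m) (e := l m)
        (y := Function.update (s.piecewise u x) m c) (by
          have : y m = s.piecewise l y m := by simp [hm]
          rw [this, Function.update_eq_self]; exact hc3) (hl m)
      refine ⟨Function.update u m c, Function.update l m d, fun k => ?_, fun k => ?_, ?_⟩
      · by_cases hk : k = m
        · subst hk; simpa using hc1
        · simpa [hk] using hu k
      · by_cases hk : k = m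
        · subst hk; simpa using hd1
        · simpa [hk] using hl k
      · have e1 : ∀ (f g : ∀ k, Y k) (c : Y m), (insert m s).piecewise (Function.update f m c) g =
            Function.update (s.piecewise f g) m c := by
          intro f g c
          rw [Finset.piecewise_insert, Function.update_self]
          congr 1
          refine s.piecewise_congr (fun k hk => ?_) fun _ _ => rfl
          rw [Function.update_of_ne]
          rintro rfl
          exact hm hk
        rw [e1, e1]
        exact hd3
  obtain ⟨u, l, hu, hl, hlt⟩ := this Finset.univ
  exact ⟨u, l, hu, hl, by simpa using hlt⟩

end Model

/-- `P` holds on an open box around `z`. -/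
def Near (z : ∀ k, Y k) (P : (∀ k, Y k) → Prop) : Prop :=
  ∃ l u : ∀ k, Y k, (∀ k, l k < z k ∧ z k < u k) ∧ ∀ z' : ∀ k, Y k, (∀ k, l k < z' k ∧ z' k < u k) → P z'

theorem Near.mono {z : ∀ k, Y k} {P Q : (∀ k, Y k) → Prop} (h : Near z P) (hPQ : ∀ z, P z → Q z) :
    Near z Q := by
  obtain ⟨l, u, h1, h2⟩ := h
  exact ⟨l, u, h1, fun z' hz => hPQ _ (h2 z' hz)⟩

theorem Near.and {z : ∀ k, Y k} {P Q : (∀ k, Y k) → Prop} (hP : Near z P) (hQ : Near z Q) :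
    Near z fun z => P z ∧ Q z := by
  obtain ⟨l, u, h1, h2⟩ := hP
  obtain ⟨l', u', h1', h2'⟩ := hQ
  refine ⟨fun k => max (l k) (l' k), fun k => min (u k) (u' k), fun k => ⟨?_, ?_⟩, fun z' hz => ?_⟩
  · exact max_lt (h1 k).1 (h1' k).1
  · exact lt_min (h1 k).2 (h1' k).2
  · exact ⟨h2 z' fun k => ⟨(le_max_left _ _).trans_lt (hz k).1, (hz k).2.trans_le (min_le_left _ _)⟩,
      h2' z' fun k => ⟨(le_max_right _ _).trans_lt (hz k).1, (hz k).2.trans_le (min_le_right _ _)⟩⟩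

namespace Model

theorem near_true (M : Model V Ord Ess) (z : ∀ k, Y k) {P : (∀ k, Y k) → Prop} (h : ∀ z, P z) :
    Near z P := by
  have := M.noMax
  have := M.noMin
  exact ⟨fun k => (exists_lt (z k)).choose, fun k => (exists_gt (z k)).choose,
    fun k => ⟨(exists_lt (z k)).choose_spec, (exists_gt (z k)).choose_spec⟩, fun z' _ => h z'⟩

theorem near_all (M : Model V Ord Ess) {z : ∀ k, Y k} {ι : Type*} [Finite ι]
    {P : ι → (∀ k, Y k) → Prop} (h : ∀ i, Near z (P i)) : Near z fun z => ∀ i, P i z := by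
  classical
  have := Fintype.ofFinite ι
  have : ∀ s : Finset ι, Near z fun z => ∀ i ∈ s, P i z := by
    intro s
    induction s using Finset.induction_on with
    | empty => exact M.near_true z (by simp)
    | insert m s hm ih => exact ((h m).and ih).mono fun z hz => by simpa using hz
  exact (this Finset.univ).mono fun z hz i => hz i (Finset.mem_univ i)

theorem near_lt (M : Model V Ord Ess) {z : ∀ k, Y k} {p q : Fin n} (hpq : p ≠ q) {a b : Y p} {P Q : Y q}
    (h : V (pt2 z p q a P) < V (pt2 z p q b Q)) :
    Near z fun z' => V (pt2 z' p q a P) < V (pt2 z' p q b Q) := by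
  obtain ⟨u, l, hu, hl, hlt⟩ := M.exists_box_lt h
  have key : ∀ {k} (z' : ∀ k, Y k) (a : Y p) (P : Y q), k ≠ p → k ≠ q → pt2 z' p q a P k = z' k :=
    fun z' a P h1 h2 => pt2_of_ne _ h1 h2 _ _
  obtain ⟨l0, u0, h0, -⟩ := M.near_true z (P := fun _ => True) (by simp)
  classical
  refine ⟨fun k => if k = p ∨ k = q then l0 k else l k, fun k => if k = p ∨ k = q then u0 k else u k,
    fun k => ?_, fun z' hz' => ?_⟩
  · by_cases hk : k = p ∨ k = q
    · simpa [hk] using h0 k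
    · push Not at hk
      simp only [hk.1, hk.2, or_self, if_false]
      have h1 := hl k
      have h2 := hu k
      rw [key _ _ _ hk.1 hk.2] at h1 h2
      exact ⟨h1, h2⟩
  · have c1 : V (pt2 z' p q a P) ≤ V u := M.monotone fun k => by
      by_cases h1 : k = p
      · subst h1
        have := hu k
        rw [pt2_self_left _ hpq] at this ⊢
        exact this.le
      by_cases h2 : k = q
      · subst h2
        have := hu k
        rw [pt2_self_right] at this ⊢
        exact this.le
      · rw [key _ _ _ h1 h2]
        have := (hz' k).2
        simp only [h1, h2, or_self, if_false] at this
        exact this.le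
    have c2 : V l ≤ V (pt2 z' p q b Q) := M.monotone fun k => by
      by_cases h1 : k = p
      · subst h1
        have := hl k
        rw [pt2_self_left _ hpq] at this ⊢
        exact this.le
      by_cases h2 : k = q
      · subst h2
        have := hl k
        rw [pt2_self_right] at this ⊢
        exact this.le
      · rw [key _ _ _ h1 h2]
        have := (hz' k).1
        simp only [h1, h2, or_self, if_false] at this
        exact this.le
    exact c1.trans_lt (hlt.trans_le c2)

theorem near_coord (M : Model V Ord Ess) (z : ∀ k, Y k) (p : Fin n) {s : Y p → Prop}
    (h : ∃ l u, l < z p ∧ z p < u ∧ ∀ a, l < a → a < u → s a) : Near z fun z' => s (z' p) := by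
  obtain ⟨l, u, h1, h2, h3⟩ := h
  obtain ⟨l0, u0, h0, -⟩ := M.near_true z (P := fun _ => True) (by simp)
  refine ⟨Function.update l0 p l, Function.update u0 p u, fun k => ?_, fun z' hz' => ?_⟩
  · by_cases hk : k = p
    · subst hk; simp [h1, h2]
    · simpa [hk] using h0 k
  · have := hz' p
    simp only [Function.update_self] at this
    exact h3 _ this.1 this.2

/-- The relation `S` is open. -/
theorem near_brk (M : Model V Ord Ess) {z : ∀ k, Y k} {p q : Fin n} (hpq : p ≠ q)
    (h : Brk V z p q) : Near z fun z' => Brk V z' p q := by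
  have := M.noMax
  have := M.noMin
  obtain ⟨a, b, c, d, P, Q, R, S, ⟨h1, h2, h3, h4⟩, h5, h6⟩ := h
  simp only [Set.mem_insert_iff, Set.mem_singleton_iff, forall_eq_or_imp, forall_eq] at h5 h6
  have k1 : ∀ x : Y p, x < z p → Near z fun z' => x < z' p := fun x hx =>
    M.near_coord z p ⟨x, (exists_gt (z p)).choose, hx, (exists_gt (z p)).choose_spec, fun _ h _ => h⟩
  have k2 : ∀ x : Y q, z q < x → Near z fun z' => z' q < x := fun x hx =>
    M.near_coord z q ⟨(exists_lt (z q)).choose, x, (exists_lt (z q)).choose_spec, hx, fun _ _ h => h⟩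
  refine (((((M.near_lt hpq h1).and (M.near_lt hpq h2)).and ((M.near_lt hpq h3).and
    (M.near_lt hpq h4))).and (((k1 _ h5.1).and (k1 _ h5.2.1)).and ((k1 _ h5.2.2.1).and
    (k1 _ h5.2.2.2)))).and (((k2 _ h6.1).and (k2 _ h6.2.1)).and ((k2 _ h6.2.2.1).and
    (k2 _ h6.2.2.2)))).mono ?_
  rintro z' ⟨⟨⟨⟨e1, e2⟩, e3, e4⟩, ⟨f1, f2⟩, f3, f4⟩, ⟨g1, g2⟩, g3, g4⟩
  refine ⟨a, b, c, d, P, Q, R, S, ⟨e1, e2, e3, e4⟩, ?_, ?_⟩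
  · simp only [Set.mem_insert_iff, Set.mem_singleton_iff, forall_eq_or_imp, forall_eq]
    exact ⟨f1, f2, f3, f4⟩
  · simp only [Set.mem_insert_iff, Set.mem_singleton_iff, forall_eq_or_imp, forall_eq]
    exact ⟨g1, g2, g3, g4⟩

/-- Colours can only grow near a point: a strict violation is an open condition, its absence is not.
-/
theorem near_col (M : Model V Ord Ess) (z : ∀ k, Y k) : Near z fun z' => col V z ≤ col V z' := by
  have : Near z fun z' => ∀ p : Fin n, ∀ q : Fin n, col V z p q → col V z' p q := by
    refine M.near_all fun p => M.near_all fun q => ?_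
    by_cases h : col V z p q
    · exact (M.near_brk h.1 h.2).mono fun z' hz' _ => ⟨h.1, hz'⟩
    · exact M.near_true z fun z' h' => absurd h' h
  exact this

/-- Every open rectangle contains a rectangle of constant colour. -/
theorem exists_tame (M : Model V Ord Ess) {i k : Fin n} (hik : i ≠ k) (z : ∀ k, Y k) {a0 a1 : Y i}
    {p0 p1 : Y k} (ha : a0 < a1) (hp : p0 < p1) :
    ∃ (a0' a1' : Y i) (p0' p1' : Y k) (S : Fin n → Fin n → Prop), a0 < a0' ∧ a0' < a1' ∧ a1' < a1 ∧
      p0 < p0' ∧ p0' < p1' ∧ p1' < p1 ∧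
      ∀ a p, a0' ≤ a → a ≤ a1' → p0' ≤ p → p ≤ p1' → col V (pt2 z i k a p) = S := by
  have := M.dense i
  have := M.dense k
  let C : Set (Fin n → Fin n → Prop) :=
    {S | ∃ a p, a0 < a ∧ a < a1 ∧ p0 < p ∧ p < p1 ∧ col V (pt2 z i k a p) = S}
  have hC : C.Nonempty := by
    obtain ⟨a, h1, h2⟩ := exists_between ha
    obtain ⟨p, h3, h4⟩ := exists_between hp
    exact ⟨_, a, p, h1, h2, h3, h4, rfl⟩
  -- Near a point whose colour is maximal among those in the rectangle, colours can neither shrink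
  -- nor grow.
  obtain ⟨S, ⟨a, p, h1, h2, h3, h4, h5⟩, hmax⟩ := (Set.toFinite C).exists_maximal hC
  obtain ⟨l, u, hlu, hcol⟩ := M.near_col (pt2 z i k a p)
  have li := hlu i
  have lk := hlu k
  rw [pt2_self_left _ hik] at li
  rw [pt2_self_right] at lk
  obtain ⟨a0', hx1, hx2⟩ := exists_between (max_lt li.1 h1)
  obtain ⟨a1', hx3, hx4⟩ := exists_between (lt_min li.2 h2)
  obtain ⟨p0', hy1, hy2⟩ := exists_between (max_lt lk.1 h3)
  obtain ⟨p1', hy3, hy4⟩ := exists_between (lt_min lk.2 h4)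
  rw [max_lt_iff] at hx1 hy1
  rw [lt_min_iff] at hx4 hy4
  refine ⟨a0', a1', p0', p1', S, hx1.2, hx2.trans hx3, hx4.2, hy1.2, hy2.trans hy3, hy4.2,
    fun a' p' b1 b2 b3 b4 => ?_⟩
  have hle : S ≤ col V (pt2 z i k a' p') := by
    rw [← h5]
    refine hcol _ fun m => ?_
    by_cases hi : m = i
    · subst hi; rw [pt2_self_left _ hik]; exact ⟨hx1.1.trans_le b1, b2.trans_lt hx4.1⟩
    by_cases hk : m = k
    · subst hk; rw [pt2_self_right]; exact ⟨hy1.1.trans_le b3, b4.trans_lt hy4.1⟩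
    · have := hlu m
      rw [pt2_of_ne _ hi hk] at this ⊢
      exact this
  exact le_antisymm (hmax ⟨a', p', hx1.2.trans_le b1, b2.trans_lt hx4.2, hy1.2.trans_le b3,
    b4.trans_lt hy4.2, rfl⟩ hle) hle

end Model
end Conjoint

/-! ### Finiteness of the disagreement between parallel slices -/

namespace Conjoint

universe u

variable {n : ℕ} {Y : Fin n → Type u} [∀ k, LinearOrder (Y k)] {L : Type*} [LinearOrder L]
  {V : (∀ k, Y k) → L} {Ord : (Fin n → Fin n → Prop) → Prop}
  {Ess : (Fin n → Fin n → Prop) → Fin n → Prop}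

namespace Model

theorem mem_cell (_ : Model V Ord Ess) {z : ∀ k, Y k} {S : Fin n → Fin n → Prop} (h : col V z = S) :
    z ∈ Cell V S := h ▸ mem_Cell_col V z

theorem ind (M : Model V Ord Ess) {i : Fin n} {a c : Y i} {w z : ∀ k, Y k} {S T : Fin n → Fin n → Prop}
    (hS : Ord S) (hT : Ord T) (hi : Ess S i)
    (h1 : Function.update w i a ∈ Cell V S) (h2 : Function.update z i a ∈ Cell V S)
    (h3 : Function.update w i c ∈ Cell V T) (h4 : Function.update z i c ∈ Cell V T)
    (h : V (Function.update w i a) ≤ V (Function.update z i a)) :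
    V (Function.update w i c) ≤ V (Function.update z i c) :=
  M.intra hS hT hi h2 h2 h2 h1 h4 h4 h4 h3 le_rfl h le_rfl

/-- There are no long chains ordered oppositely at two values of a coordinate. -/
theorem no_opposite_chain (M : Model V Ord Ess) {j : Fin n} {q s : Y j} {K : ℕ}
    (hK : Nat.card ((Fin n → Fin n → Prop) × (Fin n → Fin n → Prop)) < K)
    {x : Fin K → ∀ k, Y k}
    (hq : ∀ m m', m < m' → V (Function.update (x m') j q) < V (Function.update (x m) j q))
    (hs : ∀ m m', m < m' → V (Function.update (x m) j s) < V (Function.update (x m') j s)) :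
    False := by
  classical
  have := M.noMax j
  have := M.dense j
  have hex : ∀ mm : Fin K × Fin K, ∃ e : Set.Ioi q, mm.1 < mm.2 →
      V (Function.update (x mm.2) j e.1) < V (Function.update (x mm.1) j q) := by
    rintro ⟨m, m'⟩
    obtain ⟨e, he⟩ := exists_gt q
    by_cases h : m < m'
    · obtain ⟨c, h1, -, h2⟩ := M.up (hq m m' h) he
      exact ⟨⟨c, h1⟩, fun _ => h2⟩
    · exact ⟨⟨e, he⟩, fun h' => absurd h' h⟩
  choose E hE using hex
  obtain ⟨⟨e, he0⟩, he⟩ : ∃ e : Set.Ioi q, ∀ mm, e ≤ E mm := by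
    have : Nonempty (Set.Ioi q) := (exists_gt q).elim fun e he => ⟨⟨e, he⟩⟩
    exact Finite.exists_ge E
  -- The strict comparisons at `q` survive up to `e`. Two values just above `q` with equal colour at
  -- every `x m` make `j` essential on the cells concerned, and pigeonhole over `m` provides two
  -- points to which independence applies.
  have : Infinite (Set.Ioo q e) := (Set.Ioo_infinite he0).to_subtype
  obtain ⟨⟨q', hq1, hq2⟩, ⟨q'', hq3, hq4⟩, hne, hqq⟩ := Finite.exists_ne_map_eq_of_infinite
    (fun q' : Set.Ioo q e => fun m => col V (Function.update (x m) j q'.1))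
  have heqc : ∀ m, col V (Function.update (x m) j q') = col V (Function.update (x m) j q'') :=
    fun m => congrFun hqq m
  have hne : q' ≠ q'' := fun h => hne (Subtype.ext h)
  have := Fintype.ofFinite ((Fin n → Fin n → Prop) × (Fin n → Fin n → Prop))
  obtain ⟨m, m', hmm, hc⟩ := Fintype.exists_ne_map_eq_of_card_lt
    (fun m : Fin K => (col V (Function.update (x m) j q'), col V (Function.update (x m) j s)))
    (by rw [Fintype.card_fin, ← Nat.card_eq_fintype_card]; exact hK)
  wlog hlt : m < m' generalizing m m'
  · exact this m' m hmm.symm hc.symm (lt_of_le_of_ne (not_lt.1 hlt) hmm.symm)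
  simp only [Prod.mk.injEq] at hc
  have h1 : V (Function.update (x m') j q') ≤ V (Function.update (x m) j q') :=
    ((M.strictMono j _).monotone (hq2.le.trans (he (m, m')))).trans ((hE (m, m') hlt).le.trans
      ((M.strictMono j _).monotone hq1.le))
  refine (hs m m' hlt).not_ge (M.ind (S := col V (Function.update (x m) j q'))
    (T := col V (Function.update (x m) j s)) (M.ord _) (M.ord _)
    (M.ess hne (mem_Cell_col _ _) (M.mem_cell (heqc m).symm)) (M.mem_cell hc.1.symm) (mem_Cell_col _ _)
    (M.mem_cell hc.2.symm) (mem_Cell_col _ _) h1)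

/-- Points on one level at `q` with increasing values at `s` can be perturbed on `k` so that their
levels at `q` strictly decrease while the order at `s` is kept. More of them than there are pairs of
colours contradict `no_opposite_chain`. -/
theorem finite_values (M : Model V Ord Ess) {j k : Fin n} (hkj : k ≠ j) (q s : Y j) (lam : L) :
    {v | ∃ y : ∀ k, Y k, V (Function.update y j q) = lam ∧ V (Function.update y j s) = v}.Finite := by
  classical
  by_contra hinf
  have := M.noMax k
  have := M.dense k
  set N := Nat.card ((Fin n → Fin n → Prop) × (Fin n → Fin n → Prop))
  obtain ⟨t, ht, htc⟩ := Set.Infinite.exists_subset_card_eq hinf (N + 1)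
  let v := t.orderEmbOfFin htc
  have hv : ∀ m, ∃ y : ∀ k, Y k, V (Function.update y j q) = lam ∧ V (Function.update y j s) = v m :=
    fun m => ht (t.orderEmbOfFin_mem htc m)
  choose y hyq hys using hv
  have hlt : ∀ m m', m < m' → V (Function.update (y m) j s) < V (Function.update (y m') j s) := by
    intro m m' h
    rw [hys, hys]
    exact v.strictMono h
  have hself : ∀ m r, Function.update (Function.update (y m) j r) k (y m k) = Function.update (y m) j r := by
    intro m r
    conv_rhs => rw [← Function.update_eq_self k (Function.update (y m) j r)]
    rw [Function.update_of_ne hkj]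
  have hex : ∀ m m', ∃ e : Set.Ioi (y m k), m < m' →
      V (Function.update (Function.update (y m) j s) k e.1) < V (Function.update (y m') j s) := by
    intro m m'
    obtain ⟨e, he⟩ := exists_gt (y m k)
    by_cases h : m < m'
    · obtain ⟨c, h1, -, h2⟩ := M.up (k := k) (x := Function.update (y m) j s) (a := y m k)
        (by rw [hself]; exact hlt m m' h) he
      exact ⟨⟨c, h1⟩, fun _ => h2⟩
    · exact ⟨⟨e, he⟩, fun h' => absurd h' h⟩
  choose E hE using hex
  have hex2 : ∀ m, ∃ e : Set.Ioi (y m k), ∀ m', e ≤ E m m' := fun m => by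
    have : Nonempty (Set.Ioi (y m k)) := (exists_gt (y m k)).elim fun e he => ⟨⟨e, he⟩⟩
    exact Finite.exists_ge (E m)
  choose c hc using hex2
  -- `m0` has the least room above the common level at `q`; a level inside that room can be reached
  -- from every `y m`.
  obtain ⟨m0, hm0⟩ := Finite.exists_min
    fun m => V (Function.update (Function.update (y m) j q) k (c m).1)
  obtain ⟨u, hu, huc⟩ := Set.Infinite.exists_subset_card_eq
    (Set.Ioo_infinite (show y m0 k < (c m0).1 from (c m0).2)) (N + 1)
  let w := u.orderEmbOfFin huc
  have hw : ∀ m, y m0 k < w m ∧ w m < (c m0).1 := fun m => hu (u.orderEmbOfFin_mem huc m)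
  -- The reversed index makes the new levels decrease with `m`.
  let mu : Fin (N + 1) → L := fun m => V (Function.update (Function.update (y m0) j q) k (w m.rev))
  have hmu : ∀ m m', m < m' → mu m' < mu m := fun m m' h =>
    M.strictMono k _ (w.strictMono (Fin.rev_lt_rev.2 h))
  have hmu1 : ∀ m, lam < mu m := fun m => by
    rw [← hyq m0, ← hself m0 q]
    exact M.strictMono k _ (hw _).1
  have hmu2 : ∀ m m', mu m < V (Function.update (Function.update (y m') j q) k (c m').1) := fun m m' =>
    (M.strictMono k _ (hw _).2).trans_le (hm0 m')
  have hd : ∀ m, ∃ d, V (Function.update (Function.update (y m) j q) k d) = mu m := fun m =>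
    M.solv (a := y m k) (b := (c m).1) (by rw [hself, hyq]; exact (hmu1 m).le) (hmu2 m m).le
  choose d hd using hd
  have hd1 : ∀ m, y m k < d m := fun m => by
    refine (M.strictMono k (Function.update (y m) j q)).lt_iff_lt.1 ?_
    rw [hself, hyq, hd]
    exact hmu1 m
  have hd2 : ∀ m, d m < (c m).1 := fun m => by
    refine (M.strictMono k (Function.update (y m) j q)).lt_iff_lt.1 ?_
    rw [hd]
    exact hmu2 m m
  refine M.no_opposite_chain (j := j) (q := q) (s := s) (K := N + 1) (Nat.lt_succ_self N)
    (x := fun m => Function.update (y m) k (d m)) (fun m m' h => ?_) (fun m m' h => ?_)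
  · simp only [Function.update_comm hkj]
    rw [hd, hd]
    exact hmu m m' h
  · simp only [Function.update_comm hkj]
    calc _ < _ := M.strictMono k _ (hd2 m)
      _ ≤ _ := (M.strictMono k _).monotone (hc m m')
      _ < _ := hE m m' h
      _ = _ := congrArg V (hself m' s).symm
      _ < _ := M.strictMono k _ (hd1 m')

end Model
end Conjoint

/-! ### Staircases and the comparison of two planes -/

namespace Conjoint

universe u

/-- An infinite staircase between two levels over the interval `[w0, w1]`. -/
def Stair {α β L : Type*} [LinearOrder β] [LT L] (B : α → β → L) (w0 w1 : β) : Prop :=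
  ∃ (v : ℕ → α) (w w' : ℕ → β) (l l' : L), ∀ t, w0 ≤ w t ∧ w t < w' t ∧ w' t ≤ w (t + 1) ∧
    w' t ≤ w1 ∧ B (v t) (w t) = l ∧ B (v t) (w' t) = l'

namespace Plane

variable {α β L : Type*} [LinearOrder α] [LinearOrder β] [LinearOrder L] {F A B : α → β → L}

/-- Steps are repeated as long as they fit below `hi`; since they cannot go on for ever, there is a
first one that overshoots. -/
theorem exists_steps (hF : Plane F) {k0 k1 : β} (hk : k0 < k1) {lo hi : α} (hlo : lo ≤ hi)
    (harch : ¬ ∃ h : ℕ → α, h 0 = lo ∧ (∀ t, h t ≤ hi) ∧ ∀ t, F (h (t + 1)) k0 = F (h t) k1) :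
    ∃ (N : ℕ) (h : ℕ → α), h 0 = lo ∧ (∀ t < N, F (h (t + 1)) k0 = F (h t) k1) ∧
      (∀ t ≤ N, h t ≤ hi) ∧ F hi k0 < F (h N) k1 := by
  classical
  have hex : ∀ u : α, ∃ u', F u k1 ≤ F hi k0 → F u' k0 = F u k1 := by
    intro u
    by_cases h : F u k1 ≤ F hi k0
    · obtain ⟨c, hc⟩ := hF.s1 (hF.m2 u hk).le h
      exact ⟨c, fun _ => hc⟩
    · exact ⟨u, fun h' => absurd h' h⟩
  choose f hf using hex
  let h : ℕ → α := fun t => f^[t] lo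
  have hs : ∀ t, h (t + 1) = f (h t) := fun t => Function.iterate_succ_apply' f t lo
  have hbd : ∀ N, (∀ t < N, F (h t) k1 ≤ F hi k0) → ∀ t ≤ N, h t ≤ hi := by
    intro N hN t ht
    cases t with
    | zero => exact hlo
    | succ t =>
      have h1 := hN t (by omega)
      have h2 := hf _ h1
      rw [← hs] at h2
      exact (hF.m1 k0).le_iff_le.1 (h2.trans_le h1)
  have hend : ∃ N, F hi k0 < F (h N) k1 := by
    by_contra hc
    push Not at hc
    refine harch ⟨h, rfl, fun t => hbd t (fun s _ => hc s) t le_rfl, fun t => ?_⟩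
    rw [hs]
    exact hf _ (hc t)
  have hlt : ∀ t < Nat.find hend, F (h t) k1 ≤ F hi k0 := fun t ht => not_lt.1 (Nat.find_min hend ht)
  refine ⟨Nat.find hend, h, rfl, fun t ht => ?_, hbd _ hlt, Nat.find_spec hend⟩
  rw [hs]
  exact hf _ (hlt t ht)

/-- Follow the level curve of `A` from `(b, w0)` to `(a, w1)`. Along it `B` takes finitely many
values, so a gap separates the initial value from the others. As long as the two legs of a step stay
within the gap, `B` keeps its initial value on the curve. Steps that exhaust the gap form a
staircase if there are infinitely many of them, so without staircases the end of the curve is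
reached with the initial value. -/
theorem eq_of_eq [DenselyOrdered α] [DenselyOrdered β] (hA : Plane A) (hB : Plane B)
    (hfin : ∀ l, {v | ∃ u w, A u w = l ∧ B u w = v}.Finite) {w0 w1 : β} (hw : w0 < w1)
    (hst : ¬ Stair B w0 w1) {a b : α} (hab : A b w0 = A a w1) : B b w0 = B a w1 := by
  classical
  have hu : ∀ w : Set.Icc w0 w1, ∃ u, A u w = A b w0 := fun w =>
    hA.s1 (p := w.1) (a := a) (e := b) (by rw [hab]; exact (hA.m2 a).monotone w.2.2)
      ((hA.m2 b).monotone w.2.1)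
  choose u hu using hu
  have ua : ∀ (w w' : Set.Icc w0 w1), w ≤ w' → u w' ≤ u w := fun w w' h => by
    refine not_lt.1 fun h' => ?_
    have h1 : A (u w) w < A (u w') w := hA.m1 _ h'
    have h2 : A (u w') w ≤ A (u w') w' := (hA.m2 _).monotone h
    rw [hu w] at h1
    rw [hu w'] at h2
    exact absurd h1 h2.not_gt
  have u0 : u ⟨w0, le_rfl, hw.le⟩ = b := (hA.m1 w0).injective (hu ⟨w0, le_rfl, hw.le⟩)
  have u1 : u ⟨w1, hw.le, le_rfl⟩ = a := (hA.m1 w1).injective ((hu ⟨w1, hw.le, le_rfl⟩).trans hab)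
  set g : Set.Icc w0 w1 → L := fun w => B (u w) w with hg
  set E := {v | ∃ u w, A u w = A b w0 ∧ B u w = v} with hE
  have hEf : E.Finite := hfin _
  have hgE : ∀ w, g w ∈ E := fun w => ⟨u w, w, hu w, rfl⟩
  set al := B b w0 with hal
  -- a separating value above
  have hsep1 : ∃ c, w0 < c ∧ ∀ v ∈ E, al < v → B b c < v := by
    have : Finite E := hEf
    have hex : ∀ v : E, ∃ c : Set.Ioi w0, al < v.1 → B b c < v.1 := by
      rintro ⟨v, u', w', -, hv⟩
      by_cases h : al < v
      · subst hv
        obtain ⟨c, h1, -, h2⟩ := hB.up2 h hw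
        exact ⟨⟨c, h1⟩, fun _ => h2⟩
      · exact ⟨⟨w1, hw⟩, fun h' => absurd h' h⟩
    choose c hc using hex
    have : Nonempty (Set.Ioi w0) := ⟨⟨w1, hw⟩⟩
    obtain ⟨e, he⟩ := Finite.exists_ge c
    exact ⟨e, e.2, fun v hv hlt => ((hB.m2 b).monotone (he ⟨v, hv⟩)).trans_lt (hc ⟨v, hv⟩ hlt)⟩
  obtain ⟨c1, hc1, hsep1⟩ := hsep1
  by_contra hne
  have hne : g ⟨w1, hw.le, le_rfl⟩ ≠ al := by
    simp only [hg, u1]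
    exact fun h => hne h.symm
  -- a separating value below
  have hsep2 : ∃ (x : α) (y : β), B x y < al ∧ ∀ v ∈ E, v < al → v < B x y := by
    have hab' : a < b := by
      refine (hA.m1 w1).lt_iff_lt.1 ?_
      rw [← hab]
      exact hA.m2 b hw
    have : Finite E := hEf
    have hex : ∀ v : E, ∃ c : Set.Iio b, v.1 < al → v.1 < B c w0 := by
      rintro ⟨v, u', w', -, hv⟩
      by_cases h : v < al
      · subst hv
        obtain ⟨c, -, h1, h2⟩ := hB.dn1 h hab'
        exact ⟨⟨c, h1⟩, fun _ => h2⟩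
      · exact ⟨⟨a, hab'⟩, fun h' => absurd h' h⟩
    choose c hc using hex
    have : Nonempty (Set.Iio b) := ⟨⟨a, hab'⟩⟩
    obtain ⟨e, he⟩ := Finite.exists_le c
    exact ⟨e, w0, hB.m1 w0 e.2, fun v hv hlt =>
      (hc ⟨v, hv⟩ hlt).trans_le ((hB.m1 w0).monotone (he ⟨v, hv⟩))⟩
  obtain ⟨x2, y2, hx2, hsep2⟩ := hsep2
  -- If the end value differed, each initial part of the curve with constant `B` could be prolonged
  -- by a step that exhausts the gap exactly: upwards in column `u w`, or downwards in the column of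
  -- the new point.
  have key : ∀ w : {w : Set.Icc w0 w1 // ∀ w' ≤ w, g w' = al}, ∃ w2 : {w : Set.Icc w0 w1 // ∀ w' ≤ w, g w' = al},
      w.1 < w2.1 ∧ (B (u w.1) w2.1 = B b c1 ∨ B (u w2.1) w.1 = B x2 y2) := by
    rintro ⟨w, hw'⟩
    have hgw : B (u w) w = al := hw' w le_rfl
    have hext : ∀ w' : Set.Icc w0 w1, B (u w) w' ≤ B b c1 → B x2 y2 ≤ B (u w') w →
        ∀ w'' ≤ w', g w'' = al := by
      intro w' h1 h2 w'' h3
      rcases le_total w'' w with h4 | h4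
      · exact hw' _ h4
      · have e1 : g w'' ≤ B b c1 := ((hB.m1 _).monotone (ua _ _ h4)).trans (((hB.m2 _).monotone h3).trans h1)
        have e2 : B x2 y2 ≤ g w'' := h2.trans (((hB.m1 _).monotone (ua _ _ h3)).trans ((hB.m2 _).monotone h4))
        rcases lt_trichotomy (g w'') al with h | h | h
        · exact absurd (hsep2 _ (hgE _) h) e2.not_gt
        · exact h
        · exact absurd (hsep1 _ (hgE _) h) e1.not_gt
    have hwlt : w < ⟨w1, hw.le, le_rfl⟩ := by
      refine lt_of_le_of_ne w.2.2 fun h => hne ?_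
      rw [← h]; exact hgw
    have hx1 : ∃ x1 : Set.Icc w0 w1, w < x1 ∧ B (u w) x1 ≤ B b c1 ∧
        (B (u w) x1 = B b c1 ∨ x1 = ⟨w1, hw.le, le_rfl⟩) := by
      by_cases h : B (u w) w1 ≤ B b c1
      · exact ⟨⟨w1, hw.le, le_rfl⟩, hwlt, h, Or.inr rfl⟩
      · have hlt : B (u w) w < B b c1 := by rw [hgw]; exact hB.m2 b hc1
        obtain ⟨x1, hx1⟩ := hB.s2 hlt.le (not_le.1 h).le
        have l1 : w.1 < x1 := (hB.m2 (u w)).lt_iff_lt.1 (by rwa [hx1])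
        have l2 : x1 < w1 := (hB.m2 (u w)).lt_iff_lt.1 (by rw [hx1]; exact not_le.1 h)
        exact ⟨⟨x1, w.2.1.trans l1.le, l2.le⟩, l1, hx1.le, Or.inl hx1⟩
    obtain ⟨x1, hwx, hx1, hx1'⟩ := hx1
    by_cases h2 : B x2 y2 ≤ B (u x1) w
    · have hz := hext x1 hx1 h2
      refine ⟨⟨x1, hz⟩, hwx, Or.inl (hx1'.resolve_right fun h => hne ?_)⟩
      rw [← h]; exact hz x1 le_rfl
    · rw [not_le] at h2
      have hle : B x2 y2 ≤ B (u w) w := by rw [hgw]; exact hx2.le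
      obtain ⟨c, hc⟩ := hB.s1 h2.le hle
      have c1' : u x1 < c := (hB.m1 w).lt_iff_lt.1 (by rwa [hc])
      have c2' : c < u w := (hB.m1 w).lt_iff_lt.1 (by rw [hc, hgw]; exact hx2)
      have d1 : A c w < A b w0 := by rw [← hu w]; exact hA.m1 _ c2'
      have d2 : A b w0 < A c x1 := by rw [← hu x1]; exact hA.m1 _ c1'
      obtain ⟨x3, hx3⟩ := hA.s2 d1.le d2.le
      have l1 : w.1 < x3 := (hA.m2 c).lt_iff_lt.1 (by rwa [hx3])
      have l2 : x3 < x1.1 := (hA.m2 c).lt_iff_lt.1 (by rwa [hx3])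
      have hux : u ⟨x3, w.2.1.trans l1.le, l2.le.trans x1.2.2⟩ = c :=
        (hA.m1 x3).injective ((hu ⟨x3, w.2.1.trans l1.le, l2.le.trans x1.2.2⟩).trans hx3.symm)
      have hz := hext ⟨x3, w.2.1.trans l1.le, l2.le.trans x1.2.2⟩
        (((hB.m2 _).monotone l2.le).trans hx1) (by rw [hux, hc])
      exact ⟨⟨_, hz⟩, l1, Or.inr (by simp only [hux, hc])⟩
  choose nx hnx1 hnx2 using key
  let W : ℕ → {w : Set.Icc w0 w1 // ∀ w' ≤ w, g w' = al} :=
    fun t => nx^[t] ⟨⟨w0, le_rfl, hw.le⟩, fun w' hw' => by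
      have : w' = ⟨w0, le_rfl, hw.le⟩ := le_antisymm hw' w'.2.1
      rw [this]; simp only [hg, u0]; rfl⟩
  have hW : ∀ t, W (t + 1) = nx (W t) := fun t => Function.iterate_succ_apply' nx t _
  have hWm : StrictMono fun t => (W t).1 := strictMono_nat_of_lt_succ fun t => by rw [hW]; exact hnx1 _
  have hWg : ∀ t, B (u (W t).1) (W t).1 = al := fun t => (W t).2 _ le_rfl
  have hor : ∀ t, B (u (W t).1) (W (t + 1)).1 = B b c1 ∨ B (u (W (t + 1)).1) (W t).1 = B x2 y2 :=
    fun t => by rw [hW]; exact hnx2 _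
  -- One of the two kinds of step occurs infinitely often, and those steps alone form a staircase
  -- between fixed levels.
  have hinf : {t | B (u (W t).1) (W (t + 1)).1 = B b c1}.Infinite ∨
      {t | B (u (W (t + 1)).1) (W t).1 = B x2 y2}.Infinite := by
    rw [← Set.infinite_union]
    convert! Set.infinite_univ (α := ℕ)
    ext t
    simpa using hor t
  rcases hinf with h | h
  · refine hst ⟨fun t => u (W (Nat.nth (fun t => B (u (W t).1) (W (t + 1)).1 = B b c1) t)).1,
      fun t => (W (Nat.nth (fun t => B (u (W t).1) (W (t + 1)).1 = B b c1) t)).1,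
      fun t => (W (Nat.nth (fun t => B (u (W t).1) (W (t + 1)).1 = B b c1) t + 1)).1, al, B b c1,
      fun t => ⟨(W _).1.2.1, hWm (Nat.lt_succ_self _), hWm.monotone ?_, (W _).1.2.2, hWg _,
        Nat.nth_mem_of_infinite h t⟩⟩
    exact Nat.nth_strictMono h (Nat.lt_succ_self t)
  · refine hst ⟨fun t => u (W (Nat.nth (fun t => B (u (W (t + 1)).1) (W t).1 = B x2 y2) t + 1)).1,
      fun t => (W (Nat.nth (fun t => B (u (W (t + 1)).1) (W t).1 = B x2 y2) t)).1,
      fun t => (W (Nat.nth (fun t => B (u (W (t + 1)).1) (W t).1 = B x2 y2) t + 1)).1, B x2 y2, al,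
      fun t => ⟨(W _).1.2.1, hWm (Nat.lt_succ_self _), hWm.monotone ?_, (W _).1.2.2,
        Nat.nth_mem_of_infinite h t, hWg _⟩⟩
    exact Nat.nth_strictMono h (Nat.lt_succ_self t)

/-- Without staircases, the orders of two planes with finite mixed level sets agree. -/
theorem le_iff_le_of_not_stair [DenselyOrdered α] [DenselyOrdered β] (hA : Plane A) (hB : Plane B)
    (hfin : ∀ l, {v | ∃ u w, A u w = l ∧ B u w = v}.Finite) {w0 w1 : β}
    (hst : ¬ Stair B w0 w1) {a b : α} {p q : β} (hp : p ∈ Set.Icc w0 w1) (hq : q ∈ Set.Icc w0 w1) :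
    A a p ≤ A b q ↔ B a p ≤ B b q := by
  have heq : ∀ {a b : α} {p q : β}, p ∈ Set.Icc w0 w1 → q ∈ Set.Icc w0 w1 → p < q →
      A a p = A b q → B a p = B b q := fun {a b p q} hp hq hpq h =>
    hA.eq_of_eq hB hfin hpq (fun ⟨v, w, w', l, l', h⟩ => hst ⟨v, w, w', l, l', fun t =>
      ⟨hp.1.trans (h t).1, (h t).2.1, (h t).2.2.1, (h t).2.2.2.1.trans hq.2, (h t).2.2.2.2⟩⟩) h
  have heq' : ∀ {a b : α} {p q : β}, p ∈ Set.Icc w0 w1 → q ∈ Set.Icc w0 w1 →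
      A a p = A b q → B a p = B b q := fun {a b p q} hp hq h => by
    rcases lt_trichotomy p q with h' | h' | h'
    · exact heq hp hq h' h
    · subst h'; rw [(hA.m1 p).injective h]
    · exact (heq hq hp h' h.symm).symm
  have hlt : ∀ {a b : α} {p q : β}, p ∈ Set.Icc w0 w1 → q ∈ Set.Icc w0 w1 →
      A a p < A b q → B a p < B b q := fun {a b p q} hp hq h => by
    rcases le_total p q with h1 | h1
    · rcases le_or_gt a b with h2 | h2
      · rcases h1.lt_or_eq with h3 | h3
        · exact (hB.m2 a h3).trans_le ((hB.m1 q).monotone h2)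
        · subst h3
          exact hB.m1 p ((hA.m1 p).lt_iff_lt.1 h)
      · obtain ⟨r, hr⟩ := hA.s2 (hA.m1 p h2).le h.le
        have r1 : p ≤ r := (hA.m2 b).le_iff_le.1 (by rw [hr]; exact (hA.m1 p h2).le)
        have r2 : r < q := (hA.m2 b).lt_iff_lt.1 (by rwa [hr])
        rw [heq' hp (q := r) ⟨hp.1.trans r1, r2.le.trans hq.2⟩ hr.symm]
        exact hB.m2 b r2
    · have h2 : A a q ≤ A a p := (hA.m2 a).monotone h1
      obtain ⟨c, hc⟩ := hA.s1 h2 h.le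
      rw [heq' hp hq hc.symm]
      exact hB.m1 q ((hA.m1 q).lt_iff_lt.1 (by rwa [hc]))
  refine ⟨fun h => ?_, fun h => not_lt.1 fun h' => (hlt hq hp h').not_ge h⟩
  rcases h.lt_or_eq with h | h
  · exact (hlt hp hq h).le
  · exact (heq' hp hq h).le

end Plane
end Conjoint

/-! ### Planes ordered independently of the other coordinates -/

namespace Conjoint

universe u

variable {n : ℕ} {Y : Fin n → Type u} {L : Type*} [LinearOrder L] {V : (∀ k, Y k) → L}

/-- The order of the plane of `l` and `i`, for values of `i` in `W`, does not depend on the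
other coordinates. -/
def PlaneInv (V : (∀ k, Y k) → L) (l i : Fin n) (W : Set (Y i)) : Prop :=
  ∀ (x x' : ∀ k, Y k) (u u' : Y l) (w w' : Y i), w ∈ W → w' ∈ W →
    V (pt2 x l i u w) ≤ V (pt2 x l i u' w') → V (pt2 x' l i u w) ≤ V (pt2 x' l i u' w')

theorem PlaneInv.iff {l i : Fin n} {W : Set (Y i)} (h : PlaneInv V l i W) {x x' : ∀ k, Y k}
    {u u' : Y l} {w w' : Y i} (hw : w ∈ W) (hw' : w' ∈ W) :
    V (pt2 x l i u w) ≤ V (pt2 x l i u' w') ↔ V (pt2 x' l i u w) ≤ V (pt2 x' l i u' w') :=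
  ⟨h _ _ _ _ _ _ hw hw', h _ _ _ _ _ _ hw hw'⟩

theorem PlaneInv.lt {l i : Fin n} {W : Set (Y i)} (h : PlaneInv V l i W) {x x' : ∀ k, Y k}
    {u u' : Y l} {w w' : Y i} (hw : w ∈ W) (hw' : w' ∈ W)
    (hlt : V (pt2 x l i u w) < V (pt2 x l i u' w')) :
    V (pt2 x' l i u w) < V (pt2 x' l i u' w') :=
  not_le.1 fun h' => hlt.not_ge (h _ _ _ _ _ _ hw' hw h')

theorem PlaneInv.eq {l i : Fin n} {W : Set (Y i)} (h : PlaneInv V l i W) {x x' : ∀ k, Y k}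
    {u u' : Y l} {w w' : Y i} (hw : w ∈ W) (hw' : w' ∈ W)
    (he : V (pt2 x l i u w) = V (pt2 x l i u' w')) :
    V (pt2 x' l i u w) = V (pt2 x' l i u' w') :=
  le_antisymm (h _ _ _ _ _ _ hw hw' he.le) (h _ _ _ _ _ _ hw' hw he.ge)

theorem pt2_update_of_ne (z : ∀ k, Y k) {i k j : Fin n} (hi : j ≠ i) (hk : j ≠ k) (a : Y i) (p : Y k)
    (v : Y j) : pt2 (Function.update z j v) i k a p = Function.update (pt2 z i k a p) j v := by
  simp only [pt2]
  rw [Function.update_comm hi, Function.update_comm hk]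

theorem pt2_update_right (z : ∀ k, Y k) {i k : Fin n} (hik : i ≠ k) (a : Y i) (p q : Y k) :
    pt2 (Function.update z k q) i k a p = pt2 z i k a p := by
  rw [pt2_comm _ hik, pt2_update_left, ← pt2_comm _ hik]

variable [∀ k, LinearOrder (Y k)] {Ord : (Fin n → Fin n → Prop) → Prop}
  {Ess : (Fin n → Fin n → Prop) → Fin n → Prop}

/-- No plane contains a staircase over the interval `[w0, w1]` of coordinate `i`. -/
def NoStair (V : (∀ k, Y k) → L) (i : Fin n) (w0 w1 : Y i) : Prop :=
  ∀ (l : Fin n) (x : ∀ k, Y k), l ≠ i → ¬ Stair (fun v w => V (pt2 x l i v w)) w0 w1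

namespace Model

/-- Two planes which differ in one transverse coordinate have the same order, if one of them
contains no staircase. -/
theorem plane_le_iff (M : Model V Ord Ess) {l i j : Fin n} (hli : l ≠ i) (hjl : j ≠ l) (hji : j ≠ i)
    (x : ∀ k, Y k) (q s : Y j) {w0 w1 : Y i}
    (hst : ¬ Stair (fun v w => V (pt2 (Function.update x j s) l i v w)) w0 w1)
    {a b : Y l} {w w' : Y i} (hw : w ∈ Set.Icc w0 w1) (hw' : w' ∈ Set.Icc w0 w1) :
    V (pt2 (Function.update x j q) l i a w) ≤ V (pt2 (Function.update x j q) l i b w') ↔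
    V (pt2 (Function.update x j s) l i a w) ≤ V (pt2 (Function.update x j s) l i b w') := by
  have := M.dense l
  have := M.dense i
  refine (M.plane hli (Function.update x j q)).le_iff_le_of_not_stair
    (M.plane hli (Function.update x j s)) (fun lam => ?_) hst hw hw'
  refine (M.finite_values (j := j) (k := i) hji.symm q s lam).subset ?_
  rintro v ⟨u, w, h1, h2⟩
  rw [pt2_update_of_ne _ hjl hji] at h1 h2
  exact ⟨pt2 x l i u w, h1, h2⟩

/-- The transverse coordinates are changed one at a time by `plane_le_iff`; the entries of the base
point at `l` and `i` do not matter. -/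
theorem planeInv (M : Model V Ord Ess) {i : Fin n} {w0 w1 : Y i} (h : NoStair V i w0 w1) {l : Fin n}
    (hli : l ≠ i) : PlaneInv V l i (Set.Icc w0 w1) := by
  intro x x' u u' w w' hw hw' hle
  refine Rep.iff_of_good
    (T := fun x => V (pt2 x l i u w) ≤ V (pt2 x l i u' w')) (G := fun _ _ => True)
    ?_ (fun _ => trivial) (fun _ => trivial) hle
  intro x j v _ _ hT
  by_cases hjl : j = l
  · subst hjl; simpa only [pt2_update_left] using hT
  by_cases hji : j = i
  · subst hji; simpa only [pt2_update_right _ hli] using hT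
  · rw [← M.plane_le_iff hli hjl hji x (x j) v (h l _ hli) hw hw', Function.update_eq_self]
    exact hT

/-- A tame interval contains no staircase. -/
theorem noStair_of_tame (M : Model V Ord Ess) {i m : Fin n} (him : i ≠ m) {z : ∀ k, Y k} {i0 i1 : Y i}
    {e0 e1 : Y m} (he : e0 < e1) {S : Fin n → Fin n → Prop}
    (htame : ∀ a p, i0 ≤ a → a ≤ i1 → e0 ≤ p → p ≤ e1 → col V (pt2 z i m a p) = S) :
    NoStair V i i0 i1 := by
  classical
  rintro l x hl ⟨v, w, w', lam, lam', hst⟩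
  beta_reduce at hst
  have := M.dense i
  have := M.dense l
  have := M.noMax l
  have hF := M.plane hl x
  have hG := M.plane him z
  obtain ⟨-, hw0, -, -, hl0, hl0'⟩ := hst 0
  obtain ⟨ws, hws1, hws2⟩ := exists_between hw0
  obtain ⟨ds, hds1, hds2⟩ := exists_between hws2
  obtain ⟨us', hus'⟩ := exists_gt (v 0)
  obtain ⟨us, hus1, -, hus2⟩ := hF.up1 (hF.m2 (v 0) hds2) hus'
  obtain ⟨c0, c1, d0, d1, S1, hc0, hc01, hc1, hd0, hd01, hd1, hS1⟩ := M.exists_tame hl x hus1 hds1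
  obtain ⟨c2, hc2, hc21, hlt2⟩ := hF.up1 (hF.m2 c0 hd01) hc01
  set K := Nat.card (Fin n → Fin n → Prop) + 1 with hK
  obtain ⟨s, hs, hsc⟩ := Set.Infinite.exists_subset_card_eq (Set.Ioo_infinite hc2) K
  let cc := s.orderEmbOfFin hsc
  have hcc : ∀ a, c0 < cc a ∧ cc a < c2 := fun a => hs (s.orderEmbOfFin_mem hsc a)
  have hmu1 : ∀ a, lam < V (pt2 x l i (cc a) d0) := fun a => by
    rw [← hl0]
    exact (hF.m2 (v 0) (hws1.trans hd0)).trans (hF.m1 d0 (hc0.trans (hcc a).1))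
  have hmu2 : ∀ a, V (pt2 x l i (cc a) d0) < lam' := fun a => by
    rw [← hl0']
    refine lt_trans (hF.m1 d0 ((hcc a).2.trans_le (hc21.trans hc1.le))) ((hF.m2 us ?_).trans hus2)
    exact hd01.trans hd1
  have hp : ∀ t a, ∃ p, V (pt2 x l i (v t) p) = V (pt2 x l i (cc a) d0) := fun t a =>
    hF.s2 (p := w t) (r := w' t) (by rw [(hst t).2.2.2.2.1]; exact (hmu1 a).le)
      (by rw [(hst t).2.2.2.2.2]; exact (hmu2 a).le)
  choose p hp using hp
  have hp1 : ∀ t a, w t < p t a := fun t a => (hF.m2 (v t)).lt_iff_lt.1 (by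
    rw [hp, (hst t).2.2.2.2.1]; exact hmu1 a)
  have hp2 : ∀ t a, p t a < w' t := fun t a => (hF.m2 (v t)).lt_iff_lt.1 (by
    rw [hp, (hst t).2.2.2.2.2]; exact hmu2 a)
  have hpab : ∀ t a b, a < b → p t a < p t b := fun t a b h => (hF.m2 (v t)).lt_iff_lt.1 (by
    rw [hp, hp]; exact hF.m1 d0 (cc.strictMono h))
  have hpi0 : ∀ t a, i0 ≤ p t a := fun t a => (hst t).1.trans (hp1 t a).le
  have hpi1 : ∀ t a, p t a ≤ i1 := fun t a => (hp2 t a).le.trans (hst t).2.2.2.1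
  -- Each stair meets one more level of the rod than there are colours, so two of these levels have
  -- equal colour there. Infinitely many stairs share the pair of levels and the colour.
  have hpig : ∀ t, ∃ ab : Fin K × Fin K, ab.1 < ab.2 ∧
      col V (pt2 x l i (v t) (p t ab.1)) = col V (pt2 x l i (v t) (p t ab.2)) := by
    intro t
    have := Fintype.ofFinite (Fin n → Fin n → Prop)
    obtain ⟨a, b, hab, hc⟩ := Fintype.exists_ne_map_eq_of_card_lt
      (fun a : Fin K => col V (pt2 x l i (v t) (p t a)))
      (by rw [Fintype.card_fin, ← Nat.card_eq_fintype_card]; exact Nat.lt_succ_self _)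
    rcases lt_or_gt_of_ne hab with h | h
    · exact ⟨(a, b), h, hc⟩
    · exact ⟨(b, a), h, hc.symm⟩
  choose ab hab1 hab2 using hpig
  obtain ⟨⟨⟨a, b⟩, S3⟩, hfib⟩ := Finite.exists_infinite_fiber
    (fun t => (ab t, col V (pt2 x l i (v t) (p t (ab t).1))))
  set T : Set ℕ := (fun t => (ab t, col V (pt2 x l i (v t) (p t (ab t).1)))) ⁻¹' {((a, b), S3)} with hT
  have hTinf : T.Infinite := Set.infinite_coe_iff.1 hfib
  have hTab : ∀ t ∈ T, ab t = (a, b) ∧ col V (pt2 x l i (v t) (p t a)) = S3 ∧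
      col V (pt2 x l i (v t) (p t b)) = S3 := by
    intro t ht
    simp only [hT, Set.mem_preimage, Set.mem_singleton_iff, Prod.mk.injEq] at ht
    have h2 := hab2 t
    obtain ⟨h1, h3⟩ := ht
    rw [h1] at h2 h3
    exact ⟨h1, h3, h2.symm.trans h3⟩
  let nt : ℕ → ℕ := Nat.nth (· ∈ T)
  have hntT : ∀ r, nt r ∈ T := fun r => Nat.nth_mem_of_infinite hTinf r
  have hntm : StrictMono nt := Nat.nth_strictMono hTinf
  have hlt : a < b := by
    have := hab1 (nt 0)
    rwa [(hTab _ (hntT 0)).1] at this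
  obtain ⟨dx, hdx⟩ := hF.s2 (a := cc a) (p := d0) (r := d1) (b := cc b) (q := d0)
    (hF.m1 d0 (cc.strictMono hlt)).le
    ((hF.m1 d0 (hcc b).2).le.trans (hlt2.le.trans (hF.m1 d1 (hcc a).1).le))
  have hdx0 : d0 ≤ dx := (hF.m2 (cc a)).le_iff_le.1 (by
    rw [hdx]; exact (hF.m1 d0 (cc.strictMono hlt)).le)
  have hdx1 : dx ≤ d1 := (hF.m2 (cc a)).le_iff_le.1 (by
    rw [hdx]; exact (hF.m1 d0 (hcc b).2).le.trans (hlt2.le.trans (hF.m1 d1 (hcc a).1).le))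
  have hcell1 : ∀ a d, d0 ≤ d → d ≤ d1 → pt2 x l i (cc a) d ∈ Cell V S1 := fun a d h1 h2 =>
    M.mem_cell (hS1 _ _ (hcc a).1.le ((hcc a).2.le.trans hc21) h1 h2)
  have hcellS : ∀ a' e', i0 ≤ a' → a' ≤ i1 → e0 ≤ e' → e' ≤ e1 → pt2 z i m a' e' ∈ Cell V S :=
    fun a' e' h1 h2 h3 h4 => M.mem_cell (htame _ _ h1 h2 h3 h4)
  have hordS1 : Ord S1 := by
    rw [← hS1 c0 d0 le_rfl hc01.le le_rfl hd01.le]; exact M.ord _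
  have hordS3 : Ord S3 := by
    rw [← (hTab _ (hntT 0)).2.1]; exact M.ord _
  have hordS : Ord S := by
    rw [← htame (p 0 a) e0 (hpi0 _ _) (hpi1 _ _) le_rfl he.le]; exact M.ord _
  -- transfer of comparisons between the steps
  have htrans : ∀ t ∈ T, ∀ t' ∈ T, ∀ e' f', e0 ≤ e' → e' ≤ e1 → e0 ≤ f' → f' ≤ e1 →
      V (pt2 z i m (p t b) f') ≤ V (pt2 z i m (p t a) e') →
      V (pt2 z i m (p t' b) f') ≤ V (pt2 z i m (p t' a) e') := by
    intro t ht t' ht' e' f' h1 h2 h3 h4 hle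
    have hc3 : ∀ t ∈ T, pt2 x l i (v t) (p t a) ∈ Cell V S3 ∧ pt2 x l i (v t) (p t b) ∈ Cell V S3 :=
      fun t ht => ⟨M.mem_cell (hTab t ht).2.1, M.mem_cell (hTab t ht).2.2⟩
    -- A5 with the reference increment from `cc a` to `cc b` in both trade-offs: the intervals from
    -- `p t a` to `p t b` are matched with it at the same two levels for all `t`, so they compare
    -- alike with increments on `m`.
    have key := M.inter hl (a := cc a) (b := cc b) (c := cc a) (d := cc b) (p := p t a) (q := p t b)
      (r := p t' a) (s := p t' b) (x := pt2 x l i (cc a) dx) (y := pt2 x l i (cc a) d0)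
      (y0 := pt2 x l i (cc a) d0) (y1 := pt2 x l i (cc a) d0) (x0 := pt2 x l i (v t) (p t a))
      (x1 := pt2 x l i (v t') (p t a)) (e := pt2 z i m (p t a) e') (f := pt2 z i m (p t a) f')
      hordS1 hordS1 hordS3 hordS
    simp only [update_pt2_left _ hl, update_pt2_right, update_pt2_left _ him] at key
    have hess1 : Ess S1 l := M.ess (x := pt2 x l i (cc a) d0) (cc.strictMono hlt).ne
      (by rw [update_pt2_left _ hl]; exact hcell1 _ _ le_rfl hd01.le)
      (by rw [update_pt2_left _ hl]; exact hcell1 _ _ le_rfl hd01.le)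
    have hess3 : Ess S3 i := M.ess (x := pt2 x l i (v t) (p t a)) (hpab t a b hlt).ne
      (by rw [update_pt2_right]; exact (hc3 t ht).1) (by rw [update_pt2_right]; exact (hc3 t ht).2)
    exact key (hcell1 _ _ hdx0 hdx1) (hcell1 _ _ le_rfl hd01.le) (hcell1 _ _ hdx0 hdx1)
      (hcell1 _ _ le_rfl hd01.le) hess1 (hcell1 _ _ le_rfl hd01.le) (hcell1 _ _ le_rfl hd01.le)
      (hcell1 _ _ le_rfl hd01.le) (hcell1 _ _ le_rfl hd01.le) (hc3 t ht).1 (hc3 t ht).2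
      (hc3 t' ht').1 (hc3 t' ht').2 hess3 (hcellS _ _ (hpi0 _ _) (hpi1 _ _) h1 h2)
      (hcellS _ _ (hpi0 _ _) (hpi1 _ _) h3 h4) (hcellS _ _ (hpi0 _ _) (hpi1 _ _) h1 h2)
      (hcellS _ _ (hpi0 _ _) (hpi1 _ _) h3 h4) hdx.le hdx.ge (hp t a).symm (hp t b).symm
      (hp t' a).symm (hp t' b).symm hle
  have := M.dense m
  obtain ⟨e', he'1, he'2, he'3⟩ := hG.up2 (hG.m1 e0 (hpab (nt 0) a b hlt)) he
  -- One increment of `m`, chosen for the first selected stair, is dominated by all selected stairs.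
  have hstep : ∀ r, V (pt2 z i m (p (nt r) a) e') < V (pt2 z i m (p (nt r) b) e0) := fun r =>
    not_le.1 fun h => he'3.not_ge (htrans _ (hntT r) _ (hntT 0) _ _ he'1.le he'2 le_rfl he.le h)
  obtain ⟨N, h, hh0, hh1, hh2, hh3⟩ := hG.exists_steps he'1 (hpi1 (nt 0) a) (by
    rintro ⟨h, hh0, hh1, hh2⟩
    have hge : ∀ t, p (nt 0) a ≤ h t := by
      intro t
      induction t with
      | zero => exact hh0.ge
      | succ t ih =>
        refine ih.trans ((hG.m1 e0).le_iff_le.1 ?_)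
        rw [hh2]
        exact (hG.m2 _ he'1).le
    exact M.arch (S := S) (i := i) (l := m) (z := z) (y0 := e0) (y1 := e') (g := h)
      (lo := p (nt 0) a) (hi := i1) hordS him.symm he'1.ne (fun t => ⟨hge t, hh1 t⟩)
      (fun t => hcellS _ _ ((hpi0 _ _).trans (hge t)) (hh1 t) he'1.le he'2)
      (fun t => hcellS _ _ ((hpi0 _ _).trans (hge _)) (hh1 _) le_rfl he.le) (fun t => (hh2 t).symm))
  -- The standard sequence with that increment climbs at most one stair per step and so stays below
  -- `i1`, although by the Archimedean property it has to overshoot `i1`.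
  have hle : ∀ t ≤ N, h t ≤ p (nt t) a := by
    intro t ht
    induction t with
    | zero => exact hh0.le
    | succ t ih =>
      refine (hG.m1 e0).le_iff_le.1 ?_
      rw [hh1 t (by omega)]
      refine ((hG.m1 e').monotone (ih (by omega))).trans ((hstep t).le.trans ((hG.m1 e0).monotone ?_))
      have hw : ∀ r s, r < s → w' r ≤ w s := by
        intro r s hrs
        induction s with
        | zero => omega
        | succ s ih =>
          rcases Nat.lt_succ_iff_lt_or_eq.1 hrs with h' | h'
          · exact (ih h').trans ((hst s).2.1.le.trans (hst s).2.2.1)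
          · subst h'; exact (hst r).2.2.1
      exact (hp2 _ _).le.trans ((hw _ _ (hntm (Nat.lt_succ_self t))).trans (hp1 _ _).le)
  refine hh3.not_ge (((hG.m1 e').monotone (hle N le_rfl)).trans ((hstep N).le.trans
    ((hG.m1 e0).monotone (hpi1 _ _))))

end Model
end Conjoint

/-! ### Compensation by another coordinate, and intervals without staircases -/

namespace Conjoint

universe u

variable {n : ℕ} {Y : Fin n → Type u} {L : Type*}

theorem pt2_rotate (x : ∀ k, Y k) {a b k : Fin n} (hab : a ≠ b) (hak : a ≠ k) (hbk : b ≠ k)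
    (u : Y a) (P : Y b) (w : Y k) :
    pt2 (Function.update x k w) a b u P = pt2 (Function.update x b P) a k u w := by
  simp only [pt2]
  rw [Function.update_comm hak.symm, Function.update_comm hab.symm, Function.update_comm hbk.symm]

variable [LinearOrder L]

theorem StrictFail.reflect {α β : Type*} {F : α → β → L} {a b c d : α} {P Q R S : β}
    (h : StrictFail F a b c d P Q R S) : StrictFail F d c b a Q P S R :=
  ⟨h.2.2.1, h.2.2.2, h.1, h.2.1⟩

/-- Used to assume, after `StrictFail.reflect`, that both increments of the first coordinate are
increases. -/
theorem StrictFail.lt {α β : Type*} [LinearOrder α] [LinearOrder β] {F : α → β → L} (hF : Plane F)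
    {a b c d : α} {P Q R S : β} (h : StrictFail F a b c d P Q R S) :
    (a < b ∧ c < d) ∨ (d < c ∧ b < a) := by
  obtain ⟨h1, h2, h3, h4⟩ := h
  rcases lt_trichotomy a b with hab | hab | hab
  · have hSR : S < R := (hF.m2 b).lt_iff_lt.1 (h2.trans (hF.m1 R hab))
    refine Or.inl ⟨hab, ?_⟩
    by_contra hcd
    exact (h4.trans_le ((hF.m1 S).monotone (not_lt.1 hcd))).not_gt (hF.m2 c hSR)
  · subst hab
    have hSR : S < R := (hF.m2 a).lt_iff_lt.1 h2
    have hPQ : P < Q := (hF.m2 a).lt_iff_lt.1 h1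
    have h5 : c < d := by
      by_contra hcd
      exact (h4.trans_le ((hF.m1 S).monotone (not_lt.1 hcd))).not_gt (hF.m2 c hSR)
    exact absurd (h3.trans (hF.m2 c hPQ)) (hF.m1 Q h5).not_gt
  · have hPQ : P < Q := (hF.m2 a).lt_iff_lt.1 (h1.trans (hF.m1 Q hab))
    refine Or.inr ⟨?_, hab⟩
    by_contra hcd
    exact (h3.trans (hF.m2 c hPQ)).not_ge ((hF.m1 Q).monotone (not_lt.1 hcd))

/-- If increments of the first coordinate can be compensated on a third coordinate, triple
cancellation holds. -/
theorem not_strictFail_of_compensate {α β γ : Type*} [LinearOrder α] [LinearOrder β] [LinearOrder γ]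
    {G : α → β → γ → L} (m3 : ∀ u P, StrictMono (G u P)) {w : γ} (hF : Plane fun u P => G u P w)
    {U : Set γ} (hw : w ∈ U)
    (hinv : ∀ u u' P P' w w', w ∈ U → w' ∈ U → G u P w < G u P' w' → G u' P w < G u' P' w') {m : α}
    (hcomp : ∀ u u', u < u' → u' ≤ m → ∃ w1 ∈ U, ∀ P, G u' P w = G u P w1) {a b c d : α}
    {P Q R S : β} (ha : a ≤ m) (hb : b ≤ m) (hc : c ≤ m) (hd : d ≤ m) :
    ¬ StrictFail (fun u P => G u P w) a b c d P Q R S := by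
  intro h
  wlog hlt : a < b ∧ c < d generalizing a b c d P Q R S
  · exact this hd hc hb ha h.reflect ((h.lt hF).resolve_left hlt)
  obtain ⟨h1, h2, h3, h4⟩ := h
  -- The increments from `a` to `b` and from `c` to `d` become increments from `w` to `w1` and from
  -- `w` to `w2`. Moved to the common element `c`, the four comparisons imply both `w2 < w1` and `w1
  -- < w2`.
  obtain ⟨w1, hw1, e1⟩ := hcomp a b hlt.1 hb
  obtain ⟨w2, hw2, e2⟩ := hcomp c d hlt.2 hd
  simp only [e1] at h1 h2
  simp only [e2] at h3 h4
  have h1' := h3.trans (hinv _ c _ _ _ _ hw hw1 h1)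
  have h2' := (hinv _ c _ _ _ _ hw1 hw h2).trans h4
  exact ((m3 _ _).lt_iff_lt.1 h1').not_gt ((m3 _ _).lt_iff_lt.1 h2')

variable [∀ k, LinearOrder (Y k)] {V : (∀ k, Y k) → L} {Ord : (Fin n → Fin n → Prop) → Prop}
  {Ess : (Fin n → Fin n → Prop) → Fin n → Prop}

/-- A staircase over the union either stays below `b` or has a tail above `b`. -/
theorem NoStair.concat {i : Fin n} {a b c : Y i} (h1 : NoStair V i a b) (h2 : NoStair V i b c) :
    NoStair V i a c := by
  rintro l x hl ⟨v, w, w', lam, lam', h⟩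
  by_cases hb : ∀ t, w' t ≤ b
  · exact h1 l x hl ⟨v, w, w', lam, lam', fun t => ⟨(h t).1, (h t).2.1, (h t).2.2.1, hb t, (h t).2.2.2.2⟩⟩
  · push Not at hb
    obtain ⟨t, ht⟩ := hb
    have hge : ∀ s, b ≤ w (t + 1 + s) := by
      intro s
      induction s with
      | zero => exact ht.le.trans (h t).2.2.1
      | succ s ih => exact ih.trans ((h _).2.1.le.trans (h _).2.2.1)
    exact h2 l x hl ⟨fun s => v (t + 1 + s), fun s => w (t + 1 + s), fun s => w' (t + 1 + s), lam, lam',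
      fun s => ⟨hge s, (h _).2.1, (h _).2.2.1, (h _).2.2.2.1, (h _).2.2.2.2⟩⟩

theorem NoStair.mono {i : Fin n} {a b c d : Y i} (h : NoStair V i a b) (h1 : a ≤ c) (h2 : d ≤ b) :
    NoStair V i c d := by
  rintro l x hl ⟨v, w, w', lam, lam', h'⟩
  exact h l x hl ⟨v, w, w', lam, lam', fun t => ⟨h1.trans (h' t).1, (h' t).2.1, (h' t).2.2.1,
    (h' t).2.2.2.1.trans h2, (h' t).2.2.2.2⟩⟩

namespace Model

/-- Each element of `[g, g']`, with `i` at `y0`, is matched by an element of `[y0, y1]`, with `k` at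
`g`. With `i` fixed at `y0`, a staircase over `[g, g']` would thus be copied to one over `[y0, y1]`;
`plane_le_iff` extends this to all values of `i`. -/
theorem not_stair_of_small (M : Model V Ord Ess) {i k l : Fin n} (hik : i ≠ k) (hli : l ≠ i)
    (hlk : l ≠ k) {y0 y1 : Y i} (hns : NoStair V i y0 y1) {g g' : Y k}
    {X : ∀ k, Y k} (hsm : V (pt2 X k i g' y0) ≤ V (pt2 X k i g y1)) (x : ∀ k, Y k) :
    ¬ Stair (fun v w => V (pt2 x l k v w)) g g' := by
  have hinv := M.planeInv hns hik.symm
  have hK := M.plane hik.symm X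
  have hL := fun x => M.plane hik.symm x
  -- staircases at the base value of the transverse coordinate
  have hbase : ¬ Stair (fun v w => V (pt2 (Function.update x i y0) l k v w)) g g' := by
    rintro ⟨v, w, w', lam, lam', h⟩
    have hY : ∀ r, g ≤ r → r ≤ g' → ∃ y, V (pt2 X k i g y) = V (pt2 X k i r y0) := fun r h1 h2 =>
      hK.s2 ((hK.m1 y0).monotone h1) (((hK.m1 y0).monotone h2).trans hsm)
    have hw0 : ∀ t, g ≤ w t ∧ w t ≤ g' := fun t => ⟨(h t).1, (h t).2.1.le.trans (h t).2.2.2.1⟩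
    have hw1 : ∀ t, g ≤ w' t ∧ w' t ≤ g' := fun t => ⟨(h t).1.trans (h t).2.1.le, (h t).2.2.2.1⟩
    have hgg : g ≤ g' := (hw0 0).1.trans (hw0 0).2
    have hy01 : y0 ≤ y1 := (hK.m2 g).le_iff_le.1 (((hK.m1 y0).monotone hgg).trans hsm)
    have : Nonempty (Y i) := ⟨y0⟩
    choose! Yf hYf using hY
    have hYmem : ∀ r, g ≤ r → r ≤ g' → Yf r ∈ Set.Icc y0 y1 := fun r h1 h2 =>
      ⟨(hK.m2 g).le_iff_le.1 (by rw [hYf r h1 h2]; exact (hK.m1 y0).monotone h1),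
        (hK.m2 g).le_iff_le.1 (by rw [hYf r h1 h2]; exact ((hK.m1 y0).monotone h2).trans hsm)⟩
    have hYlt : ∀ r s, g ≤ r → r < s → s ≤ g' → Yf r < Yf s := fun r s h1 h2 h3 =>
      (hK.m2 g).lt_iff_lt.1 (by
        rw [hYf r h1 (h2.le.trans h3), hYf s (h1.trans h2.le) h3]; exact hK.m1 y0 h2)
    have hval : ∀ r v, g ≤ r → r ≤ g' → V (pt2 (Function.update x k g) l i v (Yf r)) =
        V (pt2 (Function.update x i y0) l k v r) := fun r v h1 h2 => by
      have := hinv.eq (x' := Function.update x l v) (hYmem r h1 h2) ⟨le_rfl, hy01⟩ (hYf r h1 h2)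
      rw [pt2_rotate x hli hlk hik, pt2_comm _ hlk, pt2_rotate x hlk.symm hik.symm hli,
        pt2_comm _ hlk, pt2_rotate x hlk.symm hik.symm hli]
      exact this
    refine hns l (Function.update x k g) hli ⟨v, fun t => Yf (w t), fun t => Yf (w' t), lam, lam',
      fun t => ⟨(hYmem _ (hw0 t).1 (hw0 t).2).1, hYlt _ _ (hw0 t).1 (h t).2.1 (hw1 t).2, ?_,
        (hYmem _ (hw1 t).1 (hw1 t).2).2, ?_, ?_⟩⟩
    · rcases (h t).2.2.1.lt_or_eq with h' | h'
      · exact (hYlt _ _ (hw1 t).1 h' (hw0 _).2).le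
      · exact le_of_eq (congrArg Yf h')
    · exact (hval _ _ (hw0 t).1 (hw0 t).2).trans (h t).2.2.2.2.1
    · exact (hval _ _ (hw1 t).1 (hw1 t).2).trans (h t).2.2.2.2.2
  rintro ⟨v, w, w', lam, lam', h⟩
  have hmem0 : ∀ t, w t ∈ Set.Icc g g' := fun t => ⟨(h t).1, (h t).2.1.le.trans (h t).2.2.2.1⟩
  have hmem1 : ∀ t, w' t ∈ Set.Icc g g' := fun t => ⟨(h t).1.trans (h t).2.1.le, (h t).2.2.2.1⟩
  have key : ∀ {a b : Y l} {r s : Y k}, r ∈ Set.Icc g g' → s ∈ Set.Icc g g' →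
      V (pt2 x l k a r) = V (pt2 x l k b s) → V (pt2 (Function.update x i y0) l k a r) =
      V (pt2 (Function.update x i y0) l k b s) := by
    intro a b r s hr hs he
    have e1 := M.plane_le_iff hlk hli.symm hik x (x i) y0 hbase (a := a) (b := b) hr hs
    have e2 := M.plane_le_iff hlk hli.symm hik x (x i) y0 hbase (a := b) (b := a) hs hr
    rw [Function.update_eq_self] at e1 e2
    exact le_antisymm (e1.1 he.le) (e2.1 he.ge)
  refine hbase ⟨v, w, w', V (pt2 (Function.update x i y0) l k (v 0) (w 0)),
    V (pt2 (Function.update x i y0) l k (v 0) (w' 0)), fun t => ⟨(h t).1, (h t).2.1, (h t).2.2.1, (h t).2.2.2.1,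
    key (hmem0 t) (hmem0 0) ?_, key (hmem1 t) (hmem1 0) ?_⟩⟩
  · exact (h t).2.2.2.2.1.trans (h 0).2.2.2.2.1.symm
  · exact (h t).2.2.2.2.2.trans (h 0).2.2.2.2.2.symm

/-- The measuring coordinate must lie outside the plane considered, so two of them are needed
besides `k`. This is where a third coordinate enters. -/
theorem noStair_of_small (M : Model V Ord Ess) {i b k : Fin n} (hik : i ≠ k) (hbk : b ≠ k)
    (hib : i ≠ b) {y0 y1 : Y i} (hns : NoStair V i y0 y1) {b0 b1 : Y b} (hns' : NoStair V b b0 b1)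
    {g g' : Y k} {X X' : ∀ k, Y k} (hsm : V (pt2 X k i g' y0) ≤ V (pt2 X k i g y1))
    (hsm' : V (pt2 X' k b g' b0) ≤ V (pt2 X' k b g b1)) : NoStair V k g g' := by
  intro l x hl
  by_cases hli : l = i
  · subst hli; exact M.not_stair_of_small hbk hib hl hns' hsm' x
  · exact M.not_stair_of_small hik hli hl hns hsm x

end Model
end Conjoint

/-! ### Step sequences are unbounded -/

namespace Conjoint

universe u

variable {n : ℕ} {Y : Fin n → Type u} {L : Type*} [LinearOrder L]
variable [∀ k, LinearOrder (Y k)] {V : (∀ k, Y k) → L} {Ord : (Fin n → Fin n → Prop) → Prop}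
  {Ess : (Fin n → Fin n → Prop) → Fin n → Prop}

/-- A sequence on coordinate `k` each of whose steps is matched by a fixed step on some other
coordinate, which may be chosen different from any given coordinate, and such that the orders of
the planes containing `k` do not depend on the other coordinates over the range of the sequence. -/
structure StepSeq (V : (∀ k, Y k) → L) (k : Fin n) (h : ℕ → Y k) : Prop where
  mono : StrictMono h
  inv : ∀ l, l ≠ k → PlaneInv V l k {w | ∃ t, h 0 ≤ w ∧ w ≤ h t}
  step : ∀ a, ∃ (c : Fin n) (c0 c1 : Y c), c ≠ a ∧ c ≠ k ∧
    ∀ (x : ∀ k, Y k) (t : ℕ), V (pt2 x k c (h (t + 1)) c0) = V (pt2 x k c (h t) c1)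

namespace StepSeq

variable {k : Fin n} {h : ℕ → Y k}

theorem mem (hs : StepSeq V k h) (t : ℕ) : h t ∈ {w | ∃ t, h 0 ≤ w ∧ w ≤ h t} :=
  ⟨t, hs.mono.monotone (Nat.zero_le t), le_rfl⟩

/-- Passing between `c1` and `c0` on the auxiliary coordinate has the effect of one step of the
sequence, and the order of the plane of `a` and `k` is insensitive to that coordinate. -/
theorem shift (hs : StepSeq V k h) {a : Fin n} (hak : a ≠ k) {x : ∀ k, Y k} {e e' : Y a} {s s' : ℕ}
    (hle : V (pt2 x a k e (h s)) ≤ V (pt2 x a k e' (h s'))) :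
    V (pt2 x a k e (h (s + 1))) ≤ V (pt2 x a k e' (h (s' + 1))) := by
  obtain ⟨c, c0, c1, hca, hck, hst⟩ := hs.step a
  have key : ∀ e t, V (pt2 (Function.update x c c0) a k e (h (t + 1))) =
      V (pt2 (Function.update x c c1) a k e (h t)) := fun e t => by
    rw [pt2_comm _ hak, pt2_rotate x hak.symm hck.symm hca.symm, pt2_comm _ hak,
      pt2_rotate x hak.symm hck.symm hca.symm]
    exact hst _ t
  refine hs.inv a hak (Function.update x c c0) x _ _ _ _ (hs.mem _) (hs.mem _) ?_
  rw [key, key]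
  exact hs.inv a hak _ _ _ _ _ _ (hs.mem _) (hs.mem _) hle

theorem shift_add (hs : StepSeq V k h) {a : Fin n} (hak : a ≠ k) {x : ∀ k, Y k} {e e' : Y a}
    {s s' : ℕ} (r : ℕ) (hle : V (pt2 x a k e (h s)) ≤ V (pt2 x a k e' (h s'))) :
    V (pt2 x a k e (h (s + r))) ≤ V (pt2 x a k e' (h (s' + r))) := by
  induction r with
  | zero => exact hle
  | succ r ih => exact hs.shift hak ih

/-- Below a value from which all lower values can be reached within boundedly many steps, the
relation `a S b` does not occur. -/
theorem not_brk (hs : StepSeq V k h) (M : Model V Ord Ess) {a b : Fin n} (hab : a ≠ b) (hak : a ≠ k)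
    (hbk : b ≠ k) {x0 : ∀ k, Y k} {ea : Y a} {t : ℕ}
    (hea : ∀ e, V (pt2 x0 a k ea (h 0)) ≤ V (pt2 x0 a k e (h t))) {x : ∀ k, Y k} (hx : x a ≤ ea)
    {w : Y k} (hw : w ∈ {w | ∃ t, h 0 ≤ w ∧ w ≤ h t}) : ¬ Brk V (Function.update x k w) a b := by
  rintro ⟨α, β, γ, δ, P, Q, R, S, hf, h1, -⟩
  rw [Function.update_of_ne hak] at h1
  simp only [Set.mem_insert_iff, Set.mem_singleton_iff, forall_eq_or_imp, forall_eq] at h1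
  have e1 : ∀ u P w, pt2 (Function.update x k w) a b u P = pt2 (Function.update x b P) a k u w :=
    fun u P w => pt2_rotate x hab hak hbk u P w
  have e2 : ∀ u P w, pt2 (Function.update x k w) a b u P = pt2 (Function.update x a u) b k P w :=
    fun u P w => by rw [pt2_comm _ hab, pt2_rotate x hab.symm hbk hak]
  refine not_strictFail_of_compensate (G := fun u P w => V (pt2 (Function.update x k w) a b u P))
    (fun u P => ?_) (w := w) (M.plane hab _) hw ?_ (m := ea) ?_ (h1.1.le.trans hx) (h1.2.1.le.trans hx)
    (h1.2.2.1.le.trans hx) (h1.2.2.2.le.trans hx) hf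
  · simp only [e1]
    exact (M.plane hak _).m2 u
  · intro u u' P P' w w' hw hw' hlt
    simp only [e2] at hlt ⊢
    exact (hs.inv b hbk).lt hw hw' hlt
  -- The bound `hea`, shifted along the sequence, leaves room on `k` to compensate any increase that
  -- ends at or below `ea`.
  · intro u u' huu hu'
    obtain ⟨s, hs0, hs1⟩ := id hw
    have hF := M.plane hak x0
    have h2 : V (pt2 x0 a k u' w) ≤ V (pt2 x0 a k u (h (t + s))) :=
      (((hF.m1 w).monotone hu').trans ((hF.m2 ea).monotone hs1)).trans (by
        have := hs.shift_add hak s (hea u)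
        rwa [Nat.zero_add] at this)
    obtain ⟨w1, hw1⟩ := hF.s2 (hF.m1 w huu).le h2
    have hmem : w1 ∈ {w | ∃ t, h 0 ≤ w ∧ w ≤ h t} := ⟨t + s,
      hs0.trans ((hF.m2 u).le_iff_le.1 (by rw [hw1]; exact (hF.m1 w huu).le)),
      (hF.m2 u).le_iff_le.1 (by rwa [hw1])⟩
    refine ⟨w1, hmem, fun P => ?_⟩
    simp only [e1]
    exact ((hs.inv a hak).eq hmem hw hw1).symm

/-- Otherwise, the relation `a S b` is preserved upwards. -/
theorem brk_up (hs : StepSeq V k h) (M : Model V Ord Ess) {a b : Fin n} (hab : a ≠ b) (hak : a ≠ k)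
    (hbk : b ≠ k) {x0 : ∀ k, Y k}
    (hea : ∀ ea t, ∃ e, V (pt2 x0 a k e (h t)) < V (pt2 x0 a k ea (h 0))) {x : ∀ k, Y k}
    {w w' : Y k} (hw : w ∈ {w | ∃ t, h 0 ≤ w ∧ w ≤ h t}) (hw' : w' ∈ {w | ∃ t, h 0 ≤ w ∧ w ≤ h t})
    (hww : w ≤ w') (hb : Brk V (Function.update x k w) a b) :
    Brk V (Function.update x k w') a b := by
  have e1 : ∀ u P w, pt2 (Function.update x k w) a b u P = pt2 (Function.update x b P) a k u w :=
    fun u P w => pt2_rotate x hab hak hbk u P w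
  have hF := M.plane hak x0
  -- Raising `k` from `w` to `w'` is undone by lowering the element of `a`, which keeps a violation
  -- below the base point.
  have hsh : ∀ u, ∃ u', u' ≤ u ∧ ∀ P, V (pt2 (Function.update x k w') a b u' P) =
      V (pt2 (Function.update x k w) a b u P) := by
    intro u
    obtain ⟨t, ht0, ht1⟩ := id hw'
    obtain ⟨e, he⟩ := hea u t
    have h1 : V (pt2 x0 a k e w') ≤ V (pt2 x0 a k u w) :=
      ((hF.m2 e).monotone ht1).trans (he.le.trans ((hF.m2 u).monotone (hw.elim fun _ h => h.1)))
    obtain ⟨u', hu'⟩ := hF.s1 h1 ((hF.m2 u).monotone hww)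
    refine ⟨u', (hF.m1 w').le_iff_le.1 (by rw [hu']; exact (hF.m2 u).monotone hww), fun P => ?_⟩
    simp only [e1]
    exact (hs.inv a hak).eq hw' hw hu'
  choose sh hsh1 hsh2 using hsh
  obtain ⟨α, β, γ, δ, P, Q, R, S, ⟨f1, f2, f3, f4⟩, h1, h2⟩ := hb
  rw [Function.update_of_ne hak] at h1
  rw [Function.update_of_ne hbk] at h2
  simp only [Set.mem_insert_iff, Set.mem_singleton_iff, forall_eq_or_imp, forall_eq] at h1
  refine ⟨sh α, sh β, sh γ, sh δ, P, Q, R, S, ⟨?_, ?_, ?_, ?_⟩, ?_, ?_⟩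
  · simp only [hsh2]; exact f1
  · simp only [hsh2]; exact f2
  · simp only [hsh2]; exact f3
  · simp only [hsh2]; exact f4
  · rw [Function.update_of_ne hak]
    simp only [Set.mem_insert_iff, Set.mem_singleton_iff, forall_eq_or_imp, forall_eq]
    exact ⟨(hsh1 _).trans_lt h1.1, (hsh1 _).trans_lt h1.2.1, (hsh1 _).trans_lt h1.2.2.1,
      (hsh1 _).trans_lt h1.2.2.2⟩
  · rw [Function.update_of_ne hbk]; exact h2

/-- Raising the base point on `k` weakens the condition that a violation lie below it. In
`brk_down_self` the violation lies above, and lowering the base point weakens the condition. -/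
theorem brk_up_self {q : Fin n} (hkq : k ≠ q) {x : ∀ k, Y k} {w w' : Y k} (hww : w ≤ w')
    (hb : Brk V (Function.update x k w) k q) : Brk V (Function.update x k w') k q := by
  obtain ⟨α, β, γ, δ, P, Q, R, S, hf, h1, h2⟩ := hb
  refine ⟨α, β, γ, δ, P, Q, R, S, ?_, fun u hu => ?_, ?_⟩
  · simpa only [pt2_update_left] using hf
  · have := h1 u hu
    rw [Function.update_self] at this ⊢
    exact this.trans_le hww
  · rwa [Function.update_of_ne hkq.symm] at h2 ⊢

theorem brk_down_self {p : Fin n} (hkp : p ≠ k) {x : ∀ k, Y k} {w w' : Y k} (hww : w ≤ w')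
    (hb : Brk V (Function.update x k w') p k) : Brk V (Function.update x k w) p k := by
  obtain ⟨α, β, γ, δ, P, Q, R, S, hf, h1, h2⟩ := hb
  refine ⟨α, β, γ, δ, P, Q, R, S, ?_, ?_, fun u hu => ?_⟩
  · simpa only [pt2_update_right _ hkp] using hf
  · rwa [Function.update_of_ne hkp] at h1 ⊢
  · have := h2 u hu
    rw [Function.update_self] at this ⊢
    exact hww.trans_lt this

/-- Along the sequence the colour is eventually constant, if the base point is low enough. -/
theorem exists_low (hs : StepSeq V k h) (M : Model V Ord Ess) :
    ∃ e : ∀ k, Y k, ∀ x : ∀ k, Y k, (∀ a, a ≠ k → x a ≤ e a) → ∃ T, ∀ w, h T ≤ w → (∃ t, w ≤ h t) →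
      col V (Function.update x k w) = col V (Function.update x k (h T)) := by
  classical
  have hne : ∀ k, Nonempty (Y k) := M.nonempty
  let x0 : ∀ k, Y k := fun k => (hne k).some
  -- Either finitely many steps outweigh any descent from some `ea`, and then no violation with `a`
  -- in the first place occurs below it (`not_brk`), or descents on `a` can undo any number of
  -- steps, and violations spread upwards along the sequence (`brk_up`).
  have hex : ∀ a, ∃ ea : Y a, (∃ t, ∀ e, V (pt2 x0 a k ea (h 0)) ≤ V (pt2 x0 a k e (h t))) ∨
      ∀ ea t, ∃ e, V (pt2 x0 a k e (h t)) < V (pt2 x0 a k ea (h 0)) := by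
    intro a
    by_cases hT : ∃ ea t, ∀ e, V (pt2 x0 a k ea (h 0)) ≤ V (pt2 x0 a k e (h t))
    · obtain ⟨ea, ht⟩ := hT
      exact ⟨ea, Or.inl ht⟩
    · push Not at hT
      exact ⟨x0 a, Or.inr hT⟩
  choose e he using hex
  refine ⟨e, fun x hx => ?_⟩
  let U : Set (Y k) := {w | ∃ t, h 0 ≤ w ∧ w ≤ h t}
  -- eventual constancy of a single relation
  have hev : ∀ pq : Fin n × Fin n, ∃ T, ∀ w, h T ≤ w → w ∈ U →
      (col V (Function.update x k w) pq.1 pq.2 ↔ col V (Function.update x k (h T)) pq.1 pq.2) := by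
    rintro ⟨a, b⟩
    have hup : (∀ w w', w ∈ U → w' ∈ U → w ≤ w' → col V (Function.update x k w) a b →
        col V (Function.update x k w') a b) → ∃ T, ∀ w, h T ≤ w → w ∈ U →
        (col V (Function.update x k w) a b ↔ col V (Function.update x k (h T)) a b) := by
      intro hm
      by_cases hc : ∃ t, col V (Function.update x k (h t)) a b
      · obtain ⟨t, ht⟩ := hc
        exact ⟨t, fun w hw hU => iff_of_true (hm _ _ (hs.mem t) hU hw ht) ht⟩
      · push Not at hc
        refine ⟨0, fun w hw hU => iff_of_false (fun hcw => ?_) (hc 0)⟩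
        obtain ⟨t, -, ht⟩ := id hU
        exact hc t (hm _ _ hU (hs.mem t) ht hcw)
    have hdn : (∀ w w', w ∈ U → w' ∈ U → w ≤ w' → col V (Function.update x k w') a b →
        col V (Function.update x k w) a b) → ∃ T, ∀ w, h T ≤ w → w ∈ U →
        (col V (Function.update x k w) a b ↔ col V (Function.update x k (h T)) a b) := by
      intro hm
      by_cases hc : ∃ t, ¬ col V (Function.update x k (h t)) a b
      · obtain ⟨t, ht⟩ := hc
        exact ⟨t, fun w hw hU => iff_of_false (fun hcw => ht (hm _ _ (hs.mem t) hU hw hcw)) ht⟩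
      · push Not at hc
        refine ⟨0, fun w hw hU => iff_of_true ?_ (hc 0)⟩
        obtain ⟨t, -, ht⟩ := id hU
        exact hm _ _ hU (hs.mem t) ht (hc t)
    by_cases hab : a = b
    · exact hup fun _ _ _ _ _ hc => absurd hab hc.1
    by_cases hak : a = k
    · subst hak
      exact hup fun w w' _ _ hww hc => ⟨hab, brk_up_self hab hww hc.2⟩
    by_cases hbk : b = k
    · subst hbk
      exact hdn fun w w' _ _ hww hc => ⟨hab, brk_down_self hab hww hc.2⟩
    rcases he a with ⟨t, ht⟩ | hn
    · exact hup fun w w' hw _ _ hc => absurd hc.2 (hs.not_brk M hab hak hbk ht (hx a hak) hw)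
    · exact hup fun w w' hw hw' hww hc => ⟨hab, hs.brk_up M hab hak hbk hn hw hw' hww hc.2⟩
  choose T hT using hev
  obtain ⟨T0, hT0⟩ := Finite.exists_le T
  refine ⟨T0, fun w hw ⟨t, ht⟩ => ?_⟩
  funext a b
  have h1 : h (T (a, b)) ≤ h T0 := hs.mono.monotone (hT0 _)
  have hU : w ∈ U := ⟨t, (hs.mono.monotone (Nat.zero_le _)).trans hw, ht⟩
  exact propext ((hT (a, b) w (h1.trans hw) hU).trans (hT (a, b) (h T0) h1 (hs.mem _)).symm)

/-- Such a sequence is unbounded. -/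
theorem not_bounded (hs : StepSeq V k h) (M : Model V Ord Ess) {i : Fin n} (hik : i ≠ k) {H : Y k}
    (hH : ∀ t, h t ≤ H) : False := by
  classical
  have := M.dense i
  have := M.noMax i
  have := M.noMin i
  obtain ⟨e, he⟩ := hs.exists_low M
  obtain ⟨z0, hz0⟩ := exists_lt (e i)
  have hF := M.plane hik e
  obtain ⟨z1, hz1, hz1e, hlt⟩ := hF.up1 (hF.m2 z0 (hs.mono Nat.zero_lt_one)) hz0
  have : Infinite (Set.Ioo z0 z1) := (Set.Ioo_infinite hz1).to_subtype
  have hcol : ∀ z : Set.Ioo z0 z1, ∃ T, ∀ w, h T ≤ w → (∃ t, w ≤ h t) →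
      col V (pt2 e i k z.1 w) = col V (pt2 e i k z.1 (h T)) := fun z => by
    refine he (Function.update e i z.1) fun a ha => ?_
    by_cases hai : a = i
    · subst hai; simpa using z.2.2.le.trans hz1e
    · simp [hai]
  choose T hT using hcol
  -- There are infinitely many values of `i` but finitely many eventual colours. Two values with the
  -- same eventual colour span an increment whose exact standard sequence stays in one cell.
  obtain ⟨z, z', hne, hc⟩ := Finite.exists_ne_map_eq_of_infinite
    fun z : Set.Ioo z0 z1 => col V (pt2 e i k z.1 (h (T z)))
  wlog hzz : z < z' generalizing z z'
  · exact this z' z hne.symm hc.symm (lt_of_le_of_ne (not_lt.1 hzz) hne.symm)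
  set T0 := max (T z) (T z') with hT0
  set S := col V (pt2 e i k z.1 (h (T z))) with hS
  have hcell : ∀ w, h T0 ≤ w → (∃ t, w ≤ h t) →
      pt2 e i k z.1 w ∈ Cell V S ∧ pt2 e i k z'.1 w ∈ Cell V S := fun w hw ht =>
    ⟨M.mem_cell (hT z w ((hs.mono.monotone (le_max_left _ _)).trans hw) ht),
      M.mem_cell ((hT z' w ((hs.mono.monotone (le_max_right _ _)).trans hw) ht).trans hc.symm)⟩
  have hshift : ∀ s, V (pt2 e i k z'.1 (h s)) ≤ V (pt2 e i k z.1 (h (s + 1))) := by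
    intro s
    have h0 : V (pt2 e i k z'.1 (h 0)) ≤ V (pt2 e i k z.1 (h 1)) :=
      ((hF.m1 _).monotone z'.2.2.le).trans (hlt.le.trans ((hF.m1 _).monotone z.2.1.le))
    have := hs.shift_add hik s h0
    rwa [Nat.zero_add, Nat.add_comm] at this
  -- the exact standard sequence
  have hstep : ∀ (s : ℕ) (w : Y k), w ≤ h s → ∃ w', V (pt2 e i k z.1 w') = V (pt2 e i k z'.1 w) ∧
      w ≤ w' ∧ w' ≤ h (s + 1) := by
    intro s w hw
    have h1 : V (pt2 e i k z.1 w) ≤ V (pt2 e i k z'.1 w) := (hF.m1 w).monotone hzz.le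
    have h2 := ((hF.m2 z'.1).monotone hw).trans (hshift s)
    obtain ⟨w', hw'⟩ := hF.s2 h1 h2
    exact ⟨w', hw', (hF.m2 z.1).le_iff_le.1 (hw' ▸ h1), (hF.m2 z.1).le_iff_le.1 (hw' ▸ h2)⟩
  choose f hf1 hf2 hf3 using hstep
  -- The exact sequence never overtakes `h`, so it is bounded by `H`, contrary to A9.
  let g : ∀ t : ℕ, {w : Y k // w ≤ h (T0 + t)} :=
    fun t => Nat.rec ⟨h T0, le_rfl⟩ (fun t w => ⟨f (T0 + t) w.1 w.2, hf3 _ _ _⟩) t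
  have hg : ∀ t, V (pt2 e i k z.1 (g (t + 1)).1) = V (pt2 e i k z'.1 (g t).1) := fun t => hf1 _ _ (g t).2
  have hgm : ∀ t, h T0 ≤ (g t).1 := by
    intro t
    induction t with
    | zero => exact le_rfl
    | succ t ih => exact ih.trans (hf2 _ _ (g t).2)
  refine M.arch (S := S) (i := k) (l := i) (z := e) (y0 := z.1) (y1 := z'.1) (g := fun t => (g t).1)
    (lo := h T0) (hi := H) (M.ord _) hik (fun h => hne (Subtype.ext h))
    (fun t => ⟨hgm t, (g t).2.trans (hH _)⟩) (fun t => ?_) (fun t => ?_) (fun t => ?_)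
  · rw [← pt2_comm _ hik]; exact (hcell _ (hgm t) ⟨_, (g t).2⟩).2
  · rw [← pt2_comm _ hik]; exact (hcell _ (hgm _) ⟨_, (g _).2⟩).1
  · rw [← pt2_comm _ hik, ← pt2_comm _ hik]; exact (hg t).symm

end StepSeq
end Conjoint

/-! ### Triple cancellation from a fine grid -/

namespace Conjoint

universe u

theorem exists_floor {γ : Type*} [LinearOrder γ] (A : ℕ → γ) (N : ℕ) (x : γ) (h0 : A 0 ≤ x)
    (hN : x < A N) : ∃ r < N, A r ≤ x ∧ x < A (r + 1) := by
  induction N with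
  | zero => exact absurd h0 hN.not_ge
  | succ N ih =>
    by_cases h : x < A N
    · obtain ⟨r, hr, h'⟩ := ih h
      exact ⟨r, hr.trans N.lt_succ_self, h'⟩
    · exact ⟨N, N.lt_succ_self, not_lt.1 h, hN⟩

theorem le_of_steps {γ : Type*} [LinearOrder γ] (A : ℕ → γ) (N : ℕ) (hA : ∀ r < N, A r < A (r + 1))
    (r s : ℕ) (hrs : r ≤ s) (hs : s ≤ N) : A r ≤ A s := by
  induction s, hrs using Nat.le_induction with
  | base => exact le_rfl
  | succ s _ ih => exact (ih (by omega)).trans (hA s (by omega)).le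

/-- Steps on the two coordinates are interchangeable, so the value at a grid point is a monotone
function of the sum of its indices. -/
theorem grid_le {α β L : Type*} [LinearOrder α] [LinearOrder β] [LinearOrder L]
    {F : α → β → L} (hF : Plane F) {N M : ℕ} {A : ℕ → α} {B : ℕ → β}
    (hA : ∀ r < N, A r < A (r + 1)) (hB : ∀ s < M, B s < B (s + 1))
    (hAB : ∀ r < N, ∀ s < M, F (A (r + 1)) (B s) = F (A r) (B (s + 1))) :
    ∀ r s r' s', r ≤ N → s ≤ M → r' ≤ N → s' ≤ M → r' + s' ≤ r + s →
      F (A r') (B s') ≤ F (A r) (B s) := by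
  have hmv : ∀ t r s, r + t ≤ N → s + t ≤ M → F (A (r + t)) (B s) = F (A r) (B (s + t)) := by
    intro t
    induction t with
    | zero => intro r s _ _; rfl
    | succ t ih =>
      intro r s hr hs
      have e1 := hAB (r + t) (by omega) s (by omega)
      have e2 := ih r (s + 1) (by omega) (by omega)
      rw [← Nat.add_assoc, e1, e2, Nat.add_right_comm, Nat.add_assoc s t 1]
  intro r s r' s' hr hs hr' hs' hle
  have hm : ∀ r s r' s', r ≤ r' → s ≤ s' → r' ≤ N → s' ≤ M → F (A r) (B s) ≤ F (A r') (B s') :=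
    fun r s r' s' h1 h2 h3 h4 => ((hF.m1 _).monotone (le_of_steps A N hA _ _ h1 h3)).trans
      ((hF.m2 _).monotone (le_of_steps B M hB _ _ h2 h4))
  rcases le_total s s' with h | h
  · obtain ⟨t, rfl⟩ := Nat.exists_eq_add_of_le h
    obtain ⟨r0, rfl⟩ := Nat.exists_eq_add_of_le' (show t ≤ r by omega)
    rw [hmv t r0 s hr hs']
    exact hm _ _ _ _ (by omega) le_rfl (by omega) hs'
  · rcases le_total r r' with h' | h'
    · obtain ⟨t, rfl⟩ := Nat.exists_eq_add_of_le h'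
      obtain ⟨s0, rfl⟩ := Nat.exists_eq_add_of_le' (show t ≤ s by omega)
      rw [← hmv t r s0 hr' hs]
      exact hm _ _ _ _ le_rfl (by omega) hr' (by omega)
    · exact hm _ _ _ _ h' h hr hs

/-- A fine grid on both coordinates excludes strict violations of triple cancellation. -/
theorem not_strictFail_of_grid {α β L : Type*} [LinearOrder α] [LinearOrder β] [LinearOrder L]
    {F : α → β → L} (hF : Plane F) {N M : ℕ} {A : ℕ → α} {B : ℕ → β}
    (hA : ∀ r < N, A r < A (r + 1)) (hB : ∀ s < M, B s < B (s + 1))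
    (hAB : ∀ r < N, ∀ s < M, F (A (r + 1)) (B s) = F (A r) (B (s + 1)))
    {a b c d : α} {P Q R S : β} (h1 : ∀ x ∈ ({a, b, c, d} : Set α), A 0 ≤ x ∧ x < A N)
    (h2 : ∀ x ∈ ({P, Q, R, S} : Set β), B 0 ≤ x ∧ x < B M) {e : ℕ → α} (he0 : c ≤ e 0)
    (heN : ∀ m ≤ 5, e m < A N) (hes : ∀ m < 5, ∀ r < N, A r ≤ e m → A (r + 1) ≤ e (m + 1))
    (he5 : F (e 5) R < F d S) : ¬ StrictFail F a b c d P Q R S := by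
  rintro ⟨f1, f2, f3, -⟩
  have hle := grid_le hF hA hB hAB
  have cmp : ∀ {x y : α} {X Y : β} {r r' s s' : ℕ}, r ≤ N → s ≤ M → r' < N → s' < M → A r ≤ x → B s ≤ X →
      y < A (r' + 1) → Y < B (s' + 1) → F x X ≤ F y Y → r + s ≤ r' + s' + 1 := by
    intro x y X Y r r' s s' hr hs hr' hs' h1 h2 h3 h4 h5
    by_contra hc
    have := hle r s (r' + 1) (s' + 1) hr hs hr' hs' (by omega)
    have h6 := (this.trans ((hF.m1 _).monotone h1)).trans (((hF.m2 _).monotone h2).trans h5)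
    exact h6.not_gt ((hF.m1 _ h3).trans (hF.m2 _ h4))
  simp only [Set.mem_insert_iff, Set.mem_singleton_iff, forall_eq_or_imp, forall_eq] at h1 h2
  obtain ⟨ra, na, a1, a2⟩ := exists_floor A N a h1.1.1 h1.1.2
  obtain ⟨rb, nb, b1, b2⟩ := exists_floor A N b h1.2.1.1 h1.2.1.2
  obtain ⟨rc, nc, c1, c2⟩ := exists_floor A N c h1.2.2.1.1 h1.2.2.1.2
  obtain ⟨rd, nd, d1, d2⟩ := exists_floor A N d h1.2.2.2.1 h1.2.2.2.2
  obtain ⟨sP, nP, P1, P2⟩ := exists_floor B M P h2.1.1 h2.1.2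
  obtain ⟨sQ, nQ, Q1, Q2⟩ := exists_floor B M Q h2.2.1.1 h2.2.1.2
  obtain ⟨sR, nR, R1, R2⟩ := exists_floor B M R h2.2.2.1.1 h2.2.2.1.2
  obtain ⟨sS, nS, S1, S2⟩ := exists_floor B M S h2.2.2.2.1 h2.2.2.2.2
  have hchain : ∀ m ≤ 5, rc + m ≤ N ∧ A (rc + m) ≤ e m := by
    intro m hm
    induction m with
    | zero => exact ⟨nc.le, c1.trans he0⟩
    | succ m ih =>
      obtain ⟨i1, i2⟩ := ih (by omega)
      have hlt : rc + m < N := by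
        refine lt_of_le_of_ne i1 fun h => ?_
        rw [h] at i2
        exact i2.not_gt (heN m (by omega))
      exact ⟨hlt, hes m (by omega) _ hlt i2⟩
  obtain ⟨i1, i2⟩ := hchain 5 le_rfl
  -- Rounding down to the grid costs at most one step in each of the four comparisons, while `e`
  -- provides a slack of five steps.
  have k1 := cmp na.le nP.le nb nQ a1 P1 b2 Q2 f1.le
  have k2 := cmp nb.le nS.le na nR b1 S1 a2 R2 f2.le
  have k3 := cmp nd.le nQ.le nc nP d1 Q1 c2 P2 f3.le
  have k4 := cmp i1 nR.le nd nS i2 R1 d2 S2 he5.le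
  omega

variable {n : ℕ} {Y : Fin n → Type u} {L : Type*} [LinearOrder L]
variable [∀ k, LinearOrder (Y k)] {V : (∀ k, Y k) → L} {Ord : (Fin n → Fin n → Prop) → Prop}
  {Ess : (Fin n → Fin n → Prop) → Fin n → Prop}

namespace Model

/-- Matched steps on `i` and `b` bound the same increments on `k`. -/
theorem le_of_matched (M : Model V Ord Ess) {i b k : Fin n} (hik : i ≠ k) (hbk : b ≠ k)
    (hib : i ≠ b) {y0 y1 : Y i} (hns : NoStair V i y0 y1) {b0 b1 : Y b} (hns' : NoStair V b b0 b1)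
    (hy : y0 ≤ y1) (hb : b0 ≤ b1) {X : ∀ k, Y k} (hm : V (pt2 X i b y1 b0) = V (pt2 X i b y0 b1))
    {g g' : Y k} {X' : ∀ k, Y k} (x : ∀ k, Y k) :
    (V (pt2 X' k i g' y0) ≤ V (pt2 X' k i g y1) → V (pt2 x k b g' b0) ≤ V (pt2 x k b g b1)) ∧
    (V (pt2 X' k i g y1) ≤ V (pt2 X' k i g' y0) → V (pt2 x k b g b1) ≤ V (pt2 x k b g' b0)) := by
  have y0m : y0 ∈ Set.Icc y0 y1 := ⟨le_rfl, hy⟩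
  have y1m : y1 ∈ Set.Icc y0 y1 := ⟨hy, le_rfl⟩
  have b0m : b0 ∈ Set.Icc b0 b1 := ⟨le_rfl, hb⟩
  have b1m : b1 ∈ Set.Icc b0 b1 := ⟨hb, le_rfl⟩
  have hi := M.planeInv hns hik.symm
  have hbI := M.planeInv hns' hbk.symm
  have hm' := (M.planeInv hns' hib).eq (x' := Function.update x k g) b0m b1m hm
  have e1 : V (pt2 (Function.update x i y0) k b g' b0) = V (pt2 (Function.update x b b0) k i g' y0) := by
    rw [pt2_rotate x hbk.symm hik.symm hib.symm]
  have e2 : V (pt2 (Function.update x i y0) k b g b1) = V (pt2 (Function.update x b b0) k i g y1) := by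
    rw [pt2_rotate x hib hik hbk, pt2_rotate x hib hik hbk] at hm'
    rw [pt2_rotate x hbk.symm hik.symm hib.symm, pt2_comm _ hik.symm, ← hm', pt2_comm _ hik]
  rw [hbI.iff (x' := Function.update x i y0) b0m b1m, hbI.iff (x' := Function.update x i y0) b1m b0m, e1, e2]
  exact ⟨hi _ _ _ _ _ _ y0m y1m, hi _ _ _ _ _ _ y1m y0m⟩

/-- By `le_of_matched` the steps match the increment on `b` as well as that on `i`, so one of the
two remains available whichever coordinate has to be avoided. -/
theorem stepSeq_of_matched (M : Model V Ord Ess) {i b k : Fin n} (hik : i ≠ k) (hbk : b ≠ k)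
    (hib : i ≠ b) {y0 y1 : Y i} (hns : NoStair V i y0 y1) {b0 b1 : Y b} (hns' : NoStair V b b0 b1)
    (hy : y0 < y1) (hb : b0 < b1) {X : ∀ k, Y k} (hm : V (pt2 X i b y1 b0) = V (pt2 X i b y0 b1))
    {h : ℕ → Y k} {X' : ∀ k, Y k} (hh : ∀ t, V (pt2 X' k i (h (t + 1)) y0) = V (pt2 X' k i (h t) y1)) :
    StepSeq V k h := by
  have hall : ∀ x t, V (pt2 x k b (h (t + 1)) b0) = V (pt2 x k b (h t) b1) := fun x t =>
    le_antisymm ((M.le_of_matched hik hbk hib hns hns' hy.le hb.le hm x).1 (hh t).le)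
      ((M.le_of_matched hik hbk hib hns hns' hy.le hb.le hm x).2 (hh t).ge)
  have hK := M.plane hik.symm X'
  have hKb := M.plane hbk.symm X'
  have hmono : StrictMono h := strictMono_nat_of_lt_succ fun t =>
    (hK.m1 y0).lt_iff_lt.1 (by rw [hh]; exact hK.m2 _ hy)
  have hN : ∀ t, NoStair V k (h 0) (h t) := by
    intro t
    induction t with
    | zero => exact M.noStair_of_small hik hbk hib hns hns' (hK.m2 _ hy).le (hKb.m2 _ hb).le
    | succ t ih => exact ih.concat (M.noStair_of_small hik hbk hib hns hns' (hh t).le (hall X t).le)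
  refine ⟨hmono, fun l hl x x' u u' w w' hw hw' => ?_, fun a => ?_⟩
  · obtain ⟨t, h1, h2⟩ := hw
    obtain ⟨t', h1', h2'⟩ := hw'
    exact M.planeInv (hN (max t t')) hl x x' u u' w w' ⟨h1, h2.trans (hmono.monotone (le_max_left _ _))⟩
      ⟨h1', h2'.trans (hmono.monotone (le_max_right _ _))⟩
  · by_cases ha : i = a
    · exact ⟨b, b0, b1, fun h => hib (ha.trans h.symm), hbk, hall⟩
    · exact ⟨i, y0, y1, ha, hik, fun x t => (M.planeInv hns hik.symm).eq ⟨le_rfl, hy.le⟩ ⟨hy.le, le_rfl⟩ (hh t)⟩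

/-- Small steps reach every bound. -/
theorem exists_matched_steps (M : Model V Ord Ess) {i b k : Fin n} (hik : i ≠ k) (hbk : b ≠ k)
    (hib : i ≠ b) {y0 y1 : Y i} (hns : NoStair V i y0 y1) {b0 b1 : Y b} (hns' : NoStair V b b0 b1)
    (hy : y0 < y1) {X : ∀ k, Y k} (hm : V (pt2 X i b y1 b0) ≤ V (pt2 X i b y0 b1)) (X' : ∀ k, Y k)
    {lo hi : Y k} (hlo : lo ≤ hi) :
    ∃ (N : ℕ) (h : ℕ → Y k), h 0 = lo ∧
      (∀ t < N, V (pt2 X' k i (h (t + 1)) y0) = V (pt2 X' k i (h t) y1)) ∧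
      V (pt2 X' k i hi y0) < V (pt2 X' k i (h N) y1) ∧ NoStair V k lo hi := by
  have hB := M.plane hib X
  -- The increment on `b` is shortened until it matches the one on `i` exactly.
  obtain ⟨b1', hb1'⟩ := hB.s2 (hB.m1 b0 hy).le hm
  have hb : b0 < b1' := (hB.m2 y0).lt_iff_lt.1 (by rw [hb1']; exact hB.m1 b0 hy)
  replace hns' := hns'.mono le_rfl ((hB.m2 y0).le_iff_le.1 (hb1'.trans_le hm))
  have hK := M.plane hik.symm X'
  have hKb := M.plane hbk.symm X'
  obtain ⟨N, h, h0, h1, -, h3⟩ := hK.exists_steps hy hlo (by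
    rintro ⟨h, -, h2, h3⟩
    exact (M.stepSeq_of_matched hik hbk hib hns hns' hy hb hb1'.symm h3).not_bounded M hik h2)
  have hsm : ∀ {g g' : Y k}, V (pt2 X' k i g' y0) ≤ V (pt2 X' k i g y1) → NoStair V k g g' := fun h =>
    M.noStair_of_small hik hbk hib hns hns' h
      ((M.le_of_matched hik hbk hib hns hns' hy.le hb.le hb1'.symm X').1 h)
  refine ⟨N, h, h0, h1, h3, ?_⟩
  have hN : ∀ t ≤ N, NoStair V k lo (h t) := by
    intro t ht
    induction t with
    | zero => rw [h0]; exact hsm (hK.m2 _ hy).le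
    | succ t ih => exact (ih (by omega)).concat (hsm (h1 t (by omega)).le)
  exact (hN N le_rfl).concat (hsm h3.le)

/-- After the interval on `i` has been shortened so that it fits into the one on `b`, finitely many
matched steps cover any interval of `k`. -/
theorem noStair_of_two (M : Model V Ord Ess) {i b k : Fin n} (hik : i ≠ k) (hbk : b ≠ k)
    (hib : i ≠ b) {y0 y1 : Y i} (hns : NoStair V i y0 y1) {b0 b1 : Y b} (hns' : NoStair V b b0 b1)
    (hy : y0 < y1) (hb : b0 < b1) (w0 w1 : Y k) : NoStair V k w0 w1 := by
  choose X _ using fun k => (M.nonempty k).elim fun x => (⟨x, trivial⟩ : ∃ _ : Y k, True)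
  have := M.dense i
  have hB := M.plane hib X
  obtain ⟨y1', h1, h2, h3⟩ := hB.up1 (hB.m2 y0 hb) hy
  obtain ⟨-, -, -, -, -, h⟩ := M.exists_matched_steps hik hbk hib (hns.mono le_rfl h2) hns' h1 h3.le X
    (min_le_max (a := w0) (b := w1))
  exact h.mono (min_le_left _ _) (le_max_right _ _)

/-- A rectangle of constant colour provides short intervals on `i` and `b`. From these all intervals
of any other coordinate are reached, and from `k` one returns to `i` and `b`. -/
theorem noStair (M : Model V Ord Ess) {i b k : Fin n} (hik : i ≠ k) (hbk : b ≠ k)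
    (hib : i ≠ b) (m : Fin n) (w0 w1 : Y m) : NoStair V m w0 w1 := by
  choose X _ using fun k => (M.nonempty k).elim fun x => (⟨x, trivial⟩ : ∃ _ : Y k, True)
  have nm : ∀ m, NoMaxOrder (Y m) := M.noMax
  choose X' hX' using fun m => exists_gt (X m)
  obtain ⟨y0, y1, b0, b1, S, -, hy, -, -, hb, -, hS⟩ := M.exists_tame hib X (hX' i) (hX' b)
  have h1 : NoStair V i y0 y1 := M.noStair_of_tame hib hb fun a p k1 k2 k3 k4 => hS a p k1 k2 k3 k4
  have h2 : NoStair V b b0 b1 := M.noStair_of_tame hib.symm hy fun a p k1 k2 k3 k4 => by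
    rw [← pt2_comm _ hib]; exact hS p a k3 k4 k1 k2
  by_cases hi : i = m
  · subst hi
    exact M.noStair_of_two hik.symm hib.symm hbk.symm (M.noStair_of_two hik hbk hib h1 h2 hy hb _ _) h2
      (hX' k) hb _ _
  by_cases hbm : b = m
  · subst hbm
    exact M.noStair_of_two hbk.symm hib hik.symm (M.noStair_of_two hik hbk hib h1 h2 hy hb _ _) h1
      (hX' k) hy _ _
  · exact M.noStair_of_two hi hbm hib h1 h2 hy hb _ _

/-- With three coordinates, triple cancellation holds in every plane. -/
theorem not_strictFail (M : Model V Ord Ess) {p q k : Fin n} (hpk : p ≠ k) (hqk : q ≠ k)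
    (hpq : p ≠ q) (x : ∀ k, Y k) (a b c d : Y p) (P Q R S : Y q) :
    ¬ StrictFail (fun a P => V (pt2 x p q a P)) a b c d P Q R S := by
  intro hf
  have hns := M.noStair hpk hqk hpq
  have hF := M.plane hpq x
  have hP := M.plane hpk x
  have hQ := M.plane hqk x
  have := M.dense
  have := M.noMax
  have := M.nonempty
  obtain ⟨c', hc'⟩ := exists_gt c
  obtain ⟨e0, hce0, -, hlt0⟩ := hF.up1 hf.2.2.2 hc'
  obtain ⟨top, htop0⟩ := Set.toFinite (insert e0 ({a, b, c, d} : Set (Y p))) |>.bddAbove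
  have htop := fun u hu => htop0 (Set.mem_insert_of_mem e0 hu : u ∈ _)
  obtain ⟨bot, hbot⟩ := Set.toFinite ({a, b, c, d} : Set (Y p)) |>.bddBelow
  obtain ⟨top', htop'⟩ := Set.toFinite ({P, Q, R, S} : Set (Y q)) |>.bddAbove
  obtain ⟨bot', hbot'⟩ := Set.toFinite ({P, Q, R, S} : Set (Y q)) |>.bddBelow
  obtain ⟨top2, ht2⟩ := exists_gt top
  obtain ⟨top2', ht2'⟩ := exists_gt top'
  obtain ⟨z, hz⟩ := exists_between hce0
  have : Nonempty (Set.Ioo c e0) := ⟨⟨z, hz⟩⟩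
  -- Elements inside the slack of the last comparison; six of them bound the five gaps required by
  -- `not_strictFail_of_grid`.
  obtain ⟨e, he⟩ := Nat.exists_strictMono (Set.Ioo c e0)
  have hec : ∀ m, c < (e m).1 ∧ (e m).1 < e0 := fun m => (e m).2
  -- The unit from `x k` to `y1` is chosen to fit into each of the five gaps and into the margins
  -- above `top` and `top'`.
  obtain ⟨y1, hy1, hroom, hroom', hstep⟩ : ∃ y1, x k < y1 ∧
      V (pt2 x p k top y1) ≤ V (pt2 x p k top2 (x k)) ∧
      V (pt2 x q k top' y1) ≤ V (pt2 x q k top2' (x k)) ∧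
      ∀ m : Fin 5, V (pt2 x p k (e m).1 y1) ≤ V (pt2 x p k (e (m + 1)).1 (x k)) := by
    obtain ⟨t0, ht0⟩ := exists_gt (x k)
    obtain ⟨t1, h1, -, h1'⟩ := hP.up2 (hP.m1 (x k) ht2) ht0
    obtain ⟨t2, h2, -, h2'⟩ := hQ.up2 (hQ.m1 (x k) ht2') ht0
    have : ∀ m : Fin 5, ∃ t : Set.Ioi (x k), V (pt2 x p k (e m).1 t) < V (pt2 x p k (e (m + 1)).1 (x k)) := by
      intro m
      obtain ⟨t, h, -, h'⟩ := hP.up2 (hP.m1 (x k) (he (Nat.lt_succ_self m))) ht0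
      exact ⟨⟨t, h⟩, h'⟩
    choose f hf using this
    obtain ⟨t3, ht3⟩ := Finite.exists_ge f
    refine ⟨min t3.1 (min t1 t2), lt_min t3.2 (lt_min h1 h2), ?_, ?_, fun m => ?_⟩
    · exact ((hP.m2 _).monotone ((min_le_right _ _).trans (min_le_left _ _))).trans h1'.le
    · exact ((hQ.m2 _).monotone ((min_le_right _ _).trans (min_le_right _ _))).trans h2'.le
    · exact ((hP.m2 _).monotone ((min_le_left _ _).trans (ht3 m))).trans (hf m).le
  have hbt : bot ≤ top := (hbot (by simp : a ∈ _)).trans (htop a (by simp))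
  have hbt' : bot' ≤ top' := (hbot' (by simp : P ∈ _)).trans (htop' (by simp))
  obtain ⟨N, A, hA0, hA1, hA2, -⟩ := M.exists_matched_steps hpk.symm hpq.symm hqk.symm (hns k (x k) y1)
    (hns q bot' top2') hy1 (X := x) (by
      rw [← pt2_comm _ hqk, ← pt2_comm _ hqk]
      exact ((hQ.m1 _).monotone hbt').trans hroom') x (hbt.trans ht2.le)
  obtain ⟨N', B, hB0, hB1, hB2, -⟩ := M.exists_matched_steps hqk.symm hpq hpk.symm (hns k (x k) y1)
    (hns p bot top2) hy1 (X := x) (by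
      rw [← pt2_comm _ hpk, ← pt2_comm _ hpk]
      exact ((hP.m1 _).monotone hbt).trans hroom) x (hbt'.trans ht2'.le)
  have m0 : x k ∈ Set.Icc (x k) y1 := ⟨le_rfl, hy1.le⟩
  have m1 : y1 ∈ Set.Icc (x k) y1 := ⟨hy1.le, le_rfl⟩
  have hAN : top < A N := (hP.m1 y1).lt_iff_lt.1 (hroom.trans_lt hA2)
  have hBN : top' < B N' := (hQ.m1 y1).lt_iff_lt.1 (hroom'.trans_lt hB2)
  refine not_strictFail_of_grid hF (N := N) (M := N') (A := A) (B := B) (e := fun m => (e m).1)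
    (fun r hr => (hP.m1 (x k)).lt_iff_lt.1 (by rw [hA1 r hr]; exact hP.m2 _ hy1))
    (fun r hr => (hQ.m1 (x k)).lt_iff_lt.1 (by rw [hB1 r hr]; exact hQ.m2 _ hy1)) ?_
    (fun u hu => ⟨hA0.trans_le (hbot hu), (htop u hu).trans_lt hAN⟩)
    (fun u hu => ⟨hB0.trans_le (hbot' hu), (htop' hu).trans_lt hBN⟩) (hec 0).1.le ?_ ?_ ?_ hf
  -- Both grids are laid out with the same unit on `k`, which makes their steps interchangeable.
  · intro r hr s hs
    have e1 : ∀ u P, pt2 x p q u P = pt2 (Function.update x q P) p k u (x k) := fun u P => by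
      conv_lhs => rw [← Function.update_eq_self k x, pt2_rotate x hpq hpk hqk]
    have e2 : ∀ u P, pt2 x p q u P = pt2 (Function.update x p u) q k P (x k) := fun u P => by
      conv_lhs => rw [← Function.update_eq_self k x, pt2_comm _ hpq, pt2_rotate x hpq.symm hqk hpk]
    have k1 := (M.planeInv (hns k (x k) y1) hpk).eq (x' := Function.update x q (B s)) m0 m1 (hA1 r hr)
    have k2 := (M.planeInv (hns k (x k) y1) hqk).eq (x' := Function.update x p (A r)) m0 m1 (hB1 s hs)
    rw [e1, k1, e2, k2, ← pt2_rotate x hpq hpk hqk, ← pt2_rotate x hpq.symm hqk hpk, pt2_comm _ hpq]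
  · exact fun m _ => (hec m).2.trans_le ((htop0 (by simp)).trans hAN.le)
  · intro m hm r hr hle
    exact (hP.m1 (x k)).le_iff_le.1 (by
      rw [hA1 r hr]
      exact ((hP.m1 y1).monotone hle).trans (hstep ⟨m, hm⟩))
  · exact ((hF.m1 R).monotone (hec 5).2.le).trans_lt hlt0

end Model
end Conjoint

/-! ### No interaction in the presence of a third coordinate -/

namespace Conjoint

universe u

variable {n : ℕ} {L : Type*} [LinearOrder L] {X : Fin n → Type u}

namespace Rep

variable [∀ k, LinearOrder (X k)]
  {ge : (∀ k, X k) → (∀ k, X k) → Prop} {V : (∀ k, X k) → L}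

theorem dn (R : Rep ge V) {k : Fin n} {x y : ∀ k, X k} {e e0 : X k}
    (h : V (Function.update x k e) < V (Function.update y k e)) (he : e0 < e) :
    ∃ c, c < e ∧ V (Function.update x k e) < V (Function.update y k c) := by
  have := R.denselyOrdered k
  rcases lt_or_ge (V (Function.update x k e)) (V (Function.update y k e0)) with h1 | h1
  · exact ⟨e0, he, h1⟩
  · obtain ⟨c, hc⟩ := R.solv h1 h.le
    obtain ⟨d, h2, h3⟩ := exists_between ((R.strictMono k y).lt_iff_lt.1 (hc.symm ▸ h :
      V (Function.update y k c) < V (Function.update y k e)))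
    exact ⟨d, h3, hc ▸ R.strictMono k y h2⟩

theorem up (R : Rep ge V) {k : Fin n} {x y : ∀ k, X k} {e e0 : X k}
    (h : V (Function.update x k e) < V (Function.update y k e)) (he : e < e0) :
    ∃ c, e < c ∧ V (Function.update x k c) < V (Function.update y k e) := by
  have := R.denselyOrdered k
  rcases lt_or_ge (V (Function.update x k e0)) (V (Function.update y k e)) with h1 | h1
  · exact ⟨e0, he, h1⟩
  · obtain ⟨c, hc⟩ := R.solv h.le h1
    obtain ⟨d, h2, h3⟩ := exists_between ((R.strictMono k x).lt_iff_lt.1 (hc.symm ▸ h :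
      V (Function.update x k e) < V (Function.update x k c)))
    exact ⟨d, h2, hc ▸ R.strictMono k x h3⟩

/-- Finitely many strict preferences persist when a common coordinate is moved to a suitable
non-extreme value. -/
theorem exists_nonExtreme_lt (R : Rep ge V) {k : Fin n} {ι : Type*} [Finite ι] {x y : ι → ∀ k, X k}
    {e : X k} (h : ∀ s, V (Function.update (x s) k e) < V (Function.update (y s) k e)) :
    ∃ c, NonExtreme ge k c ∧ ∀ s, V (Function.update (x s) k c) < V (Function.update (y s) k c) := by
  have := R.denselyOrdered k
  by_cases he : NonExtreme ge k e
  · exact ⟨e, he, h⟩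
  obtain ⟨c, hc⟩ := R.exists_nonExtreme k
  obtain ⟨⟨u, hu⟩, l, hl⟩ := R.nonExtreme_iff.1 hc
  rw [R.nonExtreme_iff, not_and_or] at he
  -- `e` is greatest or least. Solvability keeps one side of every comparison beyond its bound when
  -- `e` is moved slightly inwards; monotonicity takes care of the other side.
  rcases he with he | he
  · push Not at he
    have hce : c < e := hu.trans_le (he u)
    choose f hf1 hf2 using fun s => R.dn (h s) hce
    have : Nonempty (Set.Iio e) := ⟨⟨c, hce⟩⟩
    obtain ⟨t, ht⟩ := Finite.exists_le fun s => (⟨f s, hf1 s⟩ : Set.Iio e)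
    obtain ⟨d, hd1, hd2⟩ := exists_between (max_lt t.2 hce)
    refine ⟨d, R.nonExtreme_iff.2 ⟨⟨e, hd2⟩, l, hl.trans ((le_max_right _ _).trans_lt hd1)⟩, fun s => ?_⟩
    exact (R.strictMono k _ hd2).trans ((hf2 s).trans (R.strictMono k _
      (lt_of_le_of_lt (show f s ≤ t.1 from ht s) ((le_max_left _ _).trans_lt hd1))))
  · push Not at he
    have hce : e < c := (he l).trans_lt hl
    choose f hf1 hf2 using fun s => R.up (h s) hce
    have : Nonempty (Set.Ioi e) := ⟨⟨c, hce⟩⟩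
    obtain ⟨t, ht⟩ := Finite.exists_ge fun s => (⟨f s, hf1 s⟩ : Set.Ioi e)
    obtain ⟨d, hd1, hd2⟩ := exists_between (lt_min t.2 hce)
    refine ⟨d, R.nonExtreme_iff.2 ⟨⟨u, (hd2.trans_le (min_le_right _ _)).trans hu⟩, e, hd1⟩, fun s => ?_⟩
    exact (R.strictMono k _ (lt_of_lt_of_le (hd2.trans_le (min_le_left _ _))
      (show t.1 ≤ f s from ht s))).trans ((hf2 s).trans (R.strictMono k _ hd1))

/-- The coordinates outside the plane are moved one at a time, the four strict comparisons of the
violation being preserved together by `exists_nonExtreme_lt`. -/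
theorem exists_inner_rest (R : Rep ge V) {p q : Fin n} (hpq : p ≠ q) {z : ∀ k, X k} {a b c d : X p} {P Q R' S : X q}
    (hf : StrictFail (fun a P => V (pt2 z p q a P)) a b c d P Q R' S) :
    ∃ z' : ∀ k, X k, (∀ k, NonExtreme ge k (z' k)) ∧
      StrictFail (fun a P => V (pt2 z' p q a P)) a b c d P Q R' S := by
  have key : ∀ s : Finset (Fin n), ∃ z' : ∀ k, X k, (∀ k ∈ s, NonExtreme ge k (z' k)) ∧
      StrictFail (fun a P => V (pt2 z' p q a P)) a b c d P Q R' S := by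
    intro s
    induction s using Finset.induction_on with
    | empty => exact ⟨z, by simp, hf⟩
    | insert m s hm ih =>
      obtain ⟨z', h1, h2⟩ := ih
      have hins : ∀ (e : X m), NonExtreme ge m e → ∀ k ∈ insert m s, NonExtreme ge k (Function.update z' m e k) := by
        intro e he k hk
        by_cases hkm : k = m
        · subst hkm; simpa using he
        · rw [Function.update_of_ne hkm]; exact h1 k ((Finset.mem_insert.1 hk).resolve_left hkm)
      obtain ⟨e, he⟩ := R.exists_nonExtreme m
      by_cases hmp : m = p
      · subst hmp
        exact ⟨_, hins e he, by simpa only [pt2_update_left] using h2⟩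
      by_cases hmq : m = q
      · subst hmq
        exact ⟨_, hins e he, by simpa only [pt2_update_right _ hpq] using h2⟩
      have h3 := h2
      rw [← Function.update_eq_self m z'] at h3
      simp only [pt2_update_of_ne _ hmp hmq] at h3
      obtain ⟨f1, f2, f3, f4⟩ := h3
      obtain ⟨c', hc', hall⟩ := R.exists_nonExtreme_lt (k := m) (e := z' m)
        (x := ![pt2 z' p q a P, pt2 z' p q b S, pt2 z' p q d Q, pt2 z' p q c R'])
        (y := ![pt2 z' p q b Q, pt2 z' p q a R', pt2 z' p q c P, pt2 z' p q d S]) (by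
          intro s; fin_cases s
          exacts [f1, f2, f3, f4])
      refine ⟨_, hins c' hc', ?_⟩
      simp only [pt2_update_of_ne _ hmp hmq]
      exact ⟨hall 0, hall 1, hall 2, hall 3⟩
  obtain ⟨z', h1, h2⟩ := key Finset.univ
  exact ⟨z', fun k => h1 k (Finset.mem_univ k), h2⟩

/-- Interaction is impossible in the presence of a third coordinate. -/
theorem rRel_of_three (R : Rep ge V) {p q k : Fin n} (hpq : p ≠ q) (hpk : p ≠ k) (hqk : q ≠ k)
    (z : ∀ k, X k) : RRel ge z q p := by
  by_contra h
  obtain ⟨a, b, c, d, P, Q, R', S, hf, h1, h2⟩ := R.exists_strictFail_of_not_RRel hpq h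
  obtain ⟨z', hz', hf'⟩ := R.exists_inner_rest hpq hf
  simp only [Set.mem_insert_iff, Set.mem_singleton_iff, forall_eq_or_imp, forall_eq] at h1 h2
  refine R.model.not_strictFail hpk hqk hpq (fun k => (⟨z' k, hz' k⟩ : Inner ge k))
    ⟨a, h1.1.1⟩ ⟨b, h1.2.1.1⟩ ⟨c, h1.2.2.1.1⟩ ⟨d, h1.2.2.2.1⟩ ⟨P, h2.1.1⟩
    ⟨Q, h2.2.1.1⟩ ⟨R', h2.2.2.1.1⟩ ⟨S, h2.2.2.2.1⟩ ?_
  simp only [StrictFail, incl_pt2]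
  exact hf'

theorem not_interacting_of_three (R : Rep ge V) {p q k : Fin n} (hpq : p ≠ q) (hpk : p ≠ k) (hqk : q ≠ k) :
    ¬ Interacting ge p q := by
  rintro ⟨z, ⟨-, h⟩ | ⟨-, h⟩⟩
  · exact h (R.rRel_of_three hpq hpk hqk z)
  · exact h (R.rRel_of_three hpq.symm hqk hpk z)

end Rep
end Conjoint

/-! ### Counting standard sequences on a corner -/

namespace Conjoint

universe u

variable {α β L : Type*} [LinearOrder α] [LinearOrder β] [LinearOrder L] {F : α → β → L}

/-- Reverses the orders and exchanges the coordinates, so that descending steps on the second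
coordinate become ascending steps on the first. -/
theorem Plane.dual (hF : Plane F) :
    @Plane βᵒᵈ αᵒᵈ Lᵒᵈ (OrderDual.instLinearOrder β) (OrderDual.instLinearOrder α)
      (OrderDual.instLinearOrder L) (fun p a => OrderDual.toDual (F (OrderDual.ofDual a) (OrderDual.ofDual p))) where
  m1 a _ _ h := hF.m2 (OrderDual.ofDual a) (OrderDual.ofDual_lt_ofDual.2 h)
  m2 p _ _ h := hF.m1 (OrderDual.ofDual p) (OrderDual.ofDual_lt_ofDual.2 h)
  s1 h1 h2 := hF.s2 h2 h1
  s2 h1 h2 := hF.s1 h2 h1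

theorem Plane.exists_steps_down (hF : Plane F) {k0 k1 : α} (hk : k0 < k1) {lo hi : β} (hlo : lo ≤ hi)
    (harch : ¬ ∃ h : ℕ → β, h 0 = hi ∧ (∀ t, lo ≤ h t) ∧ ∀ t, F k1 (h (t + 1)) = F k0 (h t)) :
    ∃ (N : ℕ) (h : ℕ → β), h 0 = hi ∧ (∀ t < N, F k1 (h (t + 1)) = F k0 (h t)) ∧
      (∀ t ≤ N, lo ≤ h t) ∧ F k0 (h N) < F k1 lo :=
  @Plane.exists_steps βᵒᵈ αᵒᵈ Lᵒᵈ (OrderDual.instLinearOrder β) (OrderDual.instLinearOrder α)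
    (OrderDual.instLinearOrder L) _ hF.dual (OrderDual.toDual k1) (OrderDual.toDual k0) hk
    (OrderDual.toDual hi) (OrderDual.toDual lo) hlo harch

/-- A strictly increasing solvable function, satisfying triple cancellation and the Archimedean
property, on the product of a chain with a least and a chain with a greatest element. -/
structure Corner (F : α → β → L) (a0 : α) (p0 : β) : Prop extends Plane F where
  bot : ∀ a, a0 ≤ a
  top : ∀ p, p ≤ p0
  tc : ∀ {a b c d : α} {P Q R S : β}, F a P ≤ F b Q → F b S ≤ F a R → F d Q ≤ F c P → F d S ≤ F c R
  arch1 : ∀ {k0 k1 : β} {hi : α}, k0 < k1 →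
    ¬ ∃ h : ℕ → α, (∀ t, h t ≤ hi) ∧ ∀ t, F (h (t + 1)) k0 = F (h t) k1
  arch2 : ∀ {k0 k1 : α} {lo : β}, k0 < k1 →
    ¬ ∃ h : ℕ → β, (∀ t, lo ≤ h t) ∧ ∀ t, F k1 (h (t + 1)) = F k0 (h t)

/-- The number of steps from `a0` to `a`, a step being compensated by the interval `[p1, p0]`. -/
def Count1 (F : α → β → L) (a0 : α) (p0 p1 : β) (a : α) (N : ℕ) : Prop :=
  ∃ A : ℕ → α, A 0 = a0 ∧ (∀ r < N, F (A (r + 1)) p1 = F (A r) p0) ∧ A N ≤ a ∧ F a p1 < F (A N) p0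

/-- The number of steps from `p` to `p0`, a step being compensated by the interval `[a0, a1]`. -/
def Count2 (F : α → β → L) (a0 a1 : α) (p0 : β) (p : β) (N : ℕ) : Prop :=
  ∃ B : ℕ → β, B 0 = p0 ∧ (∀ r < N, F a1 (B (r + 1)) = F a0 (B r)) ∧ p ≤ B N ∧ F a0 (B N) < F a1 p

theorem eq_of_steps {γ : Type*} {R : γ → γ → Prop} (hR : ∀ x y z, R x y → R x z → y = z) {N M : ℕ}
    {A B : ℕ → γ} (h0 : A 0 = B 0) (hA : ∀ r < N, R (A r) (A (r + 1))) (hB : ∀ r < M, R (B r) (B (r + 1)))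
    (r : ℕ) (h1 : r ≤ N) (h2 : r ≤ M) : A r = B r := by
  induction r with
  | zero => exact h0
  | succ r ih =>
    have := ih (by omega) (by omega)
    exact hR (A r) _ _ (hA r (by omega)) (this ▸ hB r (by omega))

namespace Corner

variable {a0 a1 : α} {p0 p1 : β}

theorem tc_eq (hC : Corner F a0 p0) {a b c d : α} {P Q R S : β} (h1 : F a P = F b Q)
    (h2 : F a R = F b S) (h3 : F c P = F d Q) : F c R = F d S :=
  le_antisymm (hC.tc h1.ge h2.le h3.le) (hC.tc h1.le h2.ge h3.ge)

theorem exists_count1 (hC : Corner F a0 p0) (hp : p1 < p0) (a : α) : ∃ N, Count1 F a0 p0 p1 a N := by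
  obtain ⟨N, A, h0, h1, h2, h3⟩ := hC.toPlane.exists_steps hp (hC.bot a) (by
    rintro ⟨h, -, h2, h3⟩
    exact hC.arch1 hp ⟨h, h2, h3⟩)
  exact ⟨N, A, h0, h1, h2 N le_rfl, h3⟩

theorem exists_count2 (hC : Corner F a0 p0) (ha : a0 < a1) (p : β) : ∃ N, Count2 F a0 a1 p0 p N := by
  obtain ⟨N, A, h0, h1, h2, h3⟩ := hC.toPlane.exists_steps_down ha (hC.top p) (by
    rintro ⟨h, -, h2, h3⟩
    exact hC.arch2 ha ⟨h, h2, h3⟩)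
  exact ⟨N, A, h0, h1, h2 N le_rfl, h3⟩

/-- Sequences with the same start and step agree as long as both last, so all terminal points sit on
one grid, on which a step up on the first coordinate cancels a step down on the second. The error is
a single step whatever the unit, so it disappears in the limit of fine units. -/
theorem count_le (hC : Corner F a0 p0) (ha : a0 < a1) (hp : p1 < p0) (hu : F a1 p1 = F a0 p0)
    {a b : α} {p q : β} {N N' M M' : ℕ} (hN : Count1 F a0 p0 p1 a N) (hN' : Count1 F a0 p0 p1 b N')
    (hM : Count2 F a0 a1 p0 p M) (hM' : Count2 F a0 a1 p0 q M') (hle : F a p ≤ F b q) :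
    N + M' ≤ N' + M + 1 := by
  obtain ⟨A, hA0, hA, hAa, hAN⟩ := hN
  obtain ⟨A', hA0', hA', hAa', hAN'⟩ := hN'
  obtain ⟨B, hB0, hB, hBp, hBM⟩ := hM
  obtain ⟨B', hB0', hB', hBq, hBM'⟩ := hM'
  obtain ⟨C, hC0, hCs, hCN, hCN'⟩ : ∃ C : ℕ → α, C 0 = a0 ∧ (∀ r < max N N', F (C (r + 1)) p1 = F (C r) p0) ∧
      C N = A N ∧ C N' = A' N' := by
    have e := eq_of_steps (R := fun x y => F y p1 = F x p0) (fun x y z h1 h2 =>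
      (hC.m1 p1).injective (h1.trans h2.symm)) (hA0.trans hA0'.symm) hA hA'
    rcases le_total N N' with h | h
    · exact ⟨A', hA0', by rwa [max_eq_right h], (e N le_rfl h).symm, rfl⟩
    · exact ⟨A, hA0, by rwa [max_eq_left h], rfl, e N' h le_rfl⟩
  obtain ⟨D, hD0, hDs, hDM, hDM'⟩ : ∃ D : ℕ → β, D 0 = p0 ∧ (∀ r < max M M', F a1 (D (r + 1)) = F a0 (D r)) ∧
      D M = B M ∧ D M' = B' M' := by
    have e := eq_of_steps (R := fun x y => F a1 y = F a0 x) (fun x y z h1 h2 =>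
      (hC.m2 a1).injective (h1.trans h2.symm)) (hB0.trans hB0'.symm) hB hB'
    rcases le_total M M' with h | h
    · exact ⟨B', hB0', by rwa [max_eq_right h], (e M le_rfl h).symm, rfl⟩
    · exact ⟨B, hB0, by rwa [max_eq_left h], rfl, e M' h le_rfl⟩
  rw [← hCN] at hAa hAN
  rw [← hCN'] at hAa' hAN'
  rw [← hDM] at hBp hBM
  rw [← hDM'] at hBq hBM'
  set K := max N N' with hK
  set W := max M M' with hW
  have kN : N ≤ K := le_max_left _ _
  have kN' : N' ≤ K := le_max_right _ _
  have wM : M ≤ W := le_max_left _ _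
  have wM' : M' ≤ W := le_max_right _ _
  have hCD : ∀ r < K, ∀ s < W, F (C (r + 1)) (D (s + 1)) = F (C r) (D s) := fun r hr s hs =>
    hC.tc_eq hu (hDs s hs) (hCs r hr)
  have hlt1 : ∀ r < K, C r < C (r + 1) := fun r hr => (hC.m1 p1).lt_iff_lt.1 (by
    rw [hCs r hr]; exact hC.m2 _ hp)
  have hlt2 : ∀ r < W, D (r + 1) < D r := fun r hr => (hC.m2 a1).lt_iff_lt.1 (by
    rw [hDs r hr]; exact hC.m1 _ ha)
  have hgrid : ∀ r s r' s', r ≤ K → s ≤ W → r' ≤ K → s' ≤ W → r' + s ≤ r + s' →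
      F (C r') (D s') ≤ F (C r) (D s) := by
    intro r s r' s' h1 h2 h3 h4 h5
    have := grid_le hC.toPlane (N := K) (M := W) (A := C) (B := fun s => D (W - s)) hlt1
      (fun s hs => by
        have := hlt2 (W - (s + 1)) (by omega)
        rwa [show W - (s + 1) + 1 = W - s by omega] at this)
      (fun r hr s hs => by
        have := hCD r hr (W - (s + 1)) (by omega)
        rwa [show W - (s + 1) + 1 = W - s by omega] at this)
      r (W - s) r' (W - s') h1 (by omega) h3 (by omega) (by omega)
    rwa [show W - (W - s) = s by omega, show W - (W - s') = s' by omega] at this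
  by_contra hc
  -- A grid point one step beyond a terminal one is needed. It exists on the longer sequence: `D (M
  -- + 1)` in the first case and `C (N' + 1)` in the second.
  rcases Nat.lt_or_ge M M' with hMM | hMM
  · have h1 : D (M + 1) < p := (hC.m2 a1).lt_iff_lt.1 (by rw [hDs M (by omega)]; exact hBM)
    have h2 : F b (D M') < F (C N') (D (M' - 1)) := by
      refine not_le.1 fun h => hAN'.not_ge ?_
      have e := hDs (M' - 1) (by omega)
      rw [show M' - 1 + 1 = M' by omega] at e
      exact hC.tc (a := a1) (b := a0) (P := D M') (Q := D (M' - 1)) e.le hu.ge h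
    have h3 := hgrid N (M + 1) N' (M' - 1) kN (by omega) kN' (by omega) (by omega)
    exact absurd ((hC.m2 b).monotone hBq) (not_le.2 ((h2.trans_le h3).trans_le
      ((((hC.m2 _).monotone h1.le).trans ((hC.m1 p).monotone hAa)).trans hle)))
  · have h1 : b < C (N' + 1) := (hC.m1 p1).lt_iff_lt.1 (by rw [hCs N' (by omega)]; exact hAN')
    have h2 : F (C (N - 1)) (D M) < F (C N) p := by
      refine not_le.1 fun h => hBM.not_ge ?_
      have e := hCs (N - 1) (by omega)
      rw [show N - 1 + 1 = N by omega] at e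
      exact hC.tc (a := C (N - 1)) (b := C N) (P := p0) (Q := p1) e.ge h hu.le
    have h3 := hgrid (N - 1) M (N' + 1) M' (by omega) (by omega) (by omega) (by omega) (by omega)
    have h4 : F b q < F (C (N' + 1)) (D M') :=
      ((hC.m2 b).monotone hBq).trans_lt (hC.m1 _ h1)
    exact absurd (((hC.m1 p).monotone hAa).trans hle) (not_le.2 ((h4.trans_le h3).trans h2))

end Corner
end Conjoint

/-! ### Additive representation on a corner -/

namespace Conjoint

open Filter Topology in
-- Limits along one fixed ultrafilter serve all elements at once, without a choice of subsequences.
theorem exists_ultralimit {u : ℕ → ℝ} {C : ℝ} (h0 : ∀ n, 0 ≤ u n) (h : ∀ n, u n ≤ C) :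
    ∃ x, Tendsto u (hyperfilter ℕ) (𝓝 x) := by
  obtain ⟨x, -, hx⟩ := (isCompact_Icc (a := (0 : ℝ)) (b := C)).ultrafilter_le_nhds'
    ((hyperfilter ℕ).map u) (Filter.mem_map.2 (Filter.univ_mem' fun n => ⟨h0 n, h n⟩))
  exact ⟨x, hx⟩

theorem div_le_of_le_mul_add {c N : ℕ} {K : ℕ} (h : c ≤ K * (N + 2)) : (c : ℝ) / N ≤ 3 * K := by
  -- For `N = 0` the quotient is `0` by convention.
  rcases Nat.eq_zero_or_pos N with rfl | hN
  · simp
  · rw [div_le_iff₀ (by exact_mod_cast hN)]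
    have : c ≤ K * (3 * N) := h.trans (Nat.mul_le_mul_left K (by omega))
    calc (c : ℝ) ≤ ((K * (3 * N) : ℕ) : ℝ) := by exact_mod_cast this
      _ = 3 * K * N := by push_cast; ring

namespace Corner

variable {α β L : Type*} [LinearOrder α] [LinearOrder β] [LinearOrder L] {F : α → β → L}
variable {a0 a1 : α} {p0 p1 : β}

theorem count1_bot (hC : Corner F a0 p0) (hp : p1 < p0) {N : ℕ} (h : Count1 F a0 p0 p1 a0 N) : N = 0 := by
  obtain ⟨A, -, h1, h2, -⟩ := h
  cases N with
  | zero => rfl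
  | succ N =>
    have h3 := h1 N (by omega)
    rw [le_antisymm h2 (hC.bot _)] at h3
    exact absurd ((hC.m1 p0).monotone (hC.bot (A N))) (not_le.2 (h3 ▸ hC.m2 a0 hp))

theorem count2_top (hC : Corner F a0 p0) (ha : a0 < a1) {N : ℕ} (h : Count2 F a0 a1 p0 p0 N) : N = 0 := by
  obtain ⟨B, -, h1, h2, -⟩ := h
  cases N with
  | zero => rfl
  | succ N =>
    have h3 := h1 N (by omega)
    rw [le_antisymm (hC.top _) h2] at h3
    exact absurd ((hC.m2 a0).monotone (hC.top (B N))) (not_le.2 (h3 ▸ hC.m1 p0 ha))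

theorem exists_unit [DenselyOrdered α] (hC : Corner F a0 p0) {e : α} {p : β} (he : a0 < e) (hp : p < p0) :
    ∃ a1 p1, a0 < a1 ∧ a1 ≤ e ∧ p < p1 ∧ p1 < p0 ∧ F a1 p1 = F a0 p0 := by
  obtain ⟨a1, h1, h2, h3⟩ := hC.toPlane.up1 (hC.m2 a0 hp) he
  obtain ⟨p1, hp1⟩ := hC.s2 h3.le ((hC.m1 p0).monotone h1.le)
  exact ⟨a1, p1, h1, h2, (hC.m2 a1).lt_iff_lt.1 (hp1.symm ▸ h3),
    (hC.m2 a1).lt_iff_lt.1 (hp1.symm ▸ hC.m1 p0 h1), hp1⟩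

/-- Consecutive gaps are marked out below `e`, and a step that fits into each of them is chosen; at
least `n` such steps are then needed to reach `e`. -/
theorem exists_fine_unit [DenselyOrdered α] [DenselyOrdered β] (hC : Corner F a0 p0) {e : α} {p : β}
    (he : a0 < e) (hp : p < p0) (n : ℕ) :
    ∃ a1 p1, a0 < a1 ∧ p1 < p0 ∧ F a1 p1 = F a0 p0 ∧ ∀ N, Count1 F a0 p0 p1 e N → n ≤ N := by
  obtain ⟨x, hx⟩ := exists_between he
  have : Nonempty (Set.Ioo a0 e) := ⟨⟨x, hx⟩⟩
  obtain ⟨E, hE⟩ := Nat.exists_strictMono (Set.Ioo a0 e)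
  have hm : ∀ m : Fin n, ∃ q : Set.Iio p0, F (E m).1 p0 < F (E (m + 1)).1 q := by
    intro m
    obtain ⟨q, -, h1, h2⟩ := hC.toPlane.dn2 (hC.m1 p0 (hE (Nat.lt_succ_self m))) hp
    exact ⟨⟨q, h1⟩, h2⟩
  choose q hq using hm
  have : Nonempty (Set.Iio p0) := ⟨⟨p, hp⟩⟩
  obtain ⟨P, hP⟩ := Finite.exists_le q
  obtain ⟨a1, p1, h1, -, h2, h3, h4⟩ := hC.exists_unit he P.2
  refine ⟨a1, p1, h1, h3, h4, fun N hN => ?_⟩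
  obtain ⟨A, hA0, hA, -, hAN⟩ := hN
  by_contra hlt
  have hstep : ∀ m < n, F (E m).1 p0 ≤ F (E (m + 1)).1 p1 := fun m hm =>
    (hq ⟨m, hm⟩).le.trans ((hC.m2 _).monotone ((show (q ⟨m, hm⟩).1 ≤ P.1 from hP _).trans h2.le))
  have hle : ∀ m ≤ N, A m ≤ (E m).1 := by
    intro m hmN
    induction m with
    | zero => rw [hA0]; exact hC.bot _
    | succ m ih =>
      refine (hC.m1 p1).le_iff_le.1 ?_
      rw [hA m (by omega)]
      exact ((hC.m1 p0).monotone (ih (by omega))).trans (hstep m (by omega))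
  exact hAN.not_ge (((hC.m1 p0).monotone (hle N le_rfl)).trans
    ((hstep N (by omega)).trans ((hC.m1 p1).monotone (E (N + 1)).2.2.le)))

open Filter Topology in
-- For finer and finer units, the counts divided by the count of `e` converge along an ultrafilter.
-- The error of one step in `count_le` tends to `0`, but strictness may be lost in the limit, so
-- only one implication results.
theorem exists_weak_rep [DenselyOrdered α] [DenselyOrdered β] (hC : Corner F a0 p0) {e : α} {p : β}
    (he : a0 < e) (hp : p < p0) (hu : F e p = F a0 p0) :
    ∃ (f : α → ℝ) (g : β → ℝ), f a0 = 0 ∧ f e = 1 ∧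
      ∀ a p b q, F a p ≤ F b q → f a + g p ≤ f b + g q := by
  choose a1 p1 ha hpp hunit hfine using hC.exists_fine_unit he hp
  choose c hc using fun n => hC.exists_count1 (hpp n)
  choose d hd using fun n => hC.exists_count2 (ha n)
  have hle : ∀ n {a b p q}, F a p ≤ F b q → c n a + d n q ≤ c n b + d n p + 1 := fun n a b p q h =>
    hC.count_le (ha n) (hpp n) (hunit n) (hc n a) (hc n b) (hd n p) (hd n q) h
  have hc0 : ∀ n, c n a0 = 0 := fun n => hC.count1_bot (hpp n) (hc n a0)
  have hd0 : ∀ n, d n p0 = 0 := fun n => hC.count2_top (ha n) (hd n p0)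
  have hN : ∀ n, n ≤ c n e := fun n => hfine n _ (hc n e)
  have hdp : ∀ n, d n p ≤ c n e + 1 := fun n => by
    have := hle n hu.ge
    rw [hc0, hd0] at this
    omega
  -- A count with the fixed coarse unit bounds the ratios uniformly in the fineness.
  have hbc : ∀ a, ∃ K, ∀ n, c n a ≤ K * (c n e + 2) := by
    intro a
    obtain ⟨K, A, hA0, hA, hA1, hA2⟩ := hC.exists_count1 hp a
    have hr : ∀ r ≤ K, ∀ n, c n (A r) ≤ r * (c n e + 2) := by
      intro r hr n
      induction r with
      | zero => rw [hA0, hc0]; omega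
      | succ r ih =>
        have h1 := hle n (hA r (by omega)).le
        rw [hd0] at h1
        have := ih (by omega)
        have := hdp n
        rw [Nat.succ_mul]
        omega
    refine ⟨K + 1, fun n => ?_⟩
    have h1 := hle n hA2.le
    rw [hd0] at h1
    have := hr K le_rfl n
    have := hdp n
    rw [Nat.succ_mul]
    omega
  have hbd : ∀ q, ∃ K, ∀ n, d n q ≤ K * (c n e + 2) := by
    intro q
    obtain ⟨K, B, hB0, hB, hB1, hB2⟩ := hC.exists_count2 he q
    have hr : ∀ r ≤ K, ∀ n, d n (B r) ≤ r * (c n e + 2) := by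
      intro r hr n
      induction r with
      | zero => rw [hB0, hd0]; omega
      | succ r ih =>
        have h1 := hle n (hB r (by omega)).ge
        rw [hc0] at h1
        have := ih (by omega)
        rw [Nat.succ_mul]
        omega
    refine ⟨K + 1, fun n => ?_⟩
    have h1 := hle n hB2.le
    rw [hc0] at h1
    have := hr K le_rfl n
    rw [Nat.succ_mul]
    omega
  have hf : ∀ a, ∃ x, Tendsto (fun n => (c n a : ℝ) / c n e) (hyperfilter ℕ) (𝓝 x) := fun a => by
    obtain ⟨K, hK⟩ := hbc a
    exact exists_ultralimit (fun n => by positivity) fun n => div_le_of_le_mul_add (hK n)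
  have hg : ∀ q, ∃ x, Tendsto (fun n => (d n q : ℝ) / c n e) (hyperfilter ℕ) (𝓝 x) := fun q => by
    obtain ⟨K, hK⟩ := hbd q
    exact exists_ultralimit (fun n => by positivity) fun n => div_le_of_le_mul_add (hK n)
  choose f hf using hf
  choose g hg using hg
  have hinf : Tendsto (fun n => 1 / (c n e : ℝ)) (hyperfilter ℕ) (𝓝 0) := by
    refine (tendsto_const_nhds.div_atTop ?_).mono_left Nat.hyperfilter_le_atTop
    exact tendsto_natCast_atTop_atTop.comp (tendsto_atTop_mono hN tendsto_id)
  -- Steps on the second coordinate are counted downwards, hence the sign.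
  refine ⟨f, fun q => - g q, ?_, ?_, fun a p b q h => ?_⟩
  · refine tendsto_nhds_unique (hf a0) ?_
    simp [hc0]
  · refine tendsto_nhds_unique (hf e) (tendsto_const_nhds.congr' ?_)
    refine Nat.hyperfilter_le_atTop ((eventually_ge_atTop 1).mono fun n hn => ?_)
    have : (c n e : ℝ) ≠ 0 := by have := hN n; exact_mod_cast (by omega : c n e ≠ 0)
    exact (div_self this).symm
  · have := le_of_tendsto_of_tendsto' ((hf a).add (hg q)) (((hf b).add (hg p)).add hinf) fun n => by
      rw [← add_div, ← add_div, ← add_div]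
      exact div_le_div_of_nonneg_right (by exact_mod_cast hle n h) (Nat.cast_nonneg _)
    linarith

/-- Additive representation on a corner. -/
theorem exists_rep [DenselyOrdered α] [DenselyOrdered β] [NoMaxOrder α] (hC : Corner F a0 p0)
    (hβ : ∃ p, p < p0) :
    ∃ (f : α → ℝ) (g : β → ℝ), ∀ a p b q, F a p ≤ F b q ↔ f a + g p ≤ f b + g q := by
  obtain ⟨e', he'⟩ := exists_gt a0
  obtain ⟨p', hp'⟩ := hβ
  obtain ⟨e, p, he, -, -, hp, hu⟩ := hC.exists_unit he' hp'
  obtain ⟨f, g, hf0, hf1, h⟩ := hC.exists_weak_rep he hp hu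
  have heq : ∀ {a p b q}, F a p = F b q → f a + g p = f b + g q := fun h' =>
    le_antisymm (h _ _ _ _ h'.le) (h _ _ _ _ h'.ge)
  -- Finitely many steps of the size of `x` pass `e`, where `f` is `1`, so such a step has positive
  -- length.
  have hpos : ∀ {x q}, a0 < x → q < p0 → F x q = F a0 p0 → 0 < f x := by
    intro x q hx hq hxq
    obtain ⟨N, A, hA0, hA, -, hA2⟩ := hC.exists_count1 hq e
    have e1 := heq hxq
    have hr : ∀ r ≤ N, f (A r) = r * f x := by
      intro r hr
      induction r with
      | zero => rw [hA0, hf0]; simp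
      | succ r ih =>
        have := ih (by omega)
        have := heq (hA r (by omega))
        push_cast
        linarith
    have h1 := h _ _ _ _ hA2.le
    rw [hr N le_rfl] at h1
    by_contra hneg
    have : (N + 1 : ℝ) * f x ≤ 0 := mul_nonpos_of_nonneg_of_nonpos (by positivity) (not_lt.1 hneg)
    linarith
  have hmono : StrictMono f := by
    intro a a' haa
    obtain ⟨q, -, hq, hlt⟩ := hC.toPlane.dn2 (hC.m1 p0 haa) hp'
    obtain ⟨x, y, hx, -, hy1, hy2, hxy⟩ := hC.exists_unit he' hq
    have h1 := h _ _ _ _ (hlt.le.trans ((hC.m2 a').monotone hy1.le))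
    have h2 := heq hxy
    have h3 := hpos hx hy2 hxy
    linarith
  refine ⟨f, g, fun a p b q => ⟨h a p b q, fun hle => not_lt.1 fun hlt => ?_⟩⟩
  -- A strict preference leaves room to raise `b`, and raising it strictly increases `f`.
  obtain ⟨e2, he2⟩ := exists_gt b
  obtain ⟨c, h1, -, h2⟩ := hC.toPlane.up1 hlt he2
  have := h _ _ _ _ h2.le
  have := hmono h1
  linarith

end Corner
end Conjoint

/-! ### Proportional scales and representations on regions -/

namespace Conjoint

/-- Pairs of lengths with common arbitrarily fine counts are proportional. -/
theorem cross_eq_of_counts {B C B' C' : ℝ} (hB0 : 0 ≤ B) (hC0 : 0 ≤ C) (hB0' : 0 ≤ B') (hC0' : 0 ≤ C')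
    (H : ∀ ε : ℝ, 0 < ε → ∃ (m N : ℕ) (δ δ' : ℝ), 0 < δ ∧ δ < ε ∧ 0 < δ' ∧ δ' < ε ∧
      (m * δ ≤ B ∧ m * δ' ≤ B') ∧ (B ≤ (m + 1) * δ ∧ B' ≤ (m + 1) * δ') ∧
      (N * δ ≤ C ∧ N * δ' ≤ C') ∧ (C ≤ (N + 1) * δ ∧ C' ≤ (N + 1) * δ')) : B * C' = B' * C := by
  -- Both products lie between `m * N * δ * δ'` and `(m + 1) * (N + 1) * δ * δ'`, and these bounds
  -- differ by a quantity of order `ε`.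
  have key : ∀ ε : ℝ, 0 < ε → ε ≤ 1 → |B * C' - B' * C| ≤ (B + C + B' + C' + 1) * ε := by
    intro ε hε hε1
    obtain ⟨m, N, δ, δ', hδ, hδε, hδ', hδε', hm1, hm2, hn1, hn2⟩ := H ε hε
    have u1 : B * C' ≤ ((m + 1) * δ) * ((N + 1) * δ') := mul_le_mul hm2.1 hn2.2 hC0' (by positivity)
    have u2 : (m * δ') * (N * δ) ≤ B' * C := mul_le_mul hm1.2 hn1.1 (by positivity) hB0'
    have v1 : B' * C ≤ ((m + 1) * δ') * ((N + 1) * δ) := mul_le_mul hm2.2 hn2.1 hC0 (by positivity)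
    have v2 : (m * δ) * (N * δ') ≤ B * C' := mul_le_mul hm1.1 hn1.2 (by positivity) hB0
    have w1 : (m * δ) * δ' ≤ B * ε := mul_le_mul hm1.1 hδε'.le hδ'.le hB0
    have w2 : (N * δ) * δ' ≤ C * ε := mul_le_mul hn1.1 hδε'.le hδ'.le hC0
    have w3 : δ * δ' ≤ 1 * ε := mul_le_mul (hδε.le.trans hε1) hδε'.le hδ'.le zero_le_one
    have w4 : 0 ≤ B' * ε := by positivity
    have w5 : 0 ≤ C' * ε := by positivity
    rw [abs_le]
    constructor <;> nlinarith
  by_contra hne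
  have hpos : 0 < |B * C' - B' * C| := abs_pos.2 (sub_ne_zero.2 hne)
  set Z := B + C + B' + C' + 1 with hZ
  have hZ1 : 1 ≤ Z := by rw [hZ]; linarith
  have h1 := key (min 1 (|B * C' - B' * C| / (2 * Z))) (lt_min one_pos (by positivity)) (min_le_left _ _)
  have h2 : Z * min 1 (|B * C' - B' * C| / (2 * Z)) ≤ Z * (|B * C' - B' * C| / (2 * Z)) := by
    gcongr
    exact min_le_right _ _
  have h3 : Z * (|B * C' - B' * C| / (2 * Z)) = |B * C' - B' * C| / 2 := by field_simp
  linarith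

/-- Two functions with common arbitrarily fine standard sequences have proportional increments. -/
theorem cross_eq_of_fine {A : Type*} [LinearOrder A] {f h : A → ℝ} {a b c : A} (hab : a ≤ b)
    (hbc : b ≤ c) (hf : MonotoneOn f (Set.Icc a c)) (hh : MonotoneOn h (Set.Icc a c))
    (H : ∀ ε : ℝ, 0 < ε → ∃ (N : ℕ) (s : ℕ → A) (δ δ' : ℝ), 0 < δ ∧ δ < ε ∧ 0 < δ' ∧ δ' < ε ∧ s 0 = a ∧
      (∀ r < N, s r ≤ s (r + 1) ∧ f (s (r + 1)) = f (s r) + δ ∧ h (s (r + 1)) = h (s r) + δ') ∧ s N ≤ c ∧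
      f c ≤ f (s N) + δ ∧ h c ≤ h (s N) + δ') :
    (f b - f a) * (h c - h a) = (h b - h a) * (f c - f a) := by
  set B := f b - f a with hB
  set C := f c - f a with hC
  set B' := h b - h a with hB'
  set C' := h c - h a with hC'
  have ma : a ∈ Set.Icc a c := ⟨le_rfl, hab.trans hbc⟩
  have mb : b ∈ Set.Icc a c := ⟨hab, hbc⟩
  have mc : c ∈ Set.Icc a c := ⟨hab.trans hbc, le_rfl⟩
  have hB0 : 0 ≤ B := sub_nonneg.2 (hf ma mb hab)
  have hC0 : 0 ≤ C := sub_nonneg.2 (hf ma mc (hab.trans hbc))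
  have hB0' : 0 ≤ B' := sub_nonneg.2 (hh ma mb hab)
  have hC0' : 0 ≤ C' := sub_nonneg.2 (hh ma mc (hab.trans hbc))
  refine cross_eq_of_counts hB0 hC0 hB0' hC0' fun ε hε => ?_
  · obtain ⟨N, s, δ, δ', hδ, hδε, hδ', hδε', hs0, hs, hsN, hfc, hhc⟩ := H ε hε
    have hsm : ∀ r t, r ≤ t → t ≤ N → s r ≤ s t := by
      intro r t hrt ht
      induction t, hrt using Nat.le_induction with
      | base => exact le_rfl
      | succ t _ ih => exact (ih (by omega)).trans (hs t (by omega)).1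
    have hsa : ∀ r ≤ N, s r ∈ Set.Icc a c := fun r hr =>
      ⟨hs0 ▸ hsm 0 r (Nat.zero_le _) hr, (hsm r N hr le_rfl).trans hsN⟩
    have hv : ∀ r ≤ N, f (s r) = f a + r * δ ∧ h (s r) = h a + r * δ' := by
      intro r hr
      induction r with
      | zero => simp [hs0]
      | succ r ih =>
        obtain ⟨i1, i2⟩ := ih (by omega)
        rw [(hs r (by omega)).2.1, (hs r (by omega)).2.2, i1, i2]
        push_cast
        constructor <;> ring
    obtain ⟨m, hmN, hm, hm'⟩ : ∃ m ≤ N, s m ≤ b ∧ (m = N ∨ m < N ∧ b < s (m + 1)) := by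
      by_cases hb : s N ≤ b
      · exact ⟨N, le_rfl, hb, Or.inl rfl⟩
      · obtain ⟨m, h1, h2, h3⟩ := exists_floor s N b (hs0 ▸ hab) (not_le.1 hb)
        exact ⟨m, h1.le, h2, Or.inr ⟨h1, h3⟩⟩
    have hm1 : m * δ ≤ B ∧ m * δ' ≤ B' := by
      have h1 := hf (hsa m hmN) mb hm
      have h2 := hh (hsa m hmN) mb hm
      rw [(hv m hmN).1] at h1
      rw [(hv m hmN).2] at h2
      constructor <;> linarith
    have hm2 : B ≤ (m + 1) * δ ∧ B' ≤ (m + 1) * δ' := by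
      rcases hm' with rfl | ⟨hlt, hb⟩
      · have h1 := hf mb mc hbc
        have h2 := hh mb mc hbc
        rw [(hv m le_rfl).1] at hfc
        rw [(hv m le_rfl).2] at hhc
        constructor <;> linarith
      · have h1 := hf mb (hsa _ hlt) hb.le
        have h2 := hh mb (hsa _ hlt) hb.le
        rw [(hv _ hlt).1] at h1
        rw [(hv _ hlt).2] at h2
        push_cast at h1 h2
        constructor <;> linarith
    have hn1 : N * δ ≤ C ∧ N * δ' ≤ C' := by
      have h1 := hf (hsa N le_rfl) mc hsN
      have h2 := hh (hsa N le_rfl) mc hsN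
      rw [(hv N le_rfl).1] at h1
      rw [(hv N le_rfl).2] at h2
      constructor <;> linarith
    have hn2 : C ≤ (N + 1) * δ ∧ C' ≤ (N + 1) * δ' := by
      rw [(hv N le_rfl).1] at hfc
      rw [(hv N le_rfl).2] at hhc
      constructor <;> linarith
    exact ⟨m, N, δ, δ', hδ, hδε, hδ', hδε', hm1, hm2, hn1, hn2⟩

/-- All intervals are compared through one interval `[m, M]` containing them. -/
theorem exists_ratio {A : Type*} [LinearOrder A] {f h : A → ℝ} {X : Set A} [X.OrdConnected]
    (hf : StrictMonoOn f X) (hh : StrictMonoOn h X)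
    (H : ∀ a ∈ X, ∀ b, ∀ c ∈ X, a ≤ b → b ≤ c → (f b - f a) * (h c - h a) = (h b - h a) * (f c - f a)) :
    ∃ ω : ℝ, 0 < ω ∧ ∀ a ∈ X, ∀ b ∈ X, h b - h a = ω * (f b - f a) := by
  by_cases hX : ∃ x ∈ X, ∃ y ∈ X, x < y
  · obtain ⟨x, hx, y, hy, hxy⟩ := hX
    have hfxy := sub_pos.2 (hf hx hy hxy)
    have hhxy := sub_pos.2 (hh hx hy hxy)
    refine ⟨(h y - h x) / (f y - f x), by positivity, fun a ha b hb => ?_⟩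
    obtain ⟨m, hm, m1, m2, m3, m4⟩ : ∃ m ∈ X, m ≤ x ∧ m ≤ y ∧ m ≤ a ∧ m ≤ b := by
      refine ⟨min x (min a b), ?_, min_le_left _ _, (min_le_left _ _).trans hxy.le,
        (min_le_right _ _).trans (min_le_left _ _), (min_le_right _ _).trans (min_le_right _ _)⟩
      rcases min_choice x (min a b) with h | h <;> rw [h]
      · exact hx
      · rcases min_choice a b with h | h <;> rw [h] <;> assumption
    obtain ⟨M, hM, M1, M2, M3, M4⟩ : ∃ m ∈ X, x ≤ m ∧ y ≤ m ∧ a ≤ m ∧ b ≤ m := by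
      refine ⟨max y (max a b), ?_, hxy.le.trans (le_max_left _ _), le_max_left _ _,
        (le_max_left _ _).trans (le_max_right _ _), (le_max_right _ _).trans (le_max_right _ _)⟩
      rcases max_choice y (max a b) with h | h <;> rw [h]
      · exact hy
      · rcases max_choice a b with h | h <;> rw [h] <;> assumption
    have e1 := H m hm x M hM m1 M1
    have e2 := H m hm y M hM m2 M2
    have e3 := H m hm a M hM m3 M3
    have e4 := H m hm b M hM m4 M4
    have hfM := sub_pos.2 (hf hm hM (m1.trans_lt (hxy.trans_le M2)))
    set P := f M - f m
    set Q := h M - h m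
    have k1 : (h y - h x) * P = (f y - f x) * Q := by linarith
    have k2 : (h b - h a) * P = (f b - f a) * Q := by linarith
    rw [div_mul_eq_mul_div, eq_div_iff hfxy.ne']
    have : ((h b - h a) * (f y - f x) - (h y - h x) * (f b - f a)) * P = 0 := by
      linear_combination (f y - f x) * k2 - (f b - f a) * k1
    rcases mul_eq_zero.1 this with h | h
    · linarith
    · exact absurd h hfM.ne'
  · push Not at hX
    refine ⟨1, one_pos, fun a ha b hb => ?_⟩
    rw [le_antisymm (hX b hb a ha) (hX a ha b hb)]
    ring

variable {α β L : Type*} [LinearOrder α] [LinearOrder β] [LinearOrder L] {F : α → β → L}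
  {D D' : α → β → Prop}

/-- A region, closed under increasing the first and decreasing the second coordinate, on which
triple cancellation and the Archimedean property hold. -/
structure Region (F : α → β → L) (D : α → β → Prop) : Prop extends Plane F where
  up : ∀ {a a' p p'}, D a p → a ≤ a' → p' ≤ p → D a' p'
  tc : ∀ {a b c d : α} {P Q R S : β}, D a P → D b Q → D b S → D a R → D d Q → D c P → D d S → D c R →
    F a P ≤ F b Q → F b S ≤ F a R → F d Q ≤ F c P → F d S ≤ F c R
  arch1 : ∀ {k0 k1 : β} {hi : α}, k0 < k1 →
    ¬ ∃ h : ℕ → α, D (h 0) k1 ∧ (∀ t, h t ≤ hi) ∧ ∀ t, F (h (t + 1)) k0 = F (h t) k1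
  arch2 : ∀ {k0 k1 : α} {lo : β}, k0 < k1 →
    ¬ ∃ h : ℕ → β, D k0 (h 0) ∧ (∀ t, lo ≤ h t) ∧ ∀ t, F k1 (h (t + 1)) = F k0 (h t)

/-- Additive representation on a region. -/
def RegRep (F : α → β → L) (D : α → β → Prop) (f : α → ℝ) (g : β → ℝ) : Prop :=
  ∀ {a p b q}, D a p → D b q → (F a p ≤ F b q ↔ f a + g p ≤ f b + g q)

theorem RegRep.lt {f : α → ℝ} {g : β → ℝ} (h : RegRep F D f g) {a p b q} (h1 : D a p) (h2 : D b q) :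
    F a p < F b q ↔ f a + g p < f b + g q := by
  rw [← not_le, ← not_le, h h2 h1]

theorem RegRep.eq {f : α → ℝ} {g : β → ℝ} (h : RegRep F D f g) {a p b q} (h1 : D a p) (h2 : D b q) :
    F a p = F b q ↔ f a + g p = f b + g q := by
  rw [le_antisymm_iff, le_antisymm_iff, h h1 h2, h h2 h1]

namespace Region

theorem mono (hR : Region F D) (hD : ∀ a p, D' a p → D a p)
    (hup : ∀ {a a' p p'}, D' a p → a ≤ a' → p' ≤ p → D' a' p') : Region F D' where
  toPlane := hR.toPlane
  up := hup
  tc h1 h2 h3 h4 h5 h6 h7 h8 := hR.tc (hD _ _ h1) (hD _ _ h2) (hD _ _ h3) (hD _ _ h4) (hD _ _ h5)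
    (hD _ _ h6) (hD _ _ h7) (hD _ _ h8)
  arch1 hk := fun ⟨h, h1, h2⟩ => hR.arch1 hk ⟨h, hD _ _ h1, h2⟩
  arch2 hk := fun ⟨h, h1, h2⟩ => hR.arch2 hk ⟨h, hD _ _ h1, h2⟩

/-- The quadrant at a point of a region. -/
theorem quadrant (hR : Region F D) {z : α} {q : β} (h : D z q) :
    Region F fun a p => z ≤ a ∧ p ≤ q :=
  hR.mono (fun _ _ h' => hR.up h h'.1 h'.2) fun h1 h2 h3 => ⟨h1.1.trans h2, h3.trans h1.2⟩

theorem corner (hR : Region F D) {z : α} {q : β} (h : D z q) :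
    Corner (fun (a : Set.Ici z) (p : Set.Iic q) => F a p) ⟨z, le_rfl⟩ ⟨q, le_rfl⟩ where
  toPlane := hR.toPlane.restrict (Set.Ici z) (Set.Iic q)
  bot a := a.2
  top p := p.2
  tc {a b c d P Q R S} := hR.tc (hR.up h a.2 P.2) (hR.up h b.2 Q.2) (hR.up h b.2 S.2) (hR.up h a.2 R.2)
    (hR.up h d.2 Q.2) (hR.up h c.2 P.2) (hR.up h d.2 S.2) (hR.up h c.2 R.2)
  arch1 {k0 k1 hi} hk := fun ⟨s, h1, h2⟩ => hR.arch1 (k0 := k0.1) (k1 := k1.1) (hi := hi.1) hk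
    ⟨fun t => (s t).1, hR.up h (s 0).2 k1.2, fun t => h1 t, h2⟩
  arch2 {k0 k1 lo} hk := fun ⟨s, h1, h2⟩ => hR.arch2 (k0 := k0.1) (k1 := k1.1) (lo := lo.1) hk
    ⟨fun t => (s t).1, hR.up h k0.2 (s 0).2, fun t => h1 t, h2⟩

theorem exists_quadrant_rep [DenselyOrdered α] [DenselyOrdered β] [NoMaxOrder α] [NoMinOrder β]
    (hR : Region F D) {z : α} {q : β} (h : D z q) :
    ∃ (f : α → ℝ) (g : β → ℝ), RegRep F (fun a p => z ≤ a ∧ p ≤ q) f g := by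
  classical
  obtain ⟨p, hp⟩ := exists_lt q
  obtain ⟨f, g, hfg⟩ := (hR.corner h).exists_rep ⟨⟨p, hp.le⟩, hp⟩
  refine ⟨fun a => if h : a ∈ Set.Ici z then f ⟨a, h⟩ else 0, fun p => if h : p ∈ Set.Iic q then g ⟨p, h⟩ else 0,
    fun {a p b r} h1 h2 => ?_⟩
  beta_reduce
  rw [dif_pos (Set.mem_Ici.2 h1.1), dif_pos (Set.mem_Iic.2 h1.2), dif_pos (Set.mem_Ici.2 h2.1), dif_pos (Set.mem_Iic.2 h2.2)]
  exact hfg ⟨a, h1.1⟩ ⟨p, h1.2⟩ ⟨b, h2.1⟩ ⟨r, h2.2⟩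

variable {f f' : α → ℝ} {g g' : β → ℝ}

theorem rep_strictMono1 (hR : Region F D) (h : RegRep F D f g) {a b : α} {p : β} (hD : D a p)
    (hab : a < b) : f a < f b := by
  have := (h.lt hD (hR.up hD hab.le le_rfl)).1 (hR.m1 p hab)
  linarith

theorem rep_strictMono2 (hR : Region F D) (h : RegRep F D f g) {a : α} {p q : β} (hD : D a q)
    (hpq : p < q) : g p < g q := by
  have := (h.lt (hR.up hD le_rfl hpq.le) hD).1 (hR.m2 a hpq)
  linarith

/-- Arbitrarily small steps. -/
theorem exists_small_step [DenselyOrdered α] [DenselyOrdered β] [NoMinOrder β] (hR : Region F D)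
    (h : RegRep F D f g) {a e : α} {p : β} (hD : D a p) (he : a < e) {ε : ℝ} (hε : 0 < ε) :
    ∃ a1 p1 p0, a < a1 ∧ a1 ≤ e ∧ p1 < p0 ∧ p0 ≤ p ∧ F a1 p1 = F a p0 ∧ f a1 - f a < ε := by
  obtain ⟨p', hp'⟩ := exists_lt p
  obtain ⟨x, hx⟩ := exists_between hp'
  have : Nonempty (Set.Ioo p' p) := ⟨⟨x, hx⟩⟩
  obtain ⟨E, hE⟩ := Nat.exists_strictMono (Set.Ioo p' p)
  obtain ⟨K, hK⟩ := exists_nat_gt ((g p - g (E 0)) / min ε (f e - f a))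
  have hef : 0 < f e - f a := sub_pos.2 (hR.rep_strictMono1 h hD he)
  have hmin : 0 < min ε (f e - f a) := lt_min hε hef
  rw [div_lt_iff₀ hmin] at hK
  -- Increments of `g` along an increasing sequence below `p` cannot all exceed a fixed positive
  -- bound. The term `f e - f a` in the bound makes the step solvable below `e`.
  obtain ⟨m, hm⟩ : ∃ m, g (E (m + 1)) - g (E m) < min ε (f e - f a) := by
    by_contra hc
    push Not at hc
    have : ∀ m : ℕ, g (E 0) + m * min ε (f e - f a) ≤ g (E m) := by
      intro m
      induction m with
      | zero => simp
      | succ m ih =>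
        have := hc m
        push_cast
        linarith
    have h1 := this K
    have h2 := hR.rep_strictMono2 h hD (E K).2.2
    linarith
  have hEm : (E m).1 < (E (m + 1)).1 := hE (Nat.lt_succ_self m)
  have d1 : ∀ b q, a ≤ b → q < p → D b q := fun b q h1 h2 => hR.up hD h1 h2.le
  have e1 := (E m).2.2
  have e2 := (E (m + 1)).2.2
  have h1 : F a (E (m + 1)).1 ≤ F e (E m).1 := (h (d1 _ _ le_rfl e2) (d1 _ _ he.le e1)).2 (by
    have := hm.trans_le (min_le_right _ _)
    linarith)
  obtain ⟨a1, ha1⟩ := hR.s1 (hR.m2 a hEm).le h1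
  have l1 : a < a1 := (hR.m1 (E m).1).lt_iff_lt.1 (by rw [ha1]; exact hR.m2 a hEm)
  refine ⟨a1, E m, E (m + 1), l1, (hR.m1 (E m).1).le_iff_le.1 (by rwa [ha1]), hEm, e2.le, ha1, ?_⟩
  have := (h.eq (d1 _ _ l1.le e1) (d1 _ _ le_rfl e2)).1 ha1
  have := hm.trans_le (min_le_left _ _)
  linarith

theorem exists_region_steps (hR : Region F D) {a c : α} {p1 p0 : β} (hD : D a p0) (hp : p1 < p0) (hac : a ≤ c) :
    ∃ (N : ℕ) (s : ℕ → α), s 0 = a ∧ (∀ r < N, F (s (r + 1)) p1 = F (s r) p0) ∧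
        (∀ r ≤ N, a ≤ s r ∧ s r ≤ c) ∧ F c p1 < F (s N) p0 := by
  obtain ⟨N, s, s0, s1, s2, s3⟩ := hR.toPlane.exists_steps hp hac (by
    rintro ⟨s, s0, s1, s2⟩
    exact hR.arch1 hp ⟨s, s0 ▸ hD, s1, s2⟩)
  refine ⟨N, s, s0, s1, fun r hr => ⟨?_, s2 r hr⟩, s3⟩
  induction r with
  | zero => exact s0.ge
  | succ r ih =>
    refine (ih (by omega)).trans ((hR.m1 p1).le_iff_le.1 ?_)
    rw [s1 r (by omega)]
    exact (hR.m2 _ hp).le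

/-- Fine standard sequences. -/
theorem exists_fine_steps [DenselyOrdered α] [DenselyOrdered β] [NoMinOrder β] (hR : Region F D)
    (h : RegRep F D f g) {a e c : α} {p : β} (hD : D a p) (he : a < e) (hac : a ≤ c) {ε : ℝ} (hε : 0 < ε) :
    ∃ a1 p1 p0, a < a1 ∧ a1 ≤ e ∧ p1 < p0 ∧ p0 ≤ p ∧ F a1 p1 = F a p0 ∧ f a1 - f a < ε ∧
      ∃ (N : ℕ) (s : ℕ → α), s 0 = a ∧ (∀ r < N, F (s (r + 1)) p1 = F (s r) p0) ∧
        (∀ r ≤ N, a ≤ s r ∧ s r ≤ c) ∧ F c p1 < F (s N) p0 := by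
  obtain ⟨a1, p1, p0, h1, h2, h3, h4, h5, h6⟩ := hR.exists_small_step h hD he hε
  exact ⟨a1, p1, p0, h1, h2, h3, h4, h5, h6, hR.exists_region_steps (hR.up hD le_rfl h4) h3 hac⟩

/-- A function which is right-continuous and increases by equal amounts along standard sequences is
proportional to the representing function. -/
theorem cross_eq [DenselyOrdered α] [DenselyOrdered β] [NoMinOrder β] (hR : Region F D)
    (h : RegRep F D f g) {a b c : α} {p : β} (hD : D a p) (hab : a ≤ b) (hbc : b ≤ c) {φ : α → ℝ}
    (hφ : StrictMonoOn φ (Set.Icc a c))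
    (hcont : a < c → ∀ ε : ℝ, 0 < ε → ∃ e, a < e ∧ e ≤ c ∧ φ e - φ a < ε)
    (hstep : ∀ e, a < e → e ≤ c → ∃ e' ≤ e, a < e' ∧ ∃ p' ≤ p, ∀ a1 p1 p0 x y, a < a1 → a1 ≤ e' → p1 < p0 → p0 ≤ p' →
      F a1 p1 = F a p0 → a ≤ x → x ≤ c → a ≤ y → y ≤ c → (F y p1 ≤ F x p0 → φ y - φ x ≤ φ a1 - φ a) ∧
      (F x p0 ≤ F y p1 → φ a1 - φ a ≤ φ y - φ x)) :
    (f b - f a) * (φ c - φ a) = (φ b - φ a) * (f c - f a) := by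
  rcases hab.lt_or_eq with hab' | rfl
  swap
  · ring
  have hac := hab'.trans_le hbc
  have ma : a ∈ Set.Icc a c := ⟨le_rfl, hac.le⟩
  have hfm : StrictMonoOn f (Set.Ici a) := fun x hx y _ hxy =>
    hR.rep_strictMono1 h (hR.up hD hx le_rfl) hxy
  refine cross_eq_of_fine hab hbc (hfm.monotoneOn.mono Set.Icc_subset_Ici_self) hφ.monotoneOn fun ε hε => ?_
  obtain ⟨e, he, hec, hφe⟩ := hcont hac ε hε
  obtain ⟨e', hee', hae', p', hpp', hst⟩ := hstep e he hec
  obtain ⟨a1, p1, p0, k1, k2, k3, k4, k5, k6, N, s, s0, s1, s2, s3⟩ :=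
    hR.exists_fine_steps h (hR.up hD le_rfl hpp') hae' hac.le hε
  have hd : ∀ x q, a ≤ x → q ≤ p0 → D x q := fun x q h1 h2 => hR.up hD h1 (h2.trans (k4.trans hpp'))
  have m1 : a1 ∈ Set.Icc a c := ⟨k1.le, k2.trans (hee'.trans hec)⟩
  have hδ := (h.eq (hd _ _ k1.le k3.le) (hd _ _ le_rfl le_rfl)).1 k5
  refine ⟨N, s, f a1 - f a, φ a1 - φ a, sub_pos.2 (hfm Set.self_mem_Ici k1.le k1), k6,
    sub_pos.2 (hφ ma m1 k1), ?_, s0, fun r hr => ?_, (s2 N le_rfl).2, ?_, ?_⟩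
  · have := hφ.monotoneOn m1 ⟨he.le, hec⟩ (k2.trans hee')
    linarith
  · have i1 := s2 r hr.le
    have i2 := s2 (r + 1) hr
    have e1 := s1 r hr
    have e2 := (h.eq (hd _ _ i2.1 k3.le) (hd _ _ i1.1 le_rfl)).1 e1
    have e3 := hst a1 p1 p0 (s r) (s (r + 1)) k1 k2 k3 k4 k5 i1.1 i1.2 i2.1 i2.2
    refine ⟨(hR.m1 p1).le_iff_le.1 (by rw [e1]; exact (hR.m2 _ k3).le), by linarith, ?_⟩
    have := e3.1 e1.le
    have := e3.2 e1.ge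
    linarith
  · have i1 := s2 N le_rfl
    have := (h.lt (hd _ _ hac.le k3.le) (hd _ _ i1.1 le_rfl)).1 s3
    linarith
  · have i1 := s2 N le_rfl
    have := (hst a1 p1 p0 (s N) c k1 k2 k3 k4 k5 i1.1 i1.2 hac.le le_rfl).1 s3.le
    linarith

theorem rep_right_cont [DenselyOrdered α] [DenselyOrdered β] [NoMinOrder β] (hR : Region F D)
    (h : RegRep F D f g) {a c : α} {p : β} (hD : D a p) (hac : a < c) {ε : ℝ} (hε : 0 < ε) :
    ∃ e, a < e ∧ e ≤ c ∧ f e - f a < ε := by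
  obtain ⟨a1, -, -, h1, h2, -, -, -, h3⟩ := hR.exists_small_step h hD hac hε
  exact ⟨a1, h1, h2, h3⟩

theorem rep_right_cont2 [DenselyOrdered α] [DenselyOrdered β] [NoMinOrder β] [NoMaxOrder α] (hR : Region F D)
    (h : RegRep F D f g) {a : α} {p c : β} (hD : D a c) (hpc : p < c) {ε : ℝ} (hε : 0 < ε) :
    ∃ e, p < e ∧ e ≤ c ∧ g e - g p < ε := by
  obtain ⟨b, hb⟩ := exists_gt a
  obtain ⟨x, h1, -, h2⟩ := hR.rep_right_cont h hD hb hε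
  obtain ⟨e, h3, h4, h5⟩ := hR.toPlane.up2 (hR.m1 p h1) hpc
  have := (h.lt (hR.up hD le_rfl h4) (hR.up hD h1.le hpc.le)).1 h5
  exact ⟨e, h3, h4, by linarith⟩

/-- Uniqueness of the representation. -/
theorem rep_unique [DenselyOrdered α] [DenselyOrdered β] [NoMinOrder β] (hR : Region F D)
    (h : RegRep F D f g) (h' : RegRep F D f' g') : ∃ ω : ℝ, 0 < ω ∧
    (∀ a b p q, D a p → D b q → f' b - f' a = ω * (f b - f a)) := by
  have hX : Set.OrdConnected {a | ∃ p, D a p} := ⟨fun a ⟨p, hp⟩ b _ c hc => ⟨p, hR.up hp hc.1 le_rfl⟩⟩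
  have H : ∀ a ∈ {a | ∃ p, D a p}, ∀ b, ∀ c ∈ {a | ∃ p, D a p}, a ≤ b → b ≤ c →
      (f b - f a) * (f' c - f' a) = (f' b - f' a) * (f c - f a) := by
    rintro a ⟨p, hp⟩ b c - hab hbc
    refine hR.cross_eq h hp hab hbc (fun x hx y _ hxy => hR.rep_strictMono1 h' (hR.up hp hx.1 le_rfl) hxy)
      (fun hac ε hε => hR.rep_right_cont h' hp hac hε) fun e _ _ => ⟨e, le_rfl, ‹_›, p, le_rfl, ?_⟩
    intro a1 p1 p0 x y k1 _ k3 k4 k5 hx _ hy _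
    have hd : ∀ x q, a ≤ x → q ≤ p0 → D x q := fun x q h1 h2 => hR.up hp h1 (h2.trans k4)
    have e1 := (h'.eq (hd _ _ k1.le k3.le) (hd _ _ le_rfl le_rfl)).1 k5
    constructor
    · intro hle
      have := (h' (hd _ _ hy k3.le) (hd _ _ hx le_rfl)).1 hle
      linarith
    · intro hle
      have := (h' (hd _ _ hx le_rfl) (hd _ _ hy k3.le)).1 hle
      linarith
  obtain ⟨ω, h0, h1⟩ := exists_ratio (f := f) (h := f') (X := {a | ∃ p, D a p})
    (fun a ⟨p, hp⟩ b _ hab => hR.rep_strictMono1 h hp hab)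
    (fun a ⟨p, hp⟩ b _ hab => hR.rep_strictMono1 h' hp hab) H
  exact ⟨ω, h0, fun a b p q ha hb => h1 a ⟨p, ha⟩ b ⟨q, hb⟩⟩

/-- The second component is determined by the first. -/
theorem rep_unique_right [NoMaxOrder α] (hR : Region F D)
    (h : RegRep F D f g) (h' : RegRep F D f' g') {ω : ℝ}
    (hω : ∀ a b p q, D a p → D b q → f' b - f' a = ω * (f b - f a)) {a : α} {p q : β} (hD : D a p)
    (hqp : q ≤ p) : g' p - g' q = ω * (g p - g q) := by
  obtain ⟨e, he⟩ := exists_gt a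
  obtain ⟨N, s, s0, s1, s2, s3⟩ := hR.toPlane.exists_steps_down he hqp (by
    rintro ⟨s, s0, s1, s2⟩
    exact hR.arch2 he ⟨s, s0 ▸ hD, s1, s2⟩)
  have hsp : ∀ r ≤ N, s r ≤ p := by
    intro r hr
    induction r with
    | zero => exact s0.le
    | succ r ih =>
      refine le_trans ((hR.m2 e).le_iff_le.1 ?_) (ih (by omega))
      rw [s1 r (by omega)]
      exact (hR.m1 _ he).le
  have hd : ∀ x q, a ≤ x → q ≤ p → D x q := fun x q h1 h2 => hR.up hD h1 h2
  -- Each descending step is compensated by the increment from `a` to `e` and inherits its factor;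
  -- the remainder is compensated by the increment from `a` to `x`.
  have hr : ∀ r ≤ N, g' p - g' (s r) = ω * (g p - g (s r)) := by
    intro r hr
    induction r with
    | zero => rw [s0]; ring
    | succ r ih =>
      have e1 := s1 r (by omega)
      have e2 := (h.eq (hd _ _ he.le (hsp _ hr)) (hd _ _ le_rfl (hsp r (by omega)))).1 e1
      have e3 := (h'.eq (hd _ _ he.le (hsp _ hr)) (hd _ _ le_rfl (hsp r (by omega)))).1 e1
      have e4 := hω a e p p hD (hd _ _ he.le le_rfl)
      have e5 := ih (by omega)
      linear_combination e5 + e4 - e3 + ω * e2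
  have h1 := s2 N le_rfl
  obtain ⟨x, hx⟩ := hR.s1 ((hR.m2 a).monotone h1) s3.le
  have hax : a ≤ x := (hR.m1 q).le_iff_le.1 (by rw [hx]; exact (hR.m2 a).monotone h1)
  have e2 := (h.eq (hd _ _ hax hqp) (hd _ _ le_rfl (hsp N le_rfl))).1 hx
  have e3 := (h'.eq (hd _ _ hax hqp) (hd _ _ le_rfl (hsp N le_rfl))).1 hx
  have e4 := hω a x p p hD (hd _ _ hax le_rfl)
  have e5 := hr N le_rfl
  linear_combination e5 + e4 - e3 + ω * e2

/-- Additive representation on a region. -/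
theorem exists_rep [DenselyOrdered α] [DenselyOrdered β] [NoMaxOrder α] [NoMinOrder β]
    (hR : Region F D) {z0 : α} {q0 : β} (h0 : D z0 q0) :
    ∃ (f : α → ℝ) (g : β → ℝ), RegRep F D f g := by
  classical
  obtain ⟨f0, g0, hfg0⟩ := hR.exists_quadrant_rep h0
  -- two representations on quadrants, one normalised by the other
  have hcmp : ∀ {a a' p p'} {f f' : α → ℝ} {g g' : β → ℝ}, D a p → D a' p' →
      RegRep F (fun x y => a ≤ x ∧ y ≤ p) f g → RegRep F (fun x y => a' ≤ x ∧ y ≤ p') f' g' →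
      ∃ ω : ℝ, 0 < ω ∧ (∀ x y, max a a' ≤ x → max a a' ≤ y → f' y - f' x = ω * (f y - f x)) ∧
        ∀ x y, x ≤ min p p' → y ≤ min p p' → g' y - g' x = ω * (g y - g x) := by
    intro a a' p p' f f' g g' hD hD' h h'
    have hm : D (max a a') (min p p') := hR.up hD (le_max_left _ _) (min_le_left _ _)
    have hQ := hR.quadrant hm
    have k1 : RegRep F (fun x y => max a a' ≤ x ∧ y ≤ min p p') f g := fun k1 k2 =>
      h ⟨(le_max_left _ _).trans k1.1, k1.2.trans (min_le_left _ _)⟩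
        ⟨(le_max_left _ _).trans k2.1, k2.2.trans (min_le_left _ _)⟩
    have k2 : RegRep F (fun x y => max a a' ≤ x ∧ y ≤ min p p') f' g' := fun k1 k2 =>
      h' ⟨(le_max_right _ _).trans k1.1, k1.2.trans (min_le_right _ _)⟩
        ⟨(le_max_right _ _).trans k2.1, k2.2.trans (min_le_right _ _)⟩
    obtain ⟨ω, hω0, hω⟩ := hQ.rep_unique k1 k2
    have hg : ∀ x y, x ≤ y → y ≤ min p p' → g' y - g' x = ω * (g y - g x) := fun x y hxy hy =>
      hQ.rep_unique_right k1 k2 hω (a := max a a') ⟨le_rfl, hy⟩ hxy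
    refine ⟨ω, hω0, fun x y hx hy => hω x y _ _ ⟨hx, le_rfl⟩ ⟨hy, le_rfl⟩, fun x y hx hy => ?_⟩
    rcases le_total x y with h | h
    · exact hg x y h hy
    · linear_combination - hg y x h hx
  -- Every quadrant meets the reference quadrant at `(z0, q0)`, so its representation can be
  -- normalised on the overlap.
  have hN : ∀ z : {z : α × β // D z.1 z.2}, ∃ (f : α → ℝ) (g : β → ℝ),
      RegRep F (fun x y => z.1.1 ≤ x ∧ y ≤ z.1.2) f g ∧ (∀ x, max z0 z.1.1 ≤ x → f x = f0 x) ∧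
      ∀ y, y ≤ min q0 z.1.2 → g y = g0 y := by
    rintro ⟨⟨a, p⟩, hD⟩
    obtain ⟨f, g, hfg⟩ := hR.exists_quadrant_rep hD
    obtain ⟨ω, hω, h1, h2⟩ := hcmp h0 hD hfg0 hfg
    refine ⟨fun x => (f x - f (max z0 a)) / ω + f0 (max z0 a), fun y => (g y - g (min q0 p)) / ω + g0 (min q0 p),
      fun {x y x' y'} k1 k2 => ?_, fun x hx => ?_, fun y hy => ?_⟩
    · rw [hfg k1 k2]
      have e : ∀ u v w t : ℝ, (u - v) / ω + w + ((t - g (min q0 p)) / ω + g0 (min q0 p)) =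
          (u + t) / ω + (w + g0 (min q0 p) - (v + g (min q0 p)) / ω) := fun u v w t => by ring
      rw [e, e, add_le_add_iff_right, div_le_div_iff_of_pos_right hω]
    · have := h1 _ x le_rfl hx
      dsimp only
      rw [this]; field_simp; ring
    · have := h2 _ y le_rfl hy
      dsimp only
      rw [this]; field_simp; ring
  choose f g hfg hf hg using hN
  have hcons : ∀ z z' : {z : α × β // D z.1 z.2}, (∀ x, max z.1.1 z'.1.1 ≤ x → f z x = f z' x) ∧
      ∀ y, y ≤ min z.1.2 z'.1.2 → g z y = g z' y := by
    intro z z'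
    obtain ⟨ω, hω, h1, h2⟩ := hcmp z.2 z'.2 (hfg z) (hfg z')
    set M := max z0 (max z.1.1 z'.1.1) with hM
    have l1 : max z0 z.1.1 ≤ M := max_le_max le_rfl (le_max_left _ _)
    have l2 : max z0 z'.1.1 ≤ M := max_le_max le_rfl (le_max_right _ _)
    have l3 : max z.1.1 z'.1.1 ≤ M := le_max_right _ _
    obtain ⟨e, he⟩ := exists_gt M
    -- Both representations agree with `f0` far to the right, which fixes the factor.
    have hone : ω = 1 := by
      have e1 := h1 M e l3 (l3.trans he.le)
      rw [hf z M l1, hf z' M l2, hf z e (l1.trans he.le), hf z' e (l2.trans he.le)] at e1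
      have hpos : 0 < f0 e - f0 M := sub_pos.2 ((hR.quadrant h0).rep_strictMono1 hfg0 (p := q0)
        ⟨le_max_left _ _, le_rfl⟩ he)
      have : (ω - 1) * (f0 e - f0 M) = 0 := by linarith
      rcases mul_eq_zero.1 this with h | h
      · linarith
      · exact absurd h hpos.ne'
    subst hone
    constructor
    · intro x hx
      have := h1 x M hx l3
      rw [hf z M l1, hf z' M l2] at this
      linarith
    · intro y hy
      have := h2 y (min q0 (min z.1.2 z'.1.2)) hy (min_le_right _ _)
      rw [hg z _ (min_le_min le_rfl (min_le_left _ _)), hg z' _ (min_le_min le_rfl (min_le_right _ _))] at this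
      linarith
  -- Elements over which the region is empty receive the irrelevant value `0`.
  refine ⟨fun x => if h : ∃ z : {z : α × β // D z.1 z.2}, z.1.1 ≤ x then f h.choose x else 0,
    fun y => if h : ∃ z : {z : α × β // D z.1 z.2}, y ≤ z.1.2 then g h.choose y else 0, ?_⟩
  set f1 : α → ℝ := fun x => if h : ∃ z : {z : α × β // D z.1 z.2}, z.1.1 ≤ x then f h.choose x else 0 with hf1
  set g1 : β → ℝ := fun y => if h : ∃ z : {z : α × β // D z.1 z.2}, y ≤ z.1.2 then g h.choose y else 0 with hg1
  have hf2 : ∀ (z : {z : α × β // D z.1 z.2}) x, z.1.1 ≤ x → f1 x = f z x := by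
    intro z x hx
    have h : ∃ z : {z : α × β // D z.1 z.2}, z.1.1 ≤ x := ⟨z, hx⟩
    rw [hf1]
    dsimp only
    rw [dif_pos h]
    exact (hcons _ z).1 x (max_le h.choose_spec hx)
  have hg2 : ∀ (z : {z : α × β // D z.1 z.2}) y, y ≤ z.1.2 → g1 y = g z y := by
    intro z y hy
    have h : ∃ z : {z : α × β // D z.1 z.2}, y ≤ z.1.2 := ⟨z, hy⟩
    rw [hg1]
    dsimp only
    rw [dif_pos h]
    exact (hcons _ z).2 y (le_min h.choose_spec hy)
  have hq : ∀ z : {z : α × β // D z.1 z.2}, RegRep F (fun x y => z.1.1 ≤ x ∧ y ≤ z.1.2) f1 g1 := by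
    intro z a p b q k1 k2
    rw [hf2 z a k1.1, hf2 z b k2.1, hg2 z p k1.2, hg2 z q k2.2]
    exact hfg z k1 k2
  have hs1 : ∀ {a b p}, D a p → a < b → f1 a < f1 b := fun {a b p} hD hab =>
    (hR.quadrant hD).rep_strictMono1 (hq ⟨(a, p), hD⟩) (p := p) ⟨le_rfl, le_rfl⟩ hab
  have hs2 : ∀ {a p q}, D a q → p < q → g1 p < g1 q := fun {a p q} hD hpq =>
    (hR.quadrant hD).rep_strictMono2 (hq ⟨(a, q), hD⟩) (a := a) ⟨le_rfl, le_rfl⟩ hpq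
  intro a p b q h1 h2
  -- Two points of the region lie in a common quadrant inside it or are strictly ordered by
  -- monotonicity alone.
  rcases le_or_gt a b with hab | hab
  · rcases le_or_gt q p with hqp | hqp
    · exact hq ⟨(a, p), h1⟩ ⟨le_rfl, le_rfl⟩ ⟨hab, hqp⟩
    · rcases hab.lt_or_eq with hab | rfl
      · exact iff_of_true ((hR.m1 p hab).le.trans (hR.m2 b hqp).le) (by
          have := hs1 h1 hab
          have := hs2 h2 hqp
          linarith)
      · exact hq ⟨(a, q), h2⟩ ⟨le_rfl, hqp.le⟩ ⟨le_rfl, le_rfl⟩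
  · rcases le_or_gt p q with hpq | hpq
    · exact hq ⟨(b, q), h2⟩ ⟨hab.le, hpq⟩ ⟨le_rfl, le_rfl⟩
    · exact iff_of_false (not_le.2 ((hR.m1 q hab).trans (hR.m2 a hpq))) (by
        have := hs1 h2 hab
        have := hs2 h1 hpq
        linarith)

end Region
end Conjoint

/-! ### Two regions with common trade-offs -/

namespace Conjoint

variable {α β L : Type*} [LinearOrder α] [LinearOrder β] [LinearOrder L] {F : α → β → L}
  {SE NW : α → β → Prop}

/-- Two complementary regions with a common trade-off structure on each coordinate. -/
structure Cells (F : α → β → L) (SE NW : α → β → Prop) : Prop where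
  se : Region F SE
  nw : Region (fun p a => F a p) (fun p a => NW a p)
  cover : ∀ a p, SE a p ∨ NW a p
  mix1 : ∀ {a b c d : α} {x y w z : β}, SE a x → SE b y → SE c x → SE d y → NW a w → NW b z → NW c w →
    NW d z → F a x ≤ F b y → F b z ≤ F a w → F d y ≤ F c x → F d z ≤ F c w
  mix2 : ∀ {a b c d : β} {x y w z : α}, NW x a → NW y b → NW x c → NW y d → SE w a → SE z b → SE w c →
    SE z d → F x a ≤ F y b → F z b ≤ F w a → F y d ≤ F x c → F z d ≤ F w c

/-- Comparability of the levels of the two regions. -/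
def LevelTradeoff (F : α → β → L) (SE NW : α → β → Prop) : Prop :=
  ∀ {a b c d : α} {p q r s : β} {x y y0 y1 : β} {x0 x1 e f : α},
    SE a x → SE b y → SE c x → SE d y → SE a y0 → SE b y0 → SE c y1 → SE d y1 →
    NW x0 p → NW x0 q → NW x1 r → NW x1 s → NW e p → NW f q → NW e r → NW f s →
    F a x ≤ F b y → F d y ≤ F c x → F a y0 = F x0 p → F b y0 = F x0 q → F c y1 = F x1 r →
    F d y1 = F x1 s → F f q ≤ F e p → F f s ≤ F e r

namespace Cells

theorem swap (h : Cells F SE NW) : Cells (fun p a => F a p) (fun p a => NW a p) fun p a => SE a p where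
  se := h.nw
  nw := h.se
  cover p a := (h.cover a p).symm
  mix1 := h.mix2
  mix2 := h.mix1

variable [DenselyOrdered α] [DenselyOrdered β] [NoMaxOrder α] [NoMinOrder α] [NoMaxOrder β] [NoMinOrder β]
variable {f f' : α → ℝ} {g g' : β → ℝ}

/-- The representations on the two regions are proportional on a coordinate. -/
theorem exists_ratio (h : Cells F SE NW) (hf : RegRep F SE f g)
    (hf' : RegRep (fun p a => F a p) (fun p a => NW a p) g' f') :
    ∃ ω : ℝ, 0 < ω ∧ ∀ a b p q p' q', SE a p → NW a p' → SE b q → NW b q' → f' b - f' a = ω * (f b - f a) := by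
  set X : Set α := {a | (∃ p, SE a p) ∧ ∃ p, NW a p} with hX
  have hXc : X.OrdConnected := ⟨fun a ha c hc b hb => ⟨ha.1.imp fun p hp => h.se.up hp hb.1 le_rfl,
    hc.2.imp fun p hp => h.nw.up hp le_rfl hb.2⟩⟩
  have H : ∀ a ∈ X, ∀ b, ∀ c ∈ X, a ≤ b → b ≤ c →
      (f b - f a) * (f' c - f' a) = (f' b - f' a) * (f c - f a) := by
    rintro a ⟨⟨p, hp⟩, -⟩ b c ⟨-, q, hq⟩ hab hbc
    refine h.se.cross_eq hf hp hab hbc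
      (fun x _ y hy hxy => h.nw.rep_strictMono2 hf' (h.nw.up hq le_rfl hy.2) hxy)
      (fun hac ε hε => h.nw.rep_right_cont2 hf' hq hac hε) fun e hae hec => ?_
    obtain ⟨q0, hq0⟩ := exists_gt q
    obtain ⟨e', h1, h2, h3⟩ := h.se.toPlane.up1 (h.se.m2 a hq0) hae
    refine ⟨e', h2, h1, p, le_rfl, fun a1 p1 p0 x y k1 k2 k3 k4 k5 hx hx' hy hy' => ?_⟩
    have ds : ∀ {x q}, a ≤ x → q ≤ p0 → SE x q := fun k k' => h.se.up hp k (k'.trans k4)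
    have dn : ∀ {x r}, x ≤ c → q ≤ r → NW x r := fun k k' => h.nw.up hq k' k
    have ha1c := k2.trans (h2.trans hec)
    -- The increment from `a` to `a1` is compensated in `NW` by that from `q1` to `q0`. Via `mix1`
    -- these columns measure every further interval of the first coordinate, so steps that are equal
    -- in `SE` are equal in `NW`.
    obtain ⟨q1, hq1⟩ := h.se.s2 (((h.se.m1 q).monotone k2).trans h3.le) ((h.se.m1 q0).monotone k1.le)
    have hqq1 : q ≤ q1 := (h.se.m2 a1).le_iff_le.1 (by
      rw [hq1]; exact ((h.se.m1 q).monotone k2).trans h3.le)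
    have e1 := (hf'.eq (dn ha1c hqq1) (dn (hae.le.trans hec) hq0.le)).1 hq1
    constructor
    · intro hle
      have := h.mix1 (ds le_rfl le_rfl) (ds k1.le k3.le) (ds hx le_rfl) (ds hy k3.le)
        (dn (hae.le.trans hec) hq0.le) (dn ha1c hqq1) (dn hx' hq0.le) (dn hy' hqq1) k5.ge hq1.le hle
      have := (hf' (dn hy' hqq1) (dn hx' hq0.le)).1 this
      linarith
    · intro hle
      have := h.mix1 (ds k1.le k3.le) (ds le_rfl le_rfl) (ds hy k3.le) (ds hx le_rfl)
        (dn ha1c hqq1) (dn (hae.le.trans hec) hq0.le) (dn hy' hqq1) (dn hx' hq0.le) k5.le hq1.ge hle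
      have := (hf' (dn hx' hq0.le) (dn hy' hqq1)).1 this
      linarith
  obtain ⟨ω, h0, h1⟩ := Conjoint.exists_ratio (f := f) (h := f') (X := X)
    (fun a ha b _ hab => h.se.rep_strictMono1 hf ha.1.choose_spec hab)
    (fun a _ b hb hab => h.nw.rep_strictMono2 hf' hb.2.choose_spec hab) H
  exact ⟨ω, h0, fun a b p q p' q' k1 k2 k3 k4 => h1 a ⟨⟨p, k1⟩, p', k2⟩ b ⟨⟨q, k3⟩, q', k4⟩⟩

/-- Levels are matched at a constant rate along any two pairs of legs. -/
theorem two_legs (h : Cells F SE NW) (hl : LevelTradeoff F SE NW) (hf : RegRep F SE f g)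
    (hf' : RegRep (fun p a => F a p) (fun p a => NW a p) g' f')
    {a a' c c' x0 x1 : α} {p p' r r' y0 y1 : β} (ha : SE a y0) (haa : a < a') (hp : NW x0 p)
    (e1 : F a y0 = F x0 p) (e2 : F a' y0 = F x0 p')
    (hc : SE c y1) (hcc : c ≤ c') (hr : NW x1 r) (e3 : F c y1 = F x1 r) (e4 : F c' y1 = F x1 r') :
    (f a' - f a) * (g' r' - g' r) = (g' p' - g' p) * (f c' - f c) := by
  have hF := h.se.toPlane
  have hpp : p < p' := (hF.m2 x0).lt_iff_lt.1 (by rw [← e1, ← e2]; exact hF.m1 _ haa)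
  have hrr : r ≤ r' := (hF.m2 x1).le_iff_le.1 (by rw [← e3, ← e4]; exact (hF.m1 _).monotone hcc)
  have fm : ∀ {x y}, a ≤ x ∨ c ≤ x → x < y → f x < f y := fun hx hxy => by
    rcases hx with hx | hx
    · exact h.se.rep_strictMono1 hf (h.se.up ha hx le_rfl) hxy
    · exact h.se.rep_strictMono1 hf (h.se.up hc hx le_rfl) hxy
  have gm : ∀ {x y}, p ≤ x ∨ r ≤ x → x < y → g' x < g' y := fun hx hxy => by
    rcases hx with hx | hx
    · exact h.nw.rep_strictMono1 hf' (h.nw.up hp hx le_rfl) hxy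
    · exact h.nw.rep_strictMono1 hf' (h.nw.up hr hx le_rfl) hxy
  have fm' : ∀ {x y}, a ≤ x ∨ c ≤ x → x ≤ y → f x ≤ f y := fun hx hxy => by
    rcases hxy.lt_or_eq with h | rfl
    exacts [(fm hx h).le, le_rfl]
  have gm' : ∀ {x y}, p ≤ x ∨ r ≤ x → x ≤ y → g' x ≤ g' y := fun hx hxy => by
    rcases hxy.lt_or_eq with h | rfl
    exacts [(gm hx h).le, le_rfl]
  refine cross_eq_of_counts (sub_nonneg.2 (fm' (Or.inl le_rfl) haa.le)) (sub_nonneg.2 (fm' (Or.inr le_rfl) hcc))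
    (sub_nonneg.2 (gm' (Or.inl le_rfl) hpp.le)) (sub_nonneg.2 (gm' (Or.inr le_rfl) hrr)) fun ε hε => ?_
  set E := min x0 x1 with hE
  obtain ⟨E0, hE0⟩ := exists_lt E
  -- a small reference step on the second coordinate
  obtain ⟨ps, hps1, hps2, hps3⟩ := h.nw.rep_right_cont hf' hp hpp hε
  obtain ⟨ps', hps1', hps2', hps3'⟩ := hF.up2 (hF.m1 p hE0) hps1
  obtain ⟨as, has1, has2, has3⟩ := hF.up1 (e1.trans_lt (hF.m2 x0 hps1')) haa
  -- a small window
  obtain ⟨a1, w1, w0, k1, k2, k3, k4, k5, k6⟩ := h.se.exists_small_step hf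
    (h.se.up ha le_rfl (min_le_left y0 y1)) has1 hε
  have ds1 : ∀ {x w}, a ≤ x → w ≤ y0 → SE x w := fun k k' => h.se.up ha k k'
  have ds2 : ∀ {x w}, c ≤ x → w ≤ y1 → SE x w := fun k k' => h.se.up hc k k'
  have w00 : w0 ≤ y0 := k4.trans (min_le_left _ _)
  have w01 : w0 ≤ y1 := k4.trans (min_le_right _ _)
  have dn1 : ∀ {x q}, x ≤ x0 → p ≤ q → NW x q := fun k k' => h.nw.up hp k' k
  have dn2 : ∀ {x q}, x ≤ x1 → r ≤ q → NW x q := fun k k' => h.nw.up hr k' k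
  have Ex0 : E ≤ x0 := min_le_left _ _
  have Ex1 : E ≤ x1 := min_le_right _ _
  -- the matching step
  have hsolve : ∀ {x0 : α} {u u' b : α} {y : β} {q q' : β}, F u y = F x0 q → F u' y = F x0 q' → u ≤ b → b ≤ u' →
      ∃ t, F b y = F x0 t ∧ q ≤ t ∧ t ≤ q' := by
    intro x0 u u' b y q q' h1 h2 hb hb'
    obtain ⟨t, ht⟩ := hF.s2 (h1 ▸ (hF.m1 y).monotone hb) (h2 ▸ (hF.m1 y).monotone hb')
    exact ⟨t, ht.symm, (hF.m2 x0).le_iff_le.1 (by rw [ht, ← h1]; exact (hF.m1 y).monotone hb),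
      (hF.m2 x0).le_iff_le.1 (by rw [ht, ← h2]; exact (hF.m1 y).monotone hb')⟩
  obtain ⟨p1, hp1, hpp1, -⟩ := hsolve e1 e2 k1.le (k2.trans has2)
  have hp1s : p1 ≤ ps' := (hF.m2 x0).le_iff_le.1 (by rw [← hp1]; exact ((hF.m1 y0).monotone k2).trans has3.le)
  have hlt1 : p < p1 := (hF.m2 x0).lt_iff_lt.1 (by rw [← hp1, ← e1]; exact hF.m1 _ k1)
  -- The interval from `φ` to `E` converts the increment from `p` to `p1` into one of the first
  -- coordinate; it serves both legs, as `E` lies below `x0` and `x1`.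
  obtain ⟨φ, hφ⟩ := hF.s1 (p := p1) (a := E0) (e := E) (b := E) (q := p)
    (((hF.m2 E0).monotone hp1s).trans hps3'.le) ((hF.m2 E).monotone hlt1.le)
  have hφE : φ ≤ E := (hF.m1 p1).le_iff_le.1 (by rw [hφ]; exact (hF.m2 E).monotone hlt1.le)
  have hδ' := (hf'.eq (dn1 (hφE.trans Ex0) hpp1) (dn1 Ex0 le_rfl)).1 hφ
  have hδ := (hf.eq (ds1 k1.le (k3.le.trans w00)) (ds1 le_rfl w00)).1 k5
  -- counting along a leg
  have count : ∀ {c c' : α} {r r' y1 : β} {x1 : α}, SE c y1 → c ≤ c' → NW x1 r → F c y1 = F x1 r → F c' y1 = F x1 r' →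
      w0 ≤ y1 → E ≤ x1 → ∃ N : ℕ, (N * (f a1 - f a) ≤ f c' - f c ∧ N * (g' p1 - g' p) ≤ g' r' - g' r) ∧
        (f c' - f c ≤ (N + 1) * (f a1 - f a) ∧ g' r' - g' r ≤ (N + 1) * (g' p1 - g' p)) := by
    intro c c' r r' y1 x1 hc hcc hr e3 e4 w01 Ex1
    have ds2 : ∀ {x w}, c ≤ x → w ≤ y1 → SE x w := fun k k' => h.se.up hc k k'
    have dn2 : ∀ {x q}, x ≤ x1 → r ≤ q → NW x q := fun k k' => h.nw.up hr k' k
    obtain ⟨N, s, s0, s1, s2, s3⟩ := h.se.exists_region_steps (ds2 le_rfl w01) k3 hcc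
    have ht : ∀ j, ∃ t, j ≤ N → F (s j) y1 = F x1 t ∧ r ≤ t ∧ t ≤ r' := fun j => by
      by_cases hj : j ≤ N
      · obtain ⟨t, ht⟩ := hsolve e3 e4 (s2 j hj).1 (s2 j hj).2
        exact ⟨t, fun _ => ht⟩
      · exact ⟨r, fun h => absurd h hj⟩
    choose t ht using ht
    have lev1 : ∀ {b d : α} {t1 t2 : β}, c ≤ b → c ≤ d → r ≤ t1 → r ≤ t2 → F b y1 = F x1 t1 → F d y1 = F x1 t2 →
        F d w1 ≤ F b w0 → g' t2 - g' t1 ≤ g' p1 - g' p := by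
      intro b d t1 t2 hb hd h1 h2 h3 h4 h5
      -- A5 carries a comparison with the small reference step from `SE` to the matching levels in
      -- `NW`, where it is read off on the interval from `φ` to `E`.
      have := hl (ds1 le_rfl w00) (ds1 k1.le (k3.le.trans w00)) (ds2 hb w01) (ds2 hd (k3.le.trans w01))
        (ds1 le_rfl le_rfl) (ds1 k1.le le_rfl) (ds2 hb le_rfl) (ds2 hd le_rfl)
        (dn1 le_rfl le_rfl) (dn1 le_rfl hpp1) (dn2 le_rfl h1) (dn2 le_rfl h2)
        (dn1 Ex0 le_rfl) (dn1 (hφE.trans Ex0) hpp1) (dn2 Ex1 h1) (dn2 (hφE.trans Ex1) h2)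
        k5.ge h5 e1 hp1 h3 h4 hφ.le
      have := (hf' (dn2 (hφE.trans Ex1) h2) (dn2 Ex1 h1)).1 this
      linarith
    have lev2 : ∀ {b d : α} {t1 t2 : β}, c ≤ b → c ≤ d → r ≤ t1 → r ≤ t2 → F b y1 = F x1 t1 → F d y1 = F x1 t2 →
        F b w0 ≤ F d w1 → g' p1 - g' p ≤ g' t2 - g' t1 := by
      intro b d t1 t2 hb hd h1 h2 h3 h4 h5
      have := hl (ds1 k1.le (k3.le.trans w00)) (ds1 le_rfl w00) (ds2 hd (k3.le.trans w01)) (ds2 hb w01)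
        (ds1 k1.le le_rfl) (ds1 le_rfl le_rfl) (ds2 hd le_rfl) (ds2 hb le_rfl)
        (dn1 le_rfl hpp1) (dn1 le_rfl le_rfl) (dn2 le_rfl h2) (dn2 le_rfl h1)
        (dn1 (hφE.trans Ex0) hpp1) (dn1 Ex0 le_rfl) (dn2 (hφE.trans Ex1) h2) (dn2 Ex1 h1)
        k5.le h5 hp1 e1 h4 h3 hφ.ge
      have := (hf' (dn2 Ex1 h1) (dn2 (hφE.trans Ex1) h2)).1 this
      linarith
    have hstep : ∀ j ≤ N, f (s j) = f c + j * (f a1 - f a) ∧ g' (t j) = g' r + j * (g' p1 - g' p) := by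
      intro j hj
      induction j with
      | zero =>
        have h0 := ht 0 (Nat.zero_le _)
        rw [s0, e3] at h0
        rw [s0, ← (hF.m2 x1).injective h0.1]
        simp
      | succ j ih =>
        obtain ⟨i1, i2⟩ := ih (by omega)
        have t1 := ht j (by omega)
        have t2 := ht (j + 1) hj
        have b1 := (s2 j (by omega)).1
        have b2 := (s2 (j + 1) hj).1
        have hs := s1 j (by omega)
        have l1 := lev1 b1 b2 t1.2.1 t2.2.1 t1.1 t2.1 hs.le
        have l2 := lev2 b1 b2 t1.2.1 t2.2.1 t1.1 t2.1 hs.ge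
        have l3 := (hf.eq (ds2 b2 (k3.le.trans w01)) (ds2 b1 w01)).1 hs
        push_cast
        constructor <;> linarith
    obtain ⟨i1, i2⟩ := hstep N le_rfl
    have tN := ht N le_rfl
    have bN := s2 N le_rfl
    have l1 := lev1 bN.1 hcc tN.2.1 (tN.2.1.trans tN.2.2) tN.1 e4 s3.le
    have l3 := (hf.lt (ds2 hcc (k3.le.trans w01)) (ds2 bN.1 w01)).1 s3
    have m1 : f (s N) ≤ f c' := by
      rcases bN.2.lt_or_eq with h' | h'
      · exact (h.se.rep_strictMono1 hf (ds2 bN.1 le_rfl) h').le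
      · rw [h']
    have m2 : g' (t N) ≤ g' r' := by
      rcases tN.2.2.lt_or_eq with h' | h'
      · exact (h.nw.rep_strictMono1 hf' (dn2 le_rfl tN.2.1) h').le
      · rw [h']
    refine ⟨N, ⟨?_, ?_⟩, ?_, ?_⟩ <;> linarith
  obtain ⟨m, hm1, hm2⟩ := count ha haa.le hp e1 e2 w00 Ex0
  obtain ⟨N, hn1, hn2⟩ := count hc hcc hr e3 e4 w01 Ex1
  refine ⟨m, N, f a1 - f a, g' p1 - g' p, sub_pos.2 (fm (Or.inl le_rfl) k1), k6,
    sub_pos.2 (gm (Or.inl le_rfl) hlt1), ?_, hm1, hm2, hn1, hn2⟩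
  have := gm' (Or.inl hpp1) (hp1s.trans hps2')
  linarith

end Cells
end Conjoint

/-! ### Matching the levels of the two regions -/

namespace Conjoint

variable {α β L : Type*} [LinearOrder α] [LinearOrder β] [LinearOrder L] {F : α → β → L}
  {D SE NW : α → β → Prop}

/-- The level `l` is attained in the region `D`. -/
def Attained (F : α → β → L) (D : α → β → Prop) (l : L) : Prop := ∃ a p, D a p ∧ F a p = l

/-- The levels `l ≤ m` are attained in `D` at the end points of an interval in one coordinate. -/
def Leg (F : α → β → L) (D : α → β → Prop) (l m : L) : Prop :=
  (∃ a a' p, a ≤ a' ∧ D a p ∧ F a p = l ∧ F a' p = m) ∨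
    ∃ a p p', p ≤ p' ∧ D a p' ∧ F a p = l ∧ F a p' = m

namespace Region

theorem leg_right (hR : Region F D) {l m : L} (h : Leg F D l m) : Attained F D m := by
  rcases h with ⟨a, a', p, h1, h2, h3, h4⟩ | ⟨a, p, p', h1, h2, h3, h4⟩
  · exact ⟨a', p, hR.up h2 h1 le_rfl, h4⟩
  · exact ⟨a, p', h2, h4⟩

theorem leg_split (hR : Region F D) {l m : L} {b : α} {q : β} (h : Leg F D l m) (hl : l ≤ F b q)
    (hm : F b q ≤ m) : Leg F D l (F b q) ∧ Leg F D (F b q) m := by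
  rcases h with ⟨a, a', p, h1, h2, rfl, rfl⟩ | ⟨a, p, p', h1, h2, rfl, rfl⟩
  · obtain ⟨c, hc⟩ := hR.s1 hl hm
    have k1 : a ≤ c := (hR.m1 p).le_iff_le.1 (hl.trans hc.ge)
    have k2 : c ≤ a' := (hR.m1 p).le_iff_le.1 (hc.le.trans hm)
    exact ⟨Or.inl ⟨a, c, p, k1, h2, rfl, hc⟩, Or.inl ⟨c, a', p, k2, hR.up h2 k1 le_rfl, hc, rfl⟩⟩
  · obtain ⟨c, hc⟩ := hR.s2 hl hm
    have k1 : p ≤ c := (hR.m2 a).le_iff_le.1 (hl.trans hc.ge)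
    have k2 : c ≤ p' := (hR.m2 a).le_iff_le.1 (hc.le.trans hm)
    exact ⟨Or.inr ⟨a, p, c, k1, hR.up h2 le_rfl k2, rfl, hc⟩, Or.inr ⟨a, c, p', k2, h2, hc, rfl⟩⟩

/-- Two levels attained in a region are joined by two legs. -/
theorem exists_legs (hR : Region F D) {a b : α} {p q : β} (h1 : D a p) (h2 : D b q) (hle : F a p ≤ F b q) :
    ∃ c r, D c r ∧ F a p ≤ F c r ∧ F c r ≤ F b q ∧ Leg F D (F a p) (F c r) ∧ Leg F D (F c r) (F b q) := by
  rcases le_or_gt q p with hqp | hpq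
  · obtain ⟨x, hx⟩ := hR.s1 hle ((hR.m2 b).monotone hqp)
    have k1 : a ≤ x := (hR.m1 p).le_iff_le.1 (hle.trans hx.ge)
    exact ⟨x, p, hR.up h1 k1 le_rfl, hx ▸ hle, hx.le, Or.inl ⟨a, x, p, k1, h1, rfl, rfl⟩,
      Or.inl ⟨x, x, p, le_rfl, hR.up h1 k1 le_rfl, rfl, hx⟩⟩
  · rcases le_or_gt a b with hab | hba
    · exact ⟨b, p, hR.up h1 hab le_rfl, (hR.m1 p).monotone hab, (hR.m2 b).monotone hpq.le,
        Or.inl ⟨a, b, p, hab, h1, rfl, rfl⟩, Or.inr ⟨b, p, q, hpq.le, h2, rfl, rfl⟩⟩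
    · obtain ⟨x, hx⟩ := hR.s2 hle ((hR.m1 q).monotone hba.le)
      have k1 : p ≤ x := (hR.m2 a).le_iff_le.1 (hle.trans hx.ge)
      have k2 : x ≤ q := (hR.m2 a).le_iff_le.1 (hx.le.trans ((hR.m1 q).monotone hba.le))
      have k3 := hR.up h2 hba.le k2
      exact ⟨a, x, k3, hx ▸ hle, hx.le, Or.inr ⟨a, p, x, k1, k3, rfl, rfl⟩,
        Or.inr ⟨a, x, x, le_rfl, k3, rfl, hx⟩⟩

/-- A transitive relation on levels holding along the legs of the first coordinate holds along those
of the second coordinate. -/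
theorem leg_induction [NoMaxOrder α] (hR : Region F D) {R : L → L → Prop}
    (htr : ∀ {l b q m}, D b q → l ≤ F b q → F b q ≤ m → R l (F b q) → R (F b q) m → R l m)
    (hl : ∀ {a a' p}, D a p → a ≤ a' → R (F a p) (F a' p)) {l m : L} (h : Leg F D l m) : R l m := by
  rcases h with ⟨a, a', p, h1, h2, rfl, rfl⟩ | ⟨b, q0, q1, h1, h2, rfl, rfl⟩
  · exact hl h2 h1
  obtain ⟨e, he⟩ := exists_gt b
  -- The end levels of each descending step are those of the interval from `b` to `e` at its lower
  -- element, so the leg is cut into legs of the first coordinate.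
  obtain ⟨N, s, s0, s1, s2, s3⟩ := hR.toPlane.exists_steps_down he h1 (by
    rintro ⟨s, s0, s1, s2⟩
    exact hR.arch2 he ⟨s, s0 ▸ h2, s1, s2⟩)
  have sle : ∀ t ≤ N, s t ≤ q1 := by
    intro t
    induction t with
    | zero => intro _; exact s0.le
    | succ t ih =>
      intro ht
      refine le_trans ?_ (ih (by omega))
      exact ((hR.m2 e).le_iff_le.1 ((s1 t (by omega)).le.trans ((hR.m1 (s t)).monotone he.le)))
  have hD : ∀ t ≤ N, D b (s t) := fun t ht => hR.up h2 le_rfl (sle t ht)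
  obtain ⟨x, hx⟩ := hR.s1 ((hR.m2 b).monotone (s2 N le_rfl)) s3.le
  have hbx : b ≤ x := (hR.m1 q0).le_iff_le.1 (by rw [hx]; exact (hR.m2 b).monotone (s2 N le_rfl))
  have hlast : R (F b q0) (F b (s N)) := hx ▸ hl (hR.up h2 le_rfl h1) hbx
  have key : ∀ t ≤ N, R (F b q0) (F b (s (N - t))) := by
    intro t
    induction t with
    | zero => intro _; exact hlast
    | succ t ih =>
      intro ht
      obtain ⟨r, hr⟩ : ∃ r, N - t = r + 1 := ⟨N - t - 1, by omega⟩
      have hr' : N - (t + 1) = r := by omega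
      have := ih (by omega)
      rw [hr'] 
      rw [hr] at this
      refine htr (hD (r + 1) (by omega)) ((hR.m2 b).monotone (s2 _ (by omega))) ?_ this ?_
      · rw [← s1 r (by omega)]
        exact (hR.m1 _).monotone he.le
      · rw [← s1 r (by omega)]
        exact hl (hD (r + 1) (by omega)) he.le
  have := key N le_rfl
  rwa [Nat.sub_self, s0] at this

end Region

namespace Cells

variable {f f' : α → ℝ} {g g' : β → ℝ}

/-- Over the interval of levels `[l, m]`, the representation on `NW` is `κ` times that on `SE`. -/
def Matched (F : α → β → L) (SE NW : α → β → Prop) (f f' : α → ℝ) (g g' : β → ℝ) (κ : ℝ) (l m : L) : Prop :=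
  ∀ ⦃a b c d : α⦄ ⦃p q r s : β⦄, SE a p → SE b q → NW c r → NW d s → F a p = l → F b q = m → F c r = l →
    F d s = m → f' d + g' s - (f' c + g' r) = κ * (f b + g q - (f a + g p))

theorem matched_of (hf : RegRep F SE f g) (hf' : RegRep (fun p a => F a p) (fun p a => NW a p) g' f') {κ : ℝ}
    {a b c d : α} {p q r s : β} (h1 : SE a p) (h2 : SE b q) (h3 : NW c r) (h4 : NW d s) (e1 : F c r = F a p)
    (e2 : F d s = F b q) (h : f' d + g' s - (f' c + g' r) = κ * (f b + g q - (f a + g p))) :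
    Matched F SE NW f f' g g' κ (F a p) (F b q) := by
  intro a' b' c' d' p' q' r' s' k1 k2 k3 k4 i1 i2 i3 i4
  have j1 := (hf.eq k1 h1).1 i1
  have j2 := (hf.eq k2 h2).1 i2
  have j3 := (hf'.eq k3 h3).1 (i3.trans e1.symm)
  have j4 := (hf'.eq k4 h4).1 (i4.trans e2.symm)
  rw [j1, j2]
  linarith

theorem Matched.trans {κ : ℝ} {l m k : L} (h1 : Matched F SE NW f f' g g' κ l m)
    (h2 : Matched F SE NW f f' g g' κ m k) (h3 : Attained F SE m) (h4 : Attained F NW m) :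
    Matched F SE NW f f' g g' κ l k := by
  obtain ⟨a, p, k1, k2⟩ := h3
  obtain ⟨b, q, k3, k4⟩ := h4
  intro a' b' c' d' p' q' r' s' j1 j2 j3 j4 i1 i2 i3 i4
  have := h1 j1 k1 j3 k3 i1 k2 i3 k4
  have := h2 k1 j2 k3 j4 k2 i2 k4 i4
  linarith

variable [DenselyOrdered α] [DenselyOrdered β] [NoMaxOrder α] [NoMinOrder α] [NoMaxOrder β] [NoMinOrder β]

/-- The levels of the two regions are matched at a constant rate. -/
theorem exists_matched (h : Cells F SE NW) (hl : LevelTradeoff F SE NW) (hf : RegRep F SE f g)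
    (hf' : RegRep (fun p a => F a p) (fun p a => NW a p) g' f') {a0 : α} {p0 : β} (h0 : SE a0 p0)
    (h0' : NW a0 p0) :
    ∃ κ : ℝ, 0 < κ ∧ ∀ {l m}, l ≤ m → Matched F SE NW f f' g g' κ l m := by
  have hF := h.se.toPlane
  obtain ⟨a1, p1, ha, hp, e⟩ : ∃ a1 p1, a0 < a1 ∧ p0 < p1 ∧ F a1 p0 = F a0 p1 := by
    obtain ⟨x, hx⟩ := exists_gt a0
    obtain ⟨y, hy⟩ := exists_gt p0
    rcases le_total (F x p0) (F a0 y) with hle | hle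
    · obtain ⟨z, hz⟩ := hF.s2 ((hF.m1 p0).monotone hx.le) hle
      exact ⟨x, z, hx, (hF.m2 a0).lt_iff_lt.1 (by rw [hz]; exact hF.m1 p0 hx), hz.symm⟩
    · obtain ⟨z, hz⟩ := hF.s1 ((hF.m2 a0).monotone hy.le) hle
      exact ⟨z, y, (hF.m1 p0).lt_iff_lt.1 (by rw [hz]; exact hF.m2 a0 hy), hy, hz⟩
  have hfa : 0 < f a1 - f a0 := sub_pos.2 (h.se.rep_strictMono1 hf h0 ha)
  have hgp : 0 < g' p1 - g' p0 := sub_pos.2 (h.nw.rep_strictMono1 hf' h0' hp)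
  -- `κ` is read off from one pair of legs at the common point; `two_legs` makes it the rate of all
  -- others.
  set κ := (g' p1 - g' p0) / (f a1 - f a0) with hκ
  have hκf : κ * (f a1 - f a0) = g' p1 - g' p0 := div_mul_cancel₀ _ hfa.ne'
  refine ⟨κ, div_pos hgp hfa, ?_⟩
  -- intervals of the first coordinate in `SE` and of the second in `NW`
  have Q1 : ∀ {c c' x r r' y}, SE c y → c ≤ c' → NW x r → r ≤ r' → F x r = F c y → F x r' = F c' y →
      Matched F SE NW f f' g g' κ (F c y) (F c' y) := by
    intro c c' x r r' y k1 k2 k3 k4 i1 i2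
    have k5 : SE c' y := h.se.up k1 k2 le_rfl
    have k6 : NW x r' := h.nw.up (a' := r') (p' := x) k3 k4 le_rfl
    have H := matched_of (F := F) (SE := SE) (NW := NW) (κ := κ) hf hf' k1 k5 k3 k6 i1 i2
    refine H ?_
    have := h.two_legs hl hf hf' h0 ha h0' rfl e k1 k2 k3 i1.symm i2.symm
    rw [← hκf] at this
    have h5 : (f a1 - f a0) * (g' r' - g' r) = (f a1 - f a0) * (κ * (f c' - f c)) := by rw [this]; ring
    have := mul_left_cancel₀ hfa.ne' h5
    linarith
  -- intervals of the first coordinate in `SE`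
  have Q2 : ∀ {c c' y l m}, SE c y → c ≤ c' → Leg (fun p a => F a p) (fun p a => NW a p) l m → F c y ≤ l → m ≤ F c' y →
      Matched F SE NW f f' g g' κ l m := by
    intro c c' y l m k1 k2 k3
    refine h.nw.leg_induction (R := fun l m => F c y ≤ l → m ≤ F c' y → Matched F SE NW f f' g g' κ l m) ?_ ?_ k3
    · intro l r x m j1 j2 j3 j4 j5 j6 j7
      refine Matched.trans (j4 j6 (j3.trans j7)) (j5 (j6.trans j2) j7) ?_ ⟨x, r, j1, rfl⟩
      obtain ⟨z, hz⟩ := hF.s1 (j6.trans j2) (j3.trans j7)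
      exact ⟨z, y, h.se.up k1 ((hF.m1 y).le_iff_le.1 ((j6.trans j2).trans hz.ge)) le_rfl, hz⟩
    · intro r r' x j1 j2 j3 j4
      have j5 := (hF.m2 x).monotone j2
      obtain ⟨z, hz⟩ := hF.s1 j3 (j5.trans j4)
      obtain ⟨z', hz'⟩ := hF.s1 (j3.trans j5) j4
      have := Q1 (c := z) (c' := z') (y := y) (h.se.up k1 ((hF.m1 y).le_iff_le.1 (j3.trans hz.ge)) le_rfl)
        ((hF.m1 y).le_iff_le.1 (by rw [hz, hz']; exact j5)) j1 j2 hz.symm hz'.symm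
      rwa [hz, hz'] at this
  have attN : ∀ {l m b q}, Leg (fun p a => F a p) (fun p a => NW a p) l m → l ≤ F b q → F b q ≤ m →
      Attained F NW (F b q) := by
    intro l m b q k1 k2 k3
    obtain ⟨r, x, j1, j2⟩ := h.nw.leg_right (h.nw.leg_split k1 k2 k3).1
    exact ⟨x, r, j1, j2⟩
  have attS : ∀ {l m b q}, Leg F SE l m → l ≤ F b q → F b q ≤ m → Attained F SE (F b q) :=
    fun k1 k2 k3 => h.se.leg_right (h.se.leg_split k1 k2 k3).1
  -- arbitrary legs
  have Q3 : ∀ {l m}, Leg F SE l m → Leg (fun p a => F a p) (fun p a => NW a p) l m →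
      Matched F SE NW f f' g g' κ l m := by
    intro l m k1 k2
    refine h.se.leg_induction (R := fun l' m' => l ≤ l' → m' ≤ m → Matched F SE NW f f' g g' κ l' m') ?_ ?_ k1
      le_rfl le_rfl
    · intro l' b q m' j1 j2 j3 j4 j5 j6 j7
      exact Matched.trans (j4 j6 (j3.trans j7)) (j5 (j6.trans j2) j7) ⟨b, q, j1, rfl⟩
        (attN k2 (j6.trans j2) (j3.trans j7))
    · intro c c' y j1 j2 j3 j4
      have j5 := (hF.m1 y).monotone j2
      have k3 := (h.nw.leg_split k2 j3 (j5.trans j4)).2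
      have k4 := (h.nw.leg_split k3 j5 j4).1
      exact Q2 j1 j2 k4 le_rfl le_rfl
  -- Levels attained in `NW` are joined there by two legs, and the turning level splits the leg in
  -- `SE` accordingly.
  have Q4 : ∀ {l b q}, Leg F SE l (F b q) → Attained F NW l → Attained F NW (F b q) → l ≤ F b q →
      Matched F SE NW f f' g g' κ l (F b q) := by
    rintro l b q k1 ⟨c, r, k2, rfl⟩ ⟨d, s, k3, k4⟩ k5
    rw [← k4] at k1 k5 ⊢
    obtain ⟨v, z, j1, j2, j3, j4, j5⟩ := h.nw.exists_legs k2 k3 k5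
    obtain ⟨k6, k7⟩ := h.se.leg_split k1 j2 j3
    exact Matched.trans (Q3 k6 j4) (Q3 k7 j5) (h.se.leg_right k6) ⟨z, v, j1, rfl⟩
  intro l m hlm a b c d p q r s k1 k2 k3 k4 i1 i2 i3 i4
  subst i1 i2
  obtain ⟨x, y, j1, j2, j3, j4, j5⟩ := h.se.exists_legs k1 k2 hlm
  -- The levels attained in `NW` have no gaps, so the turning level of the legs in `SE` is among
  -- them.
  have hx : Attained F NW (F x y) := by
    have hle : F c r ≤ F d s := by rw [i3, i4]; exact hlm
    obtain ⟨v, z, w1, w2, w3, w4, w5⟩ := h.nw.exists_legs k3 k4 hle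
    rw [← i3] at j2
    rw [← i4] at j3
    rcases le_total (F x y) (F z v) with hc | hc
    · exact attN w4 j2 hc
    · exact attN w5 hc j3
  exact Matched.trans (Q4 j4 ⟨c, r, k3, i3⟩ hx j2) (Q4 j5 hx ⟨d, s, k4, i4⟩ j3) ⟨x, y, j1, rfl⟩ hx
    k1 k2 k3 k4 rfl rfl i3 i4

end Cells
end Conjoint

/-! ### Weighted additive representation -/

namespace Conjoint

variable {α β L : Type*} [LinearOrder α] [LinearOrder β] [LinearOrder L] {F : α → β → L}
  {SE NW : α → β → Prop}

/-- A weighted additive representation on two regions, whose weights depend on the region. -/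
structure WeightedRep (F : α → β → L) (SE NW : α → β → Prop) (W : α → β → ℝ) (u : α → ℝ) (v : β → ℝ)
    (ωi ωj : ℝ) : Prop where
  le_iff : ∀ {a p b q}, F a p ≤ F b q ↔ W a p ≤ W b q
  se : ∀ {a p}, SE a p → W a p = u a + v p
  nw : ∀ {a p}, NW a p → W a p = ωi * u a + ωj * v p
  mono1 : StrictMono u
  mono2 : StrictMono v
  pos1 : 0 < ωi
  pos2 : 0 < ωj

theorem RegRep.affine {D : α → β → Prop} {f : α → ℝ} {g : β → ℝ} (h : RegRep F D f g) {κ : ℝ} (hκ : 0 < κ) (x y : ℝ) :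
    RegRep F D (fun a => (f a - x) / κ) fun p => (g p - y) / κ := by
  intro a p b q h1 h2
  rw [h h1 h2, ← add_div, ← add_div, div_le_div_iff_of_pos_right hκ]
  constructor <;> intro h <;> linarith

namespace Cells

/-- The two points are joined by legs, and solvability fills each leg. -/
theorem attained_of_le (h : Cells F SE NW) {a b c : α} {p q r : β} (h1 : NW a p) (h2 : NW b q)
    (k1 : F a p ≤ F c r) (k2 : F c r ≤ F b q) : ∃ d s, NW d s ∧ F d s = F c r := by
  obtain ⟨v, z, w1, w2, w3, w4, w5⟩ := h.nw.exists_legs h1 h2 (k1.trans k2)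
  rcases le_total (F c r) (F z v) with hc | hc
  · obtain ⟨r, x, j1, j2⟩ := h.nw.leg_right (h.nw.leg_split w4 k1 hc).1
    exact ⟨x, r, j1, j2⟩
  · obtain ⟨r, x, j1, j2⟩ := h.nw.leg_right (h.nw.leg_split w5 hc k2).1
    exact ⟨x, r, j1, j2⟩

/-- Elements from `a0` upwards occur in `SE` and those up to `a0` in `NW`, so monotonicity is
checked on either side and joined at `a0`. -/
theorem glue_strictMono (h : Cells F SE NW) {f f' : α → ℝ} {g g' : β → ℝ} {ω : ℝ} (hf : RegRep F SE f g)
    (hf' : RegRep (fun p a => F a p) (fun p a => NW a p) g' f') (hω : 0 < ω)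
    (hff : ∀ {a p q}, SE a p → NW a q → f' a = ω * f a) {a0 : α} {p0 : β} (h0 : SE a0 p0) (h0' : NW a0 p0) :
    ∃ u : α → ℝ, StrictMono u ∧ (∀ {a p}, SE a p → u a = f a) ∧ ∀ {a p}, NW a p → ω * u a = f' a := by
  classical
  set u : α → ℝ := fun a => if ∃ p, SE a p then f a else f' a / ω with hu
  have u1 : ∀ {a p}, SE a p → u a = f a := fun k => if_pos ⟨_, k⟩
  have u2 : ∀ {a p}, NW a p → ω * u a = f' a := by
    intro a p k
    by_cases hc : ∃ p, SE a p
    · obtain ⟨q, hq⟩ := hc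
      rw [u1 hq, hff hq k]
    · simp only [hu, if_neg hc]
      field_simp
  have m1 : ∀ {a b}, a0 ≤ a → a < b → u a < u b := fun ha hab => by
    have k := h.se.up h0 ha le_rfl
    rw [u1 k, u1 (h.se.up k hab.le le_rfl)]
    exact h.se.rep_strictMono1 hf k hab
  have m2 : ∀ {a b}, b ≤ a0 → a < b → u a < u b := fun hb hab => by
    have k : NW _ p0 := h.nw.up h0' le_rfl hb
    have k' : NW _ p0 := h.nw.up k le_rfl hab.le
    have := h.nw.rep_strictMono2 hf' k hab
    rw [← u2 k, ← u2 k'] at this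
    exact lt_of_mul_lt_mul_left this hω.le
  refine ⟨u, fun a b hab => ?_, u1, u2⟩
  rcases le_or_gt a0 a with ha | ha
  · exact m1 ha hab
  · rcases le_or_gt b a0 with hb | hb
    · exact m2 hb hab
    · exact (m2 le_rfl ha).trans (m1 le_rfl hb)

variable [DenselyOrdered α] [DenselyOrdered β] [NoMaxOrder α] [NoMinOrder α] [NoMaxOrder β] [NoMinOrder β]

/-- Both representations are made to vanish at the common point. The rate `κ` between levels is
absorbed into the one on `NW`, and the remaining factors on the two coordinates become the weights.
-/
theorem exists_normalized (h : Cells F SE NW) (hl : LevelTradeoff F SE NW) {a0 : α} {p0 : β} (h0 : SE a0 p0)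
    (h0' : NW a0 p0) :
    ∃ (f f' : α → ℝ) (g g' : β → ℝ) (ωi ωj : ℝ), RegRep F SE f g ∧
      RegRep (fun p a => F a p) (fun p a => NW a p) g' f' ∧ f a0 = 0 ∧ f' a0 = 0 ∧ g p0 = 0 ∧ g' p0 = 0 ∧
      0 < ωi ∧ 0 < ωj ∧ (∀ {a p q}, SE a p → NW a q → f' a = ωi * f a) ∧
      (∀ {a b p}, SE a p → NW b p → g' p = ωj * g p) ∧
      ∀ {a p b q}, SE a p → NW b q → F a p = F b q → f a + g p = f' b + g' q := by
  obtain ⟨f, g, hf⟩ := h.se.exists_rep h0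
  obtain ⟨g', f', hf'⟩ := h.nw.exists_rep h0'
  obtain ⟨ω, hω, h1⟩ := h.exists_ratio hf hf'
  obtain ⟨ω', hω', h2⟩ := h.swap.exists_ratio hf' hf
  obtain ⟨κ, hκ, h3⟩ := h.exists_matched hl hf hf' h0 h0'
  have hf1 : RegRep F SE _ _ := RegRep.affine (F := F) (D := SE) hf one_pos (f a0) (g p0)
  have hf2 : RegRep (fun p a => F a p) (fun p a => NW a p) _ _ :=
    RegRep.affine (F := fun p a => F a p) (D := fun p a => NW a p) hf' hκ (g' p0) (f' a0)
  refine ⟨_, _, _, _, ω / κ, 1 / (κ * ω'), hf1, hf2, by simp, by simp, by simp, by simp, div_pos hω hκ,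
    by positivity, fun {a p q} k1 k2 => ?_, fun {a b p} k1 k2 => ?_, fun {a p b q} k1 k2 e => ?_⟩
  · have := h1 a0 a _ _ _ _ h0 h0' k1 k2
    rw [this]; field_simp
  · have := h2 p0 p _ _ _ _ h0' h0 k2 k1
    rw [this]; field_simp
  · rcases le_total (F a0 p0) (F a p) with hle | hle
    · have := h3 hle h0 k1 h0' k2 rfl rfl rfl e.symm
      field_simp
      linarith
    · have := h3 hle k1 h0 k2 h0' rfl rfl e.symm rfl
      field_simp
      linarith

theorem exists_weightedRep (h : Cells F SE NW) (hl : LevelTradeoff F SE NW) {a0 : α} {p0 : β} (h0 : SE a0 p0)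
    (h0' : NW a0 p0) : ∃ W u v ωi ωj, WeightedRep F SE NW W u v ωi ωj ∧ u a0 = 0 ∧ v p0 = 0 := by
  classical
  obtain ⟨f, f', g, g', ωi, ωj, hf, hf', fz, fz', gz, gz', hi, hj, hff, hgg, hm⟩ := h.exists_normalized hl h0 h0'
  obtain ⟨u, um, u1, u2⟩ := h.glue_strictMono hf hf' hi hff h0 h0'
  obtain ⟨v', vm, v1, v2⟩ := h.swap.glue_strictMono (ω := ωj⁻¹) hf' hf (inv_pos.2 hj) (fun {p a b} k1 k2 => by
    rw [hgg k2 k1]; field_simp) h0' h0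
  -- Gluing the swapped regions normalises by `NW`; the factor `ωj⁻¹` returns to the normalisation
  -- by `SE`.
  set v : β → ℝ := fun p => ωj⁻¹ * v' p with hv
  have w2 : ∀ {a p}, SE a p → v p = g p := fun k => v2 k
  have w1 : ∀ {a p}, NW a p → ωj * v p = g' p := fun k => by
    rw [← v1 k, hv, mul_inv_cancel_left₀ hj.ne']
  set W : α → β → ℝ := fun a p => if SE a p then u a + v p else ωi * u a + ωj * v p with hW
  have W1 : ∀ {a p}, SE a p → W a p = f a + g p := fun k => by
    simp only [hW, if_pos k, u1 k, w2 k]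
  have W2 : ∀ {a p}, NW a p → W a p = f' a + g' p := fun {a p} k => by
    by_cases hc : SE a p
    · rw [W1 hc, hm hc k rfl]
    · simp only [hW, if_neg hc, u2 k, w1 k]
  have r1 : ∀ {a p b q}, SE a p → SE b q → (F a p ≤ F b q ↔ W a p ≤ W b q) := fun k1 k2 => by
    rw [W1 k1, W1 k2, hf k1 k2]
  have r2 : ∀ {a p b q}, NW a p → NW b q → (F a p ≤ F b q ↔ W a p ≤ W b q) := fun k1 k2 => by
    rw [W2 k1, W2 k2, add_comm, add_comm (f' _), ← hf' k1 k2]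
  have eqW : ∀ {a p b q}, SE a p → NW b q → F a p = F b q → W a p = W b q := fun k1 k2 e => by
    rw [W1 k1, W2 k2, hm k1 k2 e]
  -- comparisons across the regions
  have cross : ∀ {a p b q}, SE a p → NW b q → (F a p ≤ F b q ↔ W a p ≤ W b q) ∧ (F b q ≤ F a p ↔ W b q ≤ W a p) := by
    intro a p b q k1 k2
    have c1 : (∃ d s, NW d s ∧ F d s = F a p) →
        (F a p ≤ F b q ↔ W a p ≤ W b q) ∧ (F b q ≤ F a p ↔ W b q ≤ W a p) := by
      rintro ⟨d, s, j1, j2⟩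
      rw [eqW k1 j1 j2.symm, ← j2]
      exact ⟨r2 j1 k2, r2 k2 j1⟩
    have c2 : (∃ d s, SE d s ∧ F d s = F b q) →
        (F a p ≤ F b q ↔ W a p ≤ W b q) ∧ (F b q ≤ F a p ↔ W b q ≤ W a p) := by
      rintro ⟨d, s, j1, j2⟩
      rw [← eqW j1 k2 j2, ← j2]
      exact ⟨r1 k1 j1, r1 j1 k1⟩
    have c2' : ∀ {c r d s}, SE c r → SE d s → F c r ≤ F b q → F b q ≤ F d s → ∃ d s, SE d s ∧ F d s = F b q :=
      fun j1 j2 j3 j4 => by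
        obtain ⟨s, d, i1, i2⟩ := h.swap.attained_of_le j1 j2 j3 j4
        exact ⟨d, s, i1, i2⟩
    have z1 := r1 k1 h0
    have z2 := r1 h0 k1
    have z3 := r2 k2 h0'
    have z4 := r2 h0' k2
    -- If both points are on the same side of the common point, the level of one of them is attained
    -- in the region of the other; otherwise the common point separates them.
    rcases le_total (F a p) (F a0 p0) with i1 | i1 <;> rcases le_total (F b q) (F a0 p0) with i2 | i2
    · rcases le_total (F a p) (F b q) with i3 | i3
      · exact c2 (c2' k1 h0 i3 i2)
      · exact c1 (h.attained_of_le k2 h0' i3 i1)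
    · have i3 := i1.trans i2
      have i4 := (z1.1 i1).trans (z4.1 i2)
      refine ⟨⟨fun _ => i4, fun _ => i3⟩, fun i5 => ?_, fun i5 => ?_⟩
      · exact (z3.1 (i5.trans i1)).trans (z2.1 (i2.trans i5))
      · exact (z3.2 (i5.trans (z1.1 i1))).trans (z2.2 ((z4.1 i2).trans i5))
    · have i3 := i2.trans i1
      have i4 := (z3.1 i2).trans (z2.1 i1)
      refine ⟨⟨fun i5 => ?_, fun i5 => ?_⟩, fun _ => i4, fun _ => i3⟩
      · exact (z1.1 (i5.trans i2)).trans (z4.1 (i1.trans i5))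
      · exact (z1.2 (i5.trans (z3.1 i2))).trans (z4.2 ((z2.1 i1).trans i5))
    · rcases le_total (F a p) (F b q) with i3 | i3
      · exact c1 (h.attained_of_le h0' k2 i1 i3)
      · exact c2 (c2' h0 k1 i2 i3)
  refine ⟨W, u, v, ωi, ωj, ⟨fun {a p b q} => ?_, fun k => ?_, fun k => ?_, um, fun x y hxy => ?_, hi, hj⟩, ?_, ?_⟩
  · rcases h.cover a p with k1 | k1 <;> rcases h.cover b q with k2 | k2
    exacts [r1 k1 k2, (cross k1 k2).1, (cross k2 k1).2, r2 k1 k2]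
  · rw [W1 k, u1 k, w2 k]
  · rw [W2 k, u2 k, w1 k]
  · exact mul_lt_mul_of_pos_left (vm hxy) (inv_pos.2 hj)
  · rw [u1 h0, fz]
  · rw [w2 h0, gz]

end Cells
end Conjoint

/-! ### Two coordinates: the regions given by the coordinate orders -/

namespace Conjoint

universe u

variable {n : ℕ} {Y : Fin n → Type u} [∀ k, LinearOrder (Y k)] {L : Type*} [LinearOrder L]
  {V : (∀ k, Y k) → L} {Ord : (Fin n → Fin n → Prop) → Prop} {Ess : (Fin n → Fin n → Prop) → Fin n → Prop}

namespace Model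

/-- The region of the plane of `i` and `j` on which `i` is ordered before `j` or alike. -/
def Before (V : (∀ k, Y k) → L) (z : ∀ k, Y k) (i j : Fin n) (a : Y i) (p : Y j) : Prop :=
  ¬ Brk V (pt2 z i j a p) j i

/-- A violation that lies beyond the new point also lies beyond the old one. -/
theorem Before.up {z : ∀ k, Y k} {i j : Fin n} (hij : i ≠ j) {a a' : Y i} {p p' : Y j} (h : Before V z i j a p)
    (ha : a ≤ a') (hp : p' ≤ p) : Before V z i j a' p' := by
  rintro ⟨A, B, C, D, P, Q, R, S, hf, h1, h2⟩
  simp only [pt2_comm _ hij.symm, pt2_pt2 _ hij, pt2_self_left _ hij, pt2_self_right] at hf h1 h2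
  refine h ⟨A, B, C, D, P, Q, R, S, ?_, fun x hx => ?_, fun x hx => ?_⟩
  · simpa only [pt2_comm _ hij.symm, pt2_pt2 _ hij] using hf
  · rw [pt2_self_right]
    exact (h1 x hx).trans_le hp
  · rw [pt2_self_left _ hij]
    exact ha.trans_lt (h2 x hx)

/-- With two coordinates and `S i j`, the only remaining condition of `Cell` is that there be no
violation for `j`, `i`. -/
theorem mem_Cell_of_before {i j : Fin n} (hn : ∀ k, k = i ∨ k = j) {S : Fin n → Fin n → Prop} (hS : S i j)
    {z : ∀ k, Y k} {a : Y i} {p : Y j} (h : Before V z i j a p) : pt2 z i j a p ∈ Cell V S := by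
  intro k l hkl hS' hb
  rcases hn k with rfl | rfl <;> rcases hn l with rfl | rfl
  exacts [hkl rfl, h hb, hS' hS, hkl rfl]

theorem region (M : Model V Ord Ess) {i j : Fin n} (hij : i ≠ j) (hn : ∀ k, k = i ∨ k = j)
    {S : Fin n → Fin n → Prop} (hO : Ord S) (hS : S i j) (hi : Ess S i) (z : ∀ k, Y k) :
    Region (fun a p => V (pt2 z i j a p)) (Before V z i j) where
  toPlane := M.plane hij z
  up h := h.up hij
  tc {a b c d P Q R T} h1 h2 h3 h4 h5 h6 h7 h8 k1 k2 k3 := by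
    have mem : ∀ {a p}, Before V z i j a p → pt2 z i j a p ∈ Cell V S := fun h => mem_Cell_of_before hn hS h
    have := M.intra (i := i) (a := a) (b := b) (c := c) (d := d) (x := pt2 z i j a P) (y := pt2 z i j a Q)
      (w := pt2 z i j a R) (z := pt2 z i j a T) hO hO hi
    simp only [update_pt2_left _ hij] at this
    exact this (mem h1) (mem h2) (mem h4) (mem h3) (mem h6) (mem h5) (mem h8) (mem h7) k1 k2 k3
  arch1 {k0 k1 hi'} hk := by
    rintro ⟨h, h0, h1, h2⟩
    have hm : StrictMono h := strictMono_nat_of_lt_succ fun t => ((M.plane hij z).m1 k0).lt_iff_lt.1 (by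
      rw [h2 t]; exact (M.plane hij z).m2 _ hk)
    have hB : ∀ t, Before V z i j (h t) k1 := fun t => h0.up hij (hm.monotone (Nat.zero_le t)) le_rfl
    exact M.arch (z := z) (g := h) (lo := h 0) (hi := hi') hO hij.symm hk.ne
      (fun t => ⟨hm.monotone (Nat.zero_le t), h1 t⟩) (fun t => mem_Cell_of_before hn hS (hB t))
      (fun t => mem_Cell_of_before hn hS ((hB _).up hij le_rfl hk.le)) fun t => (h2 t).symm
  arch2 {k0 k1 lo} hk := by
    rintro ⟨h, h0, h1, h2⟩
    have hm : StrictAnti h := strictAnti_nat_of_succ_lt fun t => ((M.plane hij z).m2 k1).lt_iff_lt.1 (by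
      rw [h2 t]; exact (M.plane hij z).m1 _ hk)
    have hB : ∀ t, Before V z i j k0 (h t) := fun t => h0.up hij le_rfl (hm.antitone (Nat.zero_le t))
    refine M.arch (z := z) (g := h) (y0 := k1) (y1 := k0) (lo := lo) (hi := h 0) hO hij hk.ne'
      (fun t => ⟨h1 t, hm.antitone (Nat.zero_le t)⟩) (fun t => ?_) (fun t => ?_) fun t => ?_
    · rw [pt2_comm _ hij.symm]
      exact mem_Cell_of_before hn hS (hB t)
    · rw [pt2_comm _ hij.symm]
      exact mem_Cell_of_before hn hS ((hB _).up hij hk.le le_rfl)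
    · rw [pt2_comm _ hij.symm, pt2_comm _ hij.symm]
      exact (h2 t).symm

variable {i j : Fin n} {Sa Sb : Fin n → Fin n → Prop}

theorem before_swap (hij : i ≠ j) (z : ∀ k, Y k) (a : Y i) (p : Y j) :
    Before V z j i p a ↔ ¬ Brk V (pt2 z i j a p) i j := by
  rw [Before, pt2_comm _ hij.symm]

theorem cells (M : Model V Ord Ess) (hij : i ≠ j) (hn : ∀ k, k = i ∨ k = j) (hSa : Ord Sa) (hSb : Ord Sb)
    (hij' : Sa i j) (hji' : Sb j i) (h1 : Ess Sa i) (h2 : Ess Sb j) (z : ∀ k, Y k) :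
    Cells (fun a p => V (pt2 z i j a p)) (Before V z i j) fun a p => Before V z j i p a where
  se := M.region hij hn hSa hij' h1 z
  nw := by
    have := M.region hij.symm (fun k => (hn k).symm) hSb hji' h2 z
    simpa only [pt2_comm z hij.symm] using this
  cover a p := by
    -- A point outside both regions would have violations in both directions, against `anti`.
    by_contra hc
    push Not at hc
    rw [before_swap hij, not_not, Before, not_not] at hc
    exact M.anti hij hc.2 hc.1
  mix1 {a b c d x y w v} k1 k2 k3 k4 k5 k6 k7 k8 := by
    have memA : ∀ {a p}, Before V z i j a p → pt2 z i j a p ∈ Cell V Sa := fun h => mem_Cell_of_before hn hij' h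
    have memB : ∀ {a p}, Before V z j i p a → pt2 z i j a p ∈ Cell V Sb := fun h => by
      rw [pt2_comm _ hij]
      exact mem_Cell_of_before (fun k => (hn k).symm) hji' h
    have := M.intra' (i := i) (a := a) (b := b) (c := c) (d := d) (x := pt2 z i j a x) (y := pt2 z i j a y)
      (w := pt2 z i j a w) (z := pt2 z i j a v) hSa hSb h1
    simp only [update_pt2_left _ hij] at this
    exact this (memA k1) (memA k2) (memA k3) (memA k4) (memB k5) (memB k6) (memB k7) (memB k8)
  mix2 {a b c d x y w v} k1 k2 k3 k4 k5 k6 k7 k8 := by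
    have memA : ∀ {a p}, Before V z i j a p → pt2 z i j a p ∈ Cell V Sa := fun h => mem_Cell_of_before hn hij' h
    have memB : ∀ {a p}, Before V z j i p a → pt2 z i j a p ∈ Cell V Sb := fun h => by
      rw [pt2_comm _ hij]
      exact mem_Cell_of_before (fun k => (hn k).symm) hji' h
    have := M.intra' (i := j) (a := a) (b := b) (c := c) (d := d) (x := pt2 z i j x a) (y := pt2 z i j y a)
      (w := pt2 z i j w a) (z := pt2 z i j v a) hSb hSa h2
    simp only [update_pt2_right] at this
    exact this (memB k1) (memB k2) (memB k3) (memB k4) (memA k5) (memA k6) (memA k7) (memA k8)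

theorem levelTradeoff (M : Model V Ord Ess) (hij : i ≠ j) (hn : ∀ k, k = i ∨ k = j) (hSa : Ord Sa) (hSb : Ord Sb)
    (hij' : Sa i j) (hji' : Sb j i) (h1 : Ess Sa i) (h2 : Ess Sb j) (z : ∀ k, Y k) :
    LevelTradeoff (fun a p => V (pt2 z i j a p)) (Before V z i j) fun a p => Before V z j i p a := by
  intro a b c d p q r s x y y0 y1 x0 x1 e f k1 k2 k3 k4 k5 k6 k7 k8 k9 k10 k11 k12 k13 k14 k15 k16
  have memA : ∀ {a p}, Before V z i j a p → pt2 z i j a p ∈ Cell V Sa := fun h => mem_Cell_of_before hn hij' h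
  have memB : ∀ {a p}, Before V z j i p a → pt2 z i j a p ∈ Cell V Sb := fun h => by
    rw [pt2_comm _ hij]
    exact mem_Cell_of_before (fun k => (hn k).symm) hji' h
  have := M.inter hij (a := a) (b := b) (c := c) (d := d) (p := p) (q := q) (r := r) (s := s)
    (x := pt2 z i j a x) (y := pt2 z i j a y) (y0 := pt2 z i j a y0) (y1 := pt2 z i j a y1)
    (x0 := pt2 z i j x0 p) (x1 := pt2 z i j x1 p) (e := pt2 z i j e p) (f := pt2 z i j f p) hSa hSa hSb hSb
  simp only [update_pt2_left _ hij, update_pt2_right] at this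
  exact this (memA k1) (memA k2) (memA k3) (memA k4) h1 (memA k5) (memA k6) (memA k7) (memA k8)
    (memB k9) (memB k10) (memB k11) (memB k12) h2 (memB k13) (memB k14) (memB k15) (memB k16)

/-- A preference on two interacting coordinates has a weighted additive representation. -/
theorem exists_weightedRep (M : Model V Ord Ess) (hij : i ≠ j) (hn : ∀ k, k = i ∨ k = j) (hSa : Ord Sa)
    (hSb : Ord Sb) (hij' : Sa i j) (hji' : Sb j i) (h1 : Ess Sa i) (h2 : Ess Sb j) {z : ∀ k, Y k}
    (hz : ¬ Brk V z i j) (hz' : ¬ Brk V z j i) :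
    ∃ W u v ωi ωj, WeightedRep (fun a p => V (pt2 z i j a p)) (Before V z i j) (fun a p => Before V z j i p a)
      W u v ωi ωj ∧ u (z i) = 0 ∧ v (z j) = 0 := by
  have := M.dense
  have := M.noMin
  have := M.noMax
  have e : pt2 z i j (z i) (z j) = z := by simp [pt2]
  exact (M.cells hij hn hSa hSb hij' hji' h1 h2 z).exists_weightedRep
    (M.levelTradeoff hij hn hSa hSb hij' hji' h1 h2 z) (by rwa [Before, e])
    (by rwa [before_swap hij, e])

end Model
end Conjoint

/-! ### Constant rate of standard sequences -/

namespace Conjoint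

variable {A B L : Type*} [LinearOrder A] [LinearOrder B] [LinearOrder L]

/-- The hypotheses on an increasing standard sequence `a` with columns `lo < hi` that lies in a region with an
additive representation; the functions are defined at non-extreme elements only. -/
structure SeqData (F : A → B → L) (P : A → Prop) (Q : B → Prop) (u : Subtype P → ℝ) (v : Subtype Q → ℝ)
    (w1 w2 : ℝ) (I : Set ℤ) (a : ℤ → A) (lo hi : B) : Prop extends Plane F where
  denseA : DenselyOrdered A
  denseB : DenselyOrdered B
  hP : ∀ x, P x ↔ (∃ y, x < y) ∧ ∃ y, y < x
  hQ : ∀ x, Q x ↔ (∃ y, x < y) ∧ ∃ y, y < x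
  mono : StrictMono u
  cont : ∀ {x e : Subtype P}, x < e → ∀ ε > 0, ∃ s, x < s ∧ s ≤ e ∧ u s < u x + ε
  pos : 0 < w1
  lohi : lo < hi
  ord : I.OrdConnected
  step : ∀ t, t ∈ I → t + 1 ∈ I → F (a t) hi = F (a (t + 1)) lo
  rep : ∀ t, t ∈ I → t + 1 ∈ I → ∀ (s s' : Subtype P) (c d : Subtype Q), a t ≤ s → s ≤ a (t + 1) → a t ≤ s' →
    s' ≤ a (t + 1) → lo ≤ c → c.1 ≤ hi → lo ≤ d → d.1 ≤ hi →
    (F s c ≤ F s' d ↔ w1 * u s + w2 * v c ≤ w1 * u s' + w2 * v d)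

namespace SeqData

variable {F : A → B → L} {P : A → Prop} {Q : B → Prop} {u : Subtype P → ℝ} {v : Subtype Q → ℝ} {w1 w2 : ℝ}
  {I : Set ℤ} {a : ℤ → A} {lo hi : B}

theorem lt_succ (h : SeqData F P Q u v w1 w2 I a lo hi) {t : ℤ} (h1 : t ∈ I) (h2 : t + 1 ∈ I) : a t < a (t + 1) :=
  (h.m1 lo).lt_iff_lt.1 (by rw [← h.step t h1 h2]; exact h.m2 _ h.lohi)

theorem le_step (h : SeqData F P Q u v w1 w2 I a lo hi) {t : ℤ} (h1 : t ∈ I) (h2 : t + 1 ∈ I) (p1 : P (a t))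
    (p2 : P (a (t + 1))) {c d : Subtype Q} (hc : lo ≤ c) (hc' : c.1 ≤ hi) (hd : lo ≤ d) (hd' : d.1 ≤ hi) :
    w2 * v c - w2 * v d ≤ w1 * (u ⟨_, p2⟩ - u ⟨_, p1⟩) := by
  have k := (h.lt_succ h1 h2).le
  have := (h.rep t h1 h2 ⟨_, p1⟩ ⟨_, p2⟩ c d le_rfl k k le_rfl hc hc' hd hd').1 (by
    refine ((h.m2 _).monotone hc').trans ?_
    rw [h.step t h1 h2]
    exact (h.m2 _).monotone hd)
  linarith

/-- The columns `lo` and `hi` may be extreme, where `v` is undefined. Once one end of the step is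
moved inwards, the slack allows non-extreme columns to replace them. -/
theorem exists_gt_step (h : SeqData F P Q u v w1 w2 I a lo hi) {t : ℤ} (h1 : t ∈ I) (h2 : t + 1 ∈ I)
    {s s' : Subtype P} (hs : a t ≤ s) (hs' : s' ≤ a (t + 1)) (k1 : s ≤ a (t + 1)) (k2 : a t ≤ s')
    (hlt : a t < s ∨ s' < a (t + 1)) :
    ∃ c d : Subtype Q, lo ≤ c ∧ c.1 ≤ hi ∧ lo ≤ d ∧ d.1 ≤ hi ∧ w1 * (u s' - u s) < w2 * v c - w2 * v d := by
  have := h.denseA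
  have := h.denseB
  have hF : F s' lo < F s hi := by
    rcases hlt with hl | hl
    · calc F s' lo ≤ F (a (t + 1)) lo := (h.m1 lo).monotone hs'
        _ = F (a t) hi := (h.step t h1 h2).symm
        _ < F s hi := h.m1 hi hl
    · calc F s' lo < F (a (t + 1)) lo := h.m1 lo hl
        _ = F (a t) hi := (h.step t h1 h2).symm
        _ ≤ F s hi := (h.m1 hi).monotone hs
  obtain ⟨m, m1, m2⟩ := exists_between h.lohi
  obtain ⟨d, d1, d2, d3⟩ := h.toPlane.up2 hF m1
  obtain ⟨c, c1, c2, c3⟩ := h.toPlane.dn2 d3 m2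
  have e1 : lo < c := m1.trans_le c1
  have e2 : d < hi := d2.trans_lt m2
  have qc : Q c := (h.hQ c).2 ⟨⟨_, c2⟩, ⟨_, e1⟩⟩
  have qd : Q d := (h.hQ d).2 ⟨⟨_, e2⟩, ⟨_, d1⟩⟩
  refine ⟨⟨c, qc⟩, ⟨d, qd⟩, e1.le, c2.le, d1.le, e2.le, ?_⟩
  have := (h.rep t h1 h2 s s' ⟨c, qc⟩ ⟨d, qd⟩ hs k1 k2 hs' e1.le c2.le d1.le e2.le).not.1 (not_le.2 c3)
  linarith

/-- Right continuity of `u` shortens the first step by less than `ε`; the shortened step lies below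
a difference of columns that the other step bounds from above. -/
theorem step_le (h : SeqData F P Q u v w1 w2 I a lo hi) {t r : ℤ} (h1 : t ∈ I) (h2 : t + 1 ∈ I) (p1 : P (a t))
    (p2 : P (a (t + 1))) (h3 : r ∈ I) (h4 : r + 1 ∈ I) (p3 : P (a r)) (p4 : P (a (r + 1))) :
    u ⟨_, p2⟩ - u ⟨_, p1⟩ ≤ u ⟨_, p4⟩ - u ⟨_, p3⟩ := by
  refine le_of_forall_pos_le_add fun ε hε => ?_
  have k : (⟨_, p1⟩ : Subtype P) < ⟨_, p2⟩ := h.lt_succ h1 h2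
  obtain ⟨s, s1, s2, s3⟩ := h.cont k ε hε
  obtain ⟨c, d, c1, c2, d1, d2, hlt⟩ := h.exists_gt_step h1 h2 (s := s) (s' := ⟨_, p2⟩) (le_of_lt s1) le_rfl s2
    (le_of_lt k) (Or.inl s1)
  have := hlt.trans_le (h.le_step h3 h4 p3 p4 c1 c2 d1 d2)
  have := (lt_of_mul_lt_mul_left this h.pos.le)
  linarith

theorem strictMonoOn (h : SeqData F P Q u v w1 w2 I a lo hi) : StrictMonoOn a I := by
  have : ∀ (s : ℤ) (n : ℕ), s ∈ I → s + (n + 1 : ℕ) ∈ I → a s < a (s + (n + 1 : ℕ)) := by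
    intro s n hs
    induction n with
    | zero => exact fun h2 => h.lt_succ hs h2
    | succ n ih =>
      intro h2
      have h3 : s + (n + 1 : ℕ) ∈ I := h.ord.out hs h2 ⟨by omega, by push_cast; omega⟩
      have e : s + ((n + 1 + 1 : ℕ) : ℤ) = s + (n + 1 : ℕ) + 1 := by push_cast; ring
      rw [e] at h2 ⊢
      exact (ih h3).trans (h.lt_succ h3 h2)
  intro s hs t ht hst
  obtain ⟨n, hn⟩ := Int.le.dest (Int.add_one_le_iff.2 hst)
  have e : t = s + (n + 1 : ℕ) := by push_cast; omega
  rw [e] at ht ⊢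
  exact this s n hs ht

theorem inner_of_between (h : SeqData F P Q u v w1 w2 I a lo hi) {s t r : ℤ} (hs : s ∈ I) (ht : t ∈ I) (hr : r ∈ I)
    (p1 : P (a s)) (p2 : P (a t)) (k1 : s ≤ r) (k2 : r ≤ t) : P (a r) :=
  (h.hP _).2 ⟨((h.hP _).1 p2).1.imp fun _ k => (h.strictMonoOn.monotoneOn hr ht k2).trans_lt k,
    ((h.hP _).1 p1).2.imp fun _ k => k.trans_le (h.strictMonoOn.monotoneOn hs hr k1)⟩

/-- Steps between non-extreme elements bound each other by `step_le` and are therefore equal. The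
last clause concerns a term that is extreme: every non-extreme element lies less than one full step
beyond the neighbouring non-extreme term, so the value predicted by the rate is not taken. -/
theorem exists_rate (h : SeqData F P Q u v w1 w2 I a lo hi) {s0 t0 : ℤ} (hs0 : s0 ∈ I) (ht0 : t0 ∈ I) (hst : s0 < t0)
    (ps : P (a s0)) (pt : P (a t0)) :
    ∃ b : ℝ, b ≠ 0 ∧ (∀ s t, s ∈ I → t ∈ I → ∀ (p1 : P (a s)) (p2 : P (a t)), u ⟨_, p2⟩ - u ⟨_, p1⟩ = (t - s) * b) ∧
      ∀ s t, s ∈ I → t ∈ I → ∀ (p1 : P (a s)), ¬ P (a t) → ∀ r, u r - u ⟨_, p1⟩ ≠ (t - s) * b := by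
  have hs1 : s0 + 1 ∈ I := h.ord.out hs0 ht0 ⟨by omega, hst⟩
  have ps1 : P (a (s0 + 1)) := h.inner_of_between hs0 ht0 hs1 ps pt (by omega) hst
  set b := u ⟨_, ps1⟩ - u ⟨_, ps⟩ with hb
  have hb0 : 0 < b := sub_pos.2 (h.mono (h.lt_succ hs0 hs1))
  have one : ∀ t, t ∈ I → t + 1 ∈ I → ∀ (p1 : P (a t)) (p2 : P (a (t + 1))), u ⟨_, p2⟩ - u ⟨_, p1⟩ = b :=
    fun t h1 h2 p1 p2 => le_antisymm (h.step_le h1 h2 p1 p2 hs0 hs1 ps ps1) (h.step_le hs0 hs1 ps ps1 h1 h2 p1 p2)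
  have up : ∀ (s : ℤ) (n : ℕ), s ∈ I → s + n ∈ I → ∀ (p1 : P (a s)) (p2 : P (a (s + n))),
      u ⟨_, p2⟩ - u ⟨_, p1⟩ = n * b := by
    intro s n hs
    induction n with
    | zero => intro h2 p1 p2; simp
    | succ n ih =>
      intro h2 p1 p2
      have h3 : s + (n : ℤ) ∈ I := h.ord.out hs h2 ⟨by omega, by push_cast; omega⟩
      have p3 : P (a (s + n)) := h.inner_of_between hs h2 h3 p1 p2 (by omega) (by push_cast; omega)
      have e : s + ((n + 1 : ℕ) : ℤ) = s + n + 1 := by push_cast; ring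
      have h2' := e ▸ h2
      have p2' : P (a (s + n + 1)) := e ▸ p2
      have e3 : (⟨_, p2⟩ : Subtype P) = ⟨_, p2'⟩ := Subtype.ext (by simp only [e])
      have k1 := ih h3 p1 p3
      have k2 := one _ h3 h2' p3 p2'
      rw [e3]
      push_cast
      linarith
  have all : ∀ s t, s ∈ I → t ∈ I → ∀ (p1 : P (a s)) (p2 : P (a t)), u ⟨_, p2⟩ - u ⟨_, p1⟩ = (t - s) * b := by
    have le : ∀ s t, s ≤ t → s ∈ I → t ∈ I → ∀ (p1 : P (a s)) (p2 : P (a t)),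
        u ⟨_, p2⟩ - u ⟨_, p1⟩ = (t - s) * b := by
      intro s t hst hs ht p1 p2
      obtain ⟨n, rfl⟩ := Int.le.dest hst
      rw [up s n hs ht p1 p2]
      push_cast
      ring
    intro s t hs ht p1 p2
    rcases le_total s t with k | k
    · exact le s t k hs ht p1 p2
    · have := le t s k ht hs p2 p1
      linarith
  refine ⟨b, hb0.ne', all, fun s t hs ht p1 np r => ?_⟩
  rcases lt_trichotomy s t with k | rfl | k
  · obtain ⟨t, rfl⟩ : ∃ t', t = t' + 1 := ⟨t - 1, by ring⟩
    have ht' : t ∈ I := h.ord.out hs ht ⟨by omega, by omega⟩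
    have hlt := h.lt_succ ht' ht
    have p2 : P (a t) := (h.hP _).2 ⟨⟨_, hlt⟩, ((h.hP _).1 p1).2.imp fun _ k' =>
      k'.trans_le (h.strictMonoOn.monotoneOn hs ht' (by omega))⟩
    have htop : r.1 < a (t + 1) := by
      by_contra hc
      rw [not_lt] at hc
      exact np ((h.hP _).2 ⟨((h.hP _).1 r.2).1.imp fun _ k' => hc.trans_lt k', ⟨_, hlt⟩⟩)
    have e := all s t hs ht' p1 p2
    have : u r < u ⟨_, p2⟩ + b := by
      rcases le_or_gt r ⟨_, p2⟩ with k' | k'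
      · have := h.mono.monotone k'
        linarith
      · obtain ⟨c, d, c1, c2, d1, d2, hlt'⟩ := h.exists_gt_step ht' ht (s := ⟨_, p2⟩) (s' := r) le_rfl htop.le
          hlt.le (le_of_lt k') (Or.inr htop)
        have := hlt'.trans_le (h.le_step hs0 hs1 ps ps1 c1 c2 d1 d2)
        have := lt_of_mul_lt_mul_left this h.pos.le
        linarith
    push_cast
    intro hc
    linarith
  · exact absurd p1 np
  · have ht' : t + 1 ∈ I := h.ord.out ht hs ⟨by omega, by omega⟩
    have hlt := h.lt_succ ht ht'
    have p2 : P (a (t + 1)) := (h.hP _).2 ⟨((h.hP _).1 p1).1.imp fun _ k' =>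
      (h.strictMonoOn.monotoneOn ht' hs (by omega)).trans_lt k', ⟨_, hlt⟩⟩
    have hbot : a t < r.1 := by
      by_contra hc
      rw [not_lt] at hc
      exact np ((h.hP _).2 ⟨⟨_, hlt⟩, ((h.hP _).1 r.2).2.imp fun _ k' => k'.trans_le hc⟩)
    have e := all s (t + 1) hs ht' p1 p2
    have : u ⟨_, p2⟩ - b < u r := by
      rcases le_or_gt ⟨_, p2⟩ r with k' | k'
      · have := h.mono.monotone k'
        linarith
      · obtain ⟨c, d, c1, c2, d1, d2, hlt'⟩ := h.exists_gt_step ht ht' (s := r) (s' := ⟨_, p2⟩) hbot.le le_rfl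
          (le_of_lt k') hlt.le (Or.inl hbot)
        have := hlt'.trans_le (h.le_step hs0 hs1 ps ps1 c1 c2 d1 d2)
        have := lt_of_mul_lt_mul_left this h.pos.le
        linarith
    push_cast at e
    intro hc
    linarith

end SeqData
end Conjoint

/-! ### Standard sequences of the preference -/

namespace Conjoint

universe u

/-- From `a0` upwards right continuity comes from `SE`, below `a0` from `NW`. -/
theorem Cells.exists_right_near {α β L : Type*} [LinearOrder α] [LinearOrder β] [LinearOrder L] {F : α → β → L}
    {SE NW : α → β → Prop} [DenselyOrdered α] [DenselyOrdered β] [NoMaxOrder α] [NoMinOrder α] [NoMaxOrder β]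
    [NoMinOrder β] (h : Cells F SE NW) {u : α → ℝ} {v : β → ℝ} {w w1 w2 : ℝ} (hw : 0 < w1)
    (hf : RegRep F SE u fun p => w * v p)
    (hf' : RegRep (fun p a => F a p) (fun p a => NW a p) (fun p => w2 * v p) fun a => w1 * u a) {a0 : α} {p0 : β}
    (h0 : SE a0 p0) (h0' : NW a0 p0) {a e : α} (hae : a < e) {ε : ℝ} (hε : 0 < ε) :
    ∃ s, a < s ∧ s ≤ e ∧ u s < u a + ε := by
  rcases le_or_gt a0 a with ha | ha
  · obtain ⟨s, h1, h2, h3⟩ := h.se.rep_right_cont hf (h.se.up h0 ha le_rfl) hae hε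
    exact ⟨s, h1, h2, by linarith⟩
  · obtain ⟨s, h1, h2, h3⟩ := h.nw.rep_right_cont2 (c := min e a0) (p := a) hf'
      (h.nw.up h0' le_rfl (min_le_right e a0)) (lt_min hae ha) (mul_pos hw hε)
    refine ⟨s, h1, h2.trans (min_le_left _ _), ?_⟩
    rw [← mul_sub] at h3
    have := lt_of_mul_lt_mul_left h3 hw.le
    linarith

variable {n : ℕ} {X : Fin n → Type u} [∀ k, LinearOrder (X k)] {L : Type u} [LinearOrder L]
  {ge : (∀ k, X k) → (∀ k, X k) → Prop} {V : (∀ k, X k) → L} {i j : Fin n}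

theorem pt2_eq_of_two (hij : i ≠ j) (hn : ∀ k, k = i ∨ k = j) (z z' : ∀ k, X k) (a : X i) (p : X j) :
    pt2 z i j a p = pt2 z' i j a p := by
  funext k
  rcases hn k with rfl | rfl
  · rw [pt2_self_left _ hij, pt2_self_left _ hij]
  · rw [pt2_self_right, pt2_self_right]

namespace Rep

theorem rRel_mono (R : Rep ge V) (hij : i ≠ j) {z : ∀ k, X k} {a a' : X i} {p p' : X j}
    (h : RRel ge (pt2 z i j a p) i j) (ha : a ≤ a') (hp : p' ≤ p) : RRel ge (pt2 z i j a' p') i j := by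
  have key : ∀ x, x ∈ SEcone ge (pt2 z i j a' p') i j → x ∈ SEcone ge (pt2 z i j a p) i j := by
    rintro x ⟨h1, h2, h3⟩
    rw [← R.le_iff, pt2_self_left _ hij] at h2
    rw [← R.le_iff, pt2_self_right] at h3
    refine ⟨fun k k1 k2 => ?_, ?_, ?_⟩
    · rw [h1 k k1 k2, pt2_of_ne _ k1 k2, pt2_of_ne _ k1 k2]
    · rw [← R.le_iff, pt2_self_left _ hij]
      exact ha.trans h2
    · rw [← R.le_iff, pt2_self_right]
      exact h3.trans hp
  intro A B C D P Q S T y h1 h2 h3 h4 h5 h6 h7 h8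
  exact h A B C D P Q S T y (key _ h1) (key _ h2) (key _ h3) (key _ h4) (key _ h5) (key _ h6) (key _ h7) (key _ h8)

/-- With an element above `a` and one below `p`, the clauses of `SESet` for maximal and minimal
elements are void. -/
theorem rRel_of_mem_SESet (R : Rep ge V) (hij : i ≠ j) {z : ∀ k, X k} {a a' : X i} {p p' : X j}
    (h : pt2 z i j a p ∈ SESet ge i j) (ha : a < a') (hp : p' < p) : RRel ge (pt2 z i j a p) i j := by
  rcases h with (h | h) | h
  · exact h.1
  · have := h.1 a'
    rw [pt2_self_left _ hij, ← R.le_iff] at this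
    exact absurd ha this.not_gt
  · have := h.1 p'
    rw [pt2_self_right, ← R.le_iff] at this
    exact absurd hp this.not_gt

/-- Additive representations, with proportional terms, on both regions of the plane. -/
def TwoRegRep (V : (∀ k, X k) → L) (y : ∀ k, Inner ge k) (i j : Fin n) (u : Inner ge i → ℝ) (v : Inner ge j → ℝ) : Prop :=
  ∃ w1 w2 w1' w2' : ℝ, 0 < w1 ∧ 0 < w1' ∧
    RegRep (fun a p => V (incl (pt2 y i j a p))) (Model.Before (fun y => V (incl y)) y i j)
      (fun a => w1 * u a) (fun p => w2 * v p) ∧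
    RegRep (fun a p => V (incl (pt2 y i j a p))) (fun a p => Model.Before (fun y => V (incl y)) y j i p a)
      (fun a => w1' * u a) (fun p => w2' * v p)

theorem before_iff (R : Rep ge V) (hij : i ≠ j) (y : ∀ k, Inner ge k) (a : Inner ge i) (p : Inner ge j) :
    Model.Before (fun y : ∀ k, Inner ge k => V (incl y)) y i j a p ↔ RRel ge (pt2 (incl y) i j a.1 p.1) i j := by
  rw [Model.Before, R.brk_iff hij.symm, not_not, incl_pt2]

/-- Acyclicity for a chain with a single link. -/
theorem isCoordOrder_asymm (R : Rep ge V) {S : Fin n → Fin n → Prop} (hS : IsCoordOrder ge S) (h : S i j) : ¬ S j i := by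
  obtain ⟨z, rfl⟩ := hS
  exact fun h' => h'.2 (R.ax.coordAcyclic z i j h.1 (.single h))

variable {y : ∀ k, Inner ge k} {u : Inner ge i → ℝ} {v : Inner ge j → ℝ} {I : Set ℤ} {a : ℤ → X i}
  {S : Fin n → Fin n → Prop}

/-- An increasing standard sequence with columns `lo < hi` progresses at a constant rate. -/
theorem exists_seqData (R : Rep ge V) (hij : i ≠ j) (hn : ∀ k, k = i ∨ k = j) (hu : StrictMono u)
    (hc : ∀ {x e : Inner ge i}, x < e → ∀ ε > 0, ∃ s, x < s ∧ s ≤ e ∧ u s < u x + ε)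
    (hrep : TwoRegRep V y i j u v) (hS : IsCoordOrder ge S) (hI : I.OrdConnected) {z : ∀ k, X k} {lo hi : X j}
    (hlo : lo < hi)
    (h : ∀ t, t ∈ I → t + 1 ∈ I → pt2 z i j (a t) hi ∈ XSet ge S ∧ pt2 z i j (a (t + 1)) lo ∈ XSet ge S ∧
      V (pt2 z i j (a t) hi) = V (pt2 z i j (a (t + 1)) lo)) :
    ∃ w1 w2, SeqData (fun a p => V (pt2 (incl y) i j a p)) (NonExtreme ge i) (NonExtreme ge j) u v w1 w2 I a lo hi := by
  obtain ⟨w1, w2, w1', w2', p1, p1', r1, r2⟩ := hrep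
  have hF := R.plane hij (incl y)
  have hstep : ∀ t, t ∈ I → t + 1 ∈ I → V (pt2 (incl y) i j (a t) hi) = V (pt2 (incl y) i j (a (t + 1)) lo) := by
    intro t h1 h2
    rw [pt2_eq_of_two hij hn _ z, pt2_eq_of_two hij hn (incl y) z]
    exact (h t h1 h2).2.2
  have hlt : ∀ t, t ∈ I → t + 1 ∈ I → a t < a (t + 1) := fun t h1 h2 =>
    (hF.m1 lo).lt_iff_lt.1 (by rw [← hstep t h1 h2]; exact hF.m2 _ hlo)
  have core : ∀ w1 w2 : ℝ, 0 < w1 → (∀ t, t ∈ I → t + 1 ∈ I → ∀ (s s' : Inner ge i) (c d : Inner ge j),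
      a t ≤ s → s ≤ a (t + 1) → a t ≤ s' → s' ≤ a (t + 1) → lo ≤ c → c.1 ≤ hi → lo ≤ d → d.1 ≤ hi →
      (V (incl (pt2 y i j s c)) ≤ V (incl (pt2 y i j s' d)) ↔ w1 * u s + w2 * v c ≤ w1 * u s' + w2 * v d)) →
      SeqData (fun a p => V (pt2 (incl y) i j a p)) (NonExtreme ge i) (NonExtreme ge j) u v w1 w2 I a lo hi := by
    intro w1 w2 hw hr
    exact
    { toPlane := hF
      denseA := R.denselyOrdered i
      denseB := R.denselyOrdered j
      hP := fun x => R.nonExtreme_iff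
      hQ := fun x => R.nonExtreme_iff
      mono := hu
      cont := hc
      pos := hw
      lohi := hlo
      ord := hI
      step := hstep
      rep := fun t h1 h2 s s' c d => by simpa only [incl_pt2] using hr t h1 h2 s s' c d }
  -- One corner governs the rectangle of a step: `(a (t + 1), lo)` if `S j i`, and `(a t, hi)`
  -- otherwise. It is a point of the sequence, hence in `XSet ge S`, and its quadrant contains the
  -- rectangle.
  by_cases hji : S j i
  · have hij' : ¬ S i j := R.isCoordOrder_asymm hS hji
    refine ⟨w1', w2', core _ _ p1' fun t h1 h2 s s' c d k1 k2 k3 k4 k5 k6 k7 k8 => ?_⟩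
    have hm := (h t h1 h2).2.1 j i hij.symm hij'
    rw [pt2_comm _ hij] at hm
    have hm := R.rRel_of_mem_SESet hij.symm hm hlo (hlt t h1 h2)
    have hB : ∀ (s : Inner ge i) (c : Inner ge j), s ≤ a (t + 1) → lo ≤ c →
        Model.Before (fun y : ∀ k, Inner ge k => V (incl y)) y j i c s := fun s c k1 k2 => by
      rw [R.before_iff hij.symm, pt2_eq_of_two hij.symm (fun k => (hn k).symm) _ z]
      exact R.rRel_mono hij.symm hm k2 k1
    exact r2 (hB _ _ k2 k5) (hB _ _ k4 k7)
  · refine ⟨w1, w2, core _ _ p1 fun t h1 h2 s s' c d k1 k2 k3 k4 k5 k6 k7 k8 => ?_⟩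
    have hm := (h t h1 h2).1 i j hij hji
    have hm := R.rRel_of_mem_SESet hij hm (hlt t h1 h2) hlo
    have hB : ∀ (s : Inner ge i) (c : Inner ge j), a t ≤ s → c.1 ≤ hi →
        Model.Before (fun y : ∀ k, Inner ge k => V (incl y)) y i j s c := fun s c k1 k2 => by
      rw [R.before_iff hij, pt2_eq_of_two hij hn _ z]
      exact R.rRel_mono hij hm k1 k2
    exact r1 (hB _ _ k1 k6) (hB _ _ k3 k8)

/-- A standard sequence progresses at a constant rate as long as it does not reach an extreme element. -/
theorem exists_rate (R : Rep ge V) (hij : i ≠ j) (hn : ∀ k, k = i ∨ k = j) (hu : StrictMono u)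
    (hc : ∀ {x e : Inner ge i}, x < e → ∀ ε > 0, ∃ s, x < s ∧ s ≤ e ∧ u s < u x + ε)
    (hrep : TwoRegRep V y i j u v) (hS : IsCoordOrder ge S) (hstd : IsStdSeqIn ge i I a (XSet ge S)) {s0 t0 : ℤ}
    (hs0 : s0 ∈ I) (ht0 : t0 ∈ I) (hst : s0 ≠ t0) (ps : NonExtreme ge i (a s0)) (pt : NonExtreme ge i (a t0)) :
    ∃ b : ℝ, b ≠ 0 ∧ (∀ s t, s ∈ I → t ∈ I → ∀ (p1 : NonExtreme ge i (a s)) (p2 : NonExtreme ge i (a t)),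
        u ⟨_, p2⟩ - u ⟨_, p1⟩ = (t - s) * b) ∧
      ∀ s t, s ∈ I → t ∈ I → ∀ (p1 : NonExtreme ge i (a s)), ¬ NonExtreme ge i (a t) →
        ∀ r, u r - u ⟨_, p1⟩ ≠ (t - s) * b := by
  obtain ⟨hI, l, z, c0, c1, hl, hne, hseq⟩ := hstd
  obtain rfl : l = j := (hn l).resolve_left hl
  have hne : c0 ≠ c1 := fun e => hne ⟨by subst e; exact (R.le_iff _ _ _).1 le_rfl, by subst e; exact (R.le_iff _ _ _).1 le_rfl⟩
  rcases lt_or_gt_of_ne hne with hlt | hlt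
  · obtain ⟨w1, w2, hd⟩ := R.exists_seqData hij hn hu hc hrep hS hI (z := z) hlt fun t h1 h2 =>
      ⟨(hseq t h1 h2).1, (hseq t h1 h2).2.1, (R.sim_iff _ _).1 (hseq t h1 h2).2.2⟩
    rcases lt_or_gt_of_ne hst with k | k
    · exact hd.exists_rate hs0 ht0 k ps pt
    · exact hd.exists_rate ht0 hs0 k pt ps
  -- With the columns in the other order the sequence decreases; reversing the index makes it
  -- increase and negates the rate.
  · have hI' : (Neg.neg ⁻¹' I).OrdConnected := hI.preimage_anti fun _ _ h => neg_le_neg h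
    obtain ⟨w1, w2, hd⟩ := R.exists_seqData (a := fun t => a (-t)) hij hn hu hc hrep hS hI' (z := z) hlt fun t h1 h2 => by
      have e : -(t + 1) + 1 = -t := by ring
      have k1 : -(t + 1) ∈ I := h2
      have k2 : -(t + 1) + 1 ∈ I := e ▸ h1
      obtain ⟨i1, i2, i3⟩ := hseq _ k1 k2
      rw [e] at i2 i3
      exact ⟨i2, i1, ((R.sim_iff _ _).1 i3).symm⟩
    have hs0' : -s0 ∈ Neg.neg ⁻¹' I := by simpa using hs0
    have ht0' : -t0 ∈ Neg.neg ⁻¹' I := by simpa using ht0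
    have ps' : NonExtreme ge i (a (- -s0)) := by simpa using ps
    have pt' : NonExtreme ge i (a (- -t0)) := by simpa using pt
    obtain ⟨b, b0, h1, h2⟩ : ∃ b : ℝ, b ≠ 0 ∧ (∀ s t, s ∈ Neg.neg ⁻¹' I → t ∈ Neg.neg ⁻¹' I →
        ∀ (p1 : NonExtreme ge i (a (-s))) (p2 : NonExtreme ge i (a (-t))),
        u ⟨_, p2⟩ - u ⟨_, p1⟩ = (t - s) * b) ∧
        ∀ s t, s ∈ Neg.neg ⁻¹' I → t ∈ Neg.neg ⁻¹' I → ∀ (p1 : NonExtreme ge i (a (-s))),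
        ¬ NonExtreme ge i (a (-t)) → ∀ r, u r - u ⟨_, p1⟩ ≠ (t - s) * b := by
      rcases lt_or_gt_of_ne hst with k | k
      · exact hd.exists_rate ht0' hs0' (neg_lt_neg k) pt' ps'
      · exact hd.exists_rate hs0' ht0' (neg_lt_neg k) ps' pt'
    refine ⟨-b, neg_ne_zero.2 b0, fun s t hs ht p1 p2 => ?_, fun s t hs ht p1 np r => ?_⟩
    · have := h1 (-s) (-t) (by simpa using hs) (by simpa using ht) (by simpa using p1) (by simpa using p2)
      simp only [neg_neg] at this
      rw [this]
      push_cast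
      ring
    · have := h2 (-s) (-t) (by simpa using hs) (by simpa using ht) (by simpa using p1) (by simpa using np) r
      simp only [neg_neg] at this
      intro hc
      apply this
      rw [hc]
      push_cast
      ring

end Rep
end Conjoint

/-! ### Conclusion for two coordinates -/

namespace Conjoint

universe u

namespace Rep

variable {n : ℕ} {X : Fin n → Type u} [∀ k, LinearOrder (X k)] {L : Type u} [LinearOrder L]
  {ge : (∀ k, X k) → (∀ k, X k) → Prop} {V : (∀ k, X k) → L} {i j : Fin n}

theorem TwoRegRep.swap {y : ∀ k, Inner ge k} {u : Inner ge i → ℝ} {v : Inner ge j → ℝ} {w1 w2 w1' w2' : ℝ}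
    (hij : i ≠ j) (h1 : 0 < w2) (h2 : 0 < w2')
    (r1 : RegRep (fun a p => V (incl (pt2 y i j a p))) (Model.Before (fun y => V (incl y)) y i j)
      (fun a => w1 * u a) (fun p => w2 * v p))
    (r2 : RegRep (fun a p => V (incl (pt2 y i j a p))) (fun a p => Model.Before (fun y => V (incl y)) y j i p a)
      (fun a => w1' * u a) (fun p => w2' * v p)) : TwoRegRep V y j i v u := by
  refine ⟨w2', w1', w2, w1, h2, h1, fun {p a q b} k1 k2 => ?_, fun {p a q b} k1 k2 => ?_⟩
  · have := r2 (a := a) (p := p) (b := b) (q := q) k1 k2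
    simp only [pt2_comm y hij.symm]
    rw [this, add_comm, add_comm (w1' * u b)]
  · have := r1 (a := a) (p := p) (b := b) (q := q) k1 k2
    simp only [pt2_comm y hij.symm]
    rw [this, add_comm, add_comm (w1 * u b)]

/-- The conclusion for two coordinates. -/
theorem eq_of_counts (R : Rep ge V) (hij : i ≠ j) (hn : ∀ k, k = i ∨ k = j) {Sa Sb Sc Sd : Fin n → Fin n → Prop}
    (hSa : IsCoordOrder ge Sa) (hSb : IsCoordOrder ge Sb) (hSa_ij : Sa i j) (hSb_ji : Sb j i)
    (hia : EssentialOn ge i (XSet ge Sa)) (hjb : EssentialOn ge j (XSet ge Sb)) {r0 r1 r2 : ∀ k, Inner ge k}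
    (hE0 : ERel ge (incl r0) i j) (hE1 : ERel ge (incl r1) i j) (hE2 : ERel ge (incl r2) i j)
    {I J : Set ℤ} {a : ℤ → X i} {b : ℤ → X j} (hSc : IsCoordOrder ge Sc) (hSd : IsCoordOrder ge Sd)
    (ha : IsStdSeqIn ge i I a (XSet ge Sc)) (hb : IsStdSeqIn ge j J b (XSet ge Sd)) {m k : ℤ} (hm : m ≠ 0)
    (h0I : 0 ∈ I) (hmI : m ∈ I) (hkI : k ∈ I) (h0J : 0 ∈ J) (hmJ : m ∈ J) (hkJ : k ∈ J)
    (ha0 : a 0 = (r0 i).1) (hb0 : b 0 = (r0 j).1) (ham : (r1 i).1 = a m) (hbm : (r1 j).1 = b m)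
    (hak : (r2 i).1 = a k) : (r2 j).1 = b k := by
  have M := R.model
  have di := M.dense i
  have dj := M.dense j
  have ni := M.noMin i
  have nj := M.noMin j
  have xi := M.noMax i
  have xj := M.noMax j
  have self : ∀ z : ∀ k, Inner ge k, pt2 r0 i j (z i) (z j) = z := fun z => by
    rw [pt2_eq_of_two hij hn r0 z]; simp [pt2]
  have cells := M.cells hij hn hSa hSb hSa_ij hSb_ji hia hjb r0
  have memE : ∀ z : ∀ k, Inner ge k, ERel ge (incl z) i j →
      Model.Before (fun y => V (incl y)) r0 i j (z i) (z j) ∧ Model.Before (fun y => V (incl y)) r0 j i (z j) (z i) := by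
    intro z hz
    refine ⟨?_, ?_⟩
    · rw [Model.Before, self, R.brk_iff hij.symm, not_not]
      exact hz.1
    · rw [Model.before_swap hij, self, R.brk_iff hij, not_not]
      exact hz.2
  obtain ⟨W, u, v, ωi, ωj, hW, u0, v0⟩ := M.exists_weightedRep hij hn hSa hSb hSa_ij hSb_ji hia hjb (z := r0)
    (by rw [R.brk_iff hij, not_not]; exact hE0.2) (by rw [R.brk_iff hij.symm, not_not]; exact hE0.1)
  have reg1 : RegRep (fun a p => V (incl (pt2 r0 i j a p))) (Model.Before (fun y => V (incl y)) r0 i j)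
      (fun a => 1 * u a) (fun p => 1 * v p) := fun {a p b q} k1 k2 => by
    rw [hW.le_iff, hW.se k1, hW.se k2]; simp only [one_mul]
  have reg2 : RegRep (fun a p => V (incl (pt2 r0 i j a p))) (fun a p => Model.Before (fun y => V (incl y)) r0 j i p a)
      (fun a => ωi * u a) (fun p => ωj * v p) := fun {a p b q} k1 k2 => by
    rw [hW.le_iff, hW.nw k1, hW.nw k2]
  have se0 := (memE r0 hE0).1
  have nw0 := (memE r0 hE0).2
  have hcu : ∀ {x e : Inner ge i}, x < e → ∀ ε > 0, ∃ s, x < s ∧ s ≤ e ∧ u s < u x + ε := fun {x e} hxe ε hε => by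
    refine cells.exists_right_near (v := v) (w := 1) (w1 := ωi) (w2 := ωj) hW.pos1 ?_ ?_ se0 nw0 hxe hε
    · exact fun {a p b q} k1 k2 => by rw [hW.le_iff, hW.se k1, hW.se k2]; simp only [one_mul]
    · exact fun {a p b q} k1 k2 => by rw [hW.le_iff, hW.nw k1, hW.nw k2, add_comm, add_comm (ωi * _)]
  have hcv : ∀ {x e : Inner ge j}, x < e → ∀ ε > 0, ∃ s, x < s ∧ s ≤ e ∧ v s < v x + ε := fun {x e} hxe ε hε => by
    -- For the swapped regions `ωj * v` plays the role of `u`, hence the rescaled `ε`.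
    refine cells.swap.exists_right_near (u := fun p => ωj * v p) (v := u) (w := ωi) (w1 := ωj⁻¹) (w2 := 1) (inv_pos.2 hW.pos2)
      ?_ ?_ nw0 se0 hxe (mul_pos hW.pos2 hε) |>.imp fun s hs => ⟨hs.1, hs.2.1, ?_⟩
    · exact fun {a p b q} k1 k2 => by rw [hW.le_iff, hW.nw k1, hW.nw k2, add_comm, add_comm (ωi * _)]
    · exact fun {a p b q} k1 k2 => by
        rw [hW.le_iff, hW.se k1, hW.se k2]
        simp only [one_mul, inv_mul_cancel_left₀ hW.pos2.ne']
    · have := hs.2.2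
      rw [← mul_add] at this
      exact lt_of_mul_lt_mul_left this hW.pos2.le
  have pa0 : NonExtreme ge i (a 0) := ha0 ▸ (r0 i).2
  have pam : NonExtreme ge i (a m) := ham ▸ (r1 i).2
  have pak : NonExtreme ge i (a k) := hak ▸ (r2 i).2
  have pb0 : NonExtreme ge j (b 0) := hb0 ▸ (r0 j).2
  have pbm : NonExtreme ge j (b m) := hbm ▸ (r1 j).2
  obtain ⟨A, hA, hA1, -⟩ := R.exists_rate hij hn hW.mono1 hcu ⟨1, 1, ωi, ωj, one_pos, hW.pos1, reg1, reg2⟩ hSc ha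
    h0I hmI hm.symm pa0 pam
  obtain ⟨B, hB, hB1, hB2⟩ := R.exists_rate hij.symm (fun k => (hn k).symm) hW.mono2 hcv
    (TwoRegRep.swap hij one_pos hW.pos2 reg1 reg2) hSd hb h0J hmJ hm.symm pb0 pbm
  have ea0 : (⟨_, pa0⟩ : Inner ge i) = r0 i := Subtype.ext ha0
  have eam : (⟨_, pam⟩ : Inner ge i) = r1 i := Subtype.ext ham.symm
  have eak : (⟨_, pak⟩ : Inner ge i) = r2 i := Subtype.ext hak.symm
  have eb0 : (⟨_, pb0⟩ : Inner ge j) = r0 j := Subtype.ext hb0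
  have ebm : (⟨_, pbm⟩ : Inner ge j) = r1 j := Subtype.ext hbm.symm
  have um := hA1 0 m h0I hmI pa0 pam
  have uk := hA1 0 k h0I hkI pa0 pak
  have vm := hB1 0 m h0J hmJ pb0 pbm
  rw [ea0, eam, u0] at um
  rw [ea0, eak, u0] at uk
  rw [eb0, ebm, v0] at vm
  -- A point with `i E j` belongs to both regions, so both formulas for `W` hold there.
  have E1 := (hW.se (memE r1 hE1).1).symm.trans (hW.nw (memE r1 hE1).2)
  have E2 := (hW.se (memE r2 hE2).1).symm.trans (hW.nw (memE r2 hE2).2)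
  simp only [Int.cast_zero, sub_zero] at um uk vm
  rw [um, vm] at E1
  rw [uk] at E2
  have hm' : (m : ℝ) ≠ 0 := Int.cast_ne_zero.2 hm
  have E1' : (ωi - 1) * A + (ωj - 1) * B = 0 := by
    refine mul_left_cancel₀ hm' ?_
    linarith
  -- The relation at `r2` combined with `k` times the relation found at `r1` eliminates `ωi`.
  have E3 : (ωj - 1) * (v (r2 j) - k * B) = 0 := by linear_combination (-E2) - k * E1'
  rcases mul_eq_zero.1 E3 with h | h
  · exfalso
    -- Both weights would then be `1` and the preference on non-extreme points additive,
    -- contradicting the strict violation behind `Sa i j`.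
    have hj1 : ωj = 1 := by linarith
    have hi1 : ωi = 1 := by
      rw [h, zero_mul, add_zero] at E1'
      have := (mul_eq_zero.1 E1').resolve_right hA
      linarith
    have hadd : ∀ a p, W a p = u a + v p := fun a p => by
      rcases cells.cover a p with k | k
      · exact hW.se k
      · rw [hW.nw k, hi1, hj1, one_mul, one_mul]
    obtain ⟨z, rfl⟩ := hSa
    obtain ⟨a, b, c, d, P, Q, S, T, ⟨f1, f2, f3, f4⟩, g1, g2⟩ := R.exists_strictFail_of_not_RRel hij hSa_ij.2
    simp only [Set.mem_insert_iff, Set.mem_singleton_iff, forall_eq_or_imp, forall_eq] at g1 g2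
    have tr : ∀ {x y : X i} {p q : X j} (hx : NonExtreme ge i x) (hy : NonExtreme ge i y) (hp : NonExtreme ge j p)
        (hq : NonExtreme ge j q), V (pt2 z i j x p) < V (pt2 z i j y q) →
        u ⟨x, hx⟩ + v ⟨p, hp⟩ < u ⟨y, hy⟩ + v ⟨q, hq⟩ := by
      intro x y p q hx hy hp hq hlt
      rw [← hadd, ← hadd, ← not_le, ← hW.le_iff, not_le]
      simp only [incl_pt2]
      rwa [pt2_eq_of_two hij hn _ z, pt2_eq_of_two hij hn (incl r0) z]
    have t1 := tr g1.1.1 g1.2.1.1 g2.1.1 g2.2.1.1 f1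
    have t2 := tr g1.2.1.1 g1.1.1 g2.2.2.2.1 g2.2.2.1.1 f2
    have t3 := tr g1.2.2.2.1 g1.2.2.1.1 g2.2.1.1 g2.1.1 f3
    have t4 := tr g1.2.2.1.1 g1.2.2.2.1 g2.2.2.1.1 g2.2.2.2.1 f4
    linarith
  · have hv : v (r2 j) = k * B := by linarith
    by_cases pbk : NonExtreme ge j (b k)
    · have vk := hB1 0 k h0J hkJ pb0 pbk
      rw [eb0, v0] at vk
      simp only [Int.cast_zero, sub_zero] at vk
      exact congrArg Subtype.val (hW.mono2.injective (hv.trans vk.symm))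
    -- `b k` cannot be extreme, because the non-extreme element `r2 j` already takes the value that
    -- the rate predicts at `k`.
    · refine absurd ?_ (hB2 0 k h0J hkJ pb0 pbk (r2 j))
      rw [eb0, v0, hv]
      push_cast
      ring

end Rep
end Conjoint

theorem mainTheorem4 {n : ℕ} {X : Fin n → Type*}
    (ge : (∀ k, X k) → (∀ k, X k) → Prop)
    (hax : Conjoint.Axioms ge) (hstr : Conjoint.StructuralAssumptions ge)
    (i j : Fin n) (hij : i ≠ j) (hint : Conjoint.Interacting ge i j)
    -- `i` and `j` are essential on `X^{S_a}` and `X^{S_b}`, where the coordinate orders `S_a`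
    -- and `S_b` differ only in the order of `i` and `j`
    (Sa Sb : Fin n → Fin n → Prop)
    (hSa : Conjoint.IsCoordOrder ge Sa) (hSb : Conjoint.IsCoordOrder ge Sb)
    (hSa_ij : Sa i j) (hSb_ji : Sb j i)
    (hSab : ∀ k l, ¬ (k = i ∧ l = j) → ¬ (k = j ∧ l = i) → (Sa k l ↔ Sb k l))
    (hia : Conjoint.EssentialOn ge i (Conjoint.XSet ge Sa))
    (hja : Conjoint.EssentialOn ge j (Conjoint.XSet ge Sa))
    (hib : Conjoint.EssentialOn ge i (Conjoint.XSet ge Sb))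
    (hjb : Conjoint.EssentialOn ge j (Conjoint.XSet ge Sb))
    -- the three points
    (r0 r1 r2 : ∀ k, X k)
    (hE0 : Conjoint.ERel ge r0 i j) (hE1 : Conjoint.ERel ge r1 i j)
    (hE2 : Conjoint.ERel ge r2 i j)
    (hr0 : Conjoint.NonExtreme ge i (r0 i) ∧ Conjoint.NonExtreme ge j (r0 j))
    (hr1 : Conjoint.NonExtreme ge i (r1 i) ∧ Conjoint.NonExtreme ge j (r1 j))
    (hr2 : Conjoint.NonExtreme ge i (r2 i) ∧ Conjoint.NonExtreme ge j (r2 j))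
    -- the two standard sequences
    (I J : Set ℤ) (a : ℤ → X i) (b : ℤ → X j)
    (Sc Sd : Fin n → Fin n → Prop)
    (hSc : Conjoint.IsCoordOrder ge Sc) (hSd : Conjoint.IsCoordOrder ge Sd)
    (hic : Conjoint.EssentialOn ge i (Conjoint.XSet ge Sc))
    (hjd : Conjoint.EssentialOn ge j (Conjoint.XSet ge Sd))
    (ha : Conjoint.IsStdSeqIn ge i I a (Conjoint.XSet ge Sc))
    (hb : Conjoint.IsStdSeqIn ge j J b (Conjoint.XSet ge Sd))
    -- the numbers of steps
    (m k : ℤ) (hm : m ≠ 0)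
    (h0I : 0 ∈ I) (hmI : m ∈ I) (hkI : k ∈ I) (h0J : 0 ∈ J) (hmJ : m ∈ J) (hkJ : k ∈ J)
    (ha0 : Conjoint.Sim ge (Function.update r0 i (a 0)) r0)
    (hb0 : Conjoint.Sim ge (Function.update r0 j (b 0)) r0)
    (ham : Conjoint.Sim ge (Function.update r0 i (r1 i)) (Function.update r0 i (a m)))
    (hbm : Conjoint.Sim ge (Function.update r0 j (r1 j)) (Function.update r0 j (b m)))
    (hak : Conjoint.Sim ge (Function.update r0 i (r2 i)) (Function.update r0 i (a k))) :
    Conjoint.Sim ge (Function.update r0 j (r2 j)) (Function.update r0 j (b k)) := by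
  obtain ⟨_, L, _, V, R⟩ := Conjoint.exists_rep hax hstr
  -- Since `i` and `j` interact, there is no further coordinate.
  have hn : ∀ l, l = i ∨ l = j := by
    intro l
    by_contra hc
    push Not at hc
    exact R.not_interacting_of_three hij (Ne.symm hc.1) (Ne.symm hc.2) hint
  have lift : ∀ r : ∀ l, X l, Conjoint.NonExtreme ge i (r i) ∧ Conjoint.NonExtreme ge j (r j) →
      ∃ y : ∀ l, Conjoint.Inner ge l, Conjoint.incl y = r := fun r hr =>
    ⟨fun l => ⟨r l, by rcases hn l with rfl | rfl; exacts [hr.1, hr.2]⟩, rfl⟩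
  obtain ⟨y0, rfl⟩ := lift r0 hr0
  obtain ⟨y1, rfl⟩ := lift r1 hr1
  obtain ⟨y2, rfl⟩ := lift r2 hr2
  have inj : ∀ (l : Fin n) (z : ∀ l, X l) (x y : X l),
      Conjoint.Sim ge (Function.update z l x) (Function.update z l y) → x = y := fun l z x y h =>
    (R.strictMono l z).injective ((R.sim_iff _ _).1 h)
  have key := R.eq_of_counts hij hn hSa hSb hSa_ij hSb_ji hia hjb hE0 hE1 hE2 hSc hSd ha hb hm h0I hmI hkI h0J hmJ hkJ
    (inj i (Conjoint.incl y0) _ _ (by rw [show (y0 i).1 = Conjoint.incl y0 i from rfl, Function.update_eq_self]; exact ha0))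
    (inj j (Conjoint.incl y0) _ _ (by rw [show (y0 j).1 = Conjoint.incl y0 j from rfl, Function.update_eq_self]; exact hb0))
    (inj i _ _ _ ham) (inj j _ _ _ hbm) (inj i _ _ _ hak)
  rw [show Conjoint.incl y2 j = b k from key]
  exact (R.sim_iff _ _).2 rfl
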